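/- **Conventions.** Let $q=e^{\hbar}\in\mathbb C[[\hbar]]$, $[n]_q=\frac{q^n-q^{-n}}{q-q^{-1}}$, and let $\binom{3}{r}_q$ be the quantum binomial coefficients. Let $a_{00}=a_{11}=2$, $a_{01}=a_{10}=-2$, let $g_{ij}(z)=\frac{q^{a_{ij}}-z}{1-q^{a_{ij}}z}$ be expanded at $z=0$, and let $\delta(z)=\sum_{n\in\mathbb Z}z^n$. Let $\widehat\otimes$ be the $\hbar$-adically completed tensor product over $\mathbb C[[\hbar]]$. For a complete $\mathbb C[[\hbar]]$-algebra $A$, let $A((u))$ and $A((u,v))$ be the $\hbar$-adic completions of the algebras of formal Laurent series with exponents bounded below (in each variable); thus $A((u))$ consists of the series $\sum_{n\in\mathbb Z}a_nu^n$ with $a_n\to 0$ $\hbar$-adically as $n\to-\infty$. Likewise $\mathcal U\otimes\mathbb C((u))$ is understood to be $\hbar$-adically completed. Identities between currents are identities between all coefficients. **The algebra.** Let $\mathcal U$ be the $\hbar$-adically complete, separated and $\hbar$-torsion-free $\mathbb C[[\hbar]]$-algebra topologically generated by $h_{i,n}$, $x^\pm_{i,n}$, $c$ ($i=0,1$, $n\in\mathbb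 Z$), subject to the relations below; that is, the quotient of the $\hbar$-adically completed free algebra by the smallest closed two-sided ideal which contains the relations and whose quotient has no $\hbar$-torsion. With $$\phi_i^\pm(z)=q^{\pm h_{i,0}}\exp\Big(\pm(q-q^{-1})\sum_{\pm n>0}h_{i,n}z^{-n}\Big),\qquad x_i^\pm(z)=\sum_{n\in\mathbb Z}x_{i,n}^\pm z^{-n},$$ the relations are * (Q1) $c$ is central, $[\phi_i^\pm(z),\phi_j^\pm(w)]=0$; * (Q2) $\phi_i^+(z)\phi_j^-(w)=\phi_j^-(w)\phi_i^+(z)\,g_{ij}(q^cw/z)^{-1}g_{ij}(q^{-c}w/z)$; * (Q3) $\phi_i^+(z)x_j^\pm(w)=x_j^\pm(w)\phi_i^+(z)\,g_{ij}(q^{\mp c/2}w/z)^{\pm1}$; * (Q4) $\phi_i^-(z)x_j^\pm(w)=x_j^\pm(w)\phi_i^-(z)\,g_{ji}(q^{\mp c/2}z/w)^{\mp1}$; * (Q5) $(q-q^{-1})[x_i^+(z),x_j^-(w)]=\delta_{ij}\big(\phi_i^+(zq^{-c/2})\delta(q^cw/z)-\phi_i^-(zq^{c/2})\delta(q^{-c}w/z)\big)$;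 * (Q6) $(z-q^{\pm2}w)x_i^\pm(z)x_i^\pm(w)=(q^{\pm2}z-w)x_i^\pm(w)x_i^\pm(z)$; and, for $i\neq j$, * (Q7) $(z-q^{\mp2}w)(z-w)x_i^\pm(z)x_j^\pm(w)=(q^{\mp2}z-w)(z-w)x_j^\pm(w)x_i^\pm(z)$; * (Q8) $\big[x_i^\pm(z_1),\,(z_2-q^{\mp2}w)x_i^\pm(z_2)x_j^\pm(w)-(q^{\mp2}z_2-w)x_j^\pm(w)x_i^\pm(z_2)\big]=0$; * (Q9) $\sum_{\sigma\in S_3}\sum_{r=0}^3(-1)^r\binom3r_q x_i^\pm(z_{\sigma(1)})\cdots x_i^\pm(z_{\sigma(r)})x_j^\pm(w)x_i^\pm(z_{\sigma(r+1)})\cdots x_i^\pm(z_{\sigma(3)})=0$. **Theorem.** There exists a unique $\mathbb C[[\hbar]]$-algebra homomorphism $\Delta_u:\mathcal U\to(\mathcal U\widehat\otimes\mathcal U)((u))$ such that, for $i=0,1$ and with $c_1=c\otimes1$, $c_2=1\otimes c$, * (Co1) $\Delta_u(c)=c\otimes1+1\otimes c$; * (Co2) $\Delta_u(\phi_i^\pm(z))=\phi_i^\pm(zq^{\pm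 c_2/2})\otimes\phi_i^\pm(zu^{-1}q^{\mp c_1/2})$; * (Co3) $\Delta_u(x_i^+(z))=x_i^+(z)\otimes1+\phi_i^-(zq^{c_1/2})\otimes x_i^+(zu^{-1}q^{c_1})$; * (Co4) $\Delta_u(x_i^-(z))=1\otimes x_i^-(zu^{-1})+x_i^-(zq^{c_2})\otimes\phi_i^+(zu^{-1}q^{c_2/2})$. There is a unique $\mathbb C[[\hbar]]$-algebra homomorphism $\epsilon:\mathcal U\to\mathbb C[[\hbar]]$ with $\epsilon(\phi_i^\pm(z))=1$ and $\epsilon(x_i^\pm(z))=0=\epsilon(c)$, and a unique $\mathbb C[[\hbar]]$-algebra homomorphism $\mathrm{Id}_u:\mathcal U\to\mathcal U\otimes\mathbb C((u))$ with $\mathrm{Id}_u(c)=c$, $\mathrm{Id}_u(\phi_i^\pm(z))=\phi_i^\pm(zu^{-1})$ and $\mathrm{Id}_u(x_i^\pm(z))=x_i^\pm(zu^{-1})$. Moreover, $$(\mathrm{Id}\otimes\Delta_v)\circ\Delta_u=(\Delta_u\otimes\mathrm{Id})\circ\Delta_{uv}$$ as $\mathbb C[[\hbar]]$-algebra homomorphisms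 $\mathcal U\to(\mathcal U\widehat\otimes\mathcal U\widehat\otimes\mathcal U)((u,v))$ (in particular both sides take values there), and $$(\mathrm{Id}\otimes\epsilon)\circ\Delta_u=\mathrm{Id},\qquad(\epsilon\otimes\mathrm{Id})\circ\Delta_u=\mathrm{Id}_u$$ as homomorphisms $\mathcal U\to\mathcal U((u))$. -/

import Mathlib

open scoped TensorProduct

noncomputable section

namespace QuantumToroidal

/-! ### The base ring `ℂ[[ħ]]` and `ħ`-adic completions -/

/-- The ring `ℂ[[ħ]]`. -/
abbrev Base : Type := PowerSeries ℂ

/-- The formal parameter `ħ`. -/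
def hbar : Base := PowerSeries.X

/-- The ideal `(ħ)`, which defines the `ħ`-adic topology. -/
abbrev hIdeal : Ideal Base := Ideal.span {PowerSeries.X}

/-- The submodule `ħ ^ n M`. -/
abbrev hPow (M : Type) [AddCommGroup M] [Module Base M] (n : ℕ) : Submodule Base M :=
  hIdeal ^ n • ⊤

/-- The `ħ`-adic completion `lim_n M / ħ ^ n M` of a `ℂ[[ħ]]`-module `M`. -/
def Completion (M : Type) [AddCommGroup M] [Module Base M] : Type :=
  AdicCompletion hIdeal M

namespace Completion

section Modules

variable {M N P : Type} [AddCommGroup M] [Module Base M] [AddCommGroup N] [Module Base N]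
  [AddCommGroup P] [Module Base P]

instance : AddCommGroup (Completion M) :=
  inferInstanceAs (AddCommGroup (AdicCompletion hIdeal M))

instance : Module Base (Completion M) :=
  inferInstanceAs (Module Base (AdicCompletion hIdeal M))

/-- The canonical map `M → lim_n M / ħ ^ n M`. -/
def of (M : Type) [AddCommGroup M] [Module Base M] : M →ₗ[Base] Completion M :=
  AdicCompletion.of hIdeal M

/-- The projection of the completion to `M / ħ ^ n M`. -/
def eval (M : Type) [AddCommGroup M] [Module Base M] (n : ℕ) :
    Completion M →ₗ[Base] M ⧸ hPow M n :=
  AdicCompletion.eval hIdeal M n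

theorem ext' {x y : Completion M} (h : ∀ n, eval M n x = eval M n y) : x = y :=
  AdicCompletion.ext h

theorem eval_of (n : ℕ) (x : M) : eval M n (of M x) = Submodule.Quotient.mk x := rfl

theorem hPow_le_ker (f : M →ₗ[Base] Completion N) (n : ℕ) :
    hPow M n ≤ LinearMap.ker (eval N n ∘ₗ f) := by
  rw [Submodule.smul_le]
  intro r hr m _
  rw [LinearMap.mem_ker, map_smul]
  generalize (eval N n ∘ₗ f) m = y
  obtain ⟨y, rfl⟩ := Submodule.Quotient.mk_surjective _ y
  rw [← Submodule.Quotient.mk_smul, Submodule.Quotient.mk_eq_zero]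
  exact Submodule.smul_mem_smul hr trivial

/-- The unique (continuous) extension to the completion of a linear map into a completion. -/
def extend (f : M →ₗ[Base] Completion N) : Completion M →ₗ[Base] Completion N :=
  AdicCompletion.lift hIdeal
    (fun n => (hPow M n).liftQ (eval N n ∘ₗ f) (hPow_le_ker f n) ∘ₗ eval M n) (by
      intro m n hle
      ext x
      obtain ⟨y, hy⟩ := Submodule.Quotient.mk_surjective _ (eval M n x)
      have hm : eval M m x = Submodule.Quotient.mk y := by
        rw [← show AdicCompletion.transitionMap hIdeal M hle (eval M n x) = eval M m x from
          x.2 hle, ← hy]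
        rfl
      simp only [LinearMap.comp_apply]
      rw [hm, ← hy]
      exact (f y).2 hle)

theorem extend_of (f : M →ₗ[Base] Completion N) (x : M) : extend f (of M x) = f x := rfl

/-- Functoriality of the completion. -/
def map (f : M →ₗ[Base] N) : Completion M →ₗ[Base] Completion N :=
  extend (of N ∘ₗ f)

theorem map_of (f : M →ₗ[Base] N) (x : M) : map f (of M x) = of N (f x) := rfl

theorem ext_map {f g : Completion M →ₗ[Base] Completion N}
    (h : ∀ x, f (of M x) = g (of M x)) : f = g := by
  ext x
  apply ext'
  intro n
  obtain ⟨y, hy⟩ := Submodule.Quotient.mk_surjective _ (eval M n x)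
  have hx : x - of M y ∈ LinearMap.ker (AdicCompletion.eval hIdeal M n) := by
    have : eval M n (x - of M y) = 0 := by
      rw [map_sub, ← hy]
      exact sub_self _
    exact this
  rw [← AdicCompletion.pow_smul_top_eq_ker_eval ⟨{PowerSeries.X}, by simp⟩] at hx
  have key : ∀ k : Completion M →ₗ[Base] Completion N, eval N n (k (x - of M y)) = 0 := by
    intro k
    have := hPow_le_ker (M := Completion M) (N := N) k n
    exact this hx
  have h1 := key f
  have h2 := key g
  rw [map_sub, map_sub, sub_eq_zero] at h1 h2
  rw [h1, h2, h]

end Modules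

section Algebras

variable {A : Type} [Ring A] [Algebra Base A]

theorem mul_mem_hPow_left (n : ℕ) (a : A) {x : A} (hx : x ∈ hPow A n) : a * x ∈ hPow A n := by
  have : hPow A n ≤ (hPow A n).comap (LinearMap.mulLeft Base a) := by
    rw [Submodule.smul_le]
    intro r hr m _
    rw [Submodule.mem_comap, map_smul]
    exact Submodule.smul_mem_smul hr trivial
  exact this hx

theorem mul_mem_hPow_right (n : ℕ) (a : A) {x : A} (hx : x ∈ hPow A n) : x * a ∈ hPow A n := by
  have : hPow A n ≤ (hPow A n).comap (LinearMap.mulRight Base a) := by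
    rw [Submodule.smul_le]
    intro r hr m _
    rw [Submodule.mem_comap, map_smul]
    exact Submodule.smul_mem_smul hr trivial
  exact this hx

/-- The multiplication of `A / ħ ^ n A`. -/
def levelMul (n : ℕ) (x y : A ⧸ hPow A n) : A ⧸ hPow A n :=
  Quotient.map₂ (· * ·) (by
    intro a a' ha b b' hb
    have ha := (Submodule.quotientRel_def _).1 ha
    have hb := (Submodule.quotientRel_def _).1 hb
    refine (Submodule.quotientRel_def _).2 ?_
    have : a * b - a' * b' = (a - a') * b + a' * (b - b') := by noncomm_ring
    show a * b - a' * b' ∈ _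
    rw [this]
    exact add_mem (mul_mem_hPow_right n b ha) (mul_mem_hPow_left n a' hb)) x y

/-- The completion of an algebra is a ring, with the multiplication of `∏_n A / ħ ^ n A`. -/
instance : Mul (Completion A) where
  mul x y := ⟨fun n => levelMul n (eval A n x) (eval A n y), by
    intro m n hmn
    obtain ⟨a, ha⟩ := Submodule.Quotient.mk_surjective _ (eval A n x)
    obtain ⟨b, hb⟩ := Submodule.Quotient.mk_surjective _ (eval A n y)
    have hx : eval A m x = Submodule.Quotient.mk a := by
      rw [← show AdicCompletion.transitionMap hIdeal A hmn (eval A n x) = eval A m x from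
        x.2 hmn, ← ha]
      rfl
    have hy : eval A m y = Submodule.Quotient.mk b := by
      rw [← show AdicCompletion.transitionMap hIdeal A hmn (eval A n y) = eval A m y from
        y.2 hmn, ← hb]
      rfl
    beta_reduce
    rw [hx, hy, ← ha, ← hb]
    rfl⟩

instance : One (Completion A) := ⟨of A 1⟩

theorem eval_mul_mk {n : ℕ} {x y : Completion A} {a b : A}
    (hx : eval A n x = Submodule.Quotient.mk a) (hy : eval A n y = Submodule.Quotient.mk b) :
    eval A n (x * y) = Submodule.Quotient.mk (a * b) := by
  show levelMul n (eval A n x) (eval A n y) = _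
  rw [hx, hy]
  rfl

theorem exists_rep (n : ℕ) (x : Completion A) : ∃ a : A, eval A n x = Submodule.Quotient.mk a :=
  let ⟨a, ha⟩ := Submodule.Quotient.mk_surjective _ (eval A n x)
  ⟨a, ha.symm⟩

theorem eval_one (n : ℕ) : eval A n (1 : Completion A) = Submodule.Quotient.mk 1 := rfl

instance : Ring (Completion A) :=
  { (inferInstance : AddCommGroup (Completion A)),
    (inferInstance : Mul (Completion A)),
    (inferInstance : One (Completion A)) with
    left_distrib := by
      intro x y z
      apply ext'
      intro n
      obtain ⟨a, ha⟩ := exists_rep n x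
      obtain ⟨b, hb⟩ := exists_rep n y
      obtain ⟨c, hc⟩ := exists_rep n z
      have hbc : eval A n (y + z) = Submodule.Quotient.mk (b + c) := by
        rw [map_add, hb, hc, Submodule.Quotient.mk_add]
      rw [eval_mul_mk ha hbc, map_add, eval_mul_mk ha hb, eval_mul_mk ha hc, mul_add,
        Submodule.Quotient.mk_add]
    right_distrib := by
      intro x y z
      apply ext'
      intro n
      obtain ⟨a, ha⟩ := exists_rep n x
      obtain ⟨b, hb⟩ := exists_rep n y
      obtain ⟨c, hc⟩ := exists_rep n z
      have hab : eval A n (x + y) = Submodule.Quotient.mk (a + b) := by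
        rw [map_add, ha, hb, Submodule.Quotient.mk_add]
      rw [eval_mul_mk hab hc, map_add, eval_mul_mk ha hc, eval_mul_mk hb hc, add_mul,
        Submodule.Quotient.mk_add]
    zero_mul := by
      intro x
      apply ext'
      intro n
      obtain ⟨a, ha⟩ := exists_rep n x
      rw [eval_mul_mk (a := 0) (by rw [map_zero, Submodule.Quotient.mk_zero]) ha, zero_mul,
        map_zero, Submodule.Quotient.mk_zero]
    mul_zero := by
      intro x
      apply ext'
      intro n
      obtain ⟨a, ha⟩ := exists_rep n x
      rw [eval_mul_mk (b := 0) ha (by rw [map_zero, Submodule.Quotient.mk_zero]), mul_zero,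
        map_zero, Submodule.Quotient.mk_zero]
    mul_assoc := by
      intro x y z
      apply ext'
      intro n
      obtain ⟨a, ha⟩ := exists_rep n x
      obtain ⟨b, hb⟩ := exists_rep n y
      obtain ⟨c, hc⟩ := exists_rep n z
      rw [eval_mul_mk (eval_mul_mk ha hb) hc, eval_mul_mk ha (eval_mul_mk hb hc), mul_assoc]
    one_mul := by
      intro x
      apply ext'
      intro n
      obtain ⟨a, ha⟩ := exists_rep n x
      rw [eval_mul_mk (eval_one n) ha, one_mul, ha]
    mul_one := by
      intro x
      apply ext'
      intro n
      obtain ⟨a, ha⟩ := exists_rep n x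
      rw [eval_mul_mk ha (eval_one n), mul_one, ha]
    neg_add_cancel := neg_add_cancel
    zsmul := fun n x => n • x
    zsmul_zero' := zero_zsmul
    zsmul_succ' := fun n x => by
      rw [Nat.succ_eq_add_one]; push_cast; rw [add_zsmul, one_zsmul]
    zsmul_neg' := fun n x => by
      rw [Int.negSucc_eq, neg_zsmul]; push_cast; rfl }

instance : Algebra Base (Completion A) :=
  Algebra.ofModule
    (by
      intro r x y
      apply ext'
      intro n
      obtain ⟨a, ha⟩ := exists_rep n x
      obtain ⟨b, hb⟩ := exists_rep n y
      have hra : eval A n (r • x) = Submodule.Quotient.mk (r • a) := by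
        rw [map_smul, ha, Submodule.Quotient.mk_smul]
      rw [eval_mul_mk hra hb, map_smul, eval_mul_mk ha hb, smul_mul_assoc,
        Submodule.Quotient.mk_smul])
    (by
      intro r x y
      apply ext'
      intro n
      obtain ⟨a, ha⟩ := exists_rep n x
      obtain ⟨b, hb⟩ := exists_rep n y
      have hrb : eval A n (r • y) = Submodule.Quotient.mk (r • b) := by
        rw [map_smul, hb, Submodule.Quotient.mk_smul]
      rw [eval_mul_mk ha hrb, map_smul, eval_mul_mk ha hb, mul_smul_comm,
        Submodule.Quotient.mk_smul])

/-- The element `exp(κ ħ a) = ∑_k (κ ^ k / k!) ħ ^ k a ^ k` of the completion of `A`. -/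
def expSeries (κ : ℂ) (a : A) : Completion A :=
  ⟨fun n => Submodule.Quotient.mk
      (∑ k ∈ Finset.range n, (PowerSeries.monomial k (κ ^ k / (k.factorial : ℂ)) : Base) • a ^ k),
    by
      intro m n hmn
      show Submodule.Quotient.mk _ = Submodule.Quotient.mk _
      rw [Submodule.Quotient.eq, LinearMap.id_apply, ← Finset.sum_range_add_sum_Ico _ hmn,
        add_sub_cancel_left]
      refine Submodule.sum_mem _ fun k hk => ?_
      refine Submodule.smul_mem_smul ?_ trivial
      rw [Ideal.span_singleton_pow, Ideal.mem_span_singleton, PowerSeries.X_pow_dvd_iff]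
      intro j hj
      rw [PowerSeries.coeff_monomial, if_neg]
      have := (Finset.mem_Ico.1 hk).1
      omega⟩

end Algebras

end Completion

/-- The `ħ`-adically completed tensor product `M ⊗̂ N`. -/
abbrev CTensor (M N : Type) [AddCommGroup M] [Module Base M] [AddCommGroup N] [Module Base N] :
    Type :=
  Completion (M ⊗[Base] N)

/-! ### Completed Laurent series

For `Γ = ℤ` the ring `HahnSeries Γ A` is `A((u))`; for `Γ = ℤ × ℤ` with the product order, it is
`A((u, v))`, the series whose exponents are bounded below in each variable. The `ħ`-adic
completion of `A((u))` consists of the series `∑_n a_n u ^ n`, `n ∈ ℤ`, with coefficients in the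
completion of `A` such that `a_n` tends to `0` in the `ħ`-adic topology as `n → -∞`, and similarly
for `A((u, v))`. -/

section Laurent

variable (Γ : Type) [AddCommGroup Γ] [PartialOrder Γ] [IsOrderedAddMonoid Γ]

/-- The (`ħ`-adically complete) algebra of Laurent series with exponents in `Γ` and coefficients in
the completion of `A`. -/
abbrev Laurent (A : Type) [Ring A] [Algebra Base A] : Type := Completion (HahnSeries Γ A)

variable {Γ}

/-- The coefficient at the exponent `g` of a Laurent series. -/
def Laurent.coeff {A : Type} [Ring A] [Algebra Base A] (g : Γ) :
    Laurent Γ A →ₗ[Base] Completion A :=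
  Completion.map (HahnSeries.coeff.linearMap g)

end Laurent

/-! ### Scalars -/

/-- `q ^ k = exp(k ħ)`. -/
def q (k : ℂ) : Base := PowerSeries.mk fun n => k ^ n / (n.factorial : ℂ)

/-- The quantum integer `[n]_q = (q ^ n - q ^ (-n)) / (q - q⁻¹)`, for `n ≥ 0`. -/
def qInt (n : ℕ) : Base := ∑ j ∈ Finset.range n, q ((n : ℂ) - 1 - 2 * j)

/-- The quantum factorial `[n]_q!`. -/
def qFactorial (n : ℕ) : Base := ∏ j ∈ Finset.range n, qInt (j + 1)

/-- The quantum binomial coefficient. -/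
def qBinom (n k : ℕ) : Base := qFactorial n * (qFactorial k)⁻¹ * (qFactorial (n - k))⁻¹

/-- The series in `z` with coefficients in `ℂ[[ħ]]` which is the Taylor expansion at `z = 0` of
`(q ^ a - z) / (1 - q ^ a z)`. -/
def gSeries (a : ℤ) : PowerSeries Base :=
  (PowerSeries.C (q a) - PowerSeries.X) * PowerSeries.mk fun k => q ((a : ℂ) * k)

theorem q_add (a b : ℂ) : q (a + b) = q a * q b := by
  have h : ∀ k : ℂ, q k = PowerSeries.rescale k (PowerSeries.exp ℂ) := by
    intro k
    ext n
    simp [q, PowerSeries.coeff_rescale, PowerSeries.coeff_exp, div_eq_mul_inv]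
  rw [h, h, h, PowerSeries.exp_mul_exp_eq_exp_add]

theorem q_zero : q 0 = 1 := by
  ext n
  rcases n with _ | n <;> simp [q, PowerSeries.coeff_one]

theorem qInt_mul (n : ℕ) : qInt n * (q 1 - q (-1)) = q n - q (-n) := by
  have h : ∀ j : ℕ, q ((n : ℂ) - 1 - 2 * j) * (q 1 - q (-1))
      = q ((n : ℂ) - 2 * j) - q ((n : ℂ) - 2 * ((j + 1 : ℕ) : ℂ)) := by
    intro j
    rw [mul_sub, ← q_add, ← q_add]
    congr 2 <;> push_cast <;> ring
  rw [qInt, Finset.sum_mul, Finset.sum_congr rfl fun j _ => h j,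
    Finset.sum_range_sub' (fun j : ℕ => q ((n : ℂ) - 2 * (j : ℂ)))]
  congr 2 <;> push_cast <;> ring

theorem gSeries_spec (a : ℤ) :
    gSeries a * (1 - PowerSeries.C (q a) * PowerSeries.X)
      = PowerSeries.C (q a) - PowerSeries.X := by
  have h : (PowerSeries.mk fun k : ℕ => q ((a : ℂ) * k))
      * (1 - PowerSeries.C (q a) * PowerSeries.X) = 1 := by
    rw [mul_sub, mul_one, mul_left_comm]
    ext1 n
    rcases n with _ | n
    · simp [q_zero]
    · rw [map_sub, PowerSeries.coeff_C_mul, PowerSeries.coeff_succ_mul_X, PowerSeries.coeff_mk,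
        PowerSeries.coeff_mk, ← q_add, PowerSeries.coeff_one, if_neg (Nat.succ_ne_zero n),
        sub_eq_zero]
      congr 1
      push_cast
      ring
  rw [gSeries, mul_assoc, h, mul_one]

/-- The series of `-a` is the inverse of the series of `a`. -/
theorem gSeries_mul_neg (a : ℤ) : gSeries a * gSeries (-a) = 1 := by
  have hq : (PowerSeries.C (q a) : PowerSeries Base) * PowerSeries.C (q ((-a : ℤ) : ℂ)) = 1 := by
    rw [← map_mul, ← q_add]
    push_cast
    rw [add_neg_cancel, q_zero, map_one]
  have h1 := gSeries_spec a
  have h2 := gSeries_spec (-a)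
  have hne : (PowerSeries.C (q a) - PowerSeries.X : PowerSeries Base) ≠ 0 := by
    intro h
    have := congrArg (PowerSeries.coeff 1) h
    simp at this
  have hne' : (1 - PowerSeries.C (q a) * PowerSeries.X : PowerSeries Base) ≠ 0 := by
    intro h
    have := congrArg (PowerSeries.coeff 0) h
    simp at this
  refine mul_right_cancel₀ (mul_ne_zero hne hne') ?_
  generalize gSeries a = g at *
  generalize gSeries (-a) = g' at *
  linear_combination (PowerSeries.C (q a) - PowerSeries.X) * g' * h1
    + (PowerSeries.C (q a) - PowerSeries.X) * PowerSeries.C (q a) * h2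
    + (PowerSeries.C (q a) - PowerSeries.X) * (PowerSeries.X * g' + 1) * hq

/-! ### The free algebra and the currents -/

/-- The signs `±`. -/
inductive Sgn
  | plus
  | minus

/-- The integer `±1`. -/
def Sgn.val : Sgn → ℤ
  | .plus => 1
  | .minus => -1

/-- The entries of the Cartan matrix of type `A₁⁽¹⁾`. -/
def cartan (i j : Fin 2) : ℤ := if i = j then 2 else -2

/-- The generators `h_{i,n}`, `x_{i,n}^±`, `c`. -/
inductive Gen
  | h (i : Fin 2) (n : ℤ)
  | x (s : Sgn) (i : Fin 2) (n : ℤ)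
  | c

/-- The `ħ`-adically completed free `ℂ[[ħ]]`-algebra on the generators. -/
abbrev Free : Type := Completion (FreeAlgebra Base Gen)

namespace Free

/-- A generator as an element of the completed free algebra. -/
def gen (g : Gen) : Free := Completion.of _ (FreeAlgebra.ι Base g)

/-- `q ^ (κ a) = exp(κ ħ a)` for a generator `a`. -/
def qGen (κ : ℂ) (g : Gen) : Free := Completion.expSeries κ (FreeAlgebra.ι Base g)

/-- `q ^ (κ c)`. -/
def qc (κ : ℂ) : Free := qGen κ Gen.c

/-- The coefficient of `z ^ (-n)` in `x_i^±(z)`. -/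
def x (s : Sgn) (i : Fin 2) (n : ℤ) : Free := gen (.x s i n)

/-- The series `±(q - q⁻¹) ∑_{m > 0} h_{i,±m} t ^ m`, with `t = z ^ (∓1)`. -/
def phiExponent (s : Sgn) (i : Fin 2) : PowerSeries Free :=
  PowerSeries.mk fun m =>
    if m = 0 then 0 else ((s.val : Base) * (q 1 - q (-1))) • gen (.h i (s.val * m))

/-- The coefficient of `z ^ (-n)` in `φ_i^±(z) = q ^ (±h_{i,0}) exp(±(q - q⁻¹) ∑ h_{i,m} z ^ (-m))`,
where the sum is over `±m > 0`. In the exponential only the powers up to `|n|` contribute to the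
coefficient, as the exponent has no constant term. -/
def phi (s : Sgn) (i : Fin 2) (n : ℤ) : Free :=
  if 0 ≤ s.val * n then
    qGen (s.val : ℂ) (.h i 0) *
      ∑ k ∈ Finset.range (n.natAbs + 1),
        (PowerSeries.C ((k.factorial : ℂ)⁻¹) : Base) •
          PowerSeries.coeff n.natAbs (phiExponent s i ^ k)
  else 0

/-- The coefficient of `y ^ k` in `g_{ij}(q ^ c y)⁻¹ g_{ij}(q ^ (-c) y)`. -/
def gg (i j : Fin 2) (k : ℕ) : Free :=
  ∑ p ∈ Finset.HasAntidiagonal.antidiagonal k,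
    (PowerSeries.coeff p.1 (gSeries (-cartan i j)) * PowerSeries.coeff p.2 (gSeries (cartan i j))) •
      qc ((p.1 : ℂ) - p.2)

/-- The coefficient of `z ^ (-m) w ^ (-n)` in
`(z - q ^ (∓2) w) x_i^±(z) x_j^±(w) - (q ^ (∓2) z - w) x_j^±(w) x_i^±(z)`. -/
def xx (s : Sgn) (i j : Fin 2) (m n : ℤ) : Free :=
  x s i (m + 1) * x s j n - q (-2 * s.val) • (x s i m * x s j (n + 1))
    - (q (-2 * s.val) • (x s j n * x s i (m + 1)) - x s j (n + 1) * x s i m)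

/-- The product `x_i^±(z_{σ(1)}) ⋯ x_i^±(z_{σ(r)}) x_j^±(w) x_i^±(z_{σ(r+1)}) ⋯ x_i^±(z_{σ(3)})`:
its coefficient of `z₁ ^ (-n₁) z₂ ^ (-n₂) z₃ ^ (-n₃) w ^ (-m)`. -/
def serreTerm (s : Sgn) (i j : Fin 2) (n : Fin 3 → ℤ) (m : ℤ) (σ : Equiv.Perm (Fin 3)) (r : ℕ) :
    Free :=
  ((List.ofFn fun k => x s i (n (σ k))).take r).prod * x s j m *
    ((List.ofFn fun k => x s i (n (σ k))).drop r).prod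

end Free

open Free in
/-- The defining relations, each one as the family of the equalities of the coefficients of the
two sides. -/
inductive Relation : Free → Free → Prop
  /-- `c` is central. -/
  | central (g : Gen) : Relation (gen .c * gen g) (gen g * gen .c)
  /-- `[φ_i^±(z), φ_j^±(w)] = 0`. -/
  | phi_phi (s : Sgn) (i j : Fin 2) (m n : ℤ) :
      Relation (phi s i m * phi s j n) (phi s j n * phi s i m)
  /-- `φ_i^+(z) φ_j^-(w) = φ_j^-(w) φ_i^+(z) g_{ij}(q ^ c w / z)⁻¹ g_{ij}(q ^ (-c) w / z)`;
  the coefficient of `z ^ (-m) w ^ n`. -/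
  | phi_plus_minus (i j : Fin 2) (m n : ℕ) :
      Relation (phi .plus i m * phi .minus j (-n))
        (∑ k ∈ Finset.range (m + 1), phi .minus j (-(n - k)) * phi .plus i (m - k) * gg i j k)
  /-- `φ_i^+(z) x_j^±(w) = x_j^±(w) φ_i^+(z) g_{ij}(q ^ (∓c/2) w / z) ^ (±1)`;
  the coefficient of `z ^ (-m) w ^ (-n)`. -/
  | phi_plus_x (s : Sgn) (i j : Fin 2) (m : ℕ) (n : ℤ) :
      Relation (phi .plus i m * x s j n)
        (∑ k ∈ Finset.range (m + 1),
          PowerSeries.coeff k (gSeries (s.val * cartan i j)) •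
            (x s j (n + k) * phi .plus i (m - k) * qc (-s.val * k / 2)))
  /-- `φ_i^-(z) x_j^±(w) = x_j^±(w) φ_i^-(z) g_{ji}(q ^ (∓c/2) z / w) ^ (∓1)`;
  the coefficient of `z ^ m w ^ (-n)`. -/
  | phi_minus_x (s : Sgn) (i j : Fin 2) (m : ℕ) (n : ℤ) :
      Relation (phi .minus i (-m) * x s j n)
        (∑ k ∈ Finset.range (m + 1),
          PowerSeries.coeff k (gSeries (-s.val * cartan j i)) •
            (x s j (n - k) * phi .minus i (-(m - k)) * qc (-s.val * k / 2)))
  /-- `(q - q⁻¹) [x_i^+(z), x_j^-(w)] = δ_{ij} (φ_i^+(z q ^ (-c/2)) δ(q ^ c w / z)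
  - φ_i^-(z q ^ (c/2)) δ(q ^ (-c) w / z))`; the coefficient of `z ^ (-m) w ^ (-n)`. -/
  | x_plus_minus (i j : Fin 2) (m n : ℤ) :
      Relation ((q 1 - q (-1)) • (x .plus i m * x .minus j n - x .minus j n * x .plus i m))
        (if i = j then
          phi .plus i (m + n) * qc (((m : ℂ) - n) / 2)
            - phi .minus i (m + n) * qc (((n : ℂ) - m) / 2)
        else 0)
  /-- `(z - q ^ (±2) w) x_i^±(z) x_i^±(w) = (q ^ (±2) z - w) x_i^±(w) x_i^±(z)`. -/
  | x_x_same (s : Sgn) (i : Fin 2) (m n : ℤ) :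
      Relation (x s i (m + 1) * x s i n - q (2 * s.val) • (x s i m * x s i (n + 1)))
        (q (2 * s.val) • (x s i n * x s i (m + 1)) - x s i (n + 1) * x s i m)
  /-- `(z - q ^ (∓2) w) (z - w) x_i^±(z) x_j^±(w) = (q ^ (∓2) z - w) (z - w) x_j^±(w) x_i^±(z)` for
  `i ≠ j`. -/
  | x_x_distinct (s : Sgn) (i j : Fin 2) (hij : i ≠ j) (m n : ℤ) :
      Relation
        (x s i (m + 2) * x s j n
          - (1 + q (-2 * s.val)) • (x s i (m + 1) * x s j (n + 1))
          + q (-2 * s.val) • (x s i m * x s j (n + 2)))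
        (q (-2 * s.val) • (x s j n * x s i (m + 2))
          - (1 + q (-2 * s.val)) • (x s j (n + 1) * x s i (m + 1))
          + x s j (n + 2) * x s i m)
  /-- `[x_i^±(z₁), (z₂ - q ^ (∓2) w) x_i^±(z₂) x_j^±(w) - (q ^ (∓2) z₂ - w) x_j^±(w) x_i^±(z₂)] = 0`
  for `i ≠ j`. -/
  | x_xx (s : Sgn) (i j : Fin 2) (hij : i ≠ j) (l m n : ℤ) :
      Relation (x s i l * xx s i j m n) (xx s i j m n * x s i l)
  /-- The Serre relation: the sum over `σ ∈ S₃` and `0 ≤ r ≤ 3` of `(-1) ^ r` times the quantum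
  binomial coefficient of `3` over `r` times
  `x_i^±(z_{σ(1)}) ⋯ x_i^±(z_{σ(r)}) x_j^±(w) x_i^±(z_{σ(r+1)}) ⋯ x_i^±(z_{σ(3)})` is zero, for
  `i ≠ j`. -/
  | serre (s : Sgn) (i j : Fin 2) (hij : i ≠ j) (n : Fin 3 → ℤ) (m : ℤ) :
      Relation
        (∑ σ : Equiv.Perm (Fin 3), ∑ r ∈ Finset.range 4,
          ((-1) ^ r * qBinom 3 r) • serreTerm s i j n m σ r)
        0

/-! ### The quantum toroidal algebra -/

/-- A two-sided ideal of the completed free algebra is `ħ`-adically closed. -/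
def IsHClosed (I : TwoSidedIdeal Free) : Prop :=
  ∀ a : Free, (∀ n : ℕ, ∃ b ∈ I, ∃ d : Free, a = b + hbar ^ n • d) → a ∈ I

/-- The quotient by a two-sided ideal of the completed free algebra has no `ħ`-torsion. -/
def IsHSaturated (I : TwoSidedIdeal Free) : Prop :=
  ∀ a : Free, hbar • a ∈ I → a ∈ I

/-- The smallest two-sided ideal which contains the defining relations and whose quotient is
`ħ`-adically separated and without `ħ`-torsion. -/
def relIdeal : TwoSidedIdeal Free :=
  sInf {I | (∀ a b, Relation a b → a - b ∈ I) ∧ IsHClosed I ∧ IsHSaturated I}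

/-- The quantum toroidal algebra `𝒰` of type `A₁`: the complete, separated and torsion-free
`ℂ[[ħ]]`-algebra topologically generated by `h_{i,n}`, `x_{i,n}^±`, `c` with the defining relations.
(As `φ_i^±(z)` is `1` modulo `ħ`, the relations between the currents give relations between the
generators only after division by powers of `ħ`, so the presentation is read among the
algebras without `ħ`-torsion.) -/
def U : Type := relIdeal.ringCon.Quotient

instance : Ring U := inferInstanceAs (Ring relIdeal.ringCon.Quotient)

instance : Algebra Base U := inferInstanceAs (Algebra Base relIdeal.ringCon.Quotient)

instance : Algebra ℂ U := Algebra.compHom U (algebraMap ℂ Base)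

instance : IsScalarTower ℂ Base U := IsScalarTower.of_algebraMap_eq fun _ => rfl

namespace U

/-- The quotient map. -/
def mk : Free →ₐ[Base] U := relIdeal.ringCon.mkₐ Base

/-- `c ∈ 𝒰`. -/
def c : U := mk (Free.gen .c)

/-- `q ^ (κ c) ∈ 𝒰`. -/
def qc (κ : ℂ) : U := mk (Free.qc κ)

/-- The coefficient of `z ^ (-n)` in `x_i^±(z)`. -/
def x (s : Sgn) (i : Fin 2) (n : ℤ) : U := mk (Free.x s i n)

/-- The coefficient of `z ^ (-n)` in `φ_i^±(z)`. -/
def phi (s : Sgn) (i : Fin 2) (n : ℤ) : U := mk (Free.phi s i n)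

end U

/-! ### The coproduct, the counit and the shift -/

/-- `𝒰 ⊗ 𝒰`, before completion. -/
abbrev U2 : Type := U ⊗[Base] U

/-- `𝒰 ⊗ 𝒰 ⊗ 𝒰`, before completion. -/
abbrev U3 : Type := U ⊗[Base] (U ⊗[Base] U)

/-- The tensor `a ⊗ b` in `𝒰 ⊗̂ 𝒰`. -/
def tens (a b : U) : Completion U2 := Completion.of U2 (a ⊗ₜ[Base] b)

/-- The formulas of the deformed Drinfeld coproduct, with `c₁ = c ⊗ 1` and `c₂ = 1 ⊗ c`. For the
current formulas, the equality of the coefficients of `z ^ (-n) u ^ k` is stated. -/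
structure IsCoproduct (Δ : U →ₐ[Base] Laurent ℤ U2) : Prop where
  /-- `Δ_u(c) = c ⊗ 1 + 1 ⊗ c`. -/
  c : ∀ k : ℤ, Laurent.coeff k (Δ U.c) = if k = 0 then tens U.c 1 + tens 1 U.c else 0
  /-- `Δ_u(φ_i^±(z)) = φ_i^±(z q ^ (±c₂/2)) ⊗ φ_i^±(z u⁻¹ q ^ (∓c₁/2))`. -/
  phi : ∀ (s : Sgn) (i : Fin 2) (n k : ℤ), Laurent.coeff k (Δ (U.phi s i n)) =
    tens (U.phi s i (n - k) * U.qc (s.val * k / 2))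
      (U.phi s i k * U.qc (-s.val * (n - k) / 2))
  /-- `Δ_u(x_i^+(z)) = x_i^+(z) ⊗ 1 + φ_i^-(z q ^ (c₁/2)) ⊗ x_i^+(z u⁻¹ q ^ c₁)`. -/
  x_plus : ∀ (i : Fin 2) (n k : ℤ), Laurent.coeff k (Δ (U.x .plus i n)) =
    (if k = 0 then tens (U.x .plus i n) 1 else 0)
      + tens (U.phi .minus i (n - k) * U.qc (-((n : ℂ) - k) / 2 - k)) (U.x .plus i k)
  /-- `Δ_u(x_i^-(z)) = 1 ⊗ x_i^-(z u⁻¹) + x_i^-(z q ^ c₂) ⊗ φ_i^+(z u⁻¹ q ^ (c₂/2))`. -/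
  x_minus : ∀ (i : Fin 2) (n k : ℤ), Laurent.coeff k (Δ (U.x .minus i n)) =
    (if k = n then tens 1 (U.x .minus i n) else 0)
      + tens (U.x .minus i (n - k)) (U.phi .plus i k * U.qc (-((n : ℂ) - k) - k / 2))

/-- The formulas of the counit. -/
structure IsCounit (ε : U →ₐ[Base] Base) : Prop where
  /-- `ε(φ_i^±(z)) = 1`. -/
  phi : ∀ (s : Sgn) (i : Fin 2) (n : ℤ), ε (U.phi s i n) = if n = 0 then 1 else 0
  /-- `ε(x_i^±(z)) = 0`. -/
  x : ∀ (s : Sgn) (i : Fin 2) (n : ℤ), ε (U.x s i n) = 0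
  /-- `ε(c) = 0`. -/
  c : ε U.c = 0

/-- The field `ℂ((u))`, as a `ℂ`-algebra. -/
def LaurentC : Type := HahnSeries ℤ ℂ

instance : CommRing LaurentC := inferInstanceAs (CommRing (HahnSeries ℤ ℂ))

instance : Algebra ℂ LaurentC := HahnSeries.instAlgebra (Γ := ℤ) (R := ℂ) (A := ℂ)

/-- The coefficient of `u ^ k` in an element of `ℂ((u))`. -/
def LaurentC.coeff (k : ℤ) : LaurentC →ₗ[ℂ] ℂ where
  toFun f := HahnSeries.coeff (show HahnSeries ℤ ℂ from f) k
  map_add' _ _ := rfl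
  map_smul' _ _ := rfl

/-- The element `u ^ k` of `ℂ((u))`. -/
def LaurentC.pow (k : ℤ) : LaurentC :=
  show HahnSeries ℤ ℂ from HahnSeries.single k 1

/-- `𝒰 ⊗ ℂ((u))` (tensor product over `ℂ`), before `ħ`-adic completion. -/
abbrev ULaurent : Type := U ⊗[ℂ] LaurentC

/-- The element `a u ^ k` of the completion of `𝒰 ⊗ ℂ((u))`. -/
def ULaurent.term (a : U) (k : ℤ) : Completion ULaurent :=
  Completion.of ULaurent (a ⊗ₜ[ℂ] LaurentC.pow k)

/-- The coefficient of `u ^ k` in an element of the completion of `𝒰 ⊗ ℂ((u))`. -/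
def ULaurent.coeff (k : ℤ) : Completion ULaurent →ₗ[Base] Completion U :=
  Completion.map
    ((TensorProduct.AlgebraTensorModule.rid ℂ Base U).toLinearMap ∘ₗ
      TensorProduct.AlgebraTensorModule.map (LinearMap.id : U →ₗ[Base] U)
        (LaurentC.coeff k))

/-- The formulas of the shift `Id_u : 𝒰 → 𝒰 ⊗ ℂ((u))`. -/
structure IsShift (S : U →ₐ[Base] Completion ULaurent) : Prop where
  /-- `Id_u(c) = c`. -/
  c : S U.c = ULaurent.term U.c 0
  /-- `Id_u(φ_i^±(z)) = φ_i^±(z u⁻¹)`. -/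
  phi : ∀ (s : Sgn) (i : Fin 2) (n : ℤ), S (U.phi s i n) = ULaurent.term (U.phi s i n) n
  /-- `Id_u(x_i^±(z)) = x_i^±(z u⁻¹)`. -/
  x : ∀ (s : Sgn) (i : Fin 2) (n : ℤ), S (U.x s i n) = ULaurent.term (U.x s i n) n

/-- The canonical map `M ⊗ N̂ → (M ⊗ N)^`, `x ⊗ lim y_n ↦ lim x ⊗ y_n`. -/
def tensorCompletion (M N : Type) [AddCommGroup M] [Module Base M] [AddCommGroup N]
    [Module Base N] : M ⊗[Base] Completion N →ₗ[Base] CTensor M N :=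
  TensorProduct.lift <|
    LinearMap.mk₂ Base (fun x y => Completion.map (TensorProduct.mk Base M N x) y)
      (fun x x' y => LinearMap.congr_fun (Completion.ext_map (f := Completion.map _)
        (g := Completion.map _ + Completion.map _) fun y => by
          simp [Completion.map_of]) y)
      (fun r x y => LinearMap.congr_fun (Completion.ext_map (f := Completion.map _)
        (g := r • Completion.map _) fun y => by
          simp [Completion.map_of]) y)
      (fun x y y' => map_add _ y y')
      (fun r x y => map_smul _ r y)

/-- For a linear map `D : 𝒰 → 𝒰 ⊗̂ 𝒰`, the map `Id ⊗ D : 𝒰 ⊗̂ 𝒰 → 𝒰 ⊗̂ 𝒰 ⊗̂ 𝒰`. -/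
def idTensor (D : U →ₗ[Base] Completion U2) : Completion U2 →ₗ[Base] Completion U3 :=
  Completion.extend (tensorCompletion U U2 ∘ₗ D.lTensor U)

/-- For a linear map `D : 𝒰 → 𝒰 ⊗̂ 𝒰`, the map `D ⊗ Id : 𝒰 ⊗̂ 𝒰 → 𝒰 ⊗̂ 𝒰 ⊗̂ 𝒰`. -/
def tensorId (D : U →ₗ[Base] Completion U2) : Completion U2 →ₗ[Base] Completion U3 :=
  Completion.extend
    (Completion.map ((TensorProduct.assoc Base U U U).toLinearMap
        ∘ₗ (TensorProduct.comm Base U U2).toLinearMap)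
      ∘ₗ tensorCompletion U U2 ∘ₗ (TensorProduct.comm Base (Completion U2) U).toLinearMap
      ∘ₗ D.rTensor U)

/-- The map `𝒰 → 𝒰 ⊗̂ 𝒰` which takes the coefficient of `u ^ k` in `Δ_u`. -/
def deltaCoeff (Δ : U →ₐ[Base] Laurent ℤ U2) (k : ℤ) : U →ₗ[Base] Completion U2 :=
  Laurent.coeff k ∘ₗ Δ.toLinearMap

/-- The coefficient of `u ^ m v ^ n` in `((Id ⊗ Δ_v) ∘ Δ_u)(x)`: the map `Id ⊗ Δ_v` is applied to
the coefficients of the powers of `u`. -/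
def coassocLeft (Δ : U →ₐ[Base] Laurent ℤ U2) (m n : ℤ) (x : U) : Completion U3 :=
  idTensor (deltaCoeff Δ n) (deltaCoeff Δ m x)

/-- The coefficient of `u ^ m v ^ n` in `((Δ_u ⊗ Id) ∘ Δ_{uv})(x)`: if `a_k` are the coefficients of
`Δ(x)`, then `Δ_{uv}(x) = ∑ a_k u ^ k v ^ k`, and the coefficient of `u ^ m v ^ n` in
`∑ (Δ_u ⊗ Id)(a_k) u ^ k v ^ k` is that of `u ^ (m - n)` in `(Δ_u ⊗ Id)(a_n)`. -/
def coassocRight (Δ : U →ₐ[Base] Laurent ℤ U2) (m n : ℤ) (x : U) : Completion U3 :=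
  tensorId (deltaCoeff Δ (m - n)) (deltaCoeff Δ n x)

/-- `Id ⊗ ε : 𝒰 ⊗̂ 𝒰 → 𝒰`. -/
def idTensorCounit (ε : U →ₐ[Base] Base) : Completion U2 →ₗ[Base] Completion U :=
  Completion.map ((TensorProduct.rid Base U).toLinearMap ∘ₗ ε.toLinearMap.lTensor U)

/-- `ε ⊗ Id : 𝒰 ⊗̂ 𝒰 → 𝒰`. -/
def counitTensorId (ε : U →ₐ[Base] Base) : Completion U2 →ₗ[Base] Completion U :=
  Completion.map ((TensorProduct.lid Base U).toLinearMap ∘ₗ ε.toLinearMap.rTensor U)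

end QuantumToroidal

end

open QuantumToroidal

/-!
The algebra `𝒰` is universal among complete `ħ`-torsion-free algebras with elements that satisfy
the defining relations, so a homomorphism out of it exists as soon as the proposed images of the
generators satisfy the relations. The relations involve the Cartan generators `h_{i,n}` through the
currents `φ_i^±` only, and `ħ h_{i,n}` is recovered from `φ_i^±` as a coefficient of a logarithm;
hence it suffices to give the currents, together with a family `h_{i,n}` of which `φ_i^±` are the
exponentials (`IsToroidal.exists_hom`, `phiΔ_eq_exp`), and a homomorphism is determined by its
values on `c`, `φ_i^±` and `x_i^±` (`U.hom_ext`). The counit and the shift `Id_u` follow directly.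

For the coproduct, all currents are written down as Laurent series in `u` with coefficients in
`𝒰 ⊗ 𝒰`. The relations between `φ` and `φ` and between `φ` and `x` are exchange relations
`f(z) g(w) = g(w) f(z) G(w / z)` with a central power series `G`, and these multiply when currents
are multiplied across the two tensor factors (`Fused.exchangeFuse`); the surplus structure
functions cancel in pairs. In `[Δ(x_i^+), Δ(x_j^-)]` two of the four commutators vanish, one of
them because the structure functions from the two tensor factors agree (`Fused.commute`), and the
terms `φ_i^- ⊗ φ_i^+` of the other two cancel (`xΔ_plus_minus`).

The relations among the `x` currents of one sign carry the main difficulty (`toroidalPair_xΔ`).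
Each `Δ(x_i^±)` is the sum of a static term, whose coefficients have nonnegative order in `u`, and
a moving term, where the coefficient of `z ^ (-n)` has order at least `n`. Each kind of term
satisfies all the relations by itself, since it arises from `x_i^±` by rescaling the variable and,
for one of the two, by multiplication with half currents from the other tensor factor, which
commute with each other and with `x_j^±` (`ToroidalPair.scale`, `ToroidalPair.dressed`). Static
and moving terms satisfy quadratic relations with each other. The point is that for two currents
which move in different directions these imply the mixed cubic and Serre relations
(`ToroidalPair.add`): ordering the letters at the cost of linear factors `α z_i - β z_j` reduces
them to polynomial identities
(`serre_identity_three`, `serre_identity_two_one`, `serre_identity_two_two`), and such a linear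
factor can be cancelled, as anything annihilated by it would satisfy a recursion along which the
order in `u` increases without bound (`WeightBounded.cancel`).

For coassociativity, both composites are realized as homomorphisms into iterated Laurent series,
in `u` and then `v`, and in `u v` and then `u` (`iterate`). The series in two variables embed into
both (`laurentCurry_injective`). The first composite maps the generators into their image, and
therefore all of `𝒰` (`exists_factor`). Both composites have the same coefficients on `c`, `φ_i^±`
and `x_i^±`, so they agree (`exists_common_lift`). The counit axioms are likewise equalities of
homomorphisms into `𝒰((u))`, which are compared on the currents.
-/

open scoped TensorProduct

noncomputable section

open QuantumToroidal

namespace QuantumToroidal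

/-! ### The `ħ`-adic filtration -/

theorem mem_hPow {M : Type} [AddCommGroup M] [Module Base M] {n : ℕ} {x : M} :
    x ∈ hPow M n ↔ ∃ d : M, x = hbar ^ n • d := by
  rw [hPow, Ideal.span_singleton_pow, Submodule.ideal_span_singleton_smul,
    Submodule.mem_smul_pointwise_iff_exists]
  constructor
  · rintro ⟨d, -, rfl⟩
    exact ⟨d, rfl⟩
  · rintro ⟨d, rfl⟩
    exact ⟨d, trivial, rfl⟩

theorem isHausdorff_of_forall {M : Type} [AddCommGroup M] [Module Base M]
    (h : ∀ x : M, (∀ n : ℕ, ∃ d : M, x = hbar ^ n • d) → x = 0) : IsHausdorff hIdeal M := by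
  refine ⟨fun x hx => h x fun n => ?_⟩
  have := hx n
  rw [SModEq.zero] at this
  exact mem_hPow.1 this

theorem eq_zero_of_forall_hbar {M : Type} [AddCommGroup M] [Module Base M]
    [hM : IsHausdorff hIdeal M] {x : M} (h : ∀ n : ℕ, ∃ d : M, x = hbar ^ n • d) : x = 0 :=
  hM.haus' x fun n => by
    rw [SModEq.zero]
    exact mem_hPow.2 (h n)

theorem eq_of_forall_hbar {M : Type} [AddCommGroup M] [Module Base M]
    [IsHausdorff hIdeal M] {x y : M} (h : ∀ n : ℕ, ∃ d : M, x - y = hbar ^ n • d) : x = y :=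
  sub_eq_zero.1 (eq_zero_of_forall_hbar h)

/-- Every nonzero element of `ℂ[[ħ]]` is a unit times a power of `ħ`, so that torsion is
`ħ`-torsion. -/
theorem isTorsionFree_of_hbar {M : Type} [AddCommGroup M] [Module Base M]
    (h : ∀ x : M, hbar • x = 0 → x = 0) : Module.IsTorsionFree Base M := by
  refine Module.IsTorsionFree.of_smul_eq_zero fun r m hr => ?_
  by_cases hr0 : r = 0
  · exact Or.inl hr0
  right
  obtain ⟨u, hu⟩ : ∃ u : Base, r = hbar ^ r.order.toNat * u ∧ IsUnit u := by
    refine ⟨_, (PowerSeries.X_pow_order_mul_divXPowOrder).symm, ?_⟩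
    rw [PowerSeries.isUnit_iff_constantCoeff, isUnit_iff_ne_zero]
    rw [← PowerSeries.coeff_zero_eq_constantCoeff_apply, PowerSeries.coeff_divXPowOrder, zero_add]
    exact PowerSeries.coeff_order hr0
  obtain ⟨hru, hu⟩ := hu
  rw [hru, mul_comm, mul_smul, hu.smul_eq_zero] at hr
  generalize r.order.toNat = n at hr
  induction n with
  | zero => simpa using hr
  | succ n ih =>
    rw [pow_succ', mul_smul] at hr
    exact ih (h _ hr)

theorem hbar_ne_zero : hbar ≠ 0 := PowerSeries.X_ne_zero

theorem eq_zero_of_hbar_smul {M : Type} [AddCommGroup M] [Module Base M]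
    [Module.IsTorsionFree Base M] {n : ℕ} {x : M} (h : hbar ^ n • x = 0) : x = 0 :=
  (smul_eq_zero.1 h).resolve_left (pow_ne_zero _ hbar_ne_zero)

instance {M : Type} [AddCommGroup M] [Module Base M] [Module.IsTorsionFree Base M] :
    Module.Flat Base M :=
  (IsDedekindDomain.flat_iff_torsion_eq_bot).2
    (Submodule.isTorsionFree_iff_torsion_eq_bot.1 inferInstance)

instance {M N : Type} [AddCommGroup M] [Module Base M] [Module.IsTorsionFree Base M]
    [AddCommGroup N] [Module Base N] [Module.IsTorsionFree Base N] :
    Module.IsTorsionFree Base (M ⊗[Base] N) :=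
  have : Module.Flat Base (M ⊗[Base] N) := inferInstance
  inferInstance

instance {Γ : Type} [PartialOrder Γ] {M : Type} [AddCommGroup M] [Module Base M]
    [Module.IsTorsionFree Base M] : Module.IsTorsionFree Base (HahnSeries Γ M) := by
  refine isTorsionFree_of_hbar fun x hx => ?_
  ext g
  have := congrArg (fun y => HahnSeries.coeff y g) hx
  simpa [hbar_ne_zero] using this

namespace Completion

section Modules

variable {M N : Type} [AddCommGroup M] [Module Base M] [AddCommGroup N] [Module Base N]

instance : IsAdicComplete hIdeal (Completion M) :=
  AdicCompletion.isAdicComplete ⟨{PowerSeries.X}, by simp⟩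

theorem eval_eq_zero {n : ℕ} {x : Completion M} :
    eval M n x = 0 ↔ ∃ d, x = hbar ^ n • d := by
  rw [← mem_hPow]
  have := AdicCompletion.pow_smul_top_eq_ker_eval (M := M) (I := hIdeal) (n := n)
    ⟨{PowerSeries.X}, by simp⟩
  exact (SetLike.ext_iff.1 this x).symm

theorem exists_of_add (n : ℕ) (x : Completion M) :
    ∃ (y : M) (d : Completion M), x = of M y + hbar ^ n • d := by
  obtain ⟨y, hy⟩ := Submodule.Quotient.mk_surjective _ (eval M n x)
  obtain ⟨d, hd⟩ := (eval_eq_zero (x := x - of M y) (n := n)).1 (by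
    rw [map_sub, eval_of, hy, sub_self])
  exact ⟨y, d, by rw [← hd]; abel⟩

theorem eval_of_eq_zero {n : ℕ} {x : M} :
    eval M n (of M x) = 0 ↔ ∃ d : M, x = hbar ^ n • d := by
  rw [eval_of, Submodule.Quotient.mk_eq_zero, mem_hPow]

instance [Module.IsTorsionFree Base M] : Module.IsTorsionFree Base (Completion M) := by
  refine isTorsionFree_of_hbar fun x hx => eq_zero_of_forall_hbar fun n => ?_
  obtain ⟨y, d, rfl⟩ := exists_of_add (n + 1) x
  have h1 : eval M (n + 1) (of M (hbar • y)) = 0 := by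
    rw [eval_eq_zero]
    refine ⟨-(hbar • d), ?_⟩
    rw [map_smul, smul_neg, smul_comm, eq_neg_iff_add_eq_zero, ← smul_add, hx]
  obtain ⟨e, he⟩ := eval_of_eq_zero.1 h1
  have h2 : y = hbar ^ n • e := by
    rw [← sub_eq_zero]
    refine eq_zero_of_hbar_smul (n := 1) ?_
    rw [pow_one, smul_sub, he, pow_succ', mul_smul, sub_self]
  exact ⟨of M e + hbar • d, by rw [h2, map_smul, smul_add, smul_smul, pow_succ]⟩

/-- Linear maps preserve the `ħ`-adic filtration, so that the image of `M` is dense for all linear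
maps into separated modules. -/
theorem ext_dense [IsHausdorff hIdeal N] {f g : Completion M →ₗ[Base] N}
    (h : ∀ x, f (of M x) = g (of M x)) : f = g := by
  ext x
  refine eq_of_forall_hbar fun n => ?_
  obtain ⟨y, d, rfl⟩ := exists_of_add n x
  exact ⟨f d - g d, by rw [map_add, map_add, h, map_smul, map_smul, smul_sub]; abel⟩

end Modules

section Algebras

variable {A B : Type} [Ring A] [Algebra Base A] [Ring B] [Algebra Base B]

theorem of_mul (a b : A) : of A (a * b) = of A a * of A b := rfl

theorem of_one : of A 1 = 1 := rfl

/-- The canonical map to the completion, as an algebra homomorphism. -/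
def ofAlg (A : Type) [Ring A] [Algebra Base A] : A →ₐ[Base] Completion A :=
  AlgHom.ofLinearMap (of A) of_one of_mul

theorem ofAlg_apply (a : A) : ofAlg A a = of A a := rfl

theorem map_mul_of_dense {T : Type} [Ring T] [Algebra Base T] [IsHausdorff hIdeal T]
    (f : Completion A →ₗ[Base] T)
    (h : ∀ a b, f (of A a * of A b) = f (of A a) * f (of A b)) (x y : Completion A) :
    f (x * y) = f x * f y := by
  have h1 : ∀ a, f ∘ₗ LinearMap.mulLeft Base (of A a) = LinearMap.mulLeft Base (f (of A a)) ∘ₗ f :=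
    fun a => ext_dense (h a)
  have h2 : f ∘ₗ LinearMap.mulRight Base y = LinearMap.mulRight Base (f y) ∘ₗ f :=
    ext_dense fun a => LinearMap.congr_fun (h1 a) y
  exact LinearMap.congr_fun h2 x

/-- The extension to the completion of an algebra homomorphism into a completion. -/
def extendAlg (f : A →ₐ[Base] Completion B) : Completion A →ₐ[Base] Completion B :=
  AlgHom.ofLinearMap (extend f.toLinearMap) (map_one f)
    (map_mul_of_dense _ fun a b => by
      rw [← of_mul, extend_of, extend_of, extend_of]
      exact map_mul f a b)

/-- Functoriality of the completion for algebras. -/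
def mapAlg (f : A →ₐ[Base] B) : Completion A →ₐ[Base] Completion B :=
  extendAlg ((ofAlg B).comp f)

theorem algHom_ext_dense {T : Type} [Ring T] [Algebra Base T] [IsHausdorff hIdeal T]
    {f g : Completion A →ₐ[Base] T} (h : ∀ a, f (of A a) = g (of A a)) : f = g :=
  AlgHom.toLinearMap_injective (ext_dense h)

end Algebras

end Completion

/-! ### Coefficients of Laurent series -/

section Laurent

variable {Γ : Type} [AddCommGroup Γ] [PartialOrder Γ] [IsOrderedAddMonoid Γ]
  {A B : Type} [Ring A] [Algebra Base A] [Ring B] [Algebra Base B]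

theorem Laurent.coeff_of (g : Γ) (f : HahnSeries Γ A) :
    Laurent.coeff g (Completion.of _ f) = Completion.of A (f.coeff g) := rfl

/-- A Laurent series is determined by its coefficients: the coefficients of a Hahn series which are
divisible by `ħ ^ n` can be divided by it all at once. -/
theorem Laurent.ext_coeff {x y : Laurent Γ A} (h : ∀ g, Laurent.coeff g x = Laurent.coeff g y) :
    x = y := by
  classical
  refine eq_of_forall_hbar fun n => ?_
  obtain ⟨f, d, hf⟩ := Completion.exists_of_add n (x - y)
  have hc : ∀ g, ∃ a : A, f.coeff g = hbar ^ n • a := by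
    intro g
    rw [← Completion.eval_of_eq_zero, ← Laurent.coeff_of, Completion.eval_eq_zero]
    refine ⟨-Laurent.coeff g d, ?_⟩
    have := congrArg (Laurent.coeff g) hf
    rw [map_sub, h, sub_self, map_add, map_smul] at this
    rw [smul_neg]
    exact eq_neg_of_add_eq_zero_left this.symm
  choose a ha using hc
  let f' : HahnSeries Γ A :=
    { coeff := fun g => if f.coeff g = 0 then 0 else a g
      isPWO_support' := f.isPWO_support.mono fun g hg => by
        simp only [Function.mem_support, ne_eq, ite_eq_left_iff, not_forall] at hg
        exact hg.1 }
  have hf' : f = hbar ^ n • f' := by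
    ext g
    rw [HahnSeries.coeff_smul]
    change f.coeff g = hbar ^ n • (if f.coeff g = 0 then 0 else a g)
    split_ifs with h0
    · rw [smul_zero, h0]
    · exact ha g
  exact ⟨Completion.of _ f' + d, by rw [hf, smul_add, ← map_smul, ← hf']⟩

/-- The algebra homomorphism between algebras of Hahn series given by a homomorphism of the
coefficients. -/
def hahnMap (Γ : Type) [AddCommGroup Γ] [PartialOrder Γ] [IsOrderedAddMonoid Γ]
    (f : A →ₐ[Base] B) : HahnSeries Γ A →ₐ[Base] HahnSeries Γ B where
  toFun x := x.map f
  map_one' := by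
    ext g
    simp only [HahnSeries.map_coeff, HahnSeries.coeff_one]
    split_ifs <;> simp
  map_mul' x y := HahnSeries.map_mul (f : A →ₙ+* B)
  map_zero' := by ext g; simp
  map_add' x y := by ext g; simp
  commutes' r := by
    ext g
    simp only [HahnSeries.map_coeff, HahnSeries.algebraMap_apply, HahnSeries.C_apply,
      HahnSeries.coeff_single]
    split_ifs <;> simp

/-- Functoriality of Laurent series in the coefficients. -/
def laurentMap (Γ : Type) [AddCommGroup Γ] [PartialOrder Γ] [IsOrderedAddMonoid Γ]
    (f : A →ₐ[Base] B) : Laurent Γ A →ₐ[Base] Laurent Γ B :=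
  Completion.mapAlg (hahnMap Γ f)

theorem laurentMap_coeff (f : A →ₐ[Base] B) (x : Laurent Γ A) (g : Γ) :
    Laurent.coeff g (laurentMap Γ f x) = Completion.map f.toLinearMap (Laurent.coeff g x) := by
  have : (Laurent.coeff g) ∘ₗ (laurentMap Γ f).toLinearMap
      = (Completion.map f.toLinearMap) ∘ₗ Laurent.coeff g := Completion.ext_dense fun x => rfl
  exact LinearMap.congr_fun this x

end Laurent

/-! ### Homomorphisms out of the quantum toroidal algebra -/

section LiftFree

variable {T : Type} [Ring T] [Algebra Base T]

/-- A complete algebra is its own completion. -/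
def completionEquiv (T : Type) [Ring T] [Algebra Base T] [IsAdicComplete hIdeal T] :
    T ≃ₐ[Base] Completion T :=
  AlgEquiv.ofBijective (Completion.ofAlg T) (AdicCompletion.of_bijective hIdeal T)

/-- The homomorphism from the completed free algebra with given values on the generators. -/
def liftFree [IsAdicComplete hIdeal T] (v : Gen → T) : Free →ₐ[Base] T :=
  (completionEquiv T).symm.toAlgHom.comp
    (Completion.mapAlg (FreeAlgebra.lift Base v))

theorem liftFree_of [IsAdicComplete hIdeal T] (v : Gen → T) (a : FreeAlgebra Base Gen) :
    liftFree v (Completion.of _ a) = FreeAlgebra.lift Base v a :=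
  (completionEquiv T).symm_apply_apply (FreeAlgebra.lift Base v a)

theorem liftFree_gen [IsAdicComplete hIdeal T] (v : Gen → T) (g : Gen) :
    liftFree v (Free.gen g) = v g := by
  rw [Free.gen, liftFree_of, FreeAlgebra.lift_ι_apply]

theorem free_hom_ext [IsHausdorff hIdeal T] {f g : Free →ₐ[Base] T}
    (h : ∀ s, f (Free.gen s) = g (Free.gen s)) : f = g := by
  refine Completion.algHom_ext_dense fun a => ?_
  have : f.comp (Completion.ofAlg _) = g.comp (Completion.ofAlg _) :=
    FreeAlgebra.hom_ext (funext h)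
  exact AlgHom.congr_fun this a

end LiftFree

namespace U

theorem mk_surjective : Function.Surjective mk := RingCon.mkₐ_surjective _

theorem mk_eq_zero {a : Free} : mk a = 0 ↔ a ∈ relIdeal := by
  rw [TwoSidedIdeal.mem_iff]
  exact RingCon.eq _

theorem mk_eq_mk {a b : Free} (h : Relation a b) : mk a = mk b := by
  rw [← sub_eq_zero, ← map_sub, mk_eq_zero, relIdeal, TwoSidedIdeal.mem_sInf]
  exact fun I hI => hI.1 a b h

instance : Module.IsTorsionFree Base U := by
  refine isTorsionFree_of_hbar fun x hx => ?_
  obtain ⟨a, rfl⟩ := mk_surjective x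
  rw [← map_smul, mk_eq_zero, relIdeal, TwoSidedIdeal.mem_sInf] at hx
  rw [mk_eq_zero, relIdeal, TwoSidedIdeal.mem_sInf]
  exact fun I hI => hI.2.2 a (hx I hI)

instance : IsHausdorff hIdeal U := by
  refine isHausdorff_of_forall fun x hx => ?_
  obtain ⟨a, rfl⟩ := mk_surjective x
  rw [mk_eq_zero, relIdeal, TwoSidedIdeal.mem_sInf]
  intro I hI
  refine hI.2.1 a fun n => ?_
  obtain ⟨d, hd⟩ := hx n
  obtain ⟨d, rfl⟩ := mk_surjective d
  refine ⟨a - hbar ^ n • d, ?_, d, by abel⟩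
  have : a - hbar ^ n • d ∈ relIdeal := by
    rw [← mk_eq_zero, map_sub, map_smul, hd, sub_self]
  rw [relIdeal, TwoSidedIdeal.mem_sInf] at this
  exact this I hI

variable {T : Type} [Ring T] [Algebra Base T]

/-- A homomorphism from the completed free algebra to a separated algebra without torsion descends
to `𝒰` as soon as it respects the defining relations. -/
def lift [IsHausdorff hIdeal T] [Module.IsTorsionFree Base T] (F : Free →ₐ[Base] T)
    (h : ∀ a b, Relation a b → F a = F b) : U →ₐ[Base] T :=
  RingCon.liftₐ relIdeal.ringCon F (by
    have hle : relIdeal ≤ TwoSidedIdeal.ker F := by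
      refine sInf_le ⟨fun a b hab => ?_, fun a ha => ?_, fun a ha => ?_⟩
      · rw [TwoSidedIdeal.mem_ker, map_sub, h a b hab, sub_self]
      · rw [TwoSidedIdeal.mem_ker]
        refine eq_zero_of_forall_hbar fun n => ?_
        obtain ⟨b, hb, d, rfl⟩ := ha n
        rw [TwoSidedIdeal.mem_ker] at hb
        exact ⟨F d, by rw [map_add, hb, zero_add, map_smul]⟩
      · rw [TwoSidedIdeal.mem_ker, map_smul] at ha
        rw [TwoSidedIdeal.mem_ker]
        exact eq_zero_of_hbar_smul (n := 1) (by rwa [pow_one])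
    intro x y hxy
    have h1 : x - y ∈ relIdeal := (TwoSidedIdeal.rel_iff _ _ _).1 hxy
    have h2 := hle h1
    rw [TwoSidedIdeal.mem_ker, map_sub, sub_eq_zero] at h2
    exact h2)

theorem lift_mk [IsHausdorff hIdeal T] [Module.IsTorsionFree Base T] (F : Free →ₐ[Base] T)
    (h : ∀ a b, Relation a b → F a = F b) (a : Free) : lift F h (mk a) = F a := rfl

/-- A generator as an element of `𝒰`. -/
def gen (g : Gen) : U := mk (Free.gen g)

theorem hom_ext_gen [IsHausdorff hIdeal T] {f g : U →ₐ[Base] T} (h : ∀ s, f (gen s) = g (gen s)) :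
    f = g := by
  have : f.comp mk = g.comp mk := free_hom_ext h
  ext x
  obtain ⟨a, rfl⟩ := mk_surjective x
  exact AlgHom.congr_fun this a

theorem commute_of_gen [IsHausdorff hIdeal T] (f : U →ₐ[Base] T) {a : T}
    (h : ∀ s, Commute a (f (gen s))) (x : U) : Commute a (f x) := by
  obtain ⟨x, rfl⟩ := mk_surjective x
  have : LinearMap.mulLeft Base a ∘ₗ f.toLinearMap ∘ₗ mk.toLinearMap
      = LinearMap.mulRight Base a ∘ₗ f.toLinearMap ∘ₗ mk.toLinearMap := by
    refine Completion.ext_dense fun y => ?_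
    change Commute a (f (mk (Completion.ofAlg _ y)))
    induction y using FreeAlgebra.induction with
    | grade0 r =>
      rw [AlgHom.commutes, AlgHom.commutes, AlgHom.commutes]
      exact (Algebra.commutes r a).symm
    | grade1 s => exact h s
    | mul x y hx hy =>
      rw [map_mul, map_mul, map_mul]
      exact hx.mul_right hy
    | add x y hx hy =>
      rw [map_add, map_add, map_add]
      exact hx.add_right hy
  exact LinearMap.congr_fun this x

theorem c_commute (x : U) : Commute c x :=
  commute_of_gen (AlgHom.id Base U) (fun s => by
    have := mk_eq_mk (Relation.central s)
    rw [map_mul, map_mul] at this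
    exact this) x

end U

/-! ### Exponentials in the `ħ`-adic topology -/

theorem sum_range_sum_range {M : Type} [AddCommMonoid M] (F : ℕ → ℕ → M) (N : ℕ) :
    ∑ i ∈ Finset.range N, ∑ j ∈ Finset.range N, F i j
      = ∑ k ∈ Finset.range N, ∑ p ∈ Finset.HasAntidiagonal.antidiagonal k, F p.1 p.2
        + ∑ p ∈ (Finset.range N ×ˢ Finset.range N).filter (fun p => ¬ p.1 + p.2 < N),
            F p.1 p.2 := by
  rw [← Finset.sum_product' (f := F), ← Finset.sum_filter_add_sum_filter_not
    (Finset.range N ×ˢ Finset.range N) (fun p => p.1 + p.2 < N)]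
  congr 1
  rw [← Finset.sum_fiberwise_of_maps_to (t := Finset.range N) (g := fun p => p.1 + p.2)
    (by intro p hp; simpa using (Finset.mem_filter.1 hp).2)]
  refine Finset.sum_congr rfl fun k hk => Finset.sum_congr ?_ fun _ _ => rfl
  ext p
  simp only [Finset.mem_filter, Finset.mem_product, Finset.mem_range,
    Finset.HasAntidiagonal.mem_antidiagonal]
    at hk ⊢
  omega

/-- The constant `1 / k!`. -/
def invFact (k : ℕ) : Base := PowerSeries.C ((k.factorial : ℂ)⁻¹)

theorem invFact_zero : invFact 0 = 1 := by simp [invFact]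

theorem invFact_one : invFact 1 = 1 := by simp [invFact]

theorem invFact_mul_choose (i j : ℕ) :
    invFact (i + j) * ((i + j).choose i : ℕ) = invFact i * invFact j := by
  have h : (i + j).choose i * i.factorial * j.factorial = (i + j).factorial := by
    have := Nat.choose_mul_factorial_mul_factorial (Nat.le_add_right i j)
    rwa [Nat.add_sub_cancel_left] at this
  have hc : (((i + j).choose i : ℕ) : Base) = PowerSeries.C (((i + j).choose i : ℕ) : ℂ) := by
    simp
  rw [invFact, invFact, invFact, hc, ← map_mul, ← map_mul, ← h]
  congr 1
  have h1 : ((i.factorial : ℕ) : ℂ) ≠ 0 := by exact_mod_cast i.factorial_ne_zero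
  have h2 : ((j.factorial : ℕ) : ℂ) ≠ 0 := by exact_mod_cast j.factorial_ne_zero
  have h3 : (((i + j).choose i : ℕ) : ℂ) ≠ 0 := by
    exact_mod_cast (Nat.choose_pos (Nat.le_add_right i j)).ne'
  push_cast
  field_simp

theorem sum_antidiagonal_invFact {R : Type} [Ring R] [Algebra Base R] {a b : R}
    (h : Commute a b) (k : ℕ) :
    invFact k • (a + b) ^ k
      = ∑ p ∈ Finset.HasAntidiagonal.antidiagonal k, (invFact p.1 * invFact p.2) •
        (a ^ p.1 * b ^ p.2) := by
  rw [h.add_pow', Finset.smul_sum]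
  refine Finset.sum_congr rfl fun p hp => ?_
  rw [Finset.HasAntidiagonal.mem_antidiagonal] at hp
  rw [← invFact_mul_choose, hp, ← Nat.cast_smul_eq_nsmul Base, smul_smul]

section IsExp

variable {T : Type} [Ring T] [Algebra Base T] {T' : Type} [Ring T'] [Algebra Base T']

theorem mul_dvd_left {n : ℕ} (a : T) {x : T} (h : ∃ d, x = hbar ^ n • d) :
    ∃ d, a * x = hbar ^ n • d := by
  obtain ⟨d, rfl⟩ := h
  exact ⟨a * d, by rw [mul_smul_comm]⟩

theorem mul_dvd_right {n : ℕ} (a : T) {x : T} (h : ∃ d, x = hbar ^ n • d) :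
    ∃ d, x * a = hbar ^ n • d := by
  obtain ⟨d, rfl⟩ := h
  exact ⟨d * a, by rw [smul_mul_assoc]⟩

theorem add_dvd {M : Type} [AddCommGroup M] [Module Base M] {n : ℕ} {x y : M}
    (hx : ∃ d, x = hbar ^ n • d) (hy : ∃ d, y = hbar ^ n • d) : ∃ d, x + y = hbar ^ n • d := by
  obtain ⟨d, rfl⟩ := hx
  obtain ⟨e, rfl⟩ := hy
  exact ⟨d + e, (smul_add _ _ _).symm⟩

theorem sum_dvd {M ι : Type} [AddCommGroup M] [Module Base M] {n : ℕ} {s : Finset ι} {f : ι → M}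
    (h : ∀ i ∈ s, ∃ d, f i = hbar ^ n • d) : ∃ d, ∑ i ∈ s, f i = hbar ^ n • d := by
  rw [← mem_hPow]
  exact Submodule.sum_mem _ fun i hi => mem_hPow.2 (h i hi)

/-- `x` is the exponential of `ħ a`: it is congruent to the partial sums of the exponential series
modulo the powers of `ħ`. -/
def IsExp (a x : T) : Prop :=
  ∀ n : ℕ, ∃ d, x - ∑ k ∈ Finset.range n, (invFact k * hbar ^ k) • a ^ k = hbar ^ n • d

theorem IsExp.unique [IsHausdorff hIdeal T] {a x y : T} (hx : IsExp a x) (hy : IsExp a y) :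
    x = y := by
  refine eq_of_forall_hbar fun n => ?_
  obtain ⟨d, hd⟩ := hx n
  obtain ⟨e, he⟩ := hy n
  exact ⟨d - e, by rw [smul_sub, ← hd, ← he]; abel⟩

theorem IsExp.map {a x : T} (h : IsExp a x) (f : T →ₐ[Base] T') : IsExp (f a) (f x) := by
  intro n
  obtain ⟨d, hd⟩ := h n
  refine ⟨f d, ?_⟩
  rw [← map_smul, ← hd, map_sub, map_sum]
  simp only [map_smul, map_pow]

theorem IsExp.zero : IsExp (0 : T) 1 := by
  intro n
  rcases n with _ | n
  · exact ⟨1, by simp⟩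
  · refine ⟨0, ?_⟩
    rw [Finset.sum_range_succ', Finset.sum_eq_zero]
    · simp [invFact_zero]
    · intro k _
      simp

theorem IsExp.add {a b x y : T} (h : Commute a b) (hx : IsExp a x) (hy : IsExp b y) :
    IsExp (a + b) (x * y) := by
  intro n
  set S : T → T := fun c => ∑ k ∈ Finset.range n, (invFact k * hbar ^ k) • c ^ k with hS
  have h1 : ∃ d, S a * S b - S (a + b) = hbar ^ n • d := by
    have hprod : S a * S b = ∑ i ∈ Finset.range n, ∑ j ∈ Finset.range n,
        (invFact i * hbar ^ i * (invFact j * hbar ^ j)) • (a ^ i * b ^ j) := by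
      simp only [hS, Finset.sum_mul_sum, smul_mul_smul_comm]
    have hsum : S (a + b) = ∑ k ∈ Finset.range n, ∑ p ∈ Finset.HasAntidiagonal.antidiagonal k,
        (invFact p.1 * hbar ^ p.1 * (invFact p.2 * hbar ^ p.2)) • (a ^ p.1 * b ^ p.2) := by
      refine Finset.sum_congr rfl fun k _ => ?_
      rw [mul_comm (invFact k), mul_smul, sum_antidiagonal_invFact h, Finset.smul_sum]
      refine Finset.sum_congr rfl fun p hp => ?_
      rw [Finset.HasAntidiagonal.mem_antidiagonal] at hp
      rw [smul_smul, ← hp, pow_add]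
      congr 1
      ring
    rw [hprod, hsum, sum_range_sum_range, add_sub_cancel_left]
    refine sum_dvd fun p hp => ?_
    have hp := (Finset.mem_filter.1 hp).2
    obtain ⟨m, hm⟩ := Nat.exists_eq_add_of_le (not_lt.1 hp)
    refine ⟨(invFact p.1 * invFact p.2 * hbar ^ m) • (a ^ p.1 * b ^ p.2), ?_⟩
    rw [smul_smul]
    congr 1
    calc invFact p.1 * hbar ^ p.1 * (invFact p.2 * hbar ^ p.2)
        = invFact p.1 * invFact p.2 * hbar ^ (p.1 + p.2) := by ring
      _ = _ := by rw [hm]; ring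
  have h2 := mul_dvd_right y (hx n)
  have h3 := mul_dvd_left (S a) (hy n)
  obtain ⟨d, hd⟩ := add_dvd (add_dvd h2 h3) h1
  refine ⟨d, ?_⟩
  rw [← hd]
  noncomm_ring

theorem IsExp.commute [IsHausdorff hIdeal T] {a x y : T} (hx : IsExp a x) (h : Commute a y) :
    Commute x y := by
  refine eq_of_forall_hbar fun n => ?_
  have h1 : Commute (∑ k ∈ Finset.range n, (invFact k * hbar ^ k) • a ^ k) y :=
    Commute.sum_left _ _ _ fun k _ => (h.pow_left k).smul_left _
  obtain ⟨d, hd⟩ := hx n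
  refine ⟨d * y - y * d, ?_⟩
  rw [smul_sub, ← smul_mul_assoc, ← mul_smul_comm, ← hd, sub_mul, mul_sub, h1.eq]
  abel

theorem pow_sub_pow_dvd {n : ℕ} {a b : T} (h : ∃ d, a - b = hbar ^ n • d) (k : ℕ) :
    ∃ d, a ^ k - b ^ k = hbar ^ n • d := by
  induction k with
  | zero => exact ⟨0, by simp⟩
  | succ k ih =>
    obtain ⟨d, hd⟩ := add_dvd (mul_dvd_right a ih) (mul_dvd_left (b ^ k) h)
    refine ⟨d, ?_⟩
    rw [← hd, pow_succ, pow_succ]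
    noncomm_ring

/-- The exponential is injective, even on elements which do not commute. -/
theorem IsExp.injective [IsHausdorff hIdeal T] [Module.IsTorsionFree Base T] {a b x : T}
    (ha : IsExp a x) (hb : IsExp b x) : a = b := by
  refine eq_of_forall_hbar fun n => ?_
  induction n with
  | zero => exact ⟨a - b, by simp⟩
  | succ n ih =>
    obtain ⟨d, hd⟩ := ha (n + 2)
    obtain ⟨e, he⟩ := hb (n + 2)
    have hsplit : ∀ c : T, ∑ k ∈ Finset.range (n + 2), (invFact k * hbar ^ k) • c ^ k
        = ∑ k ∈ Finset.range n, (invFact (k + 2) * hbar ^ (k + 2)) • c ^ (k + 2)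
          + hbar • c + 1 := by
      intro c
      rw [Finset.sum_range_succ', Finset.sum_range_succ']
      simp [invFact_zero, invFact_one]
    have hrest : ∃ f, ∑ k ∈ Finset.range n, (invFact (k + 2) * hbar ^ (k + 2)) •
        (a ^ (k + 2) - b ^ (k + 2)) = hbar ^ (n + 2) • f := by
      refine sum_dvd fun k _ => ?_
      obtain ⟨f, hf⟩ := pow_sub_pow_dvd ih (k + 2)
      refine ⟨(invFact (k + 2) * hbar ^ k) • f, ?_⟩
      rw [hf, smul_smul, smul_smul]
      congr 1
      ring
    obtain ⟨f, hf⟩ := hrest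
    refine ⟨e - d - f, ?_⟩
    rw [← sub_eq_zero]
    refine eq_zero_of_hbar_smul (n := 1) ?_
    rw [pow_one, smul_sub, smul_smul, ← pow_succ', smul_sub, smul_sub,
      show n + 1 + 1 = n + 2 from rfl, smul_sub (hbar ^ (n + 2)) e d, ← hd, ← he, ← hf, hsplit,
        hsplit]
    simp only [smul_sub, Finset.sum_sub_distrib]
    abel

theorem isExp_expSeries {A : Type} [Ring A] [Algebra Base A] (κ : ℂ) (a : A) :
    IsExp ((PowerSeries.C κ : Base) • Completion.of A a) (Completion.expSeries κ a) := by
  intro n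
  rw [← Completion.eval_eq_zero, map_sub, sub_eq_zero]
  have : ∑ k ∈ Finset.range n, (invFact k * hbar ^ k) •
      ((PowerSeries.C κ : Base) • Completion.of A a) ^ k
      = Completion.of A (∑ k ∈ Finset.range n,
        (PowerSeries.monomial k (κ ^ k / (k.factorial : ℂ)) : Base) • a ^ k) := by
    rw [map_sum]
    refine Finset.sum_congr rfl fun k _ => ?_
    rw [smul_pow, smul_smul, map_smul, ← Completion.ofAlg_apply, ← Completion.ofAlg_apply, map_pow]
    congr 1
    rw [PowerSeries.monomial_eq_C_mul_X_pow, invFact, hbar, div_eq_mul_inv, map_mul, map_pow]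
    ring
  rw [this]
  rfl

end IsExp

/-! ### Exponentials of power series without constant term -/

section PowerSeriesExp

variable {T : Type} [Ring T] [Algebra Base T] {T' : Type} [Ring T'] [Algebra Base T']

open PowerSeries in
theorem coeff_pow_eq_zero {T : Type} [Ring T] {X : PowerSeries T} (hX : coeff 0 X = 0) {k n : ℕ}
    (h : n < k) :
    coeff n (X ^ k) = 0 := by
  induction k generalizing n with
  | zero => omega
  | succ k ih =>
    rw [pow_succ, coeff_mul]
    refine Finset.sum_eq_zero fun p hp => ?_
    rw [Finset.HasAntidiagonal.mem_antidiagonal] at hp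
    by_cases h2 : p.2 = 0
    · rw [h2, hX, mul_zero]
    · rw [ih (by omega), zero_mul]

/-- The exponential of a power series without constant term; for each coefficient only finitely
many terms of the exponential series matter. -/
def psExp (X : PowerSeries T) : PowerSeries T :=
  PowerSeries.mk fun n =>
    ∑ k ∈ Finset.range (n + 1), invFact k • PowerSeries.coeff n (X ^ k)

open PowerSeries in
theorem coeff_psExp {X : PowerSeries T} (hX : coeff 0 X = 0) {n N : ℕ} (h : n < N) :
    coeff n (psExp X) = coeff n (∑ k ∈ Finset.range N, invFact k • X ^ k) := by
  rw [psExp, coeff_mk, map_sum]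
  have : ∀ k, coeff n (invFact k • X ^ k) = invFact k • coeff n (X ^ k) := fun k => rfl
  simp only [this]
  refine Finset.sum_subset (by intro k; simp; omega) fun k _ hk => ?_
  rw [coeff_pow_eq_zero hX (by simpa using hk), smul_zero]

open PowerSeries in
theorem psExp_add {X Y : PowerSeries T} (h : Commute X Y) (hX : coeff 0 X = 0)
    (hY : coeff 0 Y = 0) : psExp (X + Y) = psExp X * psExp Y := by
  ext n
  have h1 : coeff n (psExp X * psExp Y)
      = coeff n ((∑ k ∈ Finset.range (n + 1), invFact k • X ^ k)
        * ∑ k ∈ Finset.range (n + 1), invFact k • Y ^ k) := by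
    rw [coeff_mul, coeff_mul]
    refine Finset.sum_congr rfl fun p hp => ?_
    rw [Finset.HasAntidiagonal.mem_antidiagonal] at hp
    rw [coeff_psExp hX (by omega : p.1 < n + 1), coeff_psExp hY (by omega : p.2 < n + 1)]
  rw [h1, coeff_psExp (by rw [map_add, hX, hY, add_zero]) (Nat.lt_succ_self n)]
  simp only [Finset.sum_mul_sum, smul_mul_smul_comm]
  rw [sum_range_sum_range, map_add, ← Finset.sum_congr rfl
    fun k _ => sum_antidiagonal_invFact h k, left_eq_add, map_sum]
  refine Finset.sum_eq_zero fun p hp => ?_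
  have hp := (Finset.mem_filter.1 hp).2
  change (invFact p.1 * invFact p.2) • coeff n (X ^ p.1 * Y ^ p.2) = 0
  rw [coeff_mul, Finset.sum_eq_zero, smul_zero]
  intro r hr
  rw [Finset.HasAntidiagonal.mem_antidiagonal] at hr
  by_cases h2 : r.1 < p.1
  · rw [coeff_pow_eq_zero hX h2, zero_mul]
  · rw [coeff_pow_eq_zero hY (by omega : r.2 < p.2), mul_zero]

open PowerSeries in
theorem psExp_map (f : T →ₐ[Base] T') (X : PowerSeries T) :
    psExp (PowerSeries.map f.toRingHom X) = PowerSeries.map f.toRingHom (psExp X) := by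
  ext n
  simp only [psExp, coeff_mk, coeff_map, map_sum, ← map_pow]
  exact Finset.sum_congr rfl fun k _ => (map_smul f _ _).symm

/-- The substitution `t ↦ v t` for a central `v`, where `v m` stands for `v ^ m`. -/
def psScale (v : ℕ → T) (X : PowerSeries T) : PowerSeries T :=
  PowerSeries.mk fun m => v m * PowerSeries.coeff m X

open PowerSeries in
theorem psExp_scale {v : ℕ → T} (h0 : v 0 = 1) (hadd : ∀ a b, v (a + b) = v a * v b)
    (X : PowerSeries T) (hc : ∀ m y, Commute (v m) y) :
    psExp (psScale v X) = psScale v (psExp X) := by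
  have hpow : ∀ k n, coeff n (psScale v X ^ k) = v n * coeff n (X ^ k) := by
    intro k
    induction k with
    | zero =>
      intro n
      rw [pow_zero, pow_zero, coeff_one]
      split_ifs with hn
      · rw [hn, h0, one_mul]
      · rw [mul_zero]
    | succ k ih =>
      intro n
      rw [pow_succ, pow_succ, coeff_mul, coeff_mul, Finset.mul_sum]
      refine Finset.sum_congr rfl fun p hp => ?_
      rw [Finset.HasAntidiagonal.mem_antidiagonal] at hp
      rw [ih, psScale, coeff_mk, ← hp, hadd, mul_assoc, mul_assoc, ← mul_assoc _ (v p.2),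
        ← (hc p.2 _).eq, mul_assoc]
  ext n
  simp only [psExp, psScale, coeff_mk, Finset.mul_sum, mul_smul_comm]
  refine Finset.sum_congr rfl fun k _ => ?_
  have := hpow k n
  rw [psScale] at this
  rw [this]

open PowerSeries in
theorem coeff_pow_congr {T : Type} [Ring T] {X Y : PowerSeries T} (hX : coeff 0 X = 0)
    (hY : coeff 0 Y = 0) {n : ℕ}
    (h : ∀ m < n, coeff m X = coeff m Y) (k : ℕ) :
    ∀ m < n + k, coeff m (X ^ (k + 1)) = coeff m (Y ^ (k + 1)) := by
  induction k with
  | zero => simpa using h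
  | succ k ih =>
    intro m hm
    rw [pow_succ, pow_succ Y, coeff_mul, coeff_mul]
    refine Finset.sum_congr rfl fun p hp => ?_
    rw [Finset.HasAntidiagonal.mem_antidiagonal] at hp
    by_cases h2 : p.2 = 0
    · rw [h2, hX, hY, mul_zero, mul_zero]
    by_cases h1 : p.1 < k + 1
    · rw [coeff_pow_eq_zero hX h1, coeff_pow_eq_zero hY h1, zero_mul, zero_mul]
    · rw [ih _ (by omega), h _ (by omega)]

open PowerSeries in
theorem psExp_injective {X Y : PowerSeries T} (hX : coeff 0 X = 0) (hY : coeff 0 Y = 0)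
    (h : psExp X = psExp Y) : X = Y := by
  ext n
  induction n using Nat.strong_induction_on with
  | _ n ih =>
    rcases n with _ | n
    · rw [hX, hY]
    have := congrArg (coeff (n + 1)) h
    simp only [psExp, coeff_mk] at this
    rw [Finset.sum_range_succ', Finset.sum_range_succ', Finset.sum_range_succ' _ (n + 1),
      Finset.sum_range_succ' _ n] at this
    simp only [zero_add, pow_one, pow_zero, invFact_one, one_smul, add_left_inj] at this
    rw [Finset.sum_congr rfl fun k _ => ?_] at this
    · exact add_left_cancel this
    · rw [show k + 1 + 1 = (k + 1) + 1 from rfl, coeff_pow_congr hX hY ih (k + 1) _ (by omega)]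

end PowerSeriesExp

/-! ### The Cartan currents -/

/-- The scalar `±(q - q⁻¹)`. -/
def phiScalar (s : Sgn) : Base := (s.val : Base) * (q 1 - q (-1))

theorem q_sub_ne_zero : q 1 - q (-1) ≠ 0 := by
  intro h
  have := congrArg (PowerSeries.coeff 1) h
  norm_num [q] at this

theorem phiScalar_ne_zero (s : Sgn) : phiScalar s ≠ 0 := by
  refine mul_ne_zero ?_ q_sub_ne_zero
  cases s <;> simp [Sgn.val]

theorem Sgn.val_mul_self (s : Sgn) : s.val * s.val = 1 := by cases s <;> rfl

theorem Sgn.natAbs_val_mul (s : Sgn) (n : ℕ) : (s.val * n : ℤ).natAbs = n := by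
  cases s <;> simp [Sgn.val]

theorem Sgn.exists_eq (n : ℤ) : ∃ (s : Sgn) (m : ℕ), n = s.val * m := by
  rcases Int.eq_nat_or_neg n with ⟨m, rfl | rfl⟩
  · exact ⟨.plus, m, by simp [Sgn.val]⟩
  · exact ⟨.minus, m, by simp [Sgn.val]⟩

/-- The exponent `±(q - q⁻¹) ∑_{m > 0} h_{±m} t ^ m`, for given values `h` of the generators. -/
def hSeries {T : Type} [Ring T] [Algebra Base T] (s : Sgn) (h : ℤ → T) : PowerSeries T :=
  PowerSeries.mk fun m => if m = 0 then 0 else phiScalar s • h (s.val * m)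

theorem hSeries_coeff_zero {T : Type} [Ring T] [Algebra Base T] (s : Sgn) (h : ℤ → T) :
    PowerSeries.coeff 0 (hSeries s h) = 0 := by simp [hSeries]

theorem hSeries_map {T T' : Type} [Ring T] [Algebra Base T] [Ring T'] [Algebra Base T']
    (f : T →ₐ[Base] T') (s : Sgn) (h : ℤ → T) :
    PowerSeries.map f.toRingHom (hSeries s h) = hSeries s (fun n => f (h n)) := by
  ext m
  simp only [hSeries, PowerSeries.coeff_map, PowerSeries.coeff_mk]
  split_ifs
  · exact map_zero f
  · exact map_smul f _ _

theorem Free.phi_val_mul (s : Sgn) (i : Fin 2) (n : ℕ) :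
    Free.phi s i (s.val * n) = Free.qGen s.val (.h i 0) *
      PowerSeries.coeff n (psExp (hSeries s fun m => Free.gen (.h i m))) := by
  rw [Free.phi, if_pos (by rw [← mul_assoc, Sgn.val_mul_self]; positivity), Sgn.natAbs_val_mul]
  congr 1
  rw [psExp, PowerSeries.coeff_mk]
  rfl

theorem Free.phi_of_neg {s : Sgn} {i : Fin 2} {n : ℤ} (h : s.val * n < 0) : Free.phi s i n = 0 :=
  if_neg (not_le.2 h)

theorem Free.isExp_qGen (κ : ℂ) (g : Gen) :
    IsExp ((PowerSeries.C κ : Base) • Free.gen g) (Free.qGen κ g) := isExp_expSeries _ _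

namespace U

theorem isExp_qGen (κ : ℂ) (g : Gen) :
    IsExp ((PowerSeries.C κ : Base) • gen g) (mk (Free.qGen κ g)) := by
  have := (Free.isExp_qGen κ g).map mk
  rwa [map_smul] at this

theorem isExp_qc (κ : ℂ) : IsExp ((PowerSeries.C κ : Base) • c) (qc κ) := isExp_qGen κ .c

theorem qGen_add (κ κ' : ℂ) (g : Gen) :
    mk (Free.qGen (κ + κ') g) = mk (Free.qGen κ g) * mk (Free.qGen κ' g) := by
  refine (isExp_qGen _ g).unique ?_
  rw [map_add, add_smul]
  exact (isExp_qGen κ g).add (((Commute.refl _).smul_left _).smul_right _) (isExp_qGen κ' g)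

theorem qGen_zero (g : Gen) : mk (Free.qGen 0 g) = 1 := by
  refine (isExp_qGen 0 g).unique ?_
  rw [map_zero, zero_smul]
  exact IsExp.zero

theorem qc_add (κ κ' : ℂ) : qc (κ + κ') = qc κ * qc κ' := qGen_add κ κ' .c

theorem qc_zero : qc 0 = 1 := qGen_zero .c

theorem qc_commute (κ : ℂ) (x : U) : Commute (qc κ) x :=
  (isExp_qc κ).commute ((c_commute x).smul_left _)

theorem phi_val_mul (s : Sgn) (i : Fin 2) (n : ℕ) :
    phi s i (s.val * n) = mk (Free.qGen s.val (.h i 0)) *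
      PowerSeries.coeff n (psExp (hSeries s fun m => gen (.h i m))) := by
  rw [phi, Free.phi_val_mul, map_mul]
  congr 1
  have := psExp_map mk (hSeries s fun m => Free.gen (.h i m))
  rw [hSeries_map] at this
  exact (congrArg (PowerSeries.coeff n) this).symm

theorem phi_of_neg {s : Sgn} {i : Fin 2} {n : ℤ} (h : s.val * n < 0) : phi s i n = 0 := by
  rw [phi, Free.phi_of_neg h, map_zero]

theorem phi_zero (s : Sgn) (i : Fin 2) : phi s i 0 = mk (Free.qGen s.val (.h i 0)) := by
  have := phi_val_mul s i 0
  simpa [psExp, invFact_zero] using this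

/-- A homomorphism from `𝒰` is determined by its values on `c` and on the coefficients of the
currents. The generators `h_{i,n}` are recovered by taking logarithms. -/
theorem hom_ext {T : Type} [Ring T] [Algebra Base T] [IsHausdorff hIdeal T]
    [Module.IsTorsionFree Base T] {f g : U →ₐ[Base] T} (hc : f c = g c)
    (hphi : ∀ s i n, f (phi s i n) = g (phi s i n)) (hx : ∀ s i n, f (x s i n) = g (x s i n)) :
    f = g := by
  refine hom_ext_gen fun t => ?_
  cases t with
  | c => exact hc
  | x s i n => exact hx s i n
  | h i n =>
    by_cases hn : n = 0
    · subst hn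
      have h1 := isExp_qGen ((1 : ℤ) : ℂ) (.h i 0)
      rw [Int.cast_one, map_one, one_smul] at h1
      have hf := h1.map f
      have hg := h1.map g
      have := hphi .plus i 0
      rw [phi_zero, Sgn.val, Int.cast_one] at this
      rw [this] at hf
      exact hf.injective hg
    · obtain ⟨s, m, rfl⟩ := Sgn.exists_eq n
      have hm : m ≠ 0 := by
        rintro rfl
        simp at hn
      have hK : f (mk (Free.qGen s.val (.h i 0))) = g (mk (Free.qGen s.val (.h i 0))) := by
        rw [← phi_zero]
        exact hphi s i 0
      have hexp : psExp (hSeries s fun m => f (gen (.h i m)))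
          = psExp (hSeries s fun m => g (gen (.h i m))) := by
        rw [← hSeries_map f, ← hSeries_map g, psExp_map, psExp_map]
        ext k
        rw [PowerSeries.coeff_map, PowerSeries.coeff_map]
        have h1 := hphi s i (s.val * k)
        rw [phi_val_mul, map_mul, map_mul, ← hK] at h1
        have h2 : f (mk (Free.qGen (-s.val) (.h i 0))) * f (mk (Free.qGen s.val (.h i 0))) = 1 := by
          rw [← map_mul, ← qGen_add, neg_add_cancel, qGen_zero, map_one]
        have h3 := congrArg (fun y => f (mk (Free.qGen (-s.val) (.h i 0))) * y) h1
        simp only [← mul_assoc, h2, one_mul] at h3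
        exact h3
      have h4 := congrArg (PowerSeries.coeff m)
        (psExp_injective (hSeries_coeff_zero _ _) (hSeries_coeff_zero _ _) hexp)
      simp only [hSeries, PowerSeries.coeff_mk, if_neg hm] at h4
      exact smul_right_injective T (phiScalar_ne_zero s) h4

end U

/-! ### Formal distributions -/

section Distributions

variable {K : Type} [CommRing K] {ι : Type} {H : Type} [Ring H] [Algebra K H]

/-- Formal distributions in the variables `ι` with coefficients in `H`, as the functions of the
exponents. The ring structure is pointwise: a product of currents in pairwise different variables
is the product of the corresponding functions. -/
def FormalDist (ι H : Type) : Type := (ι → ℤ) → H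

instance : Ring (FormalDist ι H) := inferInstanceAs (Ring ((ι → ℤ) → H))

instance : Algebra K (FormalDist ι H) := inferInstanceAs (Algebra K ((ι → ℤ) → H))

theorem FormalDist.ext {ι H : Type} {F G : FormalDist ι H} (h : ∀ n, F n = G n) : F = G := funext h

/-- Laurent polynomials in the variables `ι`. -/
abbrev LPoly (K : Type) [CommRing K] (ι : Type) : Type := AddMonoidAlgebra K (ι → ℤ)

/-- The multiplication of a distribution by a monomial is a shift of the exponents. -/
def FormalDist.shift (K : Type) [CommRing K] (ι : Type) (H : Type) [Ring H] [Algebra K H] :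
    Multiplicative (ι → ℤ) →* Module.End K (FormalDist ι H) where
  toFun g :=
    { toFun := fun F n => F (n + g.toAdd)
      map_add' := fun _ _ => rfl
      map_smul' := fun _ _ => rfl }
  map_one' := by
    ext F
    exact FormalDist.ext fun n => congrArg F (add_zero n)
  map_mul' g h := by
    ext F
    exact FormalDist.ext fun n => congrArg F (add_assoc n g.toAdd h.toAdd).symm

/-- Distributions are a module over the Laurent polynomials in the variables. -/
instance : Module (LPoly K ι) (FormalDist ι H) :=
  Module.compHom _ (AddMonoidAlgebra.lift K (Module.End K (FormalDist ι H)) (ι → ℤ)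
    (FormalDist.shift K ι H)).toRingHom

/-- The variable `z_i`. -/
def zvar (K : Type) [CommRing K] {ι : Type} [DecidableEq ι] (i : ι) : LPoly K ι :=
  AddMonoidAlgebra.single (Pi.single i 1) 1

/-- The constant Laurent polynomials. -/
abbrev zconst {K : Type} [CommRing K] {ι : Type} (c : K) : LPoly K ι := algebraMap K _ c

theorem zvar_smul [DecidableEq ι] (i : ι) (F : FormalDist ι H) (n : ι → ℤ) :
    (zvar K i • F) n = F (n + Pi.single i 1) := by
  change AddMonoidAlgebra.lift K (Module.End K (FormalDist ι H)) (ι → ℤ) (FormalDist.shift K ι H)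
    (AddMonoidAlgebra.single (Pi.single i 1) 1) F n = _
  rw [AddMonoidAlgebra.lift_single, one_smul]
  rfl

theorem zconst_smul (c : K) (F : FormalDist ι H) : (zconst c : LPoly K ι) • F = c • F := by
  change AddMonoidAlgebra.lift K (Module.End K (FormalDist ι H)) (ι → ℤ) (FormalDist.shift K ι H)
    (algebraMap K _ c) F = _
  rw [AlgHom.commutes]
  rfl

/-- The current `f`, as a distribution which depends on the variable `z_i` only. -/
def FormalDist.current {ι H : Type} (i : ι) (f : ℤ → H) : FormalDist ι H := fun n => f (n i)

theorem FormalDist.current_apply {ι H : Type} (i : ι) (f : ℤ → H) (n : ι → ℤ) :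
    FormalDist.current i f n = f (n i) := rfl

theorem FormalDist.mul_apply (F G : FormalDist ι H) (n : ι → ℤ) : (F * G) n = F n * G n := rfl

theorem FormalDist.add_apply (F G : FormalDist ι H) (n : ι → ℤ) : (F + G) n = F n + G n := rfl

theorem FormalDist.sub_apply (F G : FormalDist ι H) (n : ι → ℤ) : (F - G) n = F n - G n := rfl

theorem FormalDist.zero_apply (n : ι → ℤ) : (0 : FormalDist ι H) n = 0 := rfl

theorem FormalDist.smul_apply (c : K) (F : FormalDist ι H) (n : ι → ℤ) : (c • F) n = c • F n := rfl

/-! ### Quadratic relations -/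

/-- The coefficient of `z ^ (-m) w ^ (-n)` in
`(α z - β w) f(z) g(w) - (β z - α w) g(w) f(z)`. -/
def quadDefect (α β : K) (f g : ℤ → H) (m n : ℤ) : H :=
  α • (f (m + 1) * g n) - β • (f m * g (n + 1)) - (β • (g n * f (m + 1)) - α • (g (n + 1) * f m))

/-- The quadratic relation `(α z - β w) f(z) g(w) = (β z - α w) g(w) f(z)`. -/
def Quad (α β : K) (f g : ℤ → H) : Prop := ∀ m n, quadDefect α β f g m n = 0

theorem Quad.symm {α β : K} {f g : ℤ → H} (h : Quad α β f g) : Quad α β g f := by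
  intro m n
  have := h n m
  rw [quadDefect] at this ⊢
  rw [← this]
  abel

theorem Quad.smul {α β : K} {f g : ℤ → H} (h : Quad α β f g) (c : K) :
    Quad (c * α) (c * β) f g := by
  intro m n
  have := congrArg (fun y => c • y) (h m n)
  simp only [quadDefect, smul_sub, smul_smul, smul_zero] at this
  exact this

theorem add_single_self [DecidableEq ι] (n : ι → ℤ) (i : ι) :
    (n + Pi.single (M := fun _ => ℤ) i 1) i = n i + 1 := by simp

theorem add_single_ne [DecidableEq ι] (n : ι → ℤ) {i j : ι} (h : j ≠ i) :
    (n + Pi.single (M := fun _ => ℤ) i 1) j = n j := by simp [h]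

theorem Quad.mul_mul {α β : K} {f g : ℤ → H} (h : Quad α β f g) (m n : ℤ) (x y : H) :
    α • (x * f (m + 1) * g n * y) - β • (x * f m * g (n + 1) * y)
      = β • (x * g n * f (m + 1) * y) - α • (x * g (n + 1) * f m * y) := by
  have := congrArg (fun t => x * t * y) (h m n)
  simp only [quadDefect, mul_sub, sub_mul, mul_smul_comm, smul_mul_assoc, mul_zero, zero_mul,
    ← mul_assoc] at this
  rwa [sub_eq_zero] at this

open FormalDist in
theorem Quad.word_left [DecidableEq ι] {α β : K} {f g : ℤ → H} (h : Quad α β f g) {i j k l : ι}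
    (hij : i ≠ j)
    (hk : k ≠ i ∧ k ≠ j) (hl : l ≠ i ∧ l ≠ j) (u v : ℤ → H) :
    (zconst α * zvar K i - zconst β * zvar K j) •
        (current i f * current j g * current k u * current l v)
      = (zconst β * zvar K i - zconst α * zvar K j) •
        (current j g * current i f * current k u * current l v) := by
  refine FormalDist.ext fun n => ?_
  have := h.mul_mul (n i) (n j) 1 (u (n k) * v (n l))
  simp only [one_mul, ← mul_assoc] at this
  simpa only [sub_smul, mul_smul, zconst_smul, FormalDist.sub_apply, FormalDist.smul_apply,
    zvar_smul, FormalDist.mul_apply, current_apply, add_single_self, add_single_ne _ hij,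
    add_single_ne _ hij.symm, add_single_ne _ hk.1, add_single_ne _ hk.2,
    add_single_ne _ hl.1, add_single_ne _ hl.2] using this

open FormalDist in
theorem Quad.word_mid [DecidableEq ι] {α β : K} {f g : ℤ → H} (h : Quad α β f g) {i j k l : ι}
    (hij : i ≠ j)
    (hk : k ≠ i ∧ k ≠ j) (hl : l ≠ i ∧ l ≠ j) (u v : ℤ → H) :
    (zconst α * zvar K i - zconst β * zvar K j) •
        (current k u * current i f * current j g * current l v)
      = (zconst β * zvar K i - zconst α * zvar K j) •
        (current k u * current j g * current i f * current l v) := by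
  refine FormalDist.ext fun n => ?_
  have := h.mul_mul (n i) (n j) (u (n k)) (v (n l))
  simpa only [sub_smul, mul_smul, zconst_smul, FormalDist.sub_apply, FormalDist.smul_apply,
    zvar_smul, FormalDist.mul_apply, current_apply, add_single_self, add_single_ne _ hij,
    add_single_ne _ hij.symm, add_single_ne _ hk.1, add_single_ne _ hk.2,
    add_single_ne _ hl.1, add_single_ne _ hl.2] using this

open FormalDist in
theorem Quad.word_right [DecidableEq ι] {α β : K} {f g : ℤ → H} (h : Quad α β f g) {i j k l : ι}
    (hij : i ≠ j)
    (hk : k ≠ i ∧ k ≠ j) (hl : l ≠ i ∧ l ≠ j) (u v : ℤ → H) :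
    (zconst α * zvar K i - zconst β * zvar K j) •
        (current k u * current l v * current i f * current j g)
      = (zconst β * zvar K i - zconst α * zvar K j) •
        (current k u * current l v * current j g * current i f) := by
  refine FormalDist.ext fun n => ?_
  have := h.mul_mul (n i) (n j) (u (n k) * v (n l)) 1
  simp only [mul_one] at this
  simpa only [sub_smul, mul_smul, zconst_smul, FormalDist.sub_apply, FormalDist.smul_apply,
    zvar_smul, FormalDist.mul_apply, current_apply, add_single_self, add_single_ne _ hij,
    add_single_ne _ hij.symm, add_single_ne _ hk.1, add_single_ne _ hk.2,
    add_single_ne _ hl.1, add_single_ne _ hl.2] using this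

end Distributions

/-! ### The Serre expression -/

section Serre

/-- The alternating sum over the positions of `b` among `x₁ x₂ x₃`, with the coefficients
`c, -s, s, -c`. -/
def serreInner {R A : Type} [Ring A] [SMul R A] (c s : R) (x₁ x₂ x₃ b : A) : A :=
  c • (b * x₁ * x₂ * x₃) - s • (x₁ * b * x₂ * x₃) + s • (x₁ * x₂ * b * x₃) - c • (x₁ * x₂ * x₃ * b)

/-- The Serre expression: the symmetrization of `serreInner`. -/
def serreSum {R A : Type} [Ring A] [SMul R A] (c s : R) (x₁ x₂ x₃ b : A) : A :=
  serreInner c s x₁ x₂ x₃ b + serreInner c s x₁ x₃ x₂ b + serreInner c s x₂ x₁ x₃ b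
    + serreInner c s x₂ x₃ x₁ b + serreInner c s x₃ x₁ x₂ b + serreInner c s x₃ x₂ x₁ b

section Module

variable {R M : Type} [CommRing R] [AddCommGroup M] [Module R M]

/-- Moving one letter through three others, all denominators being cleared. -/
theorem smul_insertions {D₁ D₂ D₃ N₁ N₂ N₃ : R} {v₀ v₁ v₂ v₃ : M} (h₁ : D₁ • v₀ = N₁ • v₁)
    (h₂ : D₂ • v₁ = N₂ • v₂) (h₃ : D₃ • v₂ = N₃ • v₃) (c₀ c₁ c₂ c₃ : R) :
    (D₁ * D₂ * D₃) • (c₀ • v₀ + c₁ • v₁ + c₂ • v₂ + c₃ • v₃)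
      = (c₀ * (N₁ * N₂ * N₃) + c₁ * (D₁ * N₂ * N₃) + c₂ * (D₁ * D₂ * N₃)
        + c₃ * (D₁ * D₂ * D₃)) • v₃ := by
  linear_combination (norm := module) (c₀ * D₂ * D₃) • h₁ + (c₀ * N₁ * D₃ + c₁ * D₁ * D₃) • h₂
    + (c₀ * N₁ * N₂ + c₁ * D₁ * N₂ + c₂ * D₁ * D₂) • h₃

/-- Moving two letters `u₁ u₂` through two letters `x₁ x₂`, all denominators being cleared:
`D_{ab}` and `N_{ab}` are the factors for `u_a` and `x_b`. -/
theorem smul_shuffles {D₁₁ D₁₂ D₂₁ D₂₂ N₁₁ N₁₂ N₂₁ N₂₂ : R} {v₀ v₁ v₂ v₃ v₄ v₅ : M}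
    (h₁ : D₂₁ • v₀ = N₂₁ • v₁) (h₂ : D₂₂ • v₁ = N₂₂ • v₂) (h₃ : D₁₁ • v₂ = N₁₁ • v₄)
    (h₄ : D₂₂ • v₃ = N₂₂ • v₄) (h₅ : D₁₂ • v₄ = N₁₂ • v₅) (c₀ c₁ c₂ c₃ c₄ c₅ : R) :
    (D₁₁ * D₁₂ * D₂₁ * D₂₂) •
        (c₀ • v₀ + c₁ • v₁ + c₂ • v₂ + c₃ • v₃ + c₄ • v₄ + c₅ • v₅)
      = (c₀ * (N₁₁ * N₁₂ * N₂₁ * N₂₂) + c₁ * (N₁₁ * N₁₂ * D₂₁ * N₂₂)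
        + c₂ * (N₁₁ * N₁₂ * D₂₁ * D₂₂) + c₃ * (D₁₁ * N₁₂ * D₂₁ * N₂₂)
        + c₄ * (D₁₁ * N₁₂ * D₂₁ * D₂₂) + c₅ * (D₁₁ * D₁₂ * D₂₁ * D₂₂)) • v₅ := by
  linear_combination (norm := module) (c₀ * D₁₁ * D₁₂ * D₂₂) • h₁
    + (c₀ * D₁₁ * D₁₂ * N₂₁ + c₁ * D₁₁ * D₁₂ * D₂₁) • h₂
    + (c₀ * D₁₂ * N₂₁ * N₂₂ + c₁ * D₁₂ * D₂₁ * N₂₂ + c₂ * D₁₂ * D₂₁ * D₂₂) • h₃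
    + (c₃ * D₁₁ * D₁₂ * D₂₁) • h₄
    + (c₀ * N₁₁ * N₂₁ * N₂₂ + c₁ * N₁₁ * D₂₁ * N₂₂ + c₂ * N₁₁ * D₂₁ * D₂₂
      + c₃ * D₁₁ * D₂₁ * N₂₂ + c₄ * D₁₁ * D₂₁ * D₂₂) • h₅

/-- The identity behind the mixed Serre relation with `x_i x_i x_i` in one and `x_j` in the other
tensor factor; `v_{abc}` stands for `x_i(z_a) x_i(z_b) x_i(z_c)`, times the current `x_j(w)`. -/
theorem serre_identity_three {p z₁ z₂ z₃ w : R} {v₁₂₃ v₁₃₂ v₂₁₃ v₂₃₁ v₃₁₂ v₃₂₁ : M}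
    (l₁₂ : (z₁ - p * z₂) • v₁₂₃ = (p * z₁ - z₂) • v₂₁₃)
    (l₁₃ : (z₁ - p * z₃) • v₁₃₂ = (p * z₁ - z₃) • v₃₁₂)
    (l₂₃ : (z₂ - p * z₃) • v₂₃₁ = (p * z₂ - z₃) • v₃₂₁)
    (r₂₃ : (z₂ - p * z₃) • v₁₂₃ = (p * z₂ - z₃) • v₁₃₂)
    (r₁₃ : (z₁ - p * z₃) • v₂₁₃ = (p * z₁ - z₃) • v₂₃₁)
    (r₁₂ : (z₁ - p * z₂) • v₃₁₂ = (p * z₁ - z₂) • v₃₂₁) (N : R → R → R → R)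
    (hN : N = fun x y z =>
      p * ((w - p * x) * (w - p * y) * (w - p * z))
        + -(p ^ 2 + p + 1) * ((p * w - x) * (w - p * y) * (w - p * z))
        + (p ^ 2 + p + 1) * ((p * w - x) * (p * w - y) * (w - p * z))
        + -p * ((p * w - x) * (p * w - y) * (p * w - z))) :
    N z₁ z₂ z₃ • v₁₂₃ + N z₁ z₃ z₂ • v₁₃₂ + N z₂ z₁ z₃ • v₂₁₃ + N z₂ z₃ z₁ • v₂₃₁
      + N z₃ z₁ z₂ • v₃₁₂ + N z₃ z₂ z₁ • v₃₂₁ = 0 := by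
  subst hN
  -- `N(x, y, z) = (x - p y) (1 - p²) w (w - p² z) + (y - p z) (1 - p²) w (x - p² w)`
  linear_combination (norm := module) ((1 - p ^ 2) * w * (w - p ^ 2 * z₃)) • l₁₂
    + ((1 - p ^ 2) * w * (w - p ^ 2 * z₂)) • l₁₃ + ((1 - p ^ 2) * w * (w - p ^ 2 * z₁)) • l₂₃
    + ((1 - p ^ 2) * w * (z₁ - p ^ 2 * w)) • r₂₃ + ((1 - p ^ 2) * w * (z₂ - p ^ 2 * w)) • r₁₃
    + ((1 - p ^ 2) * w * (z₃ - p ^ 2 * w)) • r₁₂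

/-- The identity behind the mixed Serre relation with `x_i x_i x_j` in one and `x_i` in the other
tensor factor; the subscripts of the vectors stand for the words in `x_i(z_1)`, `x_i(z_2)` and
`x_j(w)`, times the current `x_i(y)`. -/
theorem serre_identity_two_one {p z₁ z₂ y w : R} {v₁₂w v₂₁w v₁w₂ v₂w₁ vw₁₂ vw₂₁ : M}
    (l : (z₁ - p * z₂) • v₁₂w = (p * z₁ - z₂) • v₂₁w)
    (r : (z₁ - p * z₂) • vw₁₂ = (p * z₁ - z₂) • vw₂₁)
    (h₁ : (p * z₂ - w) • v₁₂w - (z₂ - p * w) • v₁w₂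
      = (p * z₂ - w) • v₂w₁ - (z₂ - p * w) • vw₂₁)
    (h₂ : (p * z₁ - w) • v₂₁w - (z₁ - p * w) • v₂w₁
      = (p * z₁ - w) • v₁w₂ - (z₁ - p * w) • vw₁₂)
    (N N' : R → R) (hN : N = fun z => p * y - z) (hN' : N' = fun z => y - p * z)
    (C₀ C₁ C₂ : R → R → R)
    (h0 : C₀ = fun a b => -p * (N a * N b * N' w) + -p * (N' a * N b * N' w)
      + -p * (N' a * N' b * N' w) + (p ^ 2 + p + 1) * (N' a * N' b * N w))
    (h1 : C₁ = fun a b => (p ^ 2 + p + 1) * (N a * N' w * N b)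
      + (p ^ 2 + p + 1) * (N' a * N' w * N b) + -(p ^ 2 + p + 1) * (N' a * N w * N b)
      + -(p ^ 2 + p + 1) * (N' a * N w * N' b))
    (h2 : C₂ = fun a b => -(p ^ 2 + p + 1) * (N' w * N a * N b) + p * (N w * N a * N b)
      + p * (N w * N' a * N b) + p * (N w * N' a * N' b)) :
    C₀ z₁ z₂ • v₁₂w + C₀ z₂ z₁ • v₂₁w + C₁ z₁ z₂ • v₁w₂ + C₁ z₂ z₁ • v₂w₁
      + C₂ z₁ z₂ • vw₁₂ + C₂ z₂ z₁ • vw₂₁ = 0 := by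
  subst h0 h1 h2 hN hN'
  linear_combination (norm := module) ((1 - p ^ 2) * y * (p ^ 2 * y - w)) • l
    + ((p ^ 2 - 1) * y * (y - p ^ 2 * w)) • r
    + ((1 + p) * (1 - p ^ 3) * y * (y - z₁)) • h₁ + ((1 + p) * (1 - p ^ 3) * y * (y - z₂)) • h₂

/-- The identity behind the mixed Serre relation with `x_i x_i` in one and `x_i x_j` in the other
tensor factor; the subscripts of the vectors stand for the words in `x_i(z_1)`, `x_i(z_2)`,
`x_i(y)` and `x_j(w)`. -/
theorem serre_identity_two_two {p z₁ z₂ y w : R} {v₁₂yw v₂₁yw v₁₂wy v₂₁wy : M}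
    (h : (z₁ - p * z₂) • v₁₂yw = (p * z₁ - z₂) • v₂₁yw)
    (h' : (z₁ - p * z₂) • v₁₂wy = (p * z₁ - z₂) • v₂₁wy)
    (k : (y - w) • ((p * y - w) • v₁₂yw - (y - p * w) • v₁₂wy) = 0)
    (k' : (y - w) • ((p * y - w) • v₂₁yw - (y - p * w) • v₂₁wy) = 0)
    (N N' P P' : R → R) (hN : N = fun z => p * y - z) (hN' : N' = fun z => y - p * z)
    (hP : P = fun z => w - p * z) (hP' : P' = fun z => p * w - z)
    (T₁ T₂ : R → R → R)
    (h1 : T₁ = fun a b => -(p ^ 2 + p + 1) * (N a * N b * P a * P b)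
      + (p ^ 2 + p + 1) * (N a * N b * P' a * P b) + -p * (N a * N b * P' a * P' b)
      + (p ^ 2 + p + 1) * (N' a * N b * P' a * P b) + -p * (N' a * N b * P' a * P' b)
      + -p * (N' a * N' b * P' a * P' b))
    (h2 : T₂ = fun a b => p * (P a * P b * N a * N b) + p * (P a * P b * N' a * N b)
      + p * (P a * P b * N' a * N' b) + -(p ^ 2 + p + 1) * (P' a * P b * N' a * N b)
      + -(p ^ 2 + p + 1) * (P' a * P b * N' a * N' b)
      + (p ^ 2 + p + 1) * (P' a * P' b * N' a * N' b)) :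
    T₁ z₁ z₂ • v₁₂yw + T₁ z₂ z₁ • v₂₁yw + T₂ z₁ z₂ • v₁₂wy + T₂ z₂ z₁ • v₂₁wy = 0 := by
  subst h1 h2 hN hN' hP hP'
  linear_combination (norm := module)
    ((1 - p ^ 2) * (-(1 + p + p ^ 2) * (z₁ * z₂ * w) + p * (1 + p) * (y * w * (z₁ + z₂))
      - p ^ 2 * y ^ 3 + p ^ 2 * (y * z₁ * z₂) - p ^ 3 * (y ^ 2 * w))) • h
    + ((1 - p ^ 2) * (y ^ 2 * w + p * y ^ 3 - p * (y * z₁ * z₂) - p * (1 + p) * (y * w * (z₁ + z₂))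
      + p * (1 + p + p ^ 2) * (z₁ * z₂ * w))) • h'
    + ((1 - p ^ 2) * (-(z₁ * z₂) + p * y * z₁ - p ^ 2 * y * z₂ + p ^ 3 * (z₁ * z₂))) • k
    + ((1 - p ^ 2) * (-(z₁ * z₂) + p * y * z₂ - p ^ 2 * y * z₁ + p ^ 3 * (z₁ * z₂))) • k'

end Module

end Serre

/-! ### The order filtration on Laurent series -/

section Order

variable {A : Type} [Ring A]

/-- The series `h` only contains powers `u ^ k` with `k ≥ N`. -/
def OrdGE (N : ℤ) (h : HahnSeries ℤ A) : Prop := ∀ k < N, h.coeff k = 0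

theorem OrdGE.mono {N M : ℤ} {h : HahnSeries ℤ A} (hN : OrdGE N h) (hM : M ≤ N) : OrdGE M h :=
  fun k hk => hN k (hk.trans_le hM)

theorem OrdGE.zero (N : ℤ) : OrdGE N (0 : HahnSeries ℤ A) := fun _ _ => rfl

theorem OrdGE.add {N : ℤ} {x y : HahnSeries ℤ A} (hx : OrdGE N x) (hy : OrdGE N y) :
    OrdGE N (x + y) := fun k hk => by
  rw [HahnSeries.coeff_add, hx k hk, hy k hk, add_zero]

theorem OrdGE.neg {N : ℤ} {x : HahnSeries ℤ A} (hx : OrdGE N x) : OrdGE N (-x) := fun k hk => by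
  rw [HahnSeries.coeff_neg, hx k hk, neg_zero]

theorem OrdGE.sub {N : ℤ} {x y : HahnSeries ℤ A} (hx : OrdGE N x) (hy : OrdGE N y) :
    OrdGE N (x - y) := by
  rw [sub_eq_add_neg]
  exact hx.add hy.neg

theorem OrdGE.mul {N M : ℤ} {x y : HahnSeries ℤ A} (hx : OrdGE N x) (hy : OrdGE M y) :
    OrdGE (N + M) (x * y) := by
  intro k hk
  rw [HahnSeries.coeff_mul]
  refine Finset.sum_eq_zero fun p hp => ?_
  have hp := (Finset.mem_antidiagonal.1 hp).2.2
  by_cases h1 : p.1 < N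
  · rw [hx _ h1, zero_mul]
  · rw [hy _ (by omega), mul_zero]

theorem OrdGE.smul {K : Type} [CommRing K] [Algebra K A] {N : ℤ} {x : HahnSeries ℤ A}
    (hx : OrdGE N x) (c : K) : OrdGE N (c • x) := fun k hk => by
  rw [HahnSeries.coeff_smul, hx k hk, smul_zero]

theorem OrdGE.exists (x : HahnSeries ℤ A) : ∃ N, OrdGE N x := by
  by_cases hx : x = 0
  · exact ⟨0, hx ▸ OrdGE.zero 0⟩
  · exact ⟨x.order, fun k hk => HahnSeries.coeff_eq_zero_of_lt_order hk⟩

theorem eq_zero_of_ordGE {x : HahnSeries ℤ A} (h : ∀ N, OrdGE N x) : x = 0 := by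
  ext k
  exact h (k + 1) k (by omega)

end Order

/-! ### Cancellation of linear factors -/

section Cancel

variable {K : Type} [CommRing K] {ι : Type} [Fintype ι] {A : Type} [Ring A] [Algebra K A]

/-- The coefficients of the distribution `F` tend to zero in the directions in which the weighted
sum of the exponents increases. -/
def WeightBounded (wt : ι → ℤ) (F : FormalDist ι (HahnSeries ℤ A)) : Prop :=
  ∃ C : ℤ, ∀ n : ι → ℤ, OrdGE (∑ i, wt i * n i - C) (F n)

theorem WeightBounded.smul {wt : ι → ℤ} {F : FormalDist ι (HahnSeries ℤ A)}
    (hF : WeightBounded wt F) (r : LPoly K ι) : WeightBounded wt (r • F) := by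
  induction r using AddMonoidAlgebra.induction_linear with
  | zero => exact ⟨0, fun n => by rw [zero_smul]; exact OrdGE.zero _⟩
  | add r s hr hs =>
    obtain ⟨C, hC⟩ := hr
    obtain ⟨D, hD⟩ := hs
    refine ⟨max C D, fun n => ?_⟩
    rw [add_smul]
    exact ((hC n).mono (by have := le_max_left C D; omega)).add
      ((hD n).mono (by have := le_max_right C D; omega))
  | single g c =>
    obtain ⟨C, hC⟩ := hF
    refine ⟨C - ∑ i, wt i * g i, fun n => ?_⟩
    have : ((AddMonoidAlgebra.single g c : LPoly K ι) • F) n = c • F (n + g) := by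
      change AddMonoidAlgebra.lift K (Module.End K (FormalDist ι (HahnSeries ℤ A))) (ι → ℤ)
        (FormalDist.shift K ι (HahnSeries ℤ A)) (AddMonoidAlgebra.single g c) F n = _
      rw [AddMonoidAlgebra.lift_single]
      rfl
    rw [this]
    refine ((hC (n + g)).smul c).mono (le_of_eq ?_)
    simp only [Pi.add_apply, mul_add, Finset.sum_add_distrib]
    ring

variable [DecidableEq ι]

/-- Iterating the recursion expresses each coefficient through coefficients of arbitrarily large
order. -/
theorem WeightBounded.eq_zero_of_shift {wt : ι → ℤ} {F : FormalDist ι (HahnSeries ℤ A)}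
    (hF : WeightBounded wt F) {i j : ι} (hij : wt j < wt i) {c : K}
    (h : ∀ n, F (n + Pi.single (M := fun _ => ℤ) j 1)
      = c • F (n + Pi.single (M := fun _ => ℤ) i 1)) : F = 0 := by
  obtain ⟨C, hC⟩ := hF
  have hk : ∀ (k : ℕ) (n : ι → ℤ),
      F n = c ^ k • F (n + (Pi.single (M := fun _ => ℤ) i (k : ℤ)
        - Pi.single (M := fun _ => ℤ) j (k : ℤ))) := by
    intro k
    induction k with
    | zero => intro n; simp
    | succ k ih =>
      intro n
      rw [ih n]
      have := h (n + (Pi.single (M := fun _ => ℤ) i (k : ℤ)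
        - Pi.single (M := fun _ => ℤ) j (k : ℤ)) - Pi.single (M := fun _ => ℤ) j 1)
      rw [sub_add_cancel] at this
      rw [this, smul_smul, ← pow_succ]
      congr 2
      rw [Nat.cast_succ, Pi.single_add, Pi.single_add]
      abel
  refine FormalDist.ext fun n => eq_zero_of_ordGE fun N => ?_
  obtain ⟨k, hkN⟩ : ∃ k : ℕ, N ≤ ∑ i, wt i * n i + k - C :=
    ⟨(N - (∑ i, wt i * n i - C)).toNat, by
      have := Int.self_le_toNat (N - (∑ i, wt i * n i - C))
      omega⟩
  rw [hk k n]
  refine ((hC _).smul _).mono (hkN.trans ?_)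
  have hsum : ∑ l, wt l * (n + (Pi.single (M := fun _ => ℤ) i (k : ℤ)
        - Pi.single (M := fun _ => ℤ) j (k : ℤ))) l
      = ∑ l, wt l * n l + (wt i - wt j) * k := by
    simp only [Pi.add_apply, Pi.sub_apply, mul_add, mul_sub, Finset.sum_add_distrib,
      Finset.sum_sub_distrib, Pi.single_apply, mul_ite, mul_zero, Finset.sum_ite_eq',
      Finset.mem_univ, if_true]
    ring
  rw [hsum]
  have : (k : ℤ) ≤ (wt i - wt j) * k := le_mul_of_one_le_left (by positivity) (by omega)
  omega

/-- A factor `α z_i - β z_j` can be cancelled, if the coefficients tend to zero as the exponent of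
one variable increases and the one of the other decreases. -/
theorem WeightBounded.cancel {wt : ι → ℤ} {F : FormalDist ι (HahnSeries ℤ A)}
    (hF : WeightBounded wt F) {i j : ι} (hij : wt i ≠ wt j) {α β : K} (hα : IsUnit α)
    (hβ : IsUnit β) (h : (zconst α * zvar K i - zconst β * zvar K j) • F = 0) : F = 0 := by
  have h' : ∀ n, α • F (n + Pi.single (M := fun _ => ℤ) i 1)
      = β • F (n + Pi.single (M := fun _ => ℤ) j 1) := by
    intro n
    have := congrFun h n
    rw [sub_smul, mul_smul, mul_smul, zconst_smul, zconst_smul] at this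
    have h2 : α • ((zvar K i) • F) n - β • ((zvar K j) • F) n = 0 := this
    rwa [zvar_smul, zvar_smul, sub_eq_zero] at h2
  rcases lt_or_gt_of_ne hij with hlt | hlt
  · obtain ⟨a, ha⟩ := hα.exists_left_inv
    refine hF.eq_zero_of_shift hlt (c := a * β) fun n => ?_
    rw [mul_smul, ← h', smul_smul, ha, one_smul]
  · obtain ⟨b, hb⟩ := hβ.exists_left_inv
    refine hF.eq_zero_of_shift hlt (c := b * α) fun n => ?_
    rw [mul_smul, h', smul_smul, hb, one_smul]

end Cancel

/-! ### The mixed Serre relations -/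

section Mixed

variable {K : Type} [CommRing K] {A : Type} [Ring A] [Algebra K A]

theorem serreInner_ordGE {c s : K} {x₁ x₂ x₃ b : HahnSeries ℤ A} {N₁ N₂ N₃ M : ℤ}
    (h₁ : OrdGE N₁ x₁) (h₂ : OrdGE N₂ x₂) (h₃ : OrdGE N₃ x₃) (hb : OrdGE M b) {N : ℤ}
    (hN : N = N₁ + N₂ + N₃ + M) : OrdGE N (serreInner c s x₁ x₂ x₃ b) := by
  subst hN
  refine OrdGE.sub (OrdGE.add (OrdGE.sub ?_ ?_) ?_) ?_
  · exact ((((hb.mul h₁).mul h₂).mul h₃).smul c).mono (by omega)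
  · exact ((((h₁.mul hb).mul h₂).mul h₃).smul s).mono (by omega)
  · exact ((((h₁.mul h₂).mul hb).mul h₃).smul s).mono (by omega)
  · exact ((((h₁.mul h₂).mul h₃).mul hb).smul c).mono (by omega)

theorem serreSum_ordGE {c s : K} {x₁ x₂ x₃ b : HahnSeries ℤ A} {N₁ N₂ N₃ M : ℤ}
    (h₁ : OrdGE N₁ x₁) (h₂ : OrdGE N₂ x₂) (h₃ : OrdGE N₃ x₃) (hb : OrdGE M b) :
    OrdGE (N₁ + N₂ + N₃ + M) (serreSum c s x₁ x₂ x₃ b) := by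
  refine (((((OrdGE.add ?_ ?_).add ?_).add ?_).add ?_).add ?_)
  · exact serreInner_ordGE h₁ h₂ h₃ hb rfl
  · exact serreInner_ordGE h₁ h₃ h₂ hb (by ring)
  · exact serreInner_ordGE h₂ h₁ h₃ hb (by ring)
  · exact serreInner_ordGE h₂ h₃ h₁ hb (by ring)
  · exact serreInner_ordGE h₃ h₁ h₂ hb (by ring)
  · exact serreInner_ordGE h₃ h₂ h₁ hb (by ring)

open FormalDist

/-- The Serre expression of currents, as a distribution in four variables. -/
def serreDist (p : K) (f₁ f₂ f₃ g : ℤ → HahnSeries ℤ A) : FormalDist (Fin 4) (HahnSeries ℤ A) :=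
  serreSum (zconst p : LPoly K (Fin 4)) (zconst (p ^ 2 + p + 1)) (current 0 f₁) (current 1 f₂)
    (current 2 f₃) (current 3 g)

theorem serreDist_apply (p : K) (f₁ f₂ f₃ g : ℤ → HahnSeries ℤ A) (n : Fin 4 → ℤ) :
    serreDist p f₁ f₂ f₃ g n
      = serreSum p (p ^ 2 + p + 1) (f₁ (n 0)) (f₂ (n 1)) (f₃ (n 2)) (g (n 3)) := by
  simp only [serreDist, serreSum, serreInner, zconst_smul, FormalDist.add_apply,
    FormalDist.sub_apply, FormalDist.smul_apply, FormalDist.mul_apply, current_apply]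

theorem serreDist_weightBounded (p : K) {f₁ f₂ f₃ g : ℤ → HahnSeries ℤ A} {e₁ e₂ e₃ e : ℤ}
    (h₁ : ∀ n, OrdGE (e₁ * n) (f₁ n)) (h₂ : ∀ n, OrdGE (e₂ * n) (f₂ n))
    (h₃ : ∀ n, OrdGE (e₃ * n) (f₃ n)) (h : ∀ n, OrdGE (e * n) (g n)) :
    WeightBounded ![e₁, e₂, e₃, e] (serreDist p f₁ f₂ f₃ g) := by
  refine ⟨0, fun n => ?_⟩
  rw [serreDist_apply, sub_zero, Fin.sum_univ_four]
  exact serreSum_ordGE (h₁ _) (h₂ _) (h₃ _) (h _)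

theorem serreSum_eq_zero_of_serreDist {p : K} {f₁ f₂ f₃ g : ℤ → HahnSeries ℤ A}
    (h : serreDist p f₁ f₂ f₃ g = 0) (n₁ n₂ n₃ m : ℤ) :
    serreSum p (p ^ 2 + p + 1) (f₁ n₁) (f₂ n₂) (f₃ n₃) (g m) = 0 := by
  have := congrFun h ![n₁, n₂, n₃, m]
  rw [serreDist_apply] at this
  exact this

/-- The Serre expression vanishes for three letters from one and one letter from the other
direction: moving the letter `g` to the end of each word, at the cost of the factors `p w - z_i`,
leaves an expression to which `serre_identity_three` applies, and these factors can be cancelled.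
-/
theorem serreSum_three_one {p : K} (hp : IsUnit p) {f g : ℤ → HahnSeries ℤ A} {e e' : ℤ}
    (hf : ∀ n, OrdGE (e * n) (f n)) (hg : ∀ n, OrdGE (e' * n) (g n)) (hee : e ≠ e')
    (hff : Quad 1 p f f) (hgf : Quad p 1 g f) (n₁ n₂ n₃ m : ℤ) :
    serreSum p (p ^ 2 + p + 1) (f n₁) (f n₂) (f n₃) (g m) = 0 := by
  have h1 : IsUnit (1 : K) := isUnit_one
  refine serreSum_eq_zero_of_serreDist ?_ n₁ n₂ n₃ m
  have hb := serreDist_weightBounded p hf hf hf hg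
  have ins : ∀ i j k : Fin 4, i ≠ j → i ≠ k → j ≠ k → i ≠ 3 → j ≠ 3 → k ≠ 3 → _ :=
    fun i j k hij hik hjk hi hj hk => smul_insertions
      (hgf.word_left (i := 3) (j := i) (k := j) (l := k) hi.symm ⟨hj, hij.symm⟩ ⟨hk, hik.symm⟩ f f)
      (hgf.word_mid (i := 3) (j := j) (k := i) (l := k) hj.symm ⟨hi, hij⟩ ⟨hk, hjk.symm⟩ f f)
      (hgf.word_right (i := 3) (j := k) (k := i) (l := j) hk.symm ⟨hi, hik⟩ ⟨hj, hjk⟩ f f)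
      (zconst p) (-zconst (p ^ 2 + p + 1)) (zconst (p ^ 2 + p + 1)) (-zconst p)
  have i₁ := ins 0 1 2 (by decide) (by decide) (by decide) (by decide) (by decide) (by decide)
  have i₂ := ins 0 2 1 (by decide) (by decide) (by decide) (by decide) (by decide) (by decide)
  have i₃ := ins 1 0 2 (by decide) (by decide) (by decide) (by decide) (by decide) (by decide)
  have i₄ := ins 1 2 0 (by decide) (by decide) (by decide) (by decide) (by decide) (by decide)
  have i₅ := ins 2 0 1 (by decide) (by decide) (by decide) (by decide) (by decide) (by decide)
  have i₆ := ins 2 1 0 (by decide) (by decide) (by decide) (by decide) (by decide) (by decide)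
  have l₁₂ := hff.word_left (i := (0 : Fin 4)) (j := 1) (k := 2) (l := 3)
    (by decide) (by decide) (by decide) f g
  have l₁₃ := hff.word_left (i := (0 : Fin 4)) (j := 2) (k := 1) (l := 3)
    (by decide) (by decide) (by decide) f g
  have l₂₃ := hff.word_left (i := (1 : Fin 4)) (j := 2) (k := 0) (l := 3)
    (by decide) (by decide) (by decide) f g
  have r₂₃ := hff.word_mid (i := (1 : Fin 4)) (j := 2) (k := 0) (l := 3)
    (by decide) (by decide) (by decide) f g
  have r₁₃ := hff.word_mid (i := (0 : Fin 4)) (j := 2) (k := 1) (l := 3)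
    (by decide) (by decide) (by decide) f g
  have r₁₂ := hff.word_mid (i := (0 : Fin 4)) (j := 1) (k := 2) (l := 3)
    (by decide) (by decide) (by decide) f g
  have key : (zconst p * zvar K (3 : Fin 4) - zconst 1 * zvar K (0 : Fin 4)) •
      (zconst p * zvar K (3 : Fin 4) - zconst 1 * zvar K (1 : Fin 4)) •
      (zconst p * zvar K (3 : Fin 4) - zconst 1 * zvar K (2 : Fin 4)) •
        serreDist p f f f g = 0 := by
    simp only [map_one, one_mul, map_add, map_pow] at *
    have id := serre_identity_three (p := zconst p) (w := zvar K (3 : Fin 4))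
      l₁₂ l₁₃ l₂₃ r₂₃ r₁₃ r₁₂ _ rfl
    beta_reduce at id
    simp only [serreDist, serreSum, serreInner, map_add, map_pow, map_one]
    linear_combination (norm := module) i₁ + i₂ + i₃ + i₄ + i₅ + i₆ + id
  exact hb.cancel (i := 3) (j := 2) hee.symm hp h1 ((hb.smul _).cancel (i := 3) (j := 1) hee.symm hp
    h1 (((hb.smul _).smul _).cancel (i := 3) (j := 0) hee.symm hp h1 key))

/-- The commutation of a current `a = x_i` with the quadratic expression in `a` and `b = x_j`,
inside a word of four letters. -/
theorem cubic_word {p : K} {a b : ℤ → HahnSeries ℤ A}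
    (h : ∀ l m n, Commute (a l) (quadDefect p 1 a b m n)) {i j k l : Fin 4} (hij : i ≠ j)
    (hik : i ≠ k) (hjk : j ≠ k) (hl : l ≠ i ∧ l ≠ j ∧ l ≠ k) (v : ℤ → HahnSeries ℤ A) :
    (zconst p * zvar K j - zvar K k) • (current i a * current j a * current k b * current l v)
        - (zvar K j - zconst p * zvar K k) •
          (current i a * current k b * current j a * current l v)
      = (zconst p * zvar K j - zvar K k) • (current j a * current k b * current i a * current l v)
        - (zvar K j - zconst p * zvar K k) •
          (current k b * current j a * current i a * current l v) := by
  refine FormalDist.ext fun n => ?_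
  have := congrArg (fun t => t * v (n l)) (h (n i) (n j) (n k)).eq
  simp only [quadDefect, mul_sub, sub_mul, mul_smul_comm, smul_mul_assoc, ← mul_assoc,
    one_smul] at this
  simpa only [sub_smul, mul_smul, zconst_smul, FormalDist.sub_apply, FormalDist.smul_apply,
    zvar_smul, FormalDist.mul_apply, current_apply, add_single_self, add_single_ne _ hij,
    add_single_ne _ hik, add_single_ne _ hjk, add_single_ne _ hjk.symm, add_single_ne _ hl.2.1,
    add_single_ne _ hl.2.2, smul_sub] using this

/-- The Serre expression vanishes if one of the three equal letters moves in another direction than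
the remaining three letters; the letter `α` is moved to the end of each word. -/
theorem serreSum_two_one {p : K} (hp : IsUnit p) {a b α : ℤ → HahnSeries ℤ A} {e e' : ℤ}
    (ha : ∀ n, OrdGE (e * n) (a n)) (hb : ∀ n, OrdGE (e * n) (b n))
    (hα : ∀ n, OrdGE (e' * n) (α n)) (hee : e ≠ e') (haa : Quad 1 p a a) (hαa : Quad 1 p α a)
    (hαb : Quad p 1 α b) (h : ∀ l m n, Commute (a l) (quadDefect p 1 a b m n))
    (n₁ n₂ n₃ m : ℤ) :
    serreSum p (p ^ 2 + p + 1) (a n₁) (a n₂) (α n₃) (b m) = 0 := by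
  have h1 : IsUnit (1 : K) := isUnit_one
  refine serreSum_eq_zero_of_serreDist ?_ n₁ n₂ n₃ m
  have hB := serreDist_weightBounded p ha ha hα hb
  have i₁ := fun (i j : Fin 4) (hij : i ≠ j) (hi : i ≠ 2 ∧ i ≠ 3) (hj : j ≠ 2 ∧ j ≠ 3) =>
    smul_insertions
      (hαa.word_left (i := 2) (j := i) (k := j) (l := 3) hi.1.symm ⟨hj.1, hij.symm⟩
        ⟨by decide, hi.2.symm⟩ a b)
      (hαa.word_mid (i := 2) (j := j) (k := i) (l := 3) hj.1.symm ⟨hi.1, hij⟩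
        ⟨by decide, hj.2.symm⟩ a b)
      (hαb.word_right (i := 2) (j := 3) (k := i) (l := j) (by decide) hi hj a a)
      (-zconst p) (-zconst p) (-zconst p) (zconst (p ^ 2 + p + 1))
  have i₂ := fun (i j : Fin 4) (hij : i ≠ j) (hi : i ≠ 2 ∧ i ≠ 3) (hj : j ≠ 2 ∧ j ≠ 3) =>
    smul_insertions
      (hαa.word_left (i := 2) (j := i) (k := 3) (l := j) hi.1.symm ⟨by decide, hi.2.symm⟩
        ⟨hj.1, hij.symm⟩ b a)
      (hαb.word_mid (i := 2) (j := 3) (k := i) (l := j) (by decide) hi hj a a)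
      (hαa.word_right (i := 2) (j := j) (k := i) (l := 3) hj.1.symm ⟨hi.1, hij⟩
        ⟨by decide, hj.2.symm⟩ a b)
      (zconst (p ^ 2 + p + 1)) (zconst (p ^ 2 + p + 1)) (-zconst (p ^ 2 + p + 1))
      (-zconst (p ^ 2 + p + 1))
  have i₃ := fun (i j : Fin 4) (hij : i ≠ j) (hi : i ≠ 2 ∧ i ≠ 3) (hj : j ≠ 2 ∧ j ≠ 3) =>
    smul_insertions
      (hαb.word_left (i := 2) (j := 3) (k := i) (l := j) (by decide) hi hj a a)
      (hαa.word_mid (i := 2) (j := i) (k := 3) (l := j) hi.1.symm ⟨by decide, hi.2.symm⟩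
        ⟨hj.1, hij.symm⟩ b a)
      (hαa.word_right (i := 2) (j := j) (k := 3) (l := i) hj.1.symm ⟨by decide, hj.2.symm⟩
        ⟨hi.1, hij⟩ b a)
      (-zconst (p ^ 2 + p + 1)) (zconst p) (zconst p) (zconst p)
  have j₁ := i₁ 0 1 (by decide) (by decide) (by decide)
  have j₂ := i₁ 1 0 (by decide) (by decide) (by decide)
  have j₃ := i₂ 0 1 (by decide) (by decide) (by decide)
  have j₄ := i₂ 1 0 (by decide) (by decide) (by decide)
  have j₅ := i₃ 0 1 (by decide) (by decide) (by decide)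
  have j₆ := i₃ 1 0 (by decide) (by decide) (by decide)
  have l := haa.word_left (i := (0 : Fin 4)) (j := 1) (k := 3) (l := 2)
    (by decide) (by decide) (by decide) b α
  have r := haa.word_mid (i := (0 : Fin 4)) (j := 1) (k := 3) (l := 2)
    (by decide) (by decide) (by decide) b α
  have c₁ := cubic_word h (i := 0) (j := 1) (k := 3) (l := 2) (by decide) (by decide) (by decide)
    (by decide) α
  have c₂ := cubic_word h (i := 1) (j := 0) (k := 3) (l := 2) (by decide) (by decide) (by decide)
    (by decide) α
  have key : (zconst 1 * zvar K (2 : Fin 4) - zconst p * zvar K (0 : Fin 4)) •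
      (zconst 1 * zvar K (2 : Fin 4) - zconst p * zvar K (1 : Fin 4)) •
      (zconst p * zvar K (2 : Fin 4) - zconst 1 * zvar K (3 : Fin 4)) •
        serreDist p a a α b = 0 := by
    clear i₁ i₂ i₃
    simp only [map_one, one_mul, map_add, map_pow] at *
    have id := serre_identity_two_one (p := zconst p) (y := zvar K (2 : Fin 4))
      l r c₁ c₂ _ _ rfl rfl _ _ _ rfl rfl rfl
    beta_reduce at id
    simp only [serreDist, serreSum, serreInner, map_add, map_pow, map_one]
    linear_combination (norm := module) j₁ + j₂ + j₃ + j₄ + j₅ + j₆ + id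
  exact hB.cancel (i := 2) (j := 3) hee.symm hp h1 ((hB.smul _).cancel (i := 2) (j := 1) hee.symm h1
    hp (((hB.smul _).smul _).cancel (i := 2) (j := 0) hee.symm h1 hp key))

/-- The quadratic relation with the additional factor `z - w`, for the last two letters of a word of
four letters. -/
theorem double_pole_word {p : K} {a b : ℤ → HahnSeries ℤ A}
    (h : ∀ m n, quadDefect p 1 a b (m + 1) n = quadDefect p 1 a b m (n + 1)) {i j k l : Fin 4}
    (hij : i ≠ j) (hk : k ≠ i ∧ k ≠ j) (hl : l ≠ i ∧ l ≠ j) (u v : ℤ → HahnSeries ℤ A) :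
    (zvar K i - zvar K j) • ((zconst p * zvar K i - zvar K j) •
        (current k u * current l v * current i a * current j b)
      - (zvar K i - zconst p * zvar K j) •
        (current k u * current l v * current j b * current i a)) = 0 := by
  refine FormalDist.ext fun n => ?_
  have := congrArg (fun t => u (n k) * v (n l) * t) (h (n i) (n j))
  simp only [quadDefect, mul_sub, mul_smul_comm, ← mul_assoc, one_smul] at this
  rw [← sub_eq_zero] at this
  rw [FormalDist.zero_apply, ← this]
  simp only [sub_smul, mul_smul, zconst_smul, FormalDist.sub_apply, FormalDist.smul_apply,
    zvar_smul, FormalDist.mul_apply, current_apply, add_single_self, add_single_ne _ hij,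
    add_single_ne _ hij.symm, add_single_ne _ hk.1, add_single_ne _ hk.2, add_single_ne _ hl.1,
    add_single_ne _ hl.2, smul_sub]
  abel

/-- The Serre expression vanishes if the fourth letter and one of the three equal letters move in
another direction than the remaining two; the letters `α` and `β` are moved to the end of each
word. -/
theorem serreSum_two_two {p : K} (hp : IsUnit p) {a α β : ℤ → HahnSeries ℤ A} {e e' : ℤ}
    (ha : ∀ n, OrdGE (e * n) (a n)) (hα : ∀ n, OrdGE (e' * n) (α n))
    (hβ : ∀ n, OrdGE (e' * n) (β n)) (hee : e ≠ e') (haa : Quad 1 p a a) (hαa : Quad 1 p α a)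
    (hβa : Quad p 1 β a)
    (h : ∀ m n, quadDefect p 1 α β (m + 1) n = quadDefect p 1 α β m (n + 1)) (n₁ n₂ n₃ m : ℤ) :
    serreSum p (p ^ 2 + p + 1) (a n₁) (a n₂) (α n₃) (β m) = 0 := by
  have h1 : IsUnit (1 : K) := isUnit_one
  refine serreSum_eq_zero_of_serreDist ?_ n₁ n₂ n₃ m
  have hB := serreDist_weightBounded p ha ha hα hβ
  have s₁ := fun (i j : Fin 4) (hij : i ≠ j) (hi : i ≠ 2 ∧ i ≠ 3) (hj : j ≠ 2 ∧ j ≠ 3) =>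
    smul_shuffles
      (hβa.word_mid (i := 3) (j := i) (k := 2) (l := j) hi.2.symm ⟨by decide, hi.1.symm⟩
        ⟨hj.2, hij.symm⟩ α a)
      (hβa.word_right (i := 3) (j := j) (k := 2) (l := i) hj.2.symm ⟨by decide, hj.1.symm⟩
        ⟨hi.2, hij⟩ α a)
      (hαa.word_left (i := 2) (j := i) (k := j) (l := 3) hi.1.symm ⟨hj.1, hij.symm⟩
        ⟨by decide, hi.2.symm⟩ a β)
      (hβa.word_right (i := 3) (j := j) (k := i) (l := 2) hj.2.symm ⟨hi.2, hij⟩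
        ⟨by decide, hj.1.symm⟩ a α)
      (hαa.word_mid (i := 2) (j := j) (k := i) (l := 3) hj.1.symm ⟨hi.1, hij⟩
        ⟨by decide, hj.2.symm⟩ a β)
      (-zconst (p ^ 2 + p + 1)) (zconst (p ^ 2 + p + 1)) (-zconst p) (zconst (p ^ 2 + p + 1))
      (-zconst p) (-zconst p)
  have s₂ := fun (i j : Fin 4) (hij : i ≠ j) (hi : i ≠ 2 ∧ i ≠ 3) (hj : j ≠ 2 ∧ j ≠ 3) =>
    smul_shuffles
      (hαa.word_mid (i := 2) (j := i) (k := 3) (l := j) hi.1.symm ⟨by decide, hi.2.symm⟩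
        ⟨hj.1, hij.symm⟩ β a)
      (hαa.word_right (i := 2) (j := j) (k := 3) (l := i) hj.1.symm ⟨by decide, hj.2.symm⟩
        ⟨hi.1, hij⟩ β a)
      (hβa.word_left (i := 3) (j := i) (k := j) (l := 2) hi.2.symm ⟨hj.2, hij.symm⟩
        ⟨by decide, hi.1.symm⟩ a α)
      (hαa.word_right (i := 2) (j := j) (k := i) (l := 3) hj.1.symm ⟨hi.1, hij⟩
        ⟨by decide, hj.2.symm⟩ a β)
      (hβa.word_mid (i := 3) (j := j) (k := i) (l := 2) hj.2.symm ⟨hi.2, hij⟩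
        ⟨by decide, hj.1.symm⟩ a α)
      (zconst p) (zconst p) (zconst p) (-zconst (p ^ 2 + p + 1)) (-zconst (p ^ 2 + p + 1))
      (zconst (p ^ 2 + p + 1))
  have j₁ := s₁ 0 1 (by decide) (by decide) (by decide)
  have j₂ := s₁ 1 0 (by decide) (by decide) (by decide)
  have j₃ := s₂ 0 1 (by decide) (by decide) (by decide)
  have j₄ := s₂ 1 0 (by decide) (by decide) (by decide)
  have l := haa.word_left (i := (0 : Fin 4)) (j := 1) (k := 2) (l := 3)
    (by decide) (by decide) (by decide) α β
  have l' := haa.word_left (i := (0 : Fin 4)) (j := 1) (k := 3) (l := 2)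
    (by decide) (by decide) (by decide) β α
  have k₁ := double_pole_word h (i := 2) (j := 3) (k := 0) (l := 1) (by decide) (by decide)
    (by decide) a a
  have k₂ := double_pole_word h (i := 2) (j := 3) (k := 1) (l := 0) (by decide) (by decide)
    (by decide) a a
  have key : (zconst 1 * zvar K (2 : Fin 4) - zconst p * zvar K (0 : Fin 4)) •
      (zconst 1 * zvar K (2 : Fin 4) - zconst p * zvar K (1 : Fin 4)) •
      (zconst p * zvar K (3 : Fin 4) - zconst 1 * zvar K (0 : Fin 4)) •
      (zconst p * zvar K (3 : Fin 4) - zconst 1 * zvar K (1 : Fin 4)) •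
        serreDist p a a α β = 0 := by
    clear s₁ s₂
    simp only [map_one, one_mul, map_add, map_pow] at *
    have id := serre_identity_two_two (p := zconst p) (y := zvar K (2 : Fin 4))
      (w := zvar K (3 : Fin 4)) l l' k₁ k₂ _ _ _ _ rfl rfl rfl rfl _ _ rfl rfl
    beta_reduce at id
    simp only [serreDist, serreSum, serreInner, map_add, map_pow, map_one]
    linear_combination (norm := module) j₁ + j₂ + j₃ + j₄ + id
  exact hB.cancel (i := 3) (j := 1) hee.symm hp h1 ((hB.smul _).cancel (i := 3) (j := 0) hee.symm hp
    h1 (((hB.smul _).smul _).cancel (i := 2) (j := 1) hee.symm h1 hp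
      ((((hB.smul _).smul _).smul _).cancel (i := 2) (j := 0) hee.symm h1 hp key)))

theorem quadDefect_ordGE {α β : K} {f g : ℤ → HahnSeries ℤ A} {e e' : ℤ}
    (hf : ∀ n, OrdGE (e * n) (f n)) (hg : ∀ n, OrdGE (e' * n) (g n)) (m n : ℤ) :
    OrdGE (e * m + e' * n - (|e| + |e'|)) (quadDefect α β f g m n) := by
  have h1 := neg_abs_le e
  have h2 := neg_abs_le e'
  have h3 := abs_nonneg e
  have h4 := abs_nonneg e'
  refine ((OrdGE.smul ?_ α).sub (OrdGE.smul ?_ β)).sub ((OrdGE.smul ?_ β).sub (OrdGE.smul ?_ α))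
  · exact ((hf _).mul (hg _)).mono (by linarith)
  · exact ((hf _).mul (hg _)).mono (by linarith)
  · exact ((hg _).mul (hf _)).mono (by linarith)
  · exact ((hg _).mul (hf _)).mono (by linarith)

/-- The quadratic expression in `a`, `b` commutes with every current `f` that moves in another
direction and satisfies quadratic relations with `a` and `b`: moving `f` past both letters
multiplies the expression with a rational function, which is `1` on the support `z = w` of the
expression. -/
theorem commute_quadDefect {p : K} (hp : IsUnit p) {f a b : ℤ → HahnSeries ℤ A} {e e' : ℤ}
    (hf : ∀ n, OrdGE (e * n) (f n)) (ha : ∀ n, OrdGE (e' * n) (a n))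
    (hb : ∀ n, OrdGE (e' * n) (b n)) (hee : e ≠ e') (hfa : Quad 1 p f a) (hfb : Quad p 1 f b)
    (h : ∀ m n, quadDefect p 1 a b (m + 1) n = quadDefect p 1 a b m (n + 1)) (l m n : ℤ) :
    Commute (f l) (quadDefect p 1 a b m n) := by
  have h1 : IsUnit (1 : K) := isUnit_one
  let one : ℤ → HahnSeries ℤ A := fun _ => 1
  let F : FormalDist (Fin 4) (HahnSeries ℤ A) := fun n =>
    f (n 0) * quadDefect p 1 a b (n 1) (n 2) - quadDefect p 1 a b (n 1) (n 2) * f (n 0)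
  have hB : WeightBounded ![e, e', e', 0] F := by
    refine ⟨|e'| + |e'|, fun n => ?_⟩
    rw [Fin.sum_univ_four]
    have := quadDefect_ordGE (α := p) (β := 1) ha hb (n 1) (n 2)
    refine (((hf (n 0)).mul this).mono ?_).sub ((this.mul (hf (n 0))).mono ?_) <;>
    · apply le_of_eq
      change e * n 0 + e' * n 1 + e' * n 2 + 0 * n 3 - (|e'| + |e'|) = _
      ring
  have hF : F = (zconst p * zvar K (1 : Fin 4) - zvar K (2 : Fin 4)) •
        (current (0 : Fin 4) f * current (1 : Fin 4) a * current (2 : Fin 4) b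
          * current (3 : Fin 4) one)
      - (zvar K (1 : Fin 4) - zconst p * zvar K (2 : Fin 4)) •
        (current (0 : Fin 4) f * current (2 : Fin 4) b * current (1 : Fin 4) a
          * current (3 : Fin 4) one)
      - ((zconst p * zvar K (1 : Fin 4) - zvar K (2 : Fin 4)) •
        (current (3 : Fin 4) one * current (1 : Fin 4) a * current (2 : Fin 4) b
          * current (0 : Fin 4) f)
      - (zvar K (1 : Fin 4) - zconst p * zvar K (2 : Fin 4)) •
        (current (3 : Fin 4) one * current (2 : Fin 4) b * current (1 : Fin 4) a
          * current (0 : Fin 4) f)) := by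
    refine FormalDist.ext fun n => ?_
    simp only [F, one, quadDefect, mul_sub, sub_mul, mul_smul_comm, smul_mul_assoc, ← mul_assoc,
      one_smul, sub_smul, mul_smul, zconst_smul, FormalDist.sub_apply, FormalDist.smul_apply,
      zvar_smul, FormalDist.mul_apply, current_apply, add_single_self, mul_one, one_mul,
      add_single_ne _ (show (0 : Fin 4) ≠ 1 by decide),
      add_single_ne _ (show (0 : Fin 4) ≠ 2 by decide),
      add_single_ne _ (show (1 : Fin 4) ≠ 2 by decide),
      add_single_ne _ (show (2 : Fin 4) ≠ 1 by decide)]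
  have w₁ := hfa.word_left (i := (0 : Fin 4)) (j := 1) (k := 2) (l := 3) (by decide) (by decide)
    (by decide) b one
  have w₂ := hfb.word_mid (i := (0 : Fin 4)) (j := 2) (k := 1) (l := 3) (by decide) (by decide)
    (by decide) a one
  have w₃ := hfb.word_left (i := (0 : Fin 4)) (j := 2) (k := 1) (l := 3) (by decide) (by decide)
    (by decide) a one
  have w₄ := hfa.word_mid (i := (0 : Fin 4)) (j := 1) (k := 2) (l := 3) (by decide) (by decide)
    (by decide) b one
  have q : (zvar K (1 : Fin 4) - zvar K (2 : Fin 4)) •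
    ((zconst p * zvar K (1 : Fin 4) - zvar K (2 : Fin 4)) •
        (current (3 : Fin 4) one * current (1 : Fin 4) a * current (2 : Fin 4) b
          * current (0 : Fin 4) f)
      - (zvar K (1 : Fin 4) - zconst p * zvar K (2 : Fin 4)) •
        (current (3 : Fin 4) one * current (2 : Fin 4) b * current (1 : Fin 4) a
          * current (0 : Fin 4) f)) = 0 := by
    refine FormalDist.ext fun n => ?_
    have := congrArg (fun t => t * f (n 0)) (h (n 1) (n 2))
    simp only [quadDefect, sub_mul, smul_mul_assoc, one_smul] at this
    rw [← sub_eq_zero] at this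
    rw [FormalDist.zero_apply, ← this]
    simp only [one, sub_smul, mul_smul, zconst_smul, FormalDist.sub_apply, FormalDist.smul_apply,
      zvar_smul, FormalDist.mul_apply, current_apply, add_single_self, one_mul, smul_sub,
      add_single_ne _ (show (0 : Fin 4) ≠ 1 by decide),
      add_single_ne _ (show (0 : Fin 4) ≠ 2 by decide),
      add_single_ne _ (show (1 : Fin 4) ≠ 2 by decide),
      add_single_ne _ (show (2 : Fin 4) ≠ 1 by decide)]
    abel
  have e₁ : current (3 : Fin 4) one * current (1 : Fin 4) a * current (2 : Fin 4) b
        * current (0 : Fin 4) f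
      = current (1 : Fin 4) a * current (2 : Fin 4) b * current (0 : Fin 4) f
        * current (3 : Fin 4) one :=
    FormalDist.ext fun n => by
      simp only [one, FormalDist.mul_apply, current_apply, one_mul, mul_one]
  have e₂ : current (3 : Fin 4) one * current (2 : Fin 4) b * current (1 : Fin 4) a
        * current (0 : Fin 4) f
      = current (2 : Fin 4) b * current (1 : Fin 4) a * current (0 : Fin 4) f
        * current (3 : Fin 4) one :=
    FormalDist.ext fun n => by
      simp only [one, FormalDist.mul_apply, current_apply, one_mul, mul_one]
  have key : (zconst 1 * zvar K (0 : Fin 4) - zconst p * zvar K (1 : Fin 4)) •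
      (zconst p * zvar K (0 : Fin 4) - zconst 1 * zvar K (2 : Fin 4)) • F = 0 := by
    rw [e₁, e₂] at q hF
    rw [hF]
    clear e₁ e₂ hF hB
    clear_value F one
    simp only [map_one, one_mul] at *
    linear_combination (norm := module)
      ((zconst p * zvar K (1 : Fin 4) - zvar K (2 : Fin 4)) *
        (zconst p * zvar K (0 : Fin 4) - zvar K (2 : Fin 4))) • w₁
      + ((zconst p * zvar K (1 : Fin 4) - zvar K (2 : Fin 4)) *
        (zconst p * zvar K (0 : Fin 4) - zvar K (1 : Fin 4))) • w₂
      - ((zvar K (1 : Fin 4) - zconst p * zvar K (2 : Fin 4)) *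
        (zvar K (0 : Fin 4) - zconst p * zvar K (1 : Fin 4))) • w₃
      - ((zvar K (1 : Fin 4) - zconst p * zvar K (2 : Fin 4)) *
        (zvar K (0 : Fin 4) - zconst p * zvar K (2 : Fin 4))) • w₄
      + (((zconst p : LPoly K (Fin 4)) ^ 2 - 1) * zvar K (0 : Fin 4)) • q
  have hF0 := hB.cancel (i := (0 : Fin 4)) (j := 2) hee hp h1
    ((hB.smul _).cancel (i := (0 : Fin 4)) (j := 1) hee h1 hp key)
  have := congrFun hF0 ![l, m, n, 0]
  exact sub_eq_zero.1 this

end Mixed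

/-! ### Fusion of pairs of currents -/

section SerreSymmetry

variable {R A : Type} [CommRing R] [Ring A] [Algebra R A]

theorem serreSum_swap (c s : R) (x₁ x₂ x₃ b : A) :
    serreSum c s x₂ x₁ x₃ b = serreSum c s x₁ x₂ x₃ b := by
  simp only [serreSum]
  abel

theorem serreSum_rotate (c s : R) (x₁ x₂ x₃ b : A) :
    serreSum c s x₂ x₃ x₁ b = serreSum c s x₁ x₂ x₃ b := by
  simp only [serreSum]
  abel

theorem serreInner_add₁ (c s : R) (x x' x₂ x₃ b : A) :
    serreInner c s (x + x') x₂ x₃ b = serreInner c s x x₂ x₃ b + serreInner c s x' x₂ x₃ b := by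
  simp only [serreInner, add_mul, mul_add, smul_add]
  abel

theorem serreInner_add₂ (c s : R) (x x' x₁ x₃ b : A) :
    serreInner c s x₁ (x + x') x₃ b = serreInner c s x₁ x x₃ b + serreInner c s x₁ x' x₃ b := by
  simp only [serreInner, add_mul, mul_add, smul_add]
  abel

theorem serreInner_add₃ (c s : R) (x x' x₁ x₂ b : A) :
    serreInner c s x₁ x₂ (x + x') b = serreInner c s x₁ x₂ x b + serreInner c s x₁ x₂ x' b := by
  simp only [serreInner, add_mul, mul_add, smul_add]
  abel

theorem serreInner_add₄ (c s : R) (b b' x₁ x₂ x₃ : A) :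
    serreInner c s x₁ x₂ x₃ (b + b') = serreInner c s x₁ x₂ x₃ b + serreInner c s x₁ x₂ x₃ b' := by
  simp only [serreInner, add_mul, mul_add, smul_add]
  abel

theorem serreSum_add (c s : R) (x x' x₂ x₃ b : A) :
    serreSum c s (x + x') x₂ x₃ b = serreSum c s x x₂ x₃ b + serreSum c s x' x₂ x₃ b := by
  simp only [serreSum, serreInner_add₁, serreInner_add₂, serreInner_add₃]
  abel

theorem serreSum_add_right (c s : R) (x₁ x₂ x₃ b b' : A) :
    serreSum c s x₁ x₂ x₃ (b + b') = serreSum c s x₁ x₂ x₃ b + serreSum c s x₁ x₂ x₃ b' := by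
  simp only [serreSum, serreInner_add₄]
  abel

end SerreSymmetry

section Pairs

variable {K : Type} [CommRing K] {H : Type} [Ring H] [Algebra K H]

theorem quadDefect_add (α β : K) (f f' g g' : ℤ → H) (m n : ℤ) :
    quadDefect α β (f + f') (g + g') m n = quadDefect α β f g m n + quadDefect α β f' g m n
      + (quadDefect α β f g' m n + quadDefect α β f' g' m n) := by
  simp only [quadDefect, Pi.add_apply, add_mul, mul_add, smul_add]
  abel

theorem Quad.add {α β : K} {f f' g g' : ℤ → H} (h₁ : Quad α β f g) (h₂ : Quad α β f' g)
    (h₃ : Quad α β f g') (h₄ : Quad α β f' g') : Quad α β (f + f') (g + g') := by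
  intro m n
  rw [quadDefect_add, h₁, h₂, h₃, h₄, add_zero, add_zero]

/-- The quadratic, cubic and Serre relations between the currents `a = x_i^±` and `b = x_j^±`,
`i ≠ j`, where `p = q ^ (±2)`; the relations are multiplied with `p` where this removes an
inverse. -/
structure ToroidalPair (p : K) (a b : ℤ → H) : Prop where
  quad : Quad 1 p a a
  double_pole : ∀ m n, quadDefect p 1 a b (m + 1) n = quadDefect p 1 a b m (n + 1)
  cubic : ∀ l m n, Commute (a l) (quadDefect p 1 a b m n)
  serre : ∀ n₁ n₂ n₃ m, serreSum p (p ^ 2 + p + 1) (a n₁) (a n₂) (a n₃) (b m) = 0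

section Maps

variable {H' : Type} [Ring H'] [Algebra K H']

theorem map_quadDefect (F : H →ₐ[K] H') (α β : K) (f g : ℤ → H) (m n : ℤ) :
    quadDefect α β (fun n => F (f n)) (fun n => F (g n)) m n = F (quadDefect α β f g m n) := by
  simp only [quadDefect, map_sub, map_smul, map_mul]

theorem Quad.map (F : H →ₐ[K] H') {α β : K} {f g : ℤ → H} (h : Quad α β f g) :
    Quad α β (fun n => F (f n)) (fun n => F (g n)) := by
  intro m n
  rw [map_quadDefect, h, map_zero]

theorem ToroidalPair.map (F : H →ₐ[K] H') {p : K} {a b : ℤ → H} (h : ToroidalPair p a b) :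
    ToroidalPair p (fun n => F (a n)) (fun n => F (b n)) where
  quad := h.quad.map F
  double_pole m n := by rw [map_quadDefect, map_quadDefect, h.double_pole]
  cubic l m n := by
    rw [map_quadDefect]
    exact (h.cubic l m n).map F
  serre n₁ n₂ n₃ m := by
    have := congrArg F (h.serre n₁ n₂ n₃ m)
    simpa only [serreSum, serreInner, map_add, map_sub, map_smul, map_mul, map_zero] using this

end Maps

theorem quadDefect_scale {z : ℤ → H} (hz : ∀ m n, z (m + n) = z m * z n)
    (hc : ∀ n x, Commute (z n) x) (α β : K) (f g : ℤ → H) (m n : ℤ) :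
    quadDefect α β (fun n => z n * f n) (fun n => z n * g n) m n
      = z (m + n + 1) * quadDefect α β f g m n := by
  have key : ∀ k l (x y : H), z k * x * (z l * y) = z (k + l) * (x * y) := by
    intro k l x y
    rw [hz, mul_assoc, ← mul_assoc x, ← (hc l x).eq, mul_assoc, mul_assoc]
  simp only [quadDefect, key, mul_sub, mul_smul_comm]
  rw [show m + 1 + n = m + n + 1 by ring, show m + (n + 1) = m + n + 1 by ring,
    show n + (m + 1) = m + n + 1 by ring, show n + 1 + m = m + n + 1 by ring]

/-- Rescaling of the variable by a central unit. -/
theorem ToroidalPair.scale {z : ℤ → H} (hz : ∀ m n, z (m + n) = z m * z n)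
    (hc : ∀ n x, Commute (z n) x) {p : K} {a b : ℤ → H} (h : ToroidalPair p a b) :
    ToroidalPair p (fun n => z n * a n) (fun n => z n * b n) where
  quad m n := by rw [quadDefect_scale hz hc, h.quad, mul_zero]
  double_pole m n := by
    rw [quadDefect_scale hz hc, quadDefect_scale hz hc, h.double_pole]
    ring_nf
  cubic l m n := by
    rw [quadDefect_scale hz hc]
    exact (hc l _).mul_left (((hc _ _).symm).mul_right (h.cubic l m n))
  serre n₁ n₂ n₃ m := by
    have key : ∀ k l (x y : H), z k * x * (z l * y) = z (k + l) * (x * y) := by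
      intro k l x y
      rw [hz, mul_assoc, ← mul_assoc x, ← (hc l x).eq, mul_assoc, mul_assoc]
    have inner : ∀ n₁ n₂ n₃ m (x₁ x₂ x₃ y : H),
        serreInner p (p ^ 2 + p + 1) (z n₁ * x₁) (z n₂ * x₂) (z n₃ * x₃) (z m * y)
          = z (n₁ + n₂ + n₃ + m) * serreInner p (p ^ 2 + p + 1) x₁ x₂ x₃ y := by
      intro n₁ n₂ n₃ m x₁ x₂ x₃ y
      simp only [serreInner, key, mul_sub, mul_add, mul_smul_comm]
      rw [show m + n₁ + n₂ + n₃ = n₁ + n₂ + n₃ + m by ring,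
        show n₁ + m + n₂ + n₃ = n₁ + n₂ + n₃ + m by ring,
        show n₁ + n₂ + m + n₃ = n₁ + n₂ + n₃ + m by ring]
    have := congrArg (fun t => z (n₁ + n₂ + n₃ + m) * t) (h.serre n₁ n₂ n₃ m)
    rw [mul_zero] at this
    rw [← this]
    simp only [serreSum, inner, mul_add]
    rw [show n₁ + n₃ + n₂ + m = n₁ + n₂ + n₃ + m by ring,
      show n₂ + n₁ + n₃ + m = n₁ + n₂ + n₃ + m by ring,
      show n₂ + n₃ + n₁ + m = n₁ + n₂ + n₃ + m by ring,
      show n₃ + n₁ + n₂ + m = n₁ + n₂ + n₃ + m by ring,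
      show n₃ + n₂ + n₁ + m = n₁ + n₂ + n₃ + m by ring]

end Pairs

section Fusion

variable {K : Type} [CommRing K] {A : Type} [Ring A] [Algebra K A]

/-- The sum of two pairs which move in different directions, and satisfy the quadratic relations
with each other, is again a pair. -/
theorem ToroidalPair.add {p : K} (hp : IsUnit p) {a b α β : ℤ → HahnSeries ℤ A} {e e' : ℤ}
    (hab : ToroidalPair p a b) (hαβ : ToroidalPair p α β) (ha : ∀ n, OrdGE (e * n) (a n))
    (hb : ∀ n, OrdGE (e * n) (b n)) (hα : ∀ n, OrdGE (e' * n) (α n))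
    (hβ : ∀ n, OrdGE (e' * n) (β n)) (hee : e ≠ e') (hαa : Quad 1 p α a) (hαb : Quad p 1 α b)
    (hβa : Quad p 1 β a) : ToroidalPair p (a + α) (b + β) := by
  have hq : ∀ m n, quadDefect p 1 (a + α) (b + β) m n
      = quadDefect p 1 a b m n + quadDefect p 1 α β m n := by
    intro m n
    rw [quadDefect_add, hαb, hβa.symm, add_zero, zero_add]
  refine ⟨hab.quad.add hαa hαa.symm hαβ.quad, fun m n => ?_, fun l m n => ?_,
    fun n₁ n₂ n₃ m => ?_⟩
  · rw [hq, hq, hab.double_pole, hαβ.double_pole]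
  · rw [hq]
    refine Commute.add_left (Commute.add_right (hab.cubic l m n) ?_)
      (Commute.add_right ?_ (hαβ.cubic l m n))
    · exact commute_quadDefect hp ha hα hβ hee hαa.symm hβa.symm hαβ.double_pole l m n
    · exact commute_quadDefect hp hα ha hb hee.symm hαa hαb hab.double_pole l m n
  · -- the sixteen terms of the expansion, sorted by their letters
    have t₁ : ∀ n₁ n₂ n₃ m, serreSum p (p ^ 2 + p + 1) (a n₁) (a n₂) (a n₃) (β m) = 0 :=
      serreSum_three_one hp ha hβ hee hab.quad hβa
    have t₂ : ∀ n₁ n₂ n₃ m, serreSum p (p ^ 2 + p + 1) (α n₁) (α n₂) (α n₃) (b m) = 0 :=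
      serreSum_three_one hp hα hb hee.symm hαβ.quad hαb.symm
    have t₃ : ∀ n₁ n₂ n₃ m, serreSum p (p ^ 2 + p + 1) (a n₁) (a n₂) (α n₃) (b m) = 0 :=
      serreSum_two_one hp ha hb hα hee hab.quad hαa hαb hab.cubic
    have t₄ : ∀ n₁ n₂ n₃ m, serreSum p (p ^ 2 + p + 1) (α n₁) (α n₂) (a n₃) (β m) = 0 :=
      serreSum_two_one hp hα hβ ha hee.symm hαβ.quad hαa.symm hβa.symm hαβ.cubic
    have t₅ : ∀ n₁ n₂ n₃ m, serreSum p (p ^ 2 + p + 1) (a n₁) (a n₂) (α n₃) (β m) = 0 :=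
      serreSum_two_two hp ha hα hβ hee hab.quad hαa hβa hαβ.double_pole
    have t₆ : ∀ n₁ n₂ n₃ m, serreSum p (p ^ 2 + p + 1) (α n₁) (α n₂) (a n₃) (b m) = 0 :=
      serreSum_two_two hp hα ha hb hee.symm hαβ.quad hαa.symm hαb.symm hab.double_pole
    have rot : ∀ {x₁ x₂ x₃ y : HahnSeries ℤ A}, serreSum p (p ^ 2 + p + 1) x₁ x₂ x₃ y = 0 →
        serreSum p (p ^ 2 + p + 1) x₃ x₁ x₂ y = 0 :=
      fun h => (serreSum_rotate _ _ _ _ _ _).symm.trans h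
    have add₂ : ∀ x x' x₁ x₃ y : HahnSeries ℤ A, serreSum p (p ^ 2 + p + 1) x₁ (x + x') x₃ y
        = serreSum p (p ^ 2 + p + 1) x₁ x x₃ y + serreSum p (p ^ 2 + p + 1) x₁ x' x₃ y := by
      intro x x' x₁ x₃ y
      rw [serreSum_swap, serreSum_add, serreSum_swap, serreSum_swap p _ x' x₁]
    have add₃ : ∀ x x' x₁ x₂ y : HahnSeries ℤ A, serreSum p (p ^ 2 + p + 1) x₁ x₂ (x + x') y
        = serreSum p (p ^ 2 + p + 1) x₁ x₂ x y + serreSum p (p ^ 2 + p + 1) x₁ x₂ x' y := by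
      intro x x' x₁ x₂ y
      rw [serreSum_rotate, serreSum_add, ← serreSum_rotate, ← serreSum_rotate p _ x']
    simp only [Pi.add_apply, serreSum_add_right, serreSum_add, add₂, add₃, hab.serre, hαβ.serre,
      t₁, t₂, t₃, t₄, t₅, t₆, rot (t₃ _ _ _ _), rot (t₄ _ _ _ _), rot (t₅ _ _ _ _),
      rot (t₆ _ _ _ _), rot (rot (t₃ _ _ _ _)), rot (rot (t₄ _ _ _ _)), rot (rot (t₅ _ _ _ _)),
      rot (rot (t₆ _ _ _ _)), add_zero]

end Fusion

/-! ### Dressing of currents -/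

section Dressing

variable {K : Type} [CommRing K] {A : Type} [Ring A] [Algebra K A]

/-- `B(z) = φ(z) Y(z)`, that is, `B_n = ∑_m φ_m Y_{n + ε m}`, where `ε = ±1` and the sum converges
in the `u`-adic topology. -/
def Dressed (ε : ℤ) (φ : ℕ → HahnSeries ℤ A) (Y B : ℤ → HahnSeries ℤ A) : Prop :=
  ∀ n N, ∃ M₀ : ℕ, ∀ M ≥ M₀, OrdGE N (B n - ∑ m ∈ Finset.range M, φ m * Y (n + ε * m))

namespace Dressed

variable {ε : ℤ} {φ : ℕ → HahnSeries ℤ A} {Y B Y' B' : ℤ → HahnSeries ℤ A}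

theorem eq_zero (h : Dressed ε φ Y B) (hY : ∀ n, Y n = 0) (n : ℤ) : B n = 0 := by
  refine eq_zero_of_ordGE fun N => ?_
  obtain ⟨M, hM⟩ := h n N
  simpa [hY] using hM M le_rfl

theorem add (h : Dressed ε φ Y B) (h' : Dressed ε φ Y' B') :
    Dressed ε φ (fun n => Y n + Y' n) (fun n => B n + B' n) := by
  intro n N
  obtain ⟨M, hM⟩ := h n N
  obtain ⟨M', hM'⟩ := h' n N
  refine ⟨max M M', fun L hL => ?_⟩
  have := (hM L (le_of_max_le_left hL)).add (hM' L (le_of_max_le_right hL))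
  simpa only [mul_add, Finset.sum_add_distrib, add_sub_add_comm] using this

theorem smul (h : Dressed ε φ Y B) (c : K) :
    Dressed ε φ (fun n => c • Y n) (fun n => c • B n) := by
  intro n N
  obtain ⟨M, hM⟩ := h n N
  refine ⟨M, fun L hL => ?_⟩
  have := (hM L hL).smul c
  simpa only [mul_smul_comm, ← Finset.smul_sum, smul_sub] using this

theorem sub (h : Dressed ε φ Y B) (h' : Dressed ε φ Y' B') :
    Dressed ε φ (fun n => Y n - Y' n) (fun n => B n - B' n) := by
  intro n N
  obtain ⟨M, hM⟩ := h n N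
  obtain ⟨M', hM'⟩ := h' n N
  refine ⟨max M M', fun L hL => ?_⟩
  have := (hM L (le_of_max_le_left hL)).sub (hM' L (le_of_max_le_right hL))
  simpa only [mul_sub, Finset.sum_sub_distrib, sub_sub_sub_comm] using this

theorem shift (h : Dressed ε φ Y B) (k : ℤ) :
    Dressed ε φ (fun n => Y (n + k)) (fun n => B (n + k)) := by
  intro n N
  obtain ⟨M, hM⟩ := h (n + k) N
  refine ⟨M, fun L hL => ?_⟩
  simpa only [add_right_comm] using hM L hL

theorem mul_right (h : Dressed ε φ Y B) (x : HahnSeries ℤ A) :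
    Dressed ε φ (fun n => Y n * x) (fun n => B n * x) := by
  intro n N
  obtain ⟨D, hD⟩ := OrdGE.exists x
  obtain ⟨M, hM⟩ := h n (N - D)
  refine ⟨M, fun L hL => ?_⟩
  have := ((hM L hL).mul hD).mono (by omega : N ≤ N - D + D)
  simpa only [sub_mul, Finset.sum_mul, mul_assoc] using this

theorem mul_left (h : Dressed ε φ Y B) {x : HahnSeries ℤ A} (hx : ∀ m, Commute x (φ m)) :
    Dressed ε φ (fun n => x * Y n) (fun n => x * B n) := by
  intro n N
  obtain ⟨D, hD⟩ := OrdGE.exists x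
  obtain ⟨M, hM⟩ := h n (N - D)
  refine ⟨M, fun L hL => ?_⟩
  have := (hD.mul (hM L hL)).mono (by omega : N ≤ D + (N - D))
  have e : ∀ m (y : HahnSeries ℤ A), x * (φ m * y) = φ m * (x * y) := fun m y => by
    rw [← mul_assoc, (hx m).eq, mul_assoc]
  simpa only [mul_sub, Finset.mul_sum, e] using this

theorem commute (h : Dressed ε φ Y B) {x : HahnSeries ℤ A} (hx : ∀ m, Commute x (φ m))
    (hY : ∀ n, Commute x (Y n)) (n : ℤ) : Commute x (B n) :=
  sub_eq_zero.1 (((h.mul_left hx).sub (h.mul_right x)).eq_zero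
    (fun n => sub_eq_zero.2 (hY n).eq) n)

variable {f g : ℤ → HahnSeries ℤ A}

theorem quadDefect_left (h : Dressed ε φ Y B) (hg : ∀ n m, Commute (g n) (φ m)) (α β : K)
    (n : ℤ) : Dressed ε φ (fun m => quadDefect α β Y g m n) (fun m => quadDefect α β B g m n) :=
  ((((h.shift 1).mul_right _).smul α).sub ((h.mul_right _).smul β)).sub
    ((((h.shift 1).mul_left (hg _)).smul β).sub ((h.mul_left (hg _)).smul α))

theorem quadDefect_right (h : Dressed ε φ Y B) (hf : ∀ n m, Commute (f n) (φ m)) (α β : K)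
    (m : ℤ) : Dressed ε φ (fun n => quadDefect α β f Y m n) (fun n => quadDefect α β f B m n) :=
  (((h.mul_left (hf _)).smul α).sub (((h.shift 1).mul_left (hf _)).smul β)).sub
    (((h.mul_right _).smul β).sub (((h.shift 1).mul_right _).smul α))

theorem quad_left (h : Dressed ε φ Y B) (hg : ∀ n m, Commute (g n) (φ m)) {α β : K}
    (hY : Quad α β Y g) : Quad α β B g :=
  fun m n => (h.quadDefect_left hg α β n).eq_zero (fun m => hY m n) m

theorem quad_right (h : Dressed ε φ Y B) (hf : ∀ n m, Commute (f n) (φ m)) {α β : K}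
    (hY : Quad α β f Y) : Quad α β f B :=
  (h.quad_left hf hY.symm).symm

theorem serreInner₁ (h : Dressed ε φ Y B) (c s : K) (x₂ x₃ : HahnSeries ℤ A) {b : HahnSeries ℤ A}
    (hb : ∀ m, Commute b (φ m)) :
    Dressed ε φ (fun n => serreInner c s (Y n) x₂ x₃ b)
      (fun n => serreInner c s (B n) x₂ x₃ b) :=
  (((((((h.mul_left hb).mul_right _).mul_right _).smul c).sub
    ((((h.mul_right _).mul_right _).mul_right _).smul s)).add
    ((((h.mul_right _).mul_right _).mul_right _).smul s)).sub
    ((((h.mul_right _).mul_right _).mul_right _).smul c))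

theorem serreInner₂ (h : Dressed ε φ Y B) (c s : K) {x₁ : HahnSeries ℤ A} (x₃ : HahnSeries ℤ A)
    {b : HahnSeries ℤ A} (h₁ : ∀ m, Commute x₁ (φ m)) (hb : ∀ m, Commute b (φ m)) :
    Dressed ε φ (fun n => serreInner c s x₁ (Y n) x₃ b)
      (fun n => serreInner c s x₁ (B n) x₃ b) :=
  ((((((h.mul_left fun m => (hb m).mul_left (h₁ m)).mul_right _).smul c).sub
    (((h.mul_left fun m => (h₁ m).mul_left (hb m)).mul_right _).smul s)).add
    ((((h.mul_left h₁).mul_right _).mul_right _).smul s)).sub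
    ((((h.mul_left h₁).mul_right _).mul_right _).smul c))

theorem serreInner₃ (h : Dressed ε φ Y B) (c s : K) {x₁ x₂ b : HahnSeries ℤ A}
    (h₁ : ∀ m, Commute x₁ (φ m)) (h₂ : ∀ m, Commute x₂ (φ m)) (hb : ∀ m, Commute b (φ m)) :
    Dressed ε φ (fun n => serreInner c s x₁ x₂ (Y n) b)
      (fun n => serreInner c s x₁ x₂ (B n) b) :=
  (((((h.mul_left fun m => ((hb m).mul_left (h₁ m)).mul_left (h₂ m)).smul c).sub
    ((h.mul_left fun m => ((h₁ m).mul_left (hb m)).mul_left (h₂ m)).smul s)).add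
    ((h.mul_left fun m => ((h₁ m).mul_left (h₂ m)).mul_left (hb m)).smul s)).sub
    (((h.mul_left fun m => (h₁ m).mul_left (h₂ m)).mul_right _).smul c))

theorem serreInner₄ (h : Dressed ε φ Y B) (c s : K) {x₁ x₂ x₃ : HahnSeries ℤ A}
    (h₁ : ∀ m, Commute x₁ (φ m)) (h₂ : ∀ m, Commute x₂ (φ m)) (h₃ : ∀ m, Commute x₃ (φ m)) :
    Dressed ε φ (fun n => serreInner c s x₁ x₂ x₃ (Y n))
      (fun n => serreInner c s x₁ x₂ x₃ (B n)) :=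
  ((((((h.mul_right _).mul_right _).mul_right _).smul c).sub
    ((((h.mul_left h₁).mul_right _).mul_right _).smul s)).add
    (((h.mul_left fun m => (h₁ m).mul_left (h₂ m)).mul_right _).smul s)).sub
    ((h.mul_left fun m => ((h₁ m).mul_left (h₂ m)).mul_left (h₃ m)).smul c)

theorem serreSum_left (h : Dressed ε φ Y B) (c s : K) {x₂ x₃ b : HahnSeries ℤ A}
    (h₂ : ∀ m, Commute x₂ (φ m)) (h₃ : ∀ m, Commute x₃ (φ m)) (hb : ∀ m, Commute b (φ m)) :
    Dressed ε φ (fun n => serreSum c s (Y n) x₂ x₃ b) (fun n => serreSum c s (B n) x₂ x₃ b) :=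
  (((((h.serreInner₁ c s _ _ hb).add (h.serreInner₁ c s _ _ hb)).add
    (h.serreInner₂ c s _ h₂ hb)).add (h.serreInner₃ c s h₂ h₃ hb)).add
    (h.serreInner₂ c s _ h₃ hb)).add (h.serreInner₃ c s h₃ h₂ hb)

theorem serreSum_right (h : Dressed ε φ Y B) (c s : K) {x₁ x₂ x₃ : HahnSeries ℤ A}
    (h₁ : ∀ m, Commute x₁ (φ m)) (h₂ : ∀ m, Commute x₂ (φ m)) (h₃ : ∀ m, Commute x₃ (φ m)) :
    Dressed ε φ (fun n => serreSum c s x₁ x₂ x₃ (Y n)) (fun n => serreSum c s x₁ x₂ x₃ (B n)) :=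
  (((((h.serreInner₄ c s h₁ h₂ h₃).add (h.serreInner₄ c s h₁ h₃ h₂)).add
    (h.serreInner₄ c s h₂ h₁ h₃)).add (h.serreInner₄ c s h₂ h₃ h₁)).add
    (h.serreInner₄ c s h₃ h₁ h₂)).add (h.serreInner₄ c s h₃ h₂ h₁)

end Dressed

theorem commute_quadDefect_of_commute {R : Type} [Ring R] [Algebra K R] {x : R} {f g : ℤ → R}
    (hf : ∀ n, Commute x (f n)) (hg : ∀ n, Commute x (g n)) (α β : K) (m n : ℤ) :
    Commute x (quadDefect α β f g m n) :=
  Commute.sub_right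
    ((((hf _).mul_right (hg _)).smul_right α).sub_right (((hf _).mul_right (hg _)).smul_right β))
    ((((hg _).mul_right (hf _)).smul_right β).sub_right (((hg _).mul_right (hf _)).smul_right α))

/-- Dressing of a pair with series that commute with each other and with the currents. -/
theorem ToroidalPair.dressed {ε : ℤ} {φ ψ : ℕ → HahnSeries ℤ A} {a b α β : ℤ → HahnSeries ℤ A}
    {p : K} (h : ToroidalPair p a b) (hα : Dressed ε φ a α) (hβ : Dressed ε ψ b β)
    (hφφ : ∀ m n, Commute (φ m) (φ n)) (hφψ : ∀ m n, Commute (φ m) (ψ n))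
    (hψψ : ∀ m n, Commute (ψ m) (ψ n)) (hφa : ∀ m n, Commute (φ m) (a n))
    (hφb : ∀ m n, Commute (φ m) (b n)) (hψa : ∀ m n, Commute (ψ m) (a n))
    (hψb : ∀ m n, Commute (ψ m) (b n)) : ToroidalPair p α β := by
  have hφα : ∀ m n, Commute (φ m) (α n) := fun m => hα.commute (hφφ m) (hφa m)
  have hψα : ∀ m n, Commute (ψ m) (α n) := fun m => hα.commute (fun n => (hφψ n m).symm) (hψa m)
  have hφβ : ∀ m n, Commute (φ m) (β n) := fun m => hβ.commute (hφψ m) (hφb m)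
  have hψβ : ∀ m n, Commute (ψ m) (β n) := fun m => hβ.commute (hψψ m) (hψb m)
  refine ⟨?_, ?_, ?_, ?_⟩
  · exact hα.quad_right (fun n m => (hφα m n).symm)
      (hα.quad_left (fun n m => (hφa m n).symm) h.quad)
  · have h₁ : ∀ m n, quadDefect p 1 α b (m + 1) n = quadDefect p 1 α b m (n + 1) := by
      intro m n
      have d := hα.quadDefect_left (fun n m => (hφb m n).symm) p 1
      exact sub_eq_zero.1 ((((d n).shift 1).sub (d (n + 1))).eq_zero
        (fun m => sub_eq_zero.2 (h.double_pole m n)) m)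
    intro m n
    have d := hβ.quadDefect_right (fun n m => (hψα m n).symm) p 1
    exact sub_eq_zero.1 (((d (m + 1)).sub ((d m).shift 1)).eq_zero
      (fun n => sub_eq_zero.2 (h₁ m n)) n)
  · have h₁ : ∀ l m n, Commute (a l) (quadDefect p 1 α b m n) := by
      intro l m n
      have d := hα.quadDefect_left (fun n m => (hφb m n).symm) p 1 n
      exact sub_eq_zero.1 (((d.mul_left fun m => (hφa m l).symm).sub (d.mul_right (a l))).eq_zero
        (fun m => sub_eq_zero.2 (h.cubic l m n)) m)
    have h₂ : ∀ l m n, Commute (a l) (quadDefect p 1 α β m n) := by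
      intro l m n
      have d := hβ.quadDefect_right (fun n m => (hψα m n).symm) p 1 m
      exact sub_eq_zero.1 (((d.mul_left fun m => (hψa m l).symm).sub (d.mul_right (a l))).eq_zero
        (fun n => sub_eq_zero.2 (h₁ l m n)) n)
    intro l m n
    exact (hα.commute (fun k => (commute_quadDefect_of_commute (hφα k) (hφβ k) p 1 m n).symm)
      (fun l => (h₂ l m n).symm) l).symm
  · have h₁ : ∀ n₁ n₂ n₃ m, serreSum p (p ^ 2 + p + 1) (α n₁) (a n₂) (a n₃) (b m) = 0 := by
      intro n₁ n₂ n₃ m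
      exact (hα.serreSum_left p _ (fun k => (hφa k n₂).symm) (fun k => (hφa k n₃).symm)
        (fun k => (hφb k m).symm)).eq_zero (fun n₁ => h.serre n₁ n₂ n₃ m) n₁
    have h₂ : ∀ n₁ n₂ n₃ m, serreSum p (p ^ 2 + p + 1) (α n₁) (α n₂) (a n₃) (b m) = 0 := by
      intro n₁ n₂ n₃ m
      exact (hα.serreSum_left p _ (fun k => (hφα k n₂).symm) (fun k => (hφa k n₃).symm)
        (fun k => (hφb k m).symm)).eq_zero
        (fun n₁ => by rw [serreSum_swap]; exact h₁ n₂ n₁ n₃ m) n₁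
    have h₃ : ∀ n₁ n₂ n₃ m, serreSum p (p ^ 2 + p + 1) (α n₁) (α n₂) (α n₃) (b m) = 0 := by
      intro n₁ n₂ n₃ m
      exact (hα.serreSum_left p _ (fun k => (hφα k n₂).symm) (fun k => (hφα k n₃).symm)
        (fun k => (hφb k m).symm)).eq_zero
        (fun n₁ => by rw [← serreSum_rotate]; exact h₂ n₂ n₃ n₁ m) n₁
    intro n₁ n₂ n₃ m
    exact (hβ.serreSum_right p _ (fun k => (hψα k n₁).symm) (fun k => (hψα k n₂).symm)
      (fun k => (hψα k n₃).symm)).eq_zero (fun m => h₃ n₁ n₂ n₃ m) m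

end Dressing

/-! ### Exchange relations -/

section Antidiagonal

open Finset

variable {M : Type} [AddCommMonoid M]

theorem sum_antidiagonal_assoc (m : ℕ) (f : ℕ → ℕ → ℕ → M) :
    ∑ p ∈ HasAntidiagonal.antidiagonal m, ∑ r ∈ HasAntidiagonal.antidiagonal p.1, f r.1 r.2 p.2
      = ∑ p ∈ HasAntidiagonal.antidiagonal m, ∑ r ∈ HasAntidiagonal.antidiagonal p.2,
          f p.1 r.1 r.2 := by
  rw [Finset.sum_sigma', Finset.sum_sigma']
  refine Finset.sum_nbij' (fun x => ⟨(x.2.1, x.2.2 + x.1.2), (x.2.2, x.1.2)⟩)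
    (fun x => ⟨(x.1.1 + x.2.1, x.2.2), (x.1.1, x.2.1)⟩) ?_ ?_ ?_ ?_ ?_
  all_goals
    rintro ⟨⟨a, b⟩, ⟨c, d⟩⟩ h
    simp only [Finset.mem_sigma, HasAntidiagonal.mem_antidiagonal] at h ⊢
    try obtain ⟨h₁, h₂⟩ := h
    try subst h₁
    try subst h₂
    try simp
    try omega

theorem sum_antidiagonal_swap (m : ℕ) (f : ℕ → ℕ → M) :
    ∑ p ∈ HasAntidiagonal.antidiagonal m, f p.2 p.1
      = ∑ p ∈ HasAntidiagonal.antidiagonal m, f p.1 p.2 :=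
  Finset.Nat.sum_antidiagonal_swap (f := fun p : ℕ × ℕ => f p.1 p.2)

theorem sum_antidiagonal_comm (m : ℕ) (f : ℕ → ℕ → ℕ → ℕ → M) :
    ∑ p ∈ HasAntidiagonal.antidiagonal m, ∑ r ∈ HasAntidiagonal.antidiagonal p.1,
        ∑ s ∈ HasAntidiagonal.antidiagonal p.2, f r.1 r.2 s.1 s.2
      = ∑ p ∈ HasAntidiagonal.antidiagonal m, ∑ r ∈ HasAntidiagonal.antidiagonal p.1,
        ∑ s ∈ HasAntidiagonal.antidiagonal p.2, f r.1 s.1 r.2 s.2 := by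
  rw [Finset.sum_sigma', Finset.sum_sigma', Finset.sum_sigma', Finset.sum_sigma']
  refine Finset.sum_nbij'
    (fun x => ⟨⟨(x.1.2.1 + x.2.1, x.1.2.2 + x.2.2), (x.1.2.1, x.2.1)⟩, (x.1.2.2, x.2.2)⟩)
    (fun x => ⟨⟨(x.1.2.1 + x.2.1, x.1.2.2 + x.2.2), (x.1.2.1, x.2.1)⟩, (x.1.2.2, x.2.2)⟩)
    ?_ ?_ ?_ ?_ (fun _ _ => rfl)
  all_goals
    rintro ⟨⟨⟨a, b⟩, ⟨c, d⟩⟩, ⟨e, f⟩⟩ h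
    simp only [Finset.mem_sigma, HasAntidiagonal.mem_antidiagonal] at h ⊢
    obtain ⟨⟨h₁, h₂⟩, h₃⟩ := h
    subst h₁ h₂ h₃
    simp [add_add_add_comm]

end Antidiagonal

section Exchange

open Finset PowerSeries

variable {R : Type} [Ring R]

/-- The exchange relation `f(z) g(w) = g(w) f(z) G(w ^ ε / z ^ ε)` between a half current
`f(z) = ∑_{m ≥ 0} f_m z ^ (-ε m)` and a current `g`. -/
def Exchange (ε : ℤ) (f : ℕ → R) (g : ℤ → R) (G : PowerSeries R) : Prop :=
  ∀ m n, f m * g n =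
    ∑ p ∈ HasAntidiagonal.antidiagonal m, coeff p.1 G * (g (n + ε * p.1) * f p.2)

/-- All the coefficients are central. -/
def IsCentral (G : PowerSeries R) : Prop := ∀ i x, Commute (coeff i G) x

theorem IsCentral.mul {G G' : PowerSeries R} (h : IsCentral G) (h' : IsCentral G') :
    IsCentral (G * G') := fun i x => by
  rw [coeff_mul]
  exact Commute.sum_left _ _ _ fun p _ => (h _ _).mul_left (h' _ _)

namespace Exchange

variable {ε : ℤ} {f : ℕ → R} {g : ℤ → R} {G : PowerSeries R}

theorem of_commute (h : ∀ m n, Commute (f m) (g n)) : Exchange ε f g 1 := by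
  intro m n
  rw [Finset.sum_eq_single (0, m)]
  · simp [(h m n).eq]
  · rintro ⟨i, j⟩ hp hne
    have hi : i ≠ 0 := by
      rintro rfl
      exact hne (Prod.ext rfl ((zero_add j).symm.trans (HasAntidiagonal.mem_antidiagonal.1 hp)))
    simp [coeff_one, hi]
  · simp

theorem add {g' : ℤ → R} (h : Exchange ε f g G) (h' : Exchange ε f g' G) :
    Exchange ε f (g + g') G := by
  intro m n
  simp only [Pi.add_apply, mul_add, add_mul, Finset.sum_add_distrib]
  rw [h m n, h' m n]

theorem mul {F F' G' : PowerSeries R} (hG' : IsCentral G')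
    (h : Exchange ε (fun m => coeff m F) g G) (h' : Exchange ε (fun m => coeff m F') g G') :
    Exchange ε (fun m => coeff m (F * F')) g (G * G') := by
  intro m n
  have h₁ : ∀ a b, coeff a F * coeff b F' * g n
      = ∑ r ∈ HasAntidiagonal.antidiagonal a, ∑ s ∈ HasAntidiagonal.antidiagonal b,
        coeff r.1 G * coeff s.1 G' * (g (n + ε * (r.1 + s.1 : ℕ)) *
          (coeff r.2 F * coeff s.2 F')) := by
    intro a b
    rw [mul_assoc, h', Finset.mul_sum, Finset.sum_comm]
    refine Finset.sum_congr rfl fun s _ => ?_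
    rw [← mul_assoc, ← (hG' _ _).eq, mul_assoc, ← mul_assoc (coeff a F), h, Finset.sum_mul,
      Finset.mul_sum]
    refine Finset.sum_congr rfl fun r _ => ?_
    rw [show n + ε * (s.1 : ℤ) + ε * (r.1 : ℤ) = n + ε * ((r.1 + s.1 : ℕ) : ℤ) by push_cast; ring]
    simp only [← mul_assoc]
    rw [(hG' s.1 (coeff r.1 G)).eq]
  change coeff m (F * F') * g n = _
  rw [coeff_mul, Finset.sum_mul, Finset.sum_congr rfl fun p _ => h₁ p.1 p.2,
    sum_antidiagonal_comm m fun i j k l => coeff i G * coeff k G'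
      * (g (n + ε * (i + k : ℕ)) * (coeff j F * coeff l F'))]
  refine Finset.sum_congr rfl fun p _ => ?_
  beta_reduce
  rw [coeff_mul, coeff_mul, Finset.sum_mul]
  refine Finset.sum_congr rfl fun r hr => ?_
  rw [Finset.mul_sum, HasAntidiagonal.mem_antidiagonal.1 hr, Finset.mul_sum]

theorem congr_right {G' : PowerSeries R} (h : Exchange ε f g G) (e : G = G') :
    Exchange ε f g G' := e ▸ h

theorem map {R' : Type} [Ring R'] (h : Exchange ε f g G) (F : R →+* R') :
    Exchange ε (fun m => F (f m)) (fun n => F (g n)) (PowerSeries.map F G) := by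
  intro m n
  simp only [← map_mul, h m n, map_sum, coeff_map]

/-- Rescaling of the variables. -/
theorem scale (h : Exchange ε f g G) {v : ℕ → R} {w : ℤ → R} (hv : ∀ a b, v (a + b) = v a * v b)
    (hw : ∀ a b, w (a + b) = w a * w b) (cv : ∀ n x, Commute (v n) x)
    (cw : ∀ n x, Commute (w n) x) :
    Exchange ε (fun m => f m * v m) (fun n => g n * w n)
      (PowerSeries.mk fun k => coeff k G * (v k * w (-(ε * k)))) := by
  intro m n
  have h₁ : f m * v m * (g n * w n) = f m * g n * (v m * w n) := by
    rw [mul_assoc, ← mul_assoc (v m), (cv m (g n)).eq, mul_assoc, mul_assoc]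
  rw [h₁, h m n, Finset.sum_mul]
  refine Finset.sum_congr rfl fun p hp => ?_
  have h₂ : v m * w n = v p.1 * w (-(ε * p.1)) * (w (n + ε * p.1) * v p.2) := by
    rw [mul_assoc, ← mul_assoc (w _), ← hw, show -(ε * (p.1 : ℤ)) + (n + ε * p.1) = n by ring,
      (cw n (v p.2)).eq, ← mul_assoc, ← hv, HasAntidiagonal.mem_antidiagonal.1 hp]
  rw [h₂, coeff_mk]
  have cs : ∀ x, Commute (v p.1 * w (-(ε * p.1))) x := fun x => (cv _ x).mul_left (cw _ x)
  generalize v p.1 * w (-(ε * p.1)) = t at cs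
  rw [mul_assoc, ← mul_assoc _ t, ← (cs _).eq, mul_assoc t, ← mul_assoc (coeff p.1 G) t]
  congr 1
  rw [mul_assoc, ← mul_assoc (f p.2), ← (cw _ (f p.2)).eq]
  simp only [mul_assoc]

/-- Reversal of the exchange relation between two half currents in opposite directions. -/
theorem reverse {f e : ℤ → R} {G' : PowerSeries R} (hf : ∀ n < 0, f n = 0)
    (he : ∀ n, 0 < n → e n = 0) (h : Exchange 1 (fun m => f m) e G) (hG : G' * G = 1) :
    Exchange (-1) (fun m => e (-m)) f G' := by
  intro m n
  have h₁ : ∀ (M : ℤ) (j : ℕ), f M * e (-j)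
      = ∑ p ∈ HasAntidiagonal.antidiagonal j, coeff p.1 G * (e (-p.2) * f (M - p.1)) := by
    intro M j
    have h₂ : ∀ (K : ℕ), j ≤ K → ∑ p ∈ HasAntidiagonal.antidiagonal j,
        coeff p.1 G * (e (-p.2) * f (M - p.1))
        = ∑ k ∈ Finset.range (K + 1), coeff k G * (e (-(j - k)) * f (M - k)) := by
      intro K hK
      rw [Finset.Nat.sum_antidiagonal_eq_sum_range_succ
        (fun k l => coeff k G * (e (-l) * f (M - k)))]
      rw [← Finset.sum_subset (Finset.range_mono (Nat.succ_le_succ hK))]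
      · refine Finset.sum_congr rfl fun k hk => ?_
        rw [Nat.cast_sub (Nat.lt_succ_iff.1 (Finset.mem_range.1 hk))]
      · intro k _ hk
        rw [Finset.mem_range] at hk
        rw [he _ (by omega), zero_mul, mul_zero]
    rcases lt_or_ge M 0 with hM | hM
    · rw [hf M hM, zero_mul]
      refine (Finset.sum_eq_zero fun p _ => ?_).symm
      rw [hf _ (by omega), mul_zero, mul_zero]
    · lift M to ℕ using hM
      rw [h₂ (max j M) (le_max_left _ _), h M (-j), Finset.Nat.sum_antidiagonal_eq_sum_range_succ
        (fun k l => coeff k G * (e (-j + 1 * k) * f l)),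
        ← Finset.sum_subset (Finset.range_mono (Nat.succ_le_succ (le_max_right j M)))]
      · refine Finset.sum_congr rfl fun k hk => ?_
        rw [Nat.cast_sub (Nat.lt_succ_iff.1 (Finset.mem_range.1 hk))]
        congr 3
        ring
      · intro k _ hk
        rw [Finset.mem_range] at hk
        rw [hf _ (by omega), mul_zero, mul_zero]
  have h₃ : ∀ i j : ℕ, coeff i G' * (f (n + -1 * i) * e (-j))
      = ∑ p ∈ HasAntidiagonal.antidiagonal j,
        coeff i G' * coeff p.1 G * (e (-p.2) * f (n - (i + p.1 : ℕ))) := by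
    intro i j
    rw [h₁, Finset.mul_sum]
    refine Finset.sum_congr rfl fun p _ => ?_
    rw [← mul_assoc]
    congr 3
    push_cast
    ring
  rw [Finset.sum_congr rfl fun p _ => h₃ p.1 p.2,
    ← sum_antidiagonal_assoc m fun i k l =>
      coeff i G' * coeff k G * (e (-l) * f (n - (i + k : ℕ)))]
  have h₄ : ∀ p ∈ HasAntidiagonal.antidiagonal m, ∑ r ∈ HasAntidiagonal.antidiagonal p.1,
      coeff r.1 G' * coeff r.2 G * (e (-p.2) * f (n - (r.1 + r.2 : ℕ)))
        = coeff p.1 (G' * G) * (e (-p.2) * f (n - p.1)) := by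
    intro p _
    rw [coeff_mul, Finset.sum_mul]
    refine Finset.sum_congr rfl fun r hr => ?_
    rw [HasAntidiagonal.mem_antidiagonal.1 hr]
  rw [Finset.sum_congr rfl h₄, hG, Finset.sum_eq_single (0, m)]
  · simp
  · rintro ⟨i, j⟩ hp hne
    have hi : i ≠ 0 := by
      rintro rfl
      exact hne (Prod.ext rfl ((zero_add j).symm.trans (HasAntidiagonal.mem_antidiagonal.1 hp)))
    simp [coeff_one, hi]
  · simp

end Exchange

end Exchange

/-! ### Currents with values in a product of two factors -/

section Fused

open Finset PowerSeries

variable {A : Type} [Ring A]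

theorem coeff_C_mul' (a : A) (x : HahnSeries ℤ A) (k : ℤ) :
    (HahnSeries.C a * x).coeff k = a * x.coeff k := by
  rw [HahnSeries.C_mul_eq_smul, HahnSeries.coeff_smul, smul_eq_mul]

theorem coeff_mul_C' (a : A) (x : HahnSeries ℤ A) (k : ℤ) :
    (x * HahnSeries.C a).coeff k = x.coeff k * a :=
  HahnSeries.coeff_mul_single_zero

/-- The current `B(z) = p(z) q(z u⁻¹)`. -/
def Fused (p q : ℤ → A) (B : ℤ → HahnSeries ℤ A) : Prop :=
  ∀ n k, (B n).coeff k = p (n - k) * q k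

/-- The current `p(z) q(z u⁻¹)`, if its coefficients are bounded below in `u`. -/
def fuse (p q : ℤ → A) (h : ∀ n, ∃ N, ∀ k < N, p (n - k) * q k = 0) (n : ℤ) : HahnSeries ℤ A :=
  HahnSeries.ofSuppBddBelow (fun k => p (n - k) * q k)
    (let ⟨N, hN⟩ := h n
     ⟨N, fun k hk => not_lt.1 fun hlt => hk (hN k hlt)⟩)

theorem fused_fuse (p q : ℤ → A) (h : ∀ n, ∃ N, ∀ k < N, p (n - k) * q k = 0) :
    Fused p q (fuse p q h) := fun n k => by
  rw [fuse, HahnSeries.coeff_ofSuppBddBelow]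

variable {p q : ℤ → A} {B : ℤ → HahnSeries ℤ A}

theorem Fused.ordGE_left (h : Fused p q B) (hp : ∀ n, 0 < n → p n = 0) (n : ℤ) :
    OrdGE n (B n) := fun k hk => by
  rw [h, hp _ (by omega), zero_mul]

theorem Fused.ordGE_right (h : Fused p q B) (hq : ∀ n < 0, q n = 0) (n : ℤ) :
    OrdGE 0 (B n) := fun k hk => by
  rw [h, hq _ hk, mul_zero]

theorem Fused.C (a : ℤ → A) : Fused a (Pi.single (M := fun _ => A) 0 1)
    (fun n => HahnSeries.C (a n)) := by
  intro n k
  change (HahnSeries.single 0 (a n)).coeff k = _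
  rcases eq_or_ne k 0 with rfl | hk
  · rw [HahnSeries.coeff_single_same, Pi.single_eq_same, sub_zero, mul_one]
  · rw [HahnSeries.coeff_single_of_ne hk, Pi.single_eq_of_ne hk, mul_zero]

theorem Fused.single (a : ℤ → A) :
    Fused (Pi.single (M := fun _ => A) 0 1) a (fun n => HahnSeries.single n (a n)) := by
  intro n k
  rcases eq_or_ne k n with rfl | hk
  · rw [HahnSeries.coeff_single_same, sub_self, Pi.single_eq_same, one_mul]
  · rw [HahnSeries.coeff_single_of_ne hk, Pi.single_eq_of_ne (by omega), zero_mul]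

/-- A half current which commutes with `q` is exchanged with `p(z) q(z u⁻¹)` as with `p(z)`. -/
theorem Exchange.fused_left {ε : ℤ} {l : ℕ → A} {G : PowerSeries A} (h : Exchange ε l p G)
    (hB : Fused p q B) (hc : ∀ m k, Commute (l m) (q k)) :
    Exchange ε (fun m => HahnSeries.C (l m)) B (PowerSeries.map HahnSeries.C G) := by
  intro m n
  ext k
  rw [coeff_C_mul', hB, ← mul_assoc, h m, HahnSeries.coeff_sum, Finset.sum_mul]
  refine Finset.sum_congr rfl fun r _ => ?_
  rw [coeff_map, coeff_C_mul', coeff_mul_C', hB, mul_assoc, mul_assoc, (hc _ _).eq,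
    ← mul_assoc (p _), sub_add_eq_add_sub]

/-- A half current which commutes with `p` is exchanged, at the argument `z u⁻¹`, with
`p(z) q(z u⁻¹)` as at the argument `z` with `q(z)`. -/
theorem Exchange.fused_right {ε : ℤ} {r : ℕ → A} {G : PowerSeries A} (h : Exchange ε r q G)
    (hG : IsCentral G) (hB : Fused p q B) (hc : ∀ m k, Commute (r m) (p k)) :
    Exchange ε (fun m => HahnSeries.single (ε * m) (r m)) B (PowerSeries.map HahnSeries.C G) := by
  intro m n
  ext k
  rw [HahnSeries.coeff_single_mul, hB, ← mul_assoc, (hc _ _).eq, mul_assoc, h m,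
    HahnSeries.coeff_sum, Finset.mul_sum]
  refine Finset.sum_congr rfl fun s hs => ?_
  have hs : (m : ℤ) = s.1 + s.2 := by
    rw [← HasAntidiagonal.mem_antidiagonal.1 hs]
    push_cast
    rfl
  rw [coeff_map, coeff_C_mul', HahnSeries.coeff_mul_single, hB, ← mul_assoc, ← (hG _ _).eq,
    mul_assoc, mul_assoc, hs, show n - (k - ε * (s.1 + s.2)) = n + ε * s.1 - (k - ε * s.2) by ring,
    show k - ε * (s.1 + s.2) + ε * s.1 = k - ε * (s.2 : ℤ) by ring]

/-- If `p` is a half current in nonpositive degrees, then `p(z) q(z u⁻¹)` is the current `q(z u⁻¹)`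
dressed with `p(z)`. -/
theorem Fused.dressed_left {K : Type} [CommRing K] [Algebra K A] (hB : Fused p q B)
    (hp : ∀ n, 0 < n → p n = 0) :
    Dressed 1 (fun m => HahnSeries.C (p (-m))) (fun k => HahnSeries.single k (q k)) B := by
  intro n N
  refine ⟨(N - n).toNat, fun M hM k hk => ?_⟩
  rw [HahnSeries.coeff_sub, HahnSeries.coeff_sum, hB, sub_eq_zero]
  simp only [coeff_C_mul']
  rcases lt_or_ge k n with hkn | hkn
  · rw [hp _ (by omega), zero_mul]
    refine (Finset.sum_eq_zero fun m _ => ?_).symm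
    rw [HahnSeries.coeff_single_of_ne (by omega), mul_zero]
  · rw [Finset.sum_eq_single (k - n).toNat]
    · rw [show n + 1 * ((k - n).toNat : ℤ) = k by omega, HahnSeries.coeff_single_same]
      congr 2
      omega
    · intro m _ hm
      rw [HahnSeries.coeff_single_of_ne (by omega), mul_zero]
    · intro hm
      rw [Finset.mem_range] at hm
      omega

/-- If `q` is a half current in nonnegative degrees which commutes with `p`, then `p(z) q(z u⁻¹)` is
the current `p(z)` dressed with `q(z u⁻¹)`. -/
theorem Fused.dressed_right {K : Type} [CommRing K] [Algebra K A] (hB : Fused p q B)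
    (hq : ∀ n < 0, q n = 0) (hpq : ∀ m n, Commute (p m) (q n)) :
    Dressed (-1) (fun m => HahnSeries.single (m : ℤ) (q m)) (fun n => HahnSeries.C (p n)) B := by
  intro n N
  refine ⟨N.toNat, fun M hM k hk => ?_⟩
  rw [HahnSeries.coeff_sub, HahnSeries.coeff_sum, hB, sub_eq_zero]
  simp only [coeff_mul_C']
  rcases lt_or_ge k 0 with hk0 | hk0
  · rw [hq _ hk0, mul_zero]
    refine (Finset.sum_eq_zero fun m _ => ?_).symm
    rw [HahnSeries.coeff_single_of_ne (by omega), zero_mul]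
  · rw [Finset.sum_eq_single k.toNat]
    · rw [show ((k.toNat : ℕ) : ℤ) = k by omega, HahnSeries.coeff_single_same, (hpq _ _).eq]
      congr 2
      ring
    · intro m _ hm
      rw [HahnSeries.coeff_single_of_ne (by omega), zero_mul]
    · intro hm
      rw [Finset.mem_range] at hm
      omega

/-- The coefficients of a product of two Laurent series, as sums over natural numbers which count
the exponents from lower bounds for the orders. -/
theorem coeff_mul_of_ordGE {x y : HahnSeries ℤ A} {a b : ℤ} (hx : OrdGE a x) (hy : OrdGE b y)
    (r : ℕ) : (x * y).coeff (a + b + r)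
      = ∑ p ∈ HasAntidiagonal.antidiagonal r, x.coeff (a + p.1) * y.coeff (b + p.2) := by
  rw [HahnSeries.coeff_mul]
  refine Finset.sum_bij_ne_zero (fun p _ _ => ((p.1 - a).toNat, (p.2 - b).toNat)) ?_ ?_ ?_ ?_
  · rintro ⟨i, j⟩ hp hne
    have h₁ : a ≤ i := not_lt.1 fun h => hne (by rw [hx _ h, zero_mul])
    have h₂ : b ≤ j := not_lt.1 fun h => hne (by rw [hy _ h, mul_zero])
    have := (Finset.mem_antidiagonal.1 hp).2.2
    rw [HasAntidiagonal.mem_antidiagonal]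
    dsimp only at this ⊢
    omega
  · rintro ⟨i, j⟩ hp hne ⟨i', j'⟩ hp' hne' h
    have h₁ : a ≤ i := not_lt.1 fun h => hne (by rw [hx _ h, zero_mul])
    have h₂ : b ≤ j := not_lt.1 fun h => hne (by rw [hy _ h, mul_zero])
    have h₁' : a ≤ i' := not_lt.1 fun h => hne' (by rw [hx _ h, zero_mul])
    have h₂' : b ≤ j' := not_lt.1 fun h => hne' (by rw [hy _ h, mul_zero])
    simp only [Prod.mk.injEq] at h ⊢
    omega
  · rintro ⟨i, j⟩ hp hne
    refine ⟨(a + i, b + j), ?_, hne, by simp⟩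
    rw [Finset.mem_antidiagonal]
    refine ⟨left_ne_zero_of_mul hne, right_ne_zero_of_mul hne, ?_⟩
    rw [← HasAntidiagonal.mem_antidiagonal.1 hp]
    push_cast
    ring
  · rintro ⟨i, j⟩ hp hne
    have h₁ : a ≤ i := not_lt.1 fun h => hne (by rw [hx _ h, zero_mul])
    have h₂ : b ≤ j := not_lt.1 fun h => hne (by rw [hy _ h, mul_zero])
    dsimp only
    rw [Int.toNat_of_nonneg (by omega), Int.toNat_of_nonneg (by omega)]
    simp

/-- The two currents commute, as the factors from the exchange in the first and in the second
tensor factor agree. -/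
theorem Fused.commute {p' q' : ℤ → A} {B' : ℤ → HahnSeries ℤ A} {G : PowerSeries A}
    (hB : Fused p q B) (hB' : Fused p' q' B') (hp : ∀ n, 0 < n → p n = 0)
    (hq' : ∀ n < 0, q' n = 0)
    (hpq' : ∀ m n, Commute (p m) (q' n)) (hp'q : ∀ m n, Commute (p' m) (q n)) (hG : IsCentral G)
    (h₁ : Exchange (-1) (fun m => p (-m)) p' G)
    (h₂ : Exchange 1 (fun m => q' m) q G) (m n : ℤ) : Commute (B m) (B' n) := by
  have hx := hB.ordGE_left hp m
  have hy := hB'.ordGE_right hq' n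
  ext N
  rcases lt_or_ge N m with hN | hN
  · rw [(hx.mul hy) N (by omega), (hy.mul hx) N (by omega)]
  obtain ⟨r, rfl⟩ := Int.le.dest hN
  rw [show m + (r : ℤ) = m + 0 + r by ring, coeff_mul_of_ordGE hx hy,
    show m + 0 + (r : ℤ) = 0 + m + r by ring, coeff_mul_of_ordGE hy hx,
    ← sum_antidiagonal_swap r fun a b => (B' n).coeff (0 + (a : ℤ)) * (B m).coeff (m + b)]
  have e₁ : ∀ a b : ℕ, (B m).coeff (m + a) * (B' n).coeff (0 + b)
      = ∑ s ∈ HasAntidiagonal.antidiagonal a,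
        coeff s.1 G * (p' (n - (b + s.1)) * p (-s.2) * (q (m + (s.1 + s.2)) * q' b)) := by
    intro a b
    rw [hB, hB', zero_add, mul_assoc, ← mul_assoc (q _), ← (hp'q _ _).eq, mul_assoc (p' _),
      ← mul_assoc (p _), show m - (m + (a : ℤ)) = -a by ring, h₁ a, Finset.sum_mul]
    refine Finset.sum_congr rfl fun s hs => ?_
    rw [mul_assoc, show n - (b : ℤ) + -1 * s.1 = n - (b + s.1) by ring,
      ← HasAntidiagonal.mem_antidiagonal.1 hs]
    push_cast
    rfl
  have e₂ : ∀ a b : ℕ, (B' n).coeff (0 + b) * (B m).coeff (m + a)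
      = ∑ s ∈ HasAntidiagonal.antidiagonal b,
        coeff s.1 G * (p' (n - (s.2 + s.1)) * p (-a) * (q (m + (s.1 + a)) * q' s.2)) := by
    intro a b
    rw [hB, hB', zero_add, mul_assoc, ← mul_assoc (q' _), ← (hpq' _ _).eq, mul_assoc (p _),
      ← mul_assoc (p' _), show m - (m + (a : ℤ)) = -a by ring, h₂ b, Finset.mul_sum]
    refine Finset.sum_congr rfl fun s hs => ?_
    rw [← mul_assoc, ← (hG _ _).eq, mul_assoc, ← HasAntidiagonal.mem_antidiagonal.1 hs]
    push_cast
    rw [add_comm (s.2 : ℤ), show m + (a : ℤ) + 1 * s.1 = m + (s.1 + a) by ring]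
  simp only [e₁, e₂]
  rw [← sum_antidiagonal_assoc r fun a i j => coeff i G *
    (p' (n - (j + i)) * p (-a) * (q (m + (i + a)) * q' j))]
  refine Finset.sum_congr rfl fun s _ => ?_
  exact (sum_antidiagonal_swap s.1 fun j i => coeff i G *
    (p' (n - (s.2 + i)) * p (-j) * (q (m + (i + j)) * q' s.2)))

end Fused

section

/-! ### The defining relations in convenient form -/

open PowerSeries Finset

/-- The series `g_{ij}(v y)^{±1}`, `a = ±a_{ij}`, where `v k` stands for `v ^ k`. -/
def gScaled {R : Type} [Ring R] [Algebra Base R] (a : ℤ) (v : ℕ → R) : PowerSeries R :=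
  PowerSeries.mk fun k => coeff k (gSeries a) • v k

theorem cartan_comm (i j : Fin 2) : cartan i j = cartan j i := by
  simp only [cartan, eq_comm]

theorem q_mul_q_neg (a : ℂ) : q a * q (-a) = 1 := by rw [← q_add, add_neg_cancel, q_zero]

theorem isUnit_q (a : ℂ) : IsUnit (q a) := IsUnit.of_mul_eq_one _ (q_mul_q_neg a)

namespace U

theorem phi_commute (s : Sgn) (i j : Fin 2) (m n : ℤ) :
    Commute (phi s i m) (phi s j n) := by
  have := mk_eq_mk (Relation.phi_phi s i j m n)
  rwa [map_mul, map_mul] at this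

theorem phi_of_pos {i : Fin 2} {n : ℤ} (h : 0 < n) : phi .minus i n = 0 :=
  phi_of_neg (by simpa [Sgn.val] using h)

theorem phi_of_lt {i : Fin 2} {n : ℤ} (h : n < 0) : phi .plus i n = 0 :=
  phi_of_neg (by simpa [Sgn.val] using h)

theorem exchange_plus_minus (i j : Fin 2) : Exchange 1 (fun m => phi .plus i m) (phi .minus j)
    (gScaled (-cartan i j) (fun k => qc k) * gScaled (cartan i j) (fun k => qc (-k))) := by
  have hG : ∀ k, coeff k (gScaled (-cartan i j) (fun k => qc k)
      * gScaled (cartan i j) (fun k => qc (-k))) = mk (Free.gg i j k) := by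
    intro k
    rw [coeff_mul, Free.gg, map_sum]
    refine Finset.sum_congr rfl fun p _ => ?_
    rw [gScaled, gScaled, coeff_mk, coeff_mk, map_smul, smul_mul_smul_comm, ← qc_add]
    rfl
  intro m n
  rcases lt_or_ge 0 n with hn | hn
  · rw [phi_of_pos hn, mul_zero]
    refine (Finset.sum_eq_zero fun p _ => ?_).symm
    rw [phi_of_pos (by omega), zero_mul, mul_zero]
  · obtain ⟨k, hk⟩ := Int.eq_ofNat_of_zero_le (neg_nonneg.2 hn)
    obtain rfl : n = -(k : ℤ) := by omega
    have := mk_eq_mk (Relation.phi_plus_minus i j m k)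
    rw [map_mul, map_sum] at this
    rw [Finset.Nat.sum_antidiagonal_eq_sum_range_succ (fun a b => coeff a _ *
      (phi .minus j (-(k : ℤ) + 1 * a) * phi .plus i b))]
    refine this.trans (Finset.sum_congr rfl fun l hl => ?_)
    have hl := Finset.mem_range_succ_iff.1 hl
    rw [map_mul, map_mul, hG, Nat.cast_sub hl, show -(k : ℤ) + 1 * l = -(k - l) by ring]
    refine Commute.eq ?_
    rw [Free.gg, map_sum]
    refine Commute.sum_right _ _ _ fun p _ => ?_
    rw [map_smul]
    exact ((qc_commute _ _).symm).smul_right _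

theorem exchange_x (S s : Sgn) (i j : Fin 2) :
    Exchange S.val (fun m => phi S i (S.val * m)) (x s j)
      (gScaled (S.val * s.val * cartan i j) (fun k => qc (-s.val / 2 * k))) := by
  intro m n
  cases S
  · have := mk_eq_mk (Relation.phi_plus_x s i j m n)
    rw [map_mul, map_sum] at this
    simp only [Sgn.val, one_mul]
    rw [Finset.Nat.sum_antidiagonal_eq_sum_range_succ (fun a b => coeff a _ *
      (x s j (n + a) * phi .plus i b))]
    refine this.trans (Finset.sum_congr rfl fun l hl => ?_)
    have hl := Finset.mem_range_succ_iff.1 hl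
    rw [map_smul, map_mul, map_mul, gScaled, coeff_mk, Nat.cast_sub hl, smul_mul_assoc,
      (qc_commute _ _).eq]
    rw [show -(s.val : ℂ) * l / 2 = -s.val / 2 * l by ring]
    rfl
  · have := mk_eq_mk (Relation.phi_minus_x s i j m n)
    rw [map_mul, map_sum] at this
    simp only [Sgn.val, neg_mul, one_mul]
    rw [Finset.Nat.sum_antidiagonal_eq_sum_range_succ (fun a b => coeff a _ *
      (x s j (n + -a) * phi .minus i (-b)))]
    refine this.trans (Finset.sum_congr rfl fun l hl => ?_)
    have hl := Finset.mem_range_succ_iff.1 hl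
    rw [map_smul, map_mul, map_mul, gScaled, coeff_mk, Nat.cast_sub hl, smul_mul_assoc,
      (qc_commute _ _).eq, cartan_comm j i, ← sub_eq_add_neg, neg_mul]
    rw [show -(s.val : ℂ) * l / 2 = -s.val / 2 * l by ring]
    rfl

theorem x_plus_minus (i j : Fin 2) (m n : ℤ) :
    (q 1 - q (-1)) • (x .plus i m * x .minus j n - x .minus j n * x .plus i m)
      = if i = j then phi .plus i (m + n) * qc (((m : ℂ) - n) / 2)
            - phi .minus i (m + n) * qc (((n : ℂ) - m) / 2)
        else 0 := by
  have := mk_eq_mk (Relation.x_plus_minus i j m n)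
  rw [map_smul, map_sub, map_mul, map_mul] at this
  refine this.trans ?_
  split_ifs
  · rw [map_sub, map_mul, map_mul]
    rfl
  · exact map_zero _

end U

theorem qInt_one : qInt 1 = 1 := by
  rw [qInt, Finset.sum_range_one]
  norm_num [q_zero]

theorem qInt_two : qInt 2 = q 1 + q (-1) := by
  rw [qInt, Finset.sum_range_succ, Finset.sum_range_one]
  norm_num

theorem qInt_three : qInt 3 = q 2 + 1 + q (-2) := by
  rw [qInt, Finset.sum_range_succ, Finset.sum_range_succ, Finset.sum_range_one]
  norm_num [q_zero]

theorem constantCoeff_q (a : ℂ) : constantCoeff (q a) = 1 := by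
  rw [← coeff_zero_eq_constantCoeff_apply, q, coeff_mk]
  simp

theorem qFactorial_three_ne : constantCoeff (qFactorial 3) ≠ 0 := by
  rw [qFactorial, Finset.prod_range_succ, Finset.prod_range_succ, Finset.prod_range_one]
  simp only [zero_add, Nat.reduceAdd, qInt_one, qInt_two, qInt_three, map_mul, map_add, map_one,
    constantCoeff_q]
  norm_num

theorem qBinom_three_zero : qBinom 3 0 = 1 := by
  rw [qBinom]
  have h0 : qFactorial 0 = 1 := Finset.prod_range_zero _
  rw [h0, inv_one, mul_one]
  exact PowerSeries.mul_inv_cancel _ qFactorial_three_ne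

theorem qBinom_three_one : qBinom 3 1 = qInt 3 := by
  have h1 : qFactorial 1 = 1 := by rw [qFactorial, Finset.prod_range_one, zero_add, qInt_one]
  have h2 : qFactorial 3 = qInt 3 * qFactorial 2 := by
    rw [qFactorial, Finset.prod_range_succ, mul_comm]
    rfl
  have h3 : constantCoeff (qFactorial 2) ≠ 0 := by
    have := qFactorial_three_ne
    rw [h2, map_mul] at this
    exact right_ne_zero_of_mul this
  rw [qBinom, h1, inv_one, mul_one, h2, mul_assoc, PowerSeries.mul_inv_cancel _ h3, mul_one]

theorem qBinom_three_symm (r : ℕ) (hr : r ≤ 3) : qBinom 3 (3 - r) = qBinom 3 r := by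
  rw [qBinom, qBinom, Nat.sub_sub_self hr]
  ring

/-- The Serre expression for `q ^ (±2)`: the coefficients are the quantum binomial coefficients,
multiplied with `q ^ (±2)`. -/
theorem q_mul_qInt_three (s : Sgn) :
    q (2 * s.val) * qInt 3 = q (2 * s.val) ^ 2 + q (2 * s.val) + 1 := by
  have h1 := q_mul_q_neg 2
  cases s
  · simp only [Sgn.val, Int.cast_one, mul_one]
    rw [qInt_three]
    linear_combination h1
  · simp only [Sgn.val, Int.cast_neg, Int.cast_one, mul_neg, mul_one]
    rw [qInt_three]
    linear_combination h1

theorem sum_perm_three {M : Type} [AddCommMonoid M] (f : Equiv.Perm (Fin 3) → M) :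
    ∑ σ, f σ = f 1 + f (Equiv.swap 1 2) + f (Equiv.swap 0 1)
      + f (Equiv.swap 0 1 * Equiv.swap 1 2) + f (Equiv.swap 0 2 * Equiv.swap 1 2)
      + f (Equiv.swap 0 2) := by
  have h : (Finset.univ : Finset (Equiv.Perm (Fin 3)))
      = {1, Equiv.swap 1 2, Equiv.swap 0 1, Equiv.swap 0 1 * Equiv.swap 1 2,
        Equiv.swap 0 2 * Equiv.swap 1 2, Equiv.swap 0 2} := by decide
  rw [h, Finset.sum_insert (by decide), Finset.sum_insert (by decide),
    Finset.sum_insert (by decide), Finset.sum_insert (by decide), Finset.sum_insert (by decide),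
    Finset.sum_singleton]
  simp only [add_assoc]

namespace U

theorem mk_serreTerm (s : Sgn) (i j : Fin 2) (n : Fin 3 → ℤ) (m : ℤ) (σ : Equiv.Perm (Fin 3)) :
    ∑ r ∈ Finset.range 4, ((-1) ^ r * qBinom 3 r) • mk (Free.serreTerm s i j n m σ r)
      = serreInner (1 : Base) (qInt 3) (x s i (n (σ 0))) (x s i (n (σ 1))) (x s i (n (σ 2)))
        (x s j m) := by
  have h3 : qBinom 3 3 = 1 := (qBinom_three_symm 0 (by norm_num)).trans qBinom_three_zero
  have h2 : qBinom 3 2 = qInt 3 := (qBinom_three_symm 1 (by norm_num)).trans qBinom_three_one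
  rw [Finset.sum_range_succ, Finset.sum_range_succ, Finset.sum_range_succ, Finset.sum_range_one,
    qBinom_three_zero, qBinom_three_one, h2, h3]
  simp only [Free.serreTerm, List.ofFn_succ, List.ofFn_zero, List.take, List.drop, List.prod_cons,
    List.prod_nil, map_mul, one_mul, mul_one, serreInner]
  have e1 : (Fin.succ 0 : Fin 3) = 1 := rfl
  have e2 : (Fin.succ (Fin.succ 0) : Fin 3) = 2 := rfl
  simp only [e1, e2, mul_assoc]
  simp only [x, pow_zero, one_smul, pow_one, neg_mul, one_mul, neg_smul]
  norm_num
  abel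

theorem toroidalPair (s : Sgn) {i j : Fin 2} (hij : i ≠ j) :
    ToroidalPair (q (2 * s.val)) (x s i) (x s j) := by
  have hq : q (2 * s.val) * q (-2 * s.val) = 1 := by
    rw [neg_mul]
    exact q_mul_q_neg _
  have hxx : ∀ m n, q (2 * s.val) • mk (Free.xx s i j m n)
      = quadDefect (q (2 * s.val)) 1 (x s i) (x s j) m n := by
    intro m n
    simp only [Free.xx, map_sub, map_smul, map_mul, quadDefect, smul_sub, smul_smul, hq]
    rfl
  refine ⟨fun m n => ?_, fun m n => ?_, fun l m n => ?_, fun n₁ n₂ n₃ m => ?_⟩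
  · have := mk_eq_mk (Relation.x_x_same s i m n)
    simp only [map_sub, map_smul, map_mul] at this
    rw [quadDefect, one_smul, one_smul, sub_eq_zero]
    exact this
  · have := congrArg (fun t => q (2 * s.val) • t) (mk_eq_mk (Relation.x_x_distinct s i j hij m n))
    simp only [map_sub, map_add, map_smul, map_mul, smul_sub, smul_add, smul_smul, hq,
      add_smul, one_smul] at this
    rw [← sub_eq_zero] at this ⊢
    rw [← this]
    simp only [quadDefect, one_smul, show m + 1 + 1 = m + 2 by ring,
      show n + 1 + 1 = n + 2 by ring]
    simp only [x]
    abel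
  · rw [← hxx]
    have := mk_eq_mk (Relation.x_xx s i j hij l m n)
    rw [map_mul, map_mul] at this
    exact Commute.smul_right this _
  · have := mk_eq_mk (Relation.serre s i j hij ![n₁, n₂, n₃] m)
    rw [map_zero, map_sum] at this
    simp only [map_sum, map_smul, mk_serreTerm] at this
    rw [sum_perm_three] at this
    have h := congrArg (fun t => q (2 * s.val) • t) this
    have hs : ∀ x₁ x₂ x₃ b : U, q (2 * s.val) • serreInner (1 : Base) (qInt 3) x₁ x₂ x₃ b
        = serreInner (q (2 * s.val)) (q (2 * s.val) ^ 2 + q (2 * s.val) + 1) x₁ x₂ x₃ b := by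
      intro x₁ x₂ x₃ b
      simp only [serreInner, smul_sub, smul_add, smul_smul, q_mul_qInt_three, mul_one]
    simp only [smul_add, smul_zero, hs] at h
    exact h

end U

/-! ### Quadratic relations from exchange relations -/

theorem coeff_zero_gSeries (a : ℤ) : coeff 0 (gSeries a) = q a := by
  rw [gSeries, coeff_zero_eq_constantCoeff_apply, map_mul, map_sub, constantCoeff_C,
    constantCoeff_X, sub_zero, ← coeff_zero_eq_constantCoeff_apply, coeff_mk, Nat.cast_zero,
      mul_zero,
    q_zero, mul_one]

theorem coeff_succ_gSeries (a : ℤ) (k : ℕ) :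
    coeff (k + 1) (gSeries a) = q a * coeff k (gSeries a) - if k = 0 then 1 else 0 := by
  have := congrArg (coeff (k + 1)) (gSeries_spec a)
  rw [mul_sub, mul_one, mul_left_comm, map_sub, coeff_C_mul, coeff_succ_mul_X, map_sub,
    coeff_C, if_neg (Nat.succ_ne_zero k), coeff_X, zero_sub] at this
  simp only [Nat.add_eq_right] at this
  linear_combination this

section QuadOfExchange

variable {R : Type} [Ring R] [Algebra Base R]

theorem Exchange.linear {ε : ℤ} {f : ℕ → R} {g : ℤ → R} {a : ℤ}
    (h : Exchange ε f g (gScaled a fun _ => 1)) (m : ℕ) (n : ℤ) :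
    f (m + 1) * g n - q a • (f m * g (n + ε)) = q a • (g n * f (m + 1)) - g (n + ε) * f m := by
  rw [h (m + 1) n, h m (n + ε), Finset.Nat.sum_antidiagonal_succ, Finset.smul_sum, add_sub_assoc,
    ← Finset.sum_sub_distrib]
  have e : ∀ p ∈ HasAntidiagonal.antidiagonal m,
      coeff (p.1 + 1) (gScaled a fun _ => (1 : R)) * (g (n + ε * (p.1 + 1 : ℕ)) * f p.2)
        - q a • (coeff p.1 (gScaled a fun _ => (1 : R)) * (g (n + ε + ε * p.1) * f p.2))
      = if p.1 = 0 then - (g (n + ε) * f p.2) else 0 := by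
    intro p _
    rw [show n + ε * (p.1 + 1 : ℕ) = n + ε + ε * p.1 by push_cast; ring, gScaled, coeff_mk,
      coeff_mk, smul_mul_assoc, smul_mul_assoc, one_mul, smul_smul, ← sub_smul,
      coeff_succ_gSeries]
    split_ifs with h0
    · rw [h0]
      simp
    · simp
  rw [Finset.sum_congr rfl e, Finset.sum_eq_single (0, m)]
  · simp only [if_true, gScaled, coeff_mk, coeff_zero_gSeries, smul_mul_assoc, one_mul]
    rw [Nat.cast_zero, mul_zero, add_zero, sub_eq_add_neg]
  · rintro ⟨i, j⟩ hp hne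
    refine if_neg ?_
    rintro rfl
    exact hne (Prod.ext rfl ((zero_add j).symm.trans (HasAntidiagonal.mem_antidiagonal.1 hp)))
  · simp

theorem Exchange.linear_zero {ε : ℤ} {f : ℕ → R} {g : ℤ → R} {a : ℤ}
    (h : Exchange ε f g (gScaled a fun _ => 1)) (n : ℤ) : f 0 * g n = q a • (g n * f 0) := by
  rw [h 0 n, Finset.Nat.antidiagonal_zero, Finset.sum_singleton, gScaled, coeff_mk,
    coeff_zero_gSeries, smul_mul_assoc, one_mul]
  simp

theorem Exchange.quad_plus {f g : ℤ → R} {a : ℤ} (hf : ∀ n < 0, f n = 0)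
    (h : Exchange 1 (fun m => f m) g (gScaled a fun _ => 1)) : Quad 1 (q a) f g := by
  intro m n
  rw [quadDefect, one_smul, one_smul, sub_eq_zero]
  rcases lt_trichotomy m (-1) with hm | rfl | hm
  · simp [hf m (by omega), hf (m + 1) (by omega)]
  · simpa [hf (-1) (by omega)] using h.linear_zero n
  · lift m to ℕ using (by omega)
    exact h.linear m n

theorem Exchange.quad_minus {f g : ℤ → R} {a : ℤ} (hf : ∀ n, 0 < n → f n = 0)
    (h : Exchange (-1) (fun m => f (-m)) g (gScaled a fun _ => 1)) : Quad (q a) 1 f g := by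
  intro m n
  rw [quadDefect, one_smul, one_smul, sub_eq_zero]
  rcases lt_trichotomy m 0 with hm | rfl | hm
  · obtain ⟨k, hk⟩ := Int.eq_ofNat_of_zero_le (show 0 ≤ -(m + 1) by omega)
    have := h.linear k (n + 1)
    rw [Nat.cast_succ, show -((k : ℤ) + 1) = m by omega, show -(k : ℤ) = m + 1 by omega,
      add_neg_cancel_right] at this
    rw [← neg_sub, this, neg_sub]
  · have := h.linear_zero (n + 1)
    simp only [Nat.cast_zero, neg_zero] at this
    rw [this]
    simp [hf 1 (by omega)]
  · simp [hf m (by omega), hf (m + 1) (by omega)]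

end QuadOfExchange

end

section

/-! ### The currents of the coproduct -/

open PowerSeries Finset

/-- `a ↦ a ⊗ 1`. -/
def inl : U →ₐ[Base] U2 := Algebra.TensorProduct.includeLeft

/-- `a ↦ 1 ⊗ a`. -/
def inr : U →ₐ[Base] U2 := Algebra.TensorProduct.includeRight

theorem inl_mul_inr (a b : U) : inl a * inr b = a ⊗ₜ[Base] b := by
  rw [inl, inr, Algebra.TensorProduct.includeLeft_apply, Algebra.TensorProduct.includeRight_apply,
    Algebra.TensorProduct.tmul_mul_tmul, one_mul, mul_one]

theorem inl_inr_commute (a b : U) : Commute (inl a) (inr b) := by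
  rw [commute_iff_eq, inl_mul_inr, inl, inr, Algebra.TensorProduct.includeLeft_apply,
    Algebra.TensorProduct.includeRight_apply, Algebra.TensorProduct.tmul_mul_tmul, one_mul, mul_one]

theorem commute_of_legs {t : U2} (hl : ∀ a, Commute t (inl a)) (hr : ∀ a, Commute t (inr a))
    (y : U2) : Commute t y := by
  induction y using TensorProduct.induction_on with
  | zero => exact Commute.zero_right _
  | tmul a b =>
    rw [← inl_mul_inr]
    exact (hl a).mul_right (hr b)
  | add x y hx hy => exact hx.add_right hy

/-- `q ^ (α c₁ + β c₂)`. -/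
def qq (α β : ℂ) : U2 := inl (U.qc α) * inr (U.qc β)

theorem qq_eq (α β : ℂ) : qq α β = U.qc α ⊗ₜ[Base] U.qc β := inl_mul_inr _ _

theorem qq_mul (α β γ δ : ℂ) : qq α β * qq γ δ = qq (α + γ) (β + δ) := by
  rw [qq_eq, qq_eq, qq_eq, Algebra.TensorProduct.tmul_mul_tmul, U.qc_add, U.qc_add]

theorem qq_zero : qq 0 0 = 1 := by
  rw [qq, U.qc_zero, map_one, map_one, mul_one]

theorem inl_qc (α : ℂ) : inl (U.qc α) = qq α 0 := by rw [qq, U.qc_zero, map_one, mul_one]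

theorem inr_qc (α : ℂ) : inr (U.qc α) = qq 0 α := by rw [qq, U.qc_zero, map_one, one_mul]

theorem qq_commute (α β : ℂ) (y : U2) : Commute (qq α β) y := by
  refine commute_of_legs (fun a => ?_) (fun a => ?_) y
  · exact ((U.qc_commute α a).map inl).mul_left (inl_inr_commute a _).symm
  · exact (inl_inr_commute _ a).mul_left ((U.qc_commute β a).map inr)

/-- The series `g_{ij}(q ^ (α c₁ + β c₂) y)^{±1}`, `a = ±a_{ij}`. -/
def gg₂ (a : ℤ) (α β : ℂ) : PowerSeries U2 := gScaled a fun k => qq (α * k) (β * k)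

theorem gg₂_isCentral (a : ℤ) (α β : ℂ) : IsCentral (gg₂ a α β) := fun i x => by
  rw [gg₂, gScaled, coeff_mk]
  exact (qq_commute _ _ x).smul_left _

theorem coeff_gg₂_mul (a b : ℤ) (α β γ δ : ℂ) (k : ℕ) :
    coeff k (gg₂ a α β * gg₂ b γ δ) = ∑ p ∈ HasAntidiagonal.antidiagonal k,
      (coeff p.1 (gSeries a) * coeff p.2 (gSeries b)) •
        qq (α * p.1 + γ * p.2) (β * p.1 + δ * p.2) := by
  rw [coeff_mul]
  refine Finset.sum_congr rfl fun p _ => ?_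
  rw [gg₂, gg₂, gScaled, gScaled, coeff_mk, coeff_mk, smul_mul_smul_comm, qq_mul]

theorem gg₂_mul_neg (a : ℤ) (α β : ℂ) : gg₂ a α β * gg₂ (-a) α β = 1 := by
  ext k
  rw [coeff_gg₂_mul]
  have : ∀ p ∈ HasAntidiagonal.antidiagonal k,
      (coeff p.1 (gSeries a) * coeff p.2 (gSeries (-a))) •
        qq (α * p.1 + α * p.2) (β * p.1 + β * p.2)
      = (coeff p.1 (gSeries a) * coeff p.2 (gSeries (-a))) • qq (α * k) (β * k) := by
    intro p hp
    rw [← mul_add, ← mul_add, ← Nat.cast_add, HasAntidiagonal.mem_antidiagonal.1 hp]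
  rw [Finset.sum_congr rfl this, ← Finset.sum_smul, ← coeff_mul, gSeries_mul_neg, coeff_one,
    coeff_one]
  split_ifs with h
  · rw [h, Nat.cast_zero, mul_zero, mul_zero, qq_zero, one_smul]
  · rw [zero_smul]

theorem IsCentral.commute {R : Type} [Ring R] {G : PowerSeries R} (h : IsCentral G)
    (F : PowerSeries R) : G * F = F * G := by
  ext k
  rw [coeff_mul, coeff_mul, ← sum_antidiagonal_swap k fun i j => coeff i F * coeff j G]
  exact Finset.sum_congr rfl fun p _ => (h _ _).eq

theorem gg₂_neg_mul (a : ℤ) (α β : ℂ) : gg₂ (-a) α β * gg₂ a α β = 1 := by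
  rw [(gg₂_isCentral _ _ _).commute, gg₂_mul_neg]

theorem map_gScaled {R R' : Type} [Ring R] [Algebra Base R] [Ring R'] [Algebra Base R']
    (F : R →ₐ[Base] R') (a : ℤ) (v : ℕ → R) :
    PowerSeries.map F.toRingHom (gScaled a v) = gScaled a fun k => F (v k) := by
  ext k
  rw [coeff_map, gScaled, gScaled, coeff_mk, coeff_mk]
  exact map_smul F _ _

theorem Exchange.scale_qq {ε : ℤ} {f : ℕ → U2} {g : ℤ → U2} {G : PowerSeries U2}
    (h : Exchange ε f g G) (α β γ δ : ℂ) :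
    Exchange ε (fun m => f m * qq (α * m) (β * m)) (fun n => g n * qq (γ * n) (δ * n))
      (PowerSeries.mk fun k => coeff k G * qq ((α - ε * γ) * k) ((β - ε * δ) * k)) := by
  refine (h.scale (v := fun m => qq (α * m) (β * m)) (w := fun n => qq (γ * n) (δ * n))
    (fun a b => ?_) (fun a b => ?_) (fun n x => qq_commute _ _ x)
    (fun n x => qq_commute _ _ x)).congr_right ?_
  · rw [qq_mul]
    push_cast
    rw [mul_add, mul_add]
  · rw [qq_mul]
    push_cast
    rw [mul_add, mul_add]
  · ext k
    rw [coeff_mk, coeff_mk, qq_mul]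
    push_cast
    congr 2 <;> ring

/-- The exchange relations between `φ_i^±` and `x_j^±` in the first tensor factor, for rescaled
currents. -/
theorem exchange_left (S s : Sgn) (i j : Fin 2) (α β γ δ : ℂ) :
    Exchange S.val (fun m => inl (U.phi S i (S.val * m)) * qq (α * m) (β * m))
      (fun n => inl (U.x s j n) * qq (γ * n) (δ * n))
      (gg₂ (S.val * s.val * cartan i j) (-s.val / 2 + α - S.val * γ) (β - S.val * δ)) := by
  refine (((U.exchange_x S s i j).map inl.toRingHom).scale_qq α β γ δ).congr_right ?_
  rw [map_gScaled]
  ext k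
  rw [coeff_mk, gg₂, gScaled, gScaled, coeff_mk, coeff_mk, inl_qc, smul_mul_assoc, qq_mul]
  congr 2 <;> ring

/-- The exchange relations between `φ_i^±` and `x_j^±` in the second tensor factor, for rescaled
currents. -/
theorem exchange_right (S s : Sgn) (i j : Fin 2) (α β γ δ : ℂ) :
    Exchange S.val (fun m => inr (U.phi S i (S.val * m)) * qq (α * m) (β * m))
      (fun n => inr (U.x s j n) * qq (γ * n) (δ * n))
      (gg₂ (S.val * s.val * cartan i j) (α - S.val * γ) (-s.val / 2 + β - S.val * δ)) := by
  refine (((U.exchange_x S s i j).map inr.toRingHom).scale_qq α β γ δ).congr_right ?_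
  rw [map_gScaled]
  ext k
  rw [coeff_mk, gg₂, gScaled, gScaled, coeff_mk, coeff_mk, inr_qc, smul_mul_assoc, qq_mul]
  congr 2 <;> ring

/-- The exchange relation between `φ_i^+` and `φ_j^-` in the first tensor factor, for rescaled
currents. -/
theorem exchange_left_phi (i j : Fin 2) (α β γ δ : ℂ) :
    Exchange 1 (fun m => inl (U.phi .plus i m) * qq (α * m) (β * m))
      (fun n => inl (U.phi .minus j n) * qq (γ * n) (δ * n))
      (gg₂ (-cartan i j) (1 + α - γ) (β - δ) * gg₂ (cartan i j) (-1 + α - γ) (β - δ)) := by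
  refine (((U.exchange_plus_minus i j).map inl.toRingHom).scale_qq α β γ δ).congr_right ?_
  rw [map_mul, map_gScaled, map_gScaled]
  ext k
  rw [coeff_mk, coeff_mul, coeff_gg₂_mul, Finset.sum_mul]
  refine Finset.sum_congr rfl fun p hp => ?_
  rw [gScaled, gScaled, coeff_mk, coeff_mk, inl_qc, inl_qc, smul_mul_smul_comm, qq_mul,
    smul_mul_assoc, qq_mul, ← HasAntidiagonal.mem_antidiagonal.1 hp]
  push_cast
  congr 2 <;> ring

/-- The exchange relation between `φ_i^+` and `φ_j^-` in the second tensor factor, for rescaled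
currents. -/
theorem exchange_right_phi (i j : Fin 2) (α β γ δ : ℂ) :
    Exchange 1 (fun m => inr (U.phi .plus i m) * qq (α * m) (β * m))
      (fun n => inr (U.phi .minus j n) * qq (γ * n) (δ * n))
      (gg₂ (-cartan i j) (α - γ) (1 + β - δ) * gg₂ (cartan i j) (α - γ) (-1 + β - δ)) := by
  refine (((U.exchange_plus_minus i j).map inr.toRingHom).scale_qq α β γ δ).congr_right ?_
  rw [map_mul, map_gScaled, map_gScaled]
  ext k
  rw [coeff_mk, coeff_mul, coeff_gg₂_mul, Finset.sum_mul]
  refine Finset.sum_congr rfl fun p hp => ?_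
  rw [gScaled, gScaled, coeff_mk, coeff_mk, inr_qc, inr_qc, smul_mul_smul_comm, qq_mul,
    smul_mul_assoc, qq_mul, ← HasAntidiagonal.mem_antidiagonal.1 hp]
  push_cast
  congr 2 <;> ring

end

section

open PowerSeries Finset

section HalfCurrents

variable {A : Type} [Ring A]

theorem commute_C_of_central {a : A} (h : ∀ x, Commute a x) (x : HahnSeries ℤ A) :
    Commute (HahnSeries.C a) x := by
  ext k
  rw [coeff_C_mul', coeff_mul_C', (h _).eq]

theorem commute_single {a : A} {n : ℤ} {x : HahnSeries ℤ A} (h : ∀ k, Commute a (x.coeff k)) :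
    Commute (HahnSeries.single n a) x := by
  ext k
  rw [HahnSeries.coeff_single_mul, HahnSeries.coeff_mul_single, (h _).eq]

theorem IsCentral.map_C {G : PowerSeries A} (h : IsCentral G) :
    IsCentral (PowerSeries.map (HahnSeries.C (Γ := ℤ)) G) := fun i x => by
  rw [coeff_map]
  exact commute_C_of_central (h i) x

variable {p q l r : ℤ → A} {B D : ℤ → HahnSeries ℤ A} {ε : ℤ}

/-- The coefficients of a half current are those of a product of two power series. -/
theorem Fused.half_current (hD : Fused l r D) (hε : ε * ε = 1) (hl : ∀ n, ε * n < 0 → l n = 0)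
    (hr : ∀ n, ε * n < 0 → r n = 0) (m : ℕ) :
    coeff m ((PowerSeries.mk fun a => HahnSeries.C (l (ε * a))) *
      (PowerSeries.mk fun b => HahnSeries.single (ε * (b : ℤ)) (r (ε * b)))) = D (ε * m) := by
  ext k
  rw [coeff_mul, HahnSeries.coeff_sum, hD]
  simp only [coeff_mk, coeff_C_mul']
  have hk : ε * (ε * k) = k := by rw [← mul_assoc, hε, one_mul]
  by_cases h : 0 ≤ ε * k ∧ ε * k ≤ m
  · obtain ⟨b, hb⟩ := Int.eq_ofNat_of_zero_le h.1
    have hbm : b ≤ m := by omega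
    have hkb : k = ε * b := by rw [← hb, hk]
    rw [Finset.sum_eq_single (m - b, b)]
    · rw [← hkb, HahnSeries.coeff_single_same, Nat.cast_sub hbm, mul_sub, ← hkb]
    · rintro ⟨i, j⟩ hp hne
      rw [HahnSeries.coeff_single_of_ne, mul_zero]
      intro hkj
      have hj : (j : ℤ) = b := by
        have : ε * (ε * (j : ℤ)) = ε * (ε * b) := by rw [← hkb, hkj]
        rwa [← mul_assoc, ← mul_assoc, hε, one_mul, one_mul] at this
      have := HasAntidiagonal.mem_antidiagonal.1 hp
      exact hne (Prod.ext (by dsimp only at this ⊢; omega) (by dsimp only; omega))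
    · intro hnot
      exact absurd (HasAntidiagonal.mem_antidiagonal.2 (Nat.sub_add_cancel hbm)) hnot
  · have h0 : l (ε * m - k) * r k = 0 := by
      by_cases h1 : ε * k < 0
      · rw [hr k h1, mul_zero]
      · rw [hl, zero_mul]
        rw [mul_sub, ← mul_assoc, hε, one_mul]
        omega
    rw [h0]
    refine Finset.sum_eq_zero fun s hs => ?_
    rw [HahnSeries.coeff_single_of_ne, mul_zero]
    rintro rfl
    have := HasAntidiagonal.mem_antidiagonal.1 hs
    rw [← mul_assoc, hε, one_mul] at h
    omega

/-- The exchange relation of a half current with a current, from those of the factors. -/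
theorem Fused.exchangeFuse {G G' : PowerSeries A} (hD : Fused l r D) (hε : ε * ε = 1)
    (hl : ∀ n, ε * n < 0 → l n = 0) (hr : ∀ n, ε * n < 0 → r n = 0) (hB : Fused p q B)
    (h : Exchange ε (fun m => l (ε * m)) p G) (h' : Exchange ε (fun m => r (ε * m)) q G')
    (hG' : IsCentral G') (hlq : ∀ m n, Commute (l m) (q n))
    (hrp : ∀ m n, Commute (r m) (p n)) :
    Exchange ε (fun m => D (ε * m)) B (PowerSeries.map HahnSeries.C (G * G')) := by
  rw [map_mul]
  simp only [← hD.half_current hε hl hr]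
  refine Exchange.mul hG'.map_C ?_ ?_
  · simp only [coeff_mk]
    exact h.fused_left hB fun m k => hlq _ _
  · simp only [coeff_mk]
    exact h'.fused_right hG' hB fun m k => hrp _ _

theorem Quad.fused_left {K : Type} [CommRing K] [Algebra K A] {α β : K} {a : ℤ → A}
    (h : Quad α β p a) (hB : Fused p q B) (hc : ∀ m n, Commute (q m) (a n)) :
    Quad α β B (fun n => HahnSeries.C (a n)) := by
  intro m n
  ext k
  have := congrArg (fun t => t * q k) (h (m - k) n)
  simp only [quadDefect, sub_mul, smul_mul_assoc, zero_mul] at this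
  simp only [quadDefect, HahnSeries.coeff_sub, HahnSeries.coeff_smul, coeff_C_mul', coeff_mul_C',
    hB _ _, HahnSeries.coeff_zero]
  simp only [mul_assoc, (hc _ _).eq, show m + 1 - k = m - k + 1 by ring]
  simp only [mul_assoc] at this
  exact this

theorem Quad.fused_right {K : Type} [CommRing K] [Algebra K A] {α β : K} {a : ℤ → A}
    (h : Quad α β q a) (hB : Fused p q B) (hc : ∀ m n, Commute (p m) (a n)) :
    Quad α β B (fun n => HahnSeries.single n (a n)) := by
  intro m n
  ext k
  have := congrArg (fun t => p (m + 1 + n - k) * t) (h (k - n - 1) n)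
  simp only [quadDefect, mul_sub, mul_smul_comm, mul_zero] at this
  simp only [quadDefect, HahnSeries.coeff_sub, HahnSeries.coeff_smul, HahnSeries.coeff_single_mul,
    HahnSeries.coeff_mul_single, hB _ _, HahnSeries.coeff_zero]
  simp only [mul_assoc, show m + 1 - (k - n) = m + 1 + n - k by ring,
    show k - (n + 1) = k - n - 1 by ring, show m - (k - n - 1) = m + 1 + n - k by ring]
  rw [sub_add_cancel] at this
  simp only [← mul_assoc, ← (hc _ _).eq]
  simp only [mul_assoc]
  exact this

end HalfCurrents

theorem Commute.mul_mul_qq {a b : U2} (h : Commute a b) (α β γ δ : ℂ) :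
    Commute (a * qq α β) (b * qq γ δ) :=
  (h.mul_right (qq_commute _ _ _).symm).mul_left (qq_commute _ _ _)

/-- The first tensor factor of the coefficients of `Δ(φ_i^±(z))`. -/
def phiL (S : Sgn) (i : Fin 2) (n : ℤ) : U2 := inl (U.phi S i n) * qq 0 (-S.val / 2 * n)

/-- The second tensor factor of the coefficients of `Δ(φ_i^±(z))`. -/
def phiR (S : Sgn) (i : Fin 2) (n : ℤ) : U2 := inr (U.phi S i n) * qq (S.val / 2 * n) 0

/-- The factor `φ_i^-(z q ^ (c₁ / 2))` of `Δ(x_i^+(z))`. -/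
def plusL (i : Fin 2) (n : ℤ) : U2 := inl (U.phi .minus i n) * qq (-1 / 2 * n) 0

/-- The factor `x_i^+(z q ^ c₁)` of `Δ(x_i^+(z))`. -/
def plusR (i : Fin 2) (n : ℤ) : U2 := inr (U.x .plus i n) * qq (-n) 0

/-- The factor `x_i^-(z q ^ c₂)` of `Δ(x_i^-(z))`. -/
def minusL (i : Fin 2) (n : ℤ) : U2 := inl (U.x .minus i n) * qq 0 (-n)

/-- The factor `φ_i^+(z q ^ (c₂ / 2))` of `Δ(x_i^-(z))`. -/
def minusR (i : Fin 2) (n : ℤ) : U2 := inr (U.phi .plus i n) * qq 0 (-1 / 2 * n)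

theorem phiL_of_neg {S : Sgn} {i : Fin 2} {n : ℤ} (h : S.val * n < 0) : phiL S i n = 0 := by
  rw [phiL, U.phi_of_neg h, map_zero, zero_mul]

theorem phiR_of_neg {S : Sgn} {i : Fin 2} {n : ℤ} (h : S.val * n < 0) : phiR S i n = 0 := by
  rw [phiR, U.phi_of_neg h, map_zero, zero_mul]

theorem plusL_of_pos {i : Fin 2} {n : ℤ} (h : 0 < n) : plusL i n = 0 := by
  rw [plusL, U.phi_of_pos h, map_zero, zero_mul]

theorem minusR_of_neg {i : Fin 2} {n : ℤ} (h : n < 0) : minusR i n = 0 := by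
  rw [minusR, U.phi_of_lt h, map_zero, zero_mul]

/-- The current `Δ(φ_i^±(z))`. -/
def phiΔ (S : Sgn) (i : Fin 2) : ℤ → HahnSeries ℤ U2 :=
  fuse (phiL S i) (phiR S i) fun n => ⟨min 0 n, fun k hk => by
    cases S
    · rw [phiR_of_neg (by simp only [Sgn.val]; omega), mul_zero]
    · rw [phiL_of_neg (by simp only [Sgn.val]; omega), zero_mul]⟩

/-- The term `x_i^+(z) ⊗ 1` of `Δ(x_i^+(z))`. -/
def plusStatic (i : Fin 2) (n : ℤ) : HahnSeries ℤ U2 := HahnSeries.C (inl (U.x .plus i n))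

/-- The term `φ_i^-(z q ^ (c₁ / 2)) ⊗ x_i^+(z u⁻¹ q ^ c₁)` of `Δ(x_i^+(z))`. -/
def plusMoving (i : Fin 2) : ℤ → HahnSeries ℤ U2 :=
  fuse (plusL i) (plusR i) fun n => ⟨n, fun k hk => by
    rw [plusL_of_pos (by omega), zero_mul]⟩

/-- The term `1 ⊗ x_i^-(z u⁻¹)` of `Δ(x_i^-(z))`. -/
def minusMoving (i : Fin 2) (n : ℤ) : HahnSeries ℤ U2 :=
  HahnSeries.single n (inr (U.x .minus i n))

/-- The term `x_i^-(z q ^ c₂) ⊗ φ_i^+(z u⁻¹ q ^ (c₂ / 2))` of `Δ(x_i^-(z))`. -/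
def minusStatic (i : Fin 2) : ℤ → HahnSeries ℤ U2 :=
  fuse (minusL i) (minusR i) fun n => ⟨0, fun k hk => by
    rw [minusR_of_neg (by omega), mul_zero]⟩

/-- The current `Δ(x_i^±(z))`. -/
def xΔ : Sgn → Fin 2 → ℤ → HahnSeries ℤ U2
  | .plus, i => plusStatic i + plusMoving i
  | .minus, i => minusMoving i + minusStatic i

theorem phiΔ_fused (S : Sgn) (i : Fin 2) : Fused (phiL S i) (phiR S i) (phiΔ S i) :=
  fused_fuse _ _ _

theorem plusStatic_fused (i : Fin 2) :
    Fused (fun n => inl (U.x .plus i n)) (Pi.single (M := fun _ => U2) 0 1) (plusStatic i) :=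
  Fused.C _

theorem plusMoving_fused (i : Fin 2) : Fused (plusL i) (plusR i) (plusMoving i) :=
  fused_fuse _ _ _

theorem minusMoving_fused (i : Fin 2) :
    Fused (Pi.single (M := fun _ => U2) 0 1) (fun n => inr (U.x .minus i n)) (minusMoving i) :=
  Fused.single _

theorem minusStatic_fused (i : Fin 2) : Fused (minusL i) (minusR i) (minusStatic i) :=
  fused_fuse _ _ _

theorem commute_single_one (a : U2) (n : ℤ) :
    Commute a (Pi.single (M := fun _ => U2) 0 1 n) := by
  rcases eq_or_ne n 0 with rfl | h
  · rw [Pi.single_eq_same]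
    exact Commute.one_right a
  · rw [Pi.single_eq_of_ne h]
    exact Commute.zero_right a

theorem phiL_val_mul (S : Sgn) (i : Fin 2) (m : ℕ) :
    phiL S i (S.val * m) = inl (U.phi S i (S.val * m)) * qq (0 * m) (-1 / 2 * m) := by
  rw [phiL]
  cases S <;> simp only [Sgn.val] <;> push_cast <;> congr 2 <;> ring

theorem phiR_val_mul (S : Sgn) (i : Fin 2) (m : ℕ) :
    phiR S i (S.val * m) = inr (U.phi S i (S.val * m)) * qq (1 / 2 * m) (0 * m) := by
  rw [phiR]
  cases S <;> simp only [Sgn.val] <;> push_cast <;> congr 2 <;> ring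

theorem plusL_eq (i : Fin 2) :
    plusL i = fun n : ℤ => inl (U.phi .minus i n) * qq (-1 / 2 * n) (0 * n) := by
  funext n
  rw [plusL, zero_mul]

theorem plusR_eq (i : Fin 2) :
    plusR i = fun n : ℤ => inr (U.x .plus i n) * qq (-1 * n) (0 * n) := by
  funext n
  rw [plusR, zero_mul, neg_one_mul]

theorem minusL_eq (i : Fin 2) :
    minusL i = fun n : ℤ => inl (U.x .minus i n) * qq (0 * n) (-1 * n) := by
  funext n
  rw [minusL, zero_mul, neg_one_mul]

theorem minusR_eq (i : Fin 2) :
    minusR i = fun n : ℤ => inr (U.phi .plus i n) * qq (0 * n) (-1 / 2 * n) := by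
  funext n
  rw [minusR, zero_mul]

theorem plusA_eq (i : Fin 2) :
    (fun n : ℤ => inl (U.x .plus i n)) = fun n : ℤ => inl (U.x .plus i n) * qq (0 * n) (0 * n) := by
  funext n
  rw [zero_mul, qq_zero, mul_one]

theorem minusA_eq (i : Fin 2) :
    (fun n : ℤ => inr (U.x .minus i n))
      = fun n : ℤ => inr (U.x .minus i n) * qq (0 * n) (0 * n) := by
  funext n
  rw [zero_mul, qq_zero, mul_one]

theorem phiL_plus_eq (i : Fin 2) (m : ℕ) :
    phiL .plus i m = inl (U.phi .plus i m) * qq (0 * m) (-1 / 2 * m) := by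
  have := phiL_val_mul .plus i m
  simpa only [Sgn.val, one_mul] using this

theorem phiR_plus_eq (i : Fin 2) (m : ℕ) :
    phiR .plus i m = inr (U.phi .plus i m) * qq (1 / 2 * m) (0 * m) := by
  have := phiR_val_mul .plus i m
  simpa only [Sgn.val, one_mul] using this

theorem phiL_minus_eq (i : Fin 2) :
    phiL .minus i = fun n : ℤ => inl (U.phi .minus i n) * qq (0 * n) (1 / 2 * n) := by
  funext n
  rw [phiL, zero_mul]
  simp [Sgn.val]

theorem phiR_minus_eq (i : Fin 2) :
    phiR .minus i = fun n : ℤ => inr (U.phi .minus i n) * qq (-1 / 2 * n) (0 * n) := by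
  funext n
  rw [phiR, zero_mul]
  simp [Sgn.val]

theorem phiL_commute_inr (S : Sgn) (i : Fin 2) (n : ℤ) (b : U) (α β : ℂ) :
    Commute (phiL S i n) (inr b * qq α β) := (inl_inr_commute _ _).mul_mul_qq _ _ _ _

theorem phiR_commute_inl (S : Sgn) (i : Fin 2) (n : ℤ) (b : U) (α β : ℂ) :
    Commute (phiR S i n) (inl b * qq α β) := (inl_inr_commute _ _).symm.mul_mul_qq _ _ _ _

theorem phiR_commute_inl' (S : Sgn) (i : Fin 2) (n : ℤ) (b : U) : Commute (phiR S i n) (inl b) :=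
  ((inl_inr_commute _ _).symm).mul_left (qq_commute _ _ _)

theorem phiL_commute_inr' (S : Sgn) (i : Fin 2) (n : ℤ) (b : U) : Commute (phiL S i n) (inr b) :=
  (inl_inr_commute _ _).mul_left (qq_commute _ _ _)

theorem inl_phi_commute (S : Sgn) (i j : Fin 2) (m n : ℤ) (α β γ δ : ℂ) :
    Commute (inl (U.phi S i m) * qq α β) (inl (U.phi S j n) * qq γ δ) :=
  ((U.phi_commute S i j m n).map inl).mul_mul_qq _ _ _ _

theorem inr_phi_commute (S : Sgn) (i j : Fin 2) (m n : ℤ) (α β γ δ : ℂ) :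
    Commute (inr (U.phi S i m) * qq α β) (inr (U.phi S j n) * qq γ δ) :=
  ((U.phi_commute S i j m n).map inr).mul_mul_qq _ _ _ _

theorem gg₂_cancel {a₁ a₂ a₃ : ℤ} {α₁ α₂ α₃ β₁ β₂ β₃ : ℂ} (ha : a₁ = -a₃) (hα : α₁ = α₃)
    (hβ : β₁ = β₃) : gg₂ a₁ α₁ β₁ * gg₂ a₂ α₂ β₂ * gg₂ a₃ α₃ β₃ = gg₂ a₂ α₂ β₂ := by
  subst ha hα hβ
  rw [(gg₂_isCentral _ _ _).commute, mul_assoc, gg₂_neg_mul, mul_one]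

/-- A half current `Δ(φ_i^±(z))` and a current in two factors. -/
theorem exchange_phiΔ (S : Sgn) (i : Fin 2) {p q : ℤ → U2} {B : ℤ → HahnSeries ℤ U2}
    {G G' : PowerSeries U2} (hB : Fused p q B)
    (h : Exchange S.val (fun m => phiL S i (S.val * m)) p G)
    (h' : Exchange S.val (fun m => phiR S i (S.val * m)) q G') (hG' : IsCentral G')
    (hlq : ∀ m n, Commute (phiL S i m) (q n)) (hrp : ∀ m n, Commute (phiR S i m) (p n)) :
    Exchange S.val (fun m => phiΔ S i (S.val * m)) B (PowerSeries.map HahnSeries.C (G * G')) :=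
  (phiΔ_fused S i).exchangeFuse (Sgn.val_mul_self S) (fun _ => phiL_of_neg)
    (fun _ => phiR_of_neg) hB h h' hG' hlq hrp

theorem isCentral_one {R : Type} [Ring R] : IsCentral (1 : PowerSeries R) := fun i x => by
  rw [coeff_one]
  split_ifs
  exacts [Commute.one_left x, Commute.zero_left x]

/-- The exchange relations between `Δ(φ_i^±)` and `Δ(x_j^+)`, with the argument
`q ^ (-(c₁ + c₂) / 2) y` in the structure function. For the moving term of `Δ(x_j^+)` and `φ_i^+`,
the factors which come from `φ_i^+ φ_j^-` in the first tensor factor correct the argument. -/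
theorem exchange_phi_plus (S : Sgn) (i j : Fin 2) :
    Exchange S.val (fun m => phiΔ S i (S.val * m)) (xΔ .plus j)
      (PowerSeries.map HahnSeries.C (gg₂ (S.val * cartan i j) (-1 / 2) (-1 / 2))) := by
  refine Exchange.add ?_ ?_
  · have h₁ := exchange_left S .plus i j 0 (-1 / 2) 0 0
    simp only [← phiL_val_mul, ← plusA_eq] at h₁
    refine (exchange_phiΔ S i (plusStatic_fused j) h₁
      (Exchange.of_commute fun m n => commute_single_one _ n) isCentral_one
      (fun m n => commute_single_one _ n) (fun m n => phiR_commute_inl' _ _ _ _)).congr_right ?_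
    rw [mul_one]
    congr 2 <;> cases S <;> norm_num [Sgn.val]
  · have h₂ := exchange_right S .plus i j (1 / 2) 0 (-1) 0
    simp only [← phiR_val_mul, ← plusR_eq] at h₂
    cases S
    · have h₁ := exchange_left_phi i j 0 (-1 / 2) (-1 / 2) 0
      simp only [← phiL_plus_eq, ← plusL_eq] at h₁
      refine (exchange_phiΔ .plus i (plusMoving_fused j) (by simpa only [Sgn.val, one_mul] using h₁)
        h₂ (gg₂_isCentral _ _ _) (fun m n => phiL_commute_inr _ _ _ _ _ _)
        (fun m n => phiR_commute_inl _ _ _ _ _ _)).congr_right ?_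
      refine congrArg _ ((gg₂_cancel ?_ ?_ ?_).trans ?_)
      rotate_right
      · congr 1 <;> norm_num [Sgn.val]
      all_goals norm_num [Sgn.val]
    · refine (exchange_phiΔ .minus i (plusMoving_fused j)
        (Exchange.of_commute fun m n => inl_phi_commute _ _ _ _ _ _ _ _ _)
        h₂ (gg₂_isCentral _ _ _) (fun m n => phiL_commute_inr _ _ _ _ _ _)
        (fun m n => phiR_commute_inl _ _ _ _ _ _)).congr_right ?_
      rw [one_mul]
      congr 2 <;> norm_num [Sgn.val]

/-- The exchange relations between `Δ(φ_i^±)` and `Δ(x_j^-)`, with the argument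
`q ^ ((c₁ + c₂) / 2) y` in the structure function. -/
theorem exchange_phi_minus (S : Sgn) (i j : Fin 2) :
    Exchange S.val (fun m => phiΔ S i (S.val * m)) (xΔ .minus j)
      (PowerSeries.map HahnSeries.C (gg₂ (-S.val * cartan i j) (1 / 2) (1 / 2))) := by
  refine Exchange.add ?_ ?_
  · have h₂ := exchange_right S .minus i j (1 / 2) 0 0 0
    simp only [← phiR_val_mul, ← minusA_eq] at h₂
    refine (exchange_phiΔ S i (minusMoving_fused j)
      (Exchange.of_commute fun m n => commute_single_one _ n) h₂ (gg₂_isCentral _ _ _)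
      (fun m n => phiL_commute_inr' _ _ _ _) (fun m n => commute_single_one _ n)).congr_right ?_
    rw [one_mul]
    congr 2 <;> cases S <;> norm_num [Sgn.val]
  · have h₁ := exchange_left S .minus i j 0 (-1 / 2) 0 (-1)
    simp only [← phiL_val_mul, ← minusL_eq] at h₁
    cases S
    · refine (exchange_phiΔ .plus i (minusStatic_fused j) h₁
        (Exchange.of_commute fun m n => inr_phi_commute _ _ _ _ _ _ _ _ _) isCentral_one
        (fun m n => phiL_commute_inr _ _ _ _ _ _)
        (fun m n => phiR_commute_inl _ _ _ _ _ _)).congr_right ?_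
      rw [mul_one]
      congr 2 <;> norm_num [Sgn.val]
    · have h₂ := exchange_right_phi j i 0 (-1 / 2) (-1 / 2) 0
      have e : (fun m : ℕ => inr (U.phi .plus j m) * qq (0 * m) (-1 / 2 * m))
          = fun m : ℕ => minusR j m := by
        funext m
        rw [minusR_eq]
        push_cast
        rfl
      rw [e, ← phiR_minus_eq] at h₂
      have h₃ := h₂.reverse (fun n hn => minusR_of_neg hn)
        (fun n hn => phiR_of_neg (by simp only [Sgn.val]; omega))
        (G' := gg₂ (-cartan i j) (1 / 2) (-3 / 2) * gg₂ (cartan i j) (1 / 2) (1 / 2)) (by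
          rw [cartan_comm j i, mul_assoc, ← mul_assoc (gg₂ (cartan i j) _ _)]
          have e₁ : gg₂ (cartan i j) (1 / 2) (1 / 2)
              * gg₂ (-cartan i j) (0 - -1 / 2) (1 + -1 / 2 - 0) = 1 := by
            norm_num
            simpa using gg₂_mul_neg (cartan i j) (1 / 2) (1 / 2)
          rw [e₁, one_mul]
          norm_num
          simpa using gg₂_neg_mul (cartan i j) (1 / 2) (-(3 / 2)))
      refine (exchange_phiΔ .minus i (minusStatic_fused j) h₁
        (by simpa only [Sgn.val, neg_mul, one_mul] using h₃)
        ((gg₂_isCentral _ _ _).mul (gg₂_isCentral _ _ _))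
        (fun m n => phiL_commute_inr _ _ _ _ _ _)
        (fun m n => phiR_commute_inl _ _ _ _ _ _)).congr_right ?_
      rw [← mul_assoc]
      have e₁ : gg₂ (Sgn.minus.val * Sgn.minus.val * cartan i j)
          (-(Sgn.minus.val : ℂ) / 2 + 0 - (Sgn.minus.val : ℂ) * 0)
          (-1 / 2 - (Sgn.minus.val : ℂ) * -1) * gg₂ (-cartan i j) (1 / 2) (-3 / 2) = 1 := by
        rw [← gg₂_mul_neg (cartan i j) (1 / 2) (-3 / 2)]
        congr 2 <;> norm_num [Sgn.val]
      rw [e₁, one_mul]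
      congr 2
      norm_num [Sgn.val]

/-- The exchange relation between `Δ(φ_i^+)` and `Δ(φ_j^-)`: of the four structure functions from
the two tensor factors, two cancel. -/
theorem exchange_phi_phi (i j : Fin 2) :
    Exchange 1 (fun m => phiΔ .plus i m) (phiΔ .minus j)
      (PowerSeries.map HahnSeries.C
        (gg₂ (-cartan i j) 1 1 * gg₂ (cartan i j) (-1) (-1))) := by
  have h₁ := exchange_left_phi i j 0 (-1 / 2) 0 (1 / 2)
  have h₂ := exchange_right_phi i j (1 / 2) 0 (-1 / 2) 0
  simp only [← phiL_plus_eq, ← phiL_minus_eq] at h₁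
  simp only [← phiR_plus_eq, ← phiR_minus_eq] at h₂
  have h := exchange_phiΔ .plus i (phiΔ_fused .minus j)
    (by simpa only [Sgn.val, one_mul] using h₁) (by simpa only [Sgn.val, one_mul] using h₂)
    ((gg₂_isCentral _ _ _).mul (gg₂_isCentral _ _ _))
    (fun m n => phiL_commute_inr _ _ _ _ _ _) (fun m n => phiR_commute_inl _ _ _ _ _ _)
  simp only [Sgn.val, one_mul] at h
  refine h.congr_right (congrArg _ ?_)
  have e₁ : gg₂ (-cartan i j) (1 + 0 - 0) (-1 / 2 - 1 / 2)
      * gg₂ (cartan i j) (1 / 2 - -1 / 2) (-1 + 0 - 0) = 1 := by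
    rw [← gg₂_neg_mul (cartan i j) 1 (-1)]
    congr 2 <;> norm_num
  rw [← mul_assoc, mul_assoc (gg₂ (-cartan i j) (1 + 0 - 0) _),
    mul_assoc (gg₂ (-cartan i j) (1 + 0 - 0) _),
    ← (gg₂_isCentral (cartan i j) (1 / 2 - -1 / 2) _).commute, ← mul_assoc, e₁, one_mul,
    (gg₂_isCentral _ _ _).commute]
  congr 2 <;> norm_num

end

section

open PowerSeries Finset

/-! ### Realizations of the defining relations -/

section Realization

variable {R : Type} [Ring R] [Algebra Base R]

/-- The defining relations for given values of `q ^ (κ c)` and of the coefficients of the currents,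
multiplied with powers of `q` where this removes an inverse. -/
structure IsToroidal (qc : ℂ → R) (phi x : Sgn → Fin 2 → ℤ → R) : Prop where
  qc_add : ∀ κ κ', qc (κ + κ') = qc κ * qc κ'
  qc_phi : ∀ κ s i n, Commute (qc κ) (phi s i n)
  qc_x : ∀ κ s i n, Commute (qc κ) (x s i n)
  phi_of_neg : ∀ {s i n}, s.val * n < 0 → phi s i n = 0
  phi_phi : ∀ s i j m n, Commute (phi s i m) (phi s j n)
  phi_plus_minus : ∀ i j, Exchange 1 (fun m => phi .plus i m) (phi .minus j)
    (gScaled (-cartan i j) (fun k => qc k) * gScaled (cartan i j) (fun k => qc (-k)))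
  phi_x : ∀ S s i j, Exchange S.val (fun m => phi S i (S.val * m)) (x s j)
    (gScaled (S.val * s.val * cartan i j) (fun k => qc (-s.val / 2 * k)))
  x_plus_minus : ∀ i j (m n : ℤ),
    (q 1 - q (-1)) • (x .plus i m * x .minus j n - x .minus j n * x .plus i m)
      = if i = j then phi .plus i (m + n) * qc (((m : ℂ) - n) / 2)
            - phi .minus i (m + n) * qc (((n : ℂ) - m) / 2)
        else 0
  pair : ∀ s {i j}, i ≠ j → ToroidalPair (q (2 * s.val)) (x s i) (x s j)

theorem U.isToroidal : IsToroidal U.qc U.phi U.x where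
  qc_add := U.qc_add
  qc_phi κ _ _ _ := U.qc_commute κ _
  qc_x κ _ _ _ := U.qc_commute κ _
  phi_of_neg := U.phi_of_neg
  phi_phi := U.phi_commute
  phi_plus_minus := U.exchange_plus_minus
  phi_x := U.exchange_x
  x_plus_minus := U.x_plus_minus
  pair s _ _ hij := U.toroidalPair s hij

namespace IsToroidal

variable {qc : ℂ → R} {phi x : Sgn → Fin 2 → ℤ → R}

theorem map {R' : Type} [Ring R'] [Algebra Base R'] (h : IsToroidal qc phi x) (F : R →ₐ[Base] R') :
    IsToroidal (fun κ => F (qc κ)) (fun s i n => F (phi s i n)) (fun s i n => F (x s i n)) where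
  qc_add κ κ' := by rw [h.qc_add, map_mul]
  qc_phi κ s i n := (h.qc_phi κ s i n).map F
  qc_x κ s i n := (h.qc_x κ s i n).map F
  phi_of_neg hn := by rw [h.phi_of_neg hn, map_zero]
  phi_phi s i j m n := (h.phi_phi s i j m n).map F
  phi_plus_minus i j := ((h.phi_plus_minus i j).map F.toRingHom).congr_right (by
    rw [map_mul, map_gScaled, map_gScaled])
  phi_x S s i j := ((h.phi_x S s i j).map F.toRingHom).congr_right (by rw [map_gScaled])
  x_plus_minus i j m n := by
    rw [← map_mul, ← map_mul, ← map_sub, ← map_smul, h.x_plus_minus]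
    split_ifs
    · rw [map_sub, map_mul, map_mul]
    · exact map_zero F
  pair s _ _ hij := (h.pair s hij).map F

/-- The substitution `z ↦ z u⁻¹` for a central unit `u` with the powers `w n`. -/
theorem scale (h : IsToroidal qc phi x) {w : ℤ → R} (h0 : w 0 = 1)
    (hw : ∀ m n, w (m + n) = w m * w n) (hc : ∀ n y, Commute (w n) y) :
    IsToroidal qc (fun s i n => phi s i n * w n) (fun s i n => x s i n * w n) where
  qc_add := h.qc_add
  qc_phi κ s i n := (h.qc_phi κ s i n).mul_right (hc n _).symm
  qc_x κ s i n := (h.qc_x κ s i n).mul_right (hc n _).symm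
  phi_of_neg hn := by rw [h.phi_of_neg hn, zero_mul]
  phi_phi s i j m n :=
    ((h.phi_phi s i j m n).mul_right (hc _ _).symm).mul_left (hc _ _)
  phi_plus_minus i j := ((h.phi_plus_minus i j).scale (v := fun m => w m) (w := w)
    (fun a b => by push_cast; exact hw _ _) hw (fun n y => hc _ y) hc).congr_right (by
      ext k
      rw [coeff_mk, ← hw, one_mul, add_neg_cancel, h0, mul_one])
  phi_x S s i j := ((h.phi_x S s i j).scale (v := fun m => w (S.val * m)) (w := w)
    (fun a b => by push_cast; rw [mul_add, hw]) hw (fun n y => hc _ y) hc).congr_right (by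
      ext k
      rw [coeff_mk, ← hw, add_neg_cancel, h0, mul_one])
  x_plus_minus i j m n := by
    have key : ∀ (k l : ℤ) (a b : R), a * w k * (b * w l) = a * b * w (k + l) := by
      intro k l a b
      rw [hw, mul_assoc, ← mul_assoc (w k), (hc k b).eq, mul_assoc, mul_assoc]
    rw [key, key, add_comm n m, ← sub_mul, ← smul_mul_assoc, h.x_plus_minus]
    split_ifs
    · rw [sub_mul, mul_assoc, mul_assoc, mul_assoc, mul_assoc, (hc _ (qc _)).eq, (hc _ (qc _)).eq]
    · exact zero_mul _
  pair s i j hij := by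
    have := (h.pair s hij).scale hw hc
    simp only [(hc _ _).eq] at this
    exact this

theorem serreTerm {F : Free →ₐ[Base] R} (hx : ∀ s i n, F (Free.x s i n) = x s i n) (s : Sgn)
    (i j : Fin 2) (n : Fin 3 → ℤ) (m : ℤ) (σ : Equiv.Perm (Fin 3)) :
    ∑ r ∈ Finset.range 4, ((-1) ^ r * qBinom 3 r) • F (Free.serreTerm s i j n m σ r)
      = serreInner (1 : Base) (qInt 3) (x s i (n (σ 0))) (x s i (n (σ 1))) (x s i (n (σ 2)))
        (x s j m) := by
  have h3 : qBinom 3 3 = 1 := (qBinom_three_symm 0 (by norm_num)).trans qBinom_three_zero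
  have h2 : qBinom 3 2 = qInt 3 := (qBinom_three_symm 1 (by norm_num)).trans qBinom_three_one
  rw [Finset.sum_range_succ, Finset.sum_range_succ, Finset.sum_range_succ, Finset.sum_range_one,
    qBinom_three_zero, qBinom_three_one, h2, h3]
  simp only [Free.serreTerm, List.ofFn_succ, List.ofFn_zero, List.take, List.drop, List.prod_cons,
    List.prod_nil, map_mul, one_mul, mul_one, serreInner, hx]
  have e1 : (Fin.succ 0 : Fin 3) = 1 := rfl
  have e2 : (Fin.succ (Fin.succ 0) : Fin 3) = 2 := rfl
  simp only [e1, e2, mul_assoc]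
  simp only [pow_zero, one_smul, pow_one, neg_mul, one_mul, neg_smul]
  norm_num
  abel

/-- A homomorphism from the completed free algebra respects the defining relations if its values on
the currents do. -/
theorem respects (h : IsToroidal qc phi x) {F : Free →ₐ[Base] R}
    (hc : ∀ g, Commute (F (Free.gen .c)) (F (Free.gen g)))
    (hqc : ∀ κ, F (Free.qc κ) = qc κ) (hphi : ∀ s i n, F (Free.phi s i n) = phi s i n)
    (hx : ∀ s i n, F (Free.x s i n) = x s i n) {a b : Free} (hab : Relation a b) : F a = F b := by
  have hq : ∀ s : Sgn, q (2 * s.val) * q (-2 * s.val) = 1 := fun s => by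
    rw [neg_mul]
    exact q_mul_q_neg _
  have cancel : ∀ (s : Sgn) {y z : R}, q (2 * s.val) • y = q (2 * s.val) • z → y = z := by
    intro s y z hyz
    have := congrArg (fun t => q (-2 * s.val) • t) hyz
    simpa only [smul_smul, mul_comm (q (-2 * s.val)), hq, one_smul] using this
  have hxx : ∀ s i j m n, q (2 * s.val) • F (Free.xx s i j m n)
      = quadDefect (q (2 * s.val)) 1 (x s i) (x s j) m n := by
    intro s i j m n
    simp only [Free.xx, map_sub, map_smul, map_mul, quadDefect, smul_sub, smul_smul, hq, hx]
  cases hab with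
  | central g =>
    rw [map_mul, map_mul]
    exact hc g
  | phi_phi s i j m n =>
    rw [map_mul, map_mul, hphi, hphi]
    exact h.phi_phi s i j m n
  | phi_plus_minus i j m n =>
    have hG : ∀ k, F (Free.gg i j k) = coeff k (gScaled (-cartan i j) (fun k => qc k)
        * gScaled (cartan i j) (fun k => qc (-k))) := by
      intro k
      rw [coeff_mul, Free.gg, map_sum]
      refine Finset.sum_congr rfl fun p _ => ?_
      rw [gScaled, gScaled, coeff_mk, coeff_mk, map_smul, smul_mul_smul_comm, ← h.qc_add, hqc]
      rfl
    rw [map_mul, hphi, hphi, map_sum]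
    refine (h.phi_plus_minus i j m (-n)).trans ?_
    rw [Finset.Nat.sum_antidiagonal_eq_sum_range_succ (fun a b => coeff a _ *
      (phi .minus j (-(n : ℤ) + 1 * a) * phi .plus i b))]
    refine Finset.sum_congr rfl fun l hl => ?_
    have hl := Finset.mem_range_succ_iff.1 hl
    rw [map_mul F, map_mul F, hG, hphi, hphi, Nat.cast_sub hl,
      show -(n : ℤ) + 1 * l = -(n - l) by ring]
    refine Commute.eq ?_
    rw [coeff_mul]
    refine Commute.sum_left _ _ _ fun p _ => ?_
    rw [gScaled, gScaled, coeff_mk, coeff_mk]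
    exact Commute.mul_left
      (((h.qc_phi _ _ _ _).mul_right (h.qc_phi _ _ _ _)).smul_left _)
      (((h.qc_phi _ _ _ _).mul_right (h.qc_phi _ _ _ _)).smul_left _)
  | phi_plus_x s i j m n =>
    rw [map_mul, hphi, hx, map_sum]
    have := h.phi_x .plus s i j m n
    simp only [Sgn.val, one_mul] at this
    refine this.trans ?_
    rw [Finset.Nat.sum_antidiagonal_eq_sum_range_succ (fun a b => coeff a _ *
      (x s j (n + a) * phi .plus i b))]
    refine Finset.sum_congr rfl fun l hl => ?_
    have hl := Finset.mem_range_succ_iff.1 hl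
    rw [map_smul, map_mul, map_mul, gScaled, coeff_mk, Nat.cast_sub hl, smul_mul_assoc, hx, hphi,
      hqc, ((h.qc_x _ _ _ _).mul_right (h.qc_phi _ _ _ _)).eq]
    rw [show -(s.val : ℂ) * l / 2 = -s.val / 2 * l by ring]
    rfl
  | phi_minus_x s i j m n =>
    rw [map_mul, hphi, hx, map_sum]
    have := h.phi_x .minus s i j m n
    simp only [Sgn.val, neg_mul, one_mul] at this
    refine this.trans ?_
    rw [Finset.Nat.sum_antidiagonal_eq_sum_range_succ (fun a b => coeff a _ *
      (x s j (n + -a) * phi .minus i (-b)))]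
    refine Finset.sum_congr rfl fun l hl => ?_
    have hl := Finset.mem_range_succ_iff.1 hl
    rw [map_smul, map_mul, map_mul, gScaled, coeff_mk, Nat.cast_sub hl, smul_mul_assoc, hx, hphi,
      hqc, ((h.qc_x _ _ _ _).mul_right (h.qc_phi _ _ _ _)).eq, cartan_comm j i, ← sub_eq_add_neg,
      neg_mul]
    rw [show -(s.val : ℂ) * l / 2 = -s.val / 2 * l by ring]
    rfl
  | x_plus_minus i j m n =>
    rw [map_smul, map_sub, map_mul, map_mul, hx, hx, h.x_plus_minus]
    split_ifs
    · rw [map_sub, map_mul, map_mul, hphi, hphi, hqc, hqc]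
    · exact (map_zero F).symm
  | x_x_same s i m n =>
    obtain ⟨j, hij⟩ : ∃ j, i ≠ j := ⟨i + 1, by fin_cases i <;> decide⟩
    have := (h.pair s hij).quad m n
    rw [quadDefect, one_smul, one_smul, sub_eq_zero] at this
    simp only [map_sub, map_smul, map_mul, hx]
    exact this
  | x_x_distinct s i j hij m n =>
    refine cancel s (sub_eq_zero.1 ?_)
    have := sub_eq_zero.2 ((h.pair s hij).double_pole m n)
    rw [← this]
    simp only [map_sub, map_add, map_smul, map_mul, smul_sub, smul_add, smul_smul, hq,
      add_smul, one_smul, hx, quadDefect, show m + 1 + 1 = m + 2 by ring,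
      show n + 1 + 1 = n + 2 by ring]
    abel
  | x_xx s i j hij l m n =>
    refine cancel s ?_
    rw [map_mul, map_mul, ← mul_smul_comm, ← smul_mul_assoc, hxx, hx]
    exact (h.pair s hij).cubic l m n
  | serre s i j hij n m =>
    refine cancel s ?_
    rw [map_zero, smul_zero, map_sum]
    simp only [map_sum, map_smul, serreTerm hx]
    rw [sum_perm_three]
    have hs : ∀ x₁ x₂ x₃ b : R, q (2 * s.val) • serreInner (1 : Base) (qInt 3) x₁ x₂ x₃ b
        = serreInner (q (2 * s.val)) (q (2 * s.val) ^ 2 + q (2 * s.val) + 1) x₁ x₂ x₃ b := by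
      intro x₁ x₂ x₃ b
      simp only [serreInner, smul_sub, smul_add, smul_smul, q_mul_qInt_three, mul_one]
    simp only [smul_add, hs]
    exact (h.pair s hij).serre (n 0) (n 1) (n 2) m

end IsToroidal

end Realization

end

section

open PowerSeries Finset

section Construction

variable {T : Type} [Ring T] [Algebra Base T] [IsAdicComplete hIdeal T]
  [Module.IsTorsionFree Base T]

/-- A realization of the relations gives a homomorphism from `𝒰`, if the currents `phi` are
exponentials of series with coefficients `k i n`. -/
theorem IsToroidal.exists_hom {qc : ℂ → T} {phi x : Sgn → Fin 2 → ℤ → T}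
    (h : IsToroidal qc phi x) {c : T} {k : Fin 2 → ℤ → T} {e : Sgn → Fin 2 → T}
    (hck : ∀ i n, Commute c (k i n)) (hcx : ∀ s i n, Commute c (x s i n))
    (hqc : ∀ κ, IsExp ((PowerSeries.C κ : Base) • c) (qc κ))
    (he : ∀ (s : Sgn) i, IsExp ((PowerSeries.C (s.val : ℂ) : Base) • k i 0) (e s i))
    (hphi : ∀ (s : Sgn) i (n : ℕ),
      phi s i (s.val * n) = e s i * coeff n (psExp (hSeries s (k i)))) :
    ∃ f : U →ₐ[Base] T, f U.c = c ∧ (∀ s i n, f (U.phi s i n) = phi s i n) ∧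
      (∀ s i n, f (U.x s i n) = x s i n) ∧ ∀ i n, f (U.gen (.h i n)) = k i n := by
  let v : Gen → T := fun g => match g with
    | .h i n => k i n
    | .x s i n => x s i n
    | .c => c
  have hexp : ∀ κ g y, IsExp ((PowerSeries.C κ : Base) • v g) y →
      liftFree v (Free.qGen κ g) = y := by
    intro κ g y hy
    have := (Free.isExp_qGen κ g).map (liftFree v)
    rw [map_smul, liftFree_gen] at this
    exact this.unique hy
  have hφ : ∀ s i n, liftFree v (Free.phi s i n) = phi s i n := by
    intro s i n
    rcases lt_or_ge (s.val * n) 0 with hn | hn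
    · rw [Free.phi_of_neg hn, map_zero, h.phi_of_neg hn]
    · obtain ⟨m, hm⟩ := Int.eq_ofNat_of_zero_le hn
      obtain rfl : n = s.val * m := by
        rw [← hm, ← mul_assoc, Sgn.val_mul_self, one_mul]
      rw [Free.phi_val_mul, map_mul, hexp _ _ _ (he s i), hphi]
      congr 1
      have := psExp_map (liftFree v) (hSeries s fun m => Free.gen (.h i m))
      rw [hSeries_map] at this
      simp only [liftFree_gen] at this
      exact (congrArg (coeff m) this).symm
  have hx : ∀ s i n, liftFree v (Free.x s i n) = x s i n := fun s i n => liftFree_gen v _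
  have hcg : ∀ g, Commute (liftFree v (Free.gen .c)) (liftFree v (Free.gen g)) := by
    intro g
    rw [liftFree_gen, liftFree_gen]
    cases g with
    | h i n => exact hck i n
    | x s i n => exact hcx s i n
    | c => exact Commute.refl _
  exact ⟨U.lift (liftFree v) fun a b hab => h.respects hcg (fun κ => hexp _ _ _ (hqc κ)) hφ hx hab,
    liftFree_gen v .c, hφ, hx, fun i n => liftFree_gen v (.h i n)⟩

end Construction

/-! ### The counit -/

theorem psExp_zero {R : Type} [Ring R] [Algebra Base R] : psExp (0 : PowerSeries R) = 1 := by
  ext n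
  rw [psExp, coeff_mk, Finset.sum_range_succ']
  simp [invFact_zero]

theorem isToroidal_trivial : IsToroidal (fun _ => (1 : Base))
    (fun _ _ n => if n = 0 then 1 else 0) (fun _ _ _ => 0) := by
  have hone : ∀ (a : ℤ), gScaled a (fun _ => (1 : Base)) = gSeries a := by
    intro a
    ext1 k
    rw [gScaled, coeff_mk, smul_eq_mul, mul_one]
  have hphi : ∀ n : ℤ, n ≠ 0 → (if n = 0 then 1 else 0 : Base) = 0 := fun n hn => if_neg hn
  refine ⟨fun _ _ => (one_mul _).symm, fun _ _ _ _ => Commute.all _ _,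
    fun _ _ _ _ => Commute.all _ _,
    fun {s i n} hn => ?_, fun _ _ _ _ _ => Commute.all _ _, fun i j => ?_, fun S s i j m n => ?_,
    fun i j m n => ?_, fun s i j _ => ⟨fun m n => ?_, fun m n => ?_, fun _ _ _ => Commute.all _ _,
      fun _ _ _ _ => ?_⟩⟩
  · refine if_neg ?_
    rintro rfl
    simp at hn
  · rw [hone, hone, mul_comm, gSeries_mul_neg]
    exact Exchange.of_commute fun _ _ => Commute.all _ _
  · simp
  · simp
  · simp [quadDefect]
  · simp [quadDefect]
  · simp [serreSum, serreInner]

theorem existsUnique_counit : ∃! ε : U →ₐ[Base] Base, IsCounit ε := by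
  obtain ⟨ε, hc, hphi, hx, -⟩ := isToroidal_trivial.exists_hom (c := 0) (k := 0) (e := 1)
    (fun _ _ => Commute.all _ _) (fun _ _ _ => Commute.all _ _)
    (fun κ => by rw [smul_zero]; exact IsExp.zero)
    (fun s i => by
      rw [Pi.zero_apply, Pi.zero_apply, smul_zero]
      exact IsExp.zero)
    (fun s i n => by
      have : hSeries s ((0 : Fin 2 → ℤ → Base) i) = 0 := by
        ext1 m
        simp [hSeries]
      rw [this, psExp_zero, coeff_one]
      cases s <;> simp [Sgn.val])
  refine ⟨ε, ⟨hphi, hx, hc⟩, fun ε' h => ?_⟩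
  exact U.hom_ext (h.c.trans hc.symm) (fun s i n => (h.phi s i n).trans (hphi s i n).symm)
    fun s i n => (h.x s i n).trans (hx s i n).symm

/-! ### The shift -/

instance : Module.IsTorsionFree Base ULaurent := by
  refine isTorsionFree_of_hbar fun x hx => ?_
  have hinj : Function.Injective (LinearMap.lsmul Base U hbar) := by
    intro a b hab
    exact smul_right_injective U hbar_ne_zero hab
  let l : U →ₗ[ℂ] U := (LinearMap.lsmul Base U hbar).restrictScalars ℂ
  have h := Module.Flat.rTensor_preserves_injective_linearMap (M := LaurentC) l hinj
  have hl : ∀ y : ULaurent, l.rTensor LaurentC y = hbar • y := by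
    intro y
    induction y using TensorProduct.induction_on with
    | zero => rw [map_zero, smul_zero]
    | tmul a b => rfl
    | add a b ha hb => rw [map_add, smul_add, ha, hb]
  refine h ?_
  rw [hl, hx, map_zero]

theorem ULaurent.term_mul (a b : U) (m n : ℤ) :
    ULaurent.term a m * ULaurent.term b n = ULaurent.term (a * b) (m + n) := by
  rw [term, term, term, ← Completion.of_mul, Algebra.TensorProduct.tmul_mul_tmul]
  have : LaurentC.pow m * LaurentC.pow n = LaurentC.pow (m + n) := by
    have := HahnSeries.single_mul_single (a := m) (b := n) (r := (1 : ℂ)) (s := 1)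
    rw [mul_one] at this
    exact this
  rw [this]

/-- `a ↦ a ⊗ 1`. -/
def ULaurent.const : U →ₐ[Base] Completion ULaurent :=
  (Completion.ofAlg ULaurent).comp Algebra.TensorProduct.includeLeft

theorem ULaurent.const_apply (a : U) : ULaurent.const a = ULaurent.term a 0 := rfl

theorem Completion.commute_of_dense {A : Type} [Ring A] [Algebra Base A] {a : A}
    (h : ∀ t, Commute a t) (y : Completion A) : Commute (Completion.of A a) y := by
  have : LinearMap.mulLeft Base (Completion.of A a) = LinearMap.mulRight Base (Completion.of A a) :=
    Completion.ext_dense fun t => congrArg (Completion.of A) (h t)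
  exact LinearMap.congr_fun this y

theorem ULaurent.term_one_commute (n : ℤ) (y : Completion ULaurent) :
    Commute (ULaurent.term 1 n) y := by
  refine Completion.commute_of_dense (fun t => ?_) y
  induction t using TensorProduct.induction_on with
  | zero => exact Commute.zero_right _
  | tmul a b =>
    rw [commute_iff_eq, Algebra.TensorProduct.tmul_mul_tmul, Algebra.TensorProduct.tmul_mul_tmul,
      one_mul, mul_one, mul_comm]
  | add a b ha hb => exact ha.add_right hb

theorem psScale_hSeries {R : Type} [Ring R] [Algebra Base R] (s : Sgn) (v : ℕ → R) (h : ℤ → R)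
    (w : ℤ → R)
    (hv : ∀ m : ℕ, v m = w (s.val * m)) :
    psScale v (hSeries s h) = hSeries s fun n => w n * h n := by
  ext m
  rw [psScale, hSeries, hSeries, coeff_mk, coeff_mk, coeff_mk]
  split_ifs
  · exact mul_zero _
  · rw [mul_smul_comm, hv]

theorem existsUnique_shift : ∃! S : U →ₐ[Base] Completion ULaurent, IsShift S := by
  have h0 : ULaurent.term 1 0 = 1 := rfl
  have hadd : ∀ m n, ULaurent.term 1 (m + n) = ULaurent.term 1 m * ULaurent.term 1 n := by
    intro m n
    rw [ULaurent.term_mul, one_mul]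
  have hterm : ∀ a n, ULaurent.const a * ULaurent.term 1 n = ULaurent.term a n := by
    intro a n
    rw [ULaurent.const_apply, ULaurent.term_mul, mul_one, zero_add]
  have hcc : ∀ y n, Commute (ULaurent.const U.c) (ULaurent.const y * ULaurent.term 1 n) :=
    fun y n =>
    ((U.c_commute _).map ULaurent.const).mul_right (ULaurent.term_one_commute _ _).symm
  obtain ⟨S, hc, hphi, hx, -⟩ :=
    ((U.isToroidal.map ULaurent.const).scale h0 hadd ULaurent.term_one_commute).exists_hom
      (c := ULaurent.const U.c)
      (k := fun i n => ULaurent.const (U.gen (.h i n)) * ULaurent.term 1 n)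
      (e := fun s i => ULaurent.const (U.mk (Free.qGen s.val (.h i 0))))
      (fun i n => hcc _ _)
      (fun s i n => hcc _ _)
      (fun κ => by
        have := (U.isExp_qc κ).map ULaurent.const
        rwa [map_smul] at this)
      (fun s i => by
        have := (U.isExp_qGen s.val (.h i 0)).map ULaurent.const
        rwa [h0, mul_one, ← map_smul])
      (fun s i n => by
        rw [U.phi_val_mul, map_mul, mul_assoc]
        congr 1
        have h1 := psExp_map ULaurent.const (hSeries s fun m => U.gen (.h i m))
        rw [hSeries_map] at h1
        have h2 := psExp_scale (v := fun m : ℕ => ULaurent.term 1 (s.val * m)) (by simpa using h0)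
          (fun a b => by push_cast; rw [mul_add, hadd])
          (hSeries s fun m => ULaurent.const (U.gen (.h i m)))
          (fun m y => ULaurent.term_one_commute _ _)
        rw [psScale_hSeries s _ _ (ULaurent.term 1) fun _ => rfl, h1] at h2
        simp only [(ULaurent.term_one_commute _ _).eq] at h2
        rw [h2, psScale, coeff_mk, (ULaurent.term_one_commute _ _).eq]
        rfl)
  refine ⟨S, ⟨hc, fun s i n => (hphi s i n).trans (hterm _ _),
    fun s i n => (hx s i n).trans (hterm _ _)⟩, fun S' h => ?_⟩
  exact U.hom_ext (h.c.trans hc.symm)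
    (fun s i n => (h.phi s i n).trans ((hphi s i n).trans (hterm _ _)).symm)
    fun s i n => (h.x s i n).trans ((hx s i n).trans (hterm _ _)).symm

end

section

open PowerSeries Finset

/-! ### The relations for the coproduct -/

/-- The inclusion of the constants into the Laurent series. -/
def hahnC (A : Type) [Ring A] [Algebra Base A] : A →ₐ[Base] HahnSeries ℤ A :=
  { HahnSeries.C with
    commutes' := fun r => by
      ext k
      rw [Algebra.algebraMap_eq_smul_one, Algebra.algebraMap_eq_smul_one]
      change (HahnSeries.C (r • (1 : A))).coeff k = (r • HahnSeries.C (1 : A)).coeff k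
      rw [HahnSeries.coeff_smul, HahnSeries.C_apply, HahnSeries.C_apply, HahnSeries.coeff_single,
        HahnSeries.coeff_single]
      split_ifs <;> simp }

theorem hahnC_apply {A : Type} [Ring A] [Algebra Base A] (a : A) : hahnC A a = HahnSeries.C a := rfl

theorem map_C_gg₂ (a : ℤ) (α β : ℂ) : PowerSeries.map HahnSeries.C (gg₂ a α β)
    = gScaled a fun k => HahnSeries.C (Γ := ℤ) (qq (α * k) (β * k)) :=
  map_gScaled (hahnC U2) a _

theorem C_qq_commute (α β : ℂ) (y : HahnSeries ℤ U2) : Commute (HahnSeries.C (qq α β)) y :=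
  commute_C_of_central (qq_commute α β) y

theorem phiΔ_eq_coeff (S : Sgn) (i : Fin 2) (m : ℕ) : phiΔ S i (S.val * m)
    = coeff m ((PowerSeries.mk fun a => HahnSeries.C (phiL S i (S.val * a))) *
      (PowerSeries.mk fun b => HahnSeries.single (S.val * (b : ℤ)) (phiR S i (S.val * b)))) :=
  ((phiΔ_fused S i).half_current (Sgn.val_mul_self S) (fun _ => phiL_of_neg)
    (fun _ => phiR_of_neg) m).symm

theorem phiΔ_of_neg {S : Sgn} {i : Fin 2} {n : ℤ} (h : S.val * n < 0) : phiΔ S i n = 0 := by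
  ext k
  rw [phiΔ_fused]
  rcases lt_or_ge (S.val * k) 0 with hk | hk
  · rw [phiR_of_neg hk, mul_zero, HahnSeries.coeff_zero]
  · rw [phiL_of_neg (by rw [mul_sub]; omega), zero_mul, HahnSeries.coeff_zero]

theorem commute_coeff_mul {R : Type} [Ring R] {F G : PowerSeries R} {y : R}
    (hF : ∀ n, Commute (coeff n F) y) (hG : ∀ n, Commute (coeff n G) y) (m : ℕ) :
    Commute (coeff m (F * G)) y := by
  rw [coeff_mul]
  exact Commute.sum_left _ _ _ fun p _ => (hF _).mul_left (hG _)

theorem commute_C_C {a b : U2} (h : Commute a b) :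
    Commute (HahnSeries.C (Γ := ℤ) a) (HahnSeries.C b) := h.map HahnSeries.C

theorem commute_single_single {A : Type} [Ring A] {a b : A} (h : Commute a b) (m n : ℤ) :
    Commute (HahnSeries.single m a) (HahnSeries.single n b) := by
  rw [commute_iff_eq, HahnSeries.single_mul_single, HahnSeries.single_mul_single, h.eq, add_comm]

theorem phiΔ_commute (S : Sgn) (i j : Fin 2) (m n : ℤ) : Commute (phiΔ S i m) (phiΔ S j n) := by
  rcases lt_or_ge (S.val * m) 0 with hm | hm
  · rw [phiΔ_of_neg hm]
    exact Commute.zero_left _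
  rcases lt_or_ge (S.val * n) 0 with hn | hn
  · rw [phiΔ_of_neg hn]
    exact Commute.zero_right _
  obtain ⟨a, ha⟩ := Int.eq_ofNat_of_zero_le hm
  obtain ⟨b, hb⟩ := Int.eq_ofNat_of_zero_le hn
  obtain rfl : m = S.val * a := by rw [← ha, ← mul_assoc, Sgn.val_mul_self, one_mul]
  obtain rfl : n = S.val * b := by rw [← hb, ← mul_assoc, Sgn.val_mul_self, one_mul]
  have hLR : ∀ i j m n, Commute (phiL S i m) (phiR S j n) := fun i j m n =>
    phiL_commute_inr _ _ _ _ _ _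
  rw [phiΔ_eq_coeff, phiΔ_eq_coeff]
  refine commute_coeff_mul (fun c => ?_) (fun c => ?_) a
  all_goals
    rw [coeff_mk, commute_iff_eq, eq_comm]
    refine commute_coeff_mul (fun d => ?_) (fun d => ?_) b
    all_goals rw [coeff_mk]
  · exact commute_single_single (inl_phi_commute _ _ _ _ _ _ _ _ _) _ _
  · exact commute_single_single (hLR _ _ _ _).symm _ _
  · exact commute_single_single (hLR _ _ _ _) _ _
  · exact commute_single_single (inr_phi_commute _ _ _ _ _ _ _ _ _) _ _

theorem legs_mul (a b : U) (α β γ δ : ℂ) : inl a * qq α β * (inr b * qq γ δ)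
    = inl a * inr b * qq (α + γ) (β + δ) := by
  rw [← qq_mul, mul_assoc, ← mul_assoc (qq α β), (qq_commute α β (inr b)).eq]
  simp only [mul_assoc]

theorem commutator_inl (x a b : U) (α β : ℂ) : inl x * (inl a * inr b * qq α β)
    - inl a * inr b * qq α β * inl x = inl (x * a - a * x) * inr b * qq α β := by
  rw [mul_assoc (inl a * inr b), (qq_commute α β (inl x)).eq,
    mul_assoc (inl a) (inr b) (inl x * qq α β), ← mul_assoc (inr b),
    (inl_inr_commute x b).symm.eq]
  simp only [map_sub, map_mul, sub_mul, mul_assoc]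

theorem commutator_inr (x a b : U) (α β : ℂ) : inl a * inr b * qq α β * inr x
    - inr x * (inl a * inr b * qq α β) = inl a * inr (b * x - x * b) * qq α β := by
  rw [mul_assoc (inl a * inr b), (qq_commute α β (inr x)).eq, mul_assoc (inl a) _ (qq α β),
    ← mul_assoc (inr x), ← (inl_inr_commute a x).eq]
  simp only [map_sub, map_mul, sub_mul, mul_sub, mul_assoc]

theorem inl_mul_qc (a : U) (κ : ℂ) (b : U) (α β : ℂ) :
    inl (a * U.qc κ) * inr b * qq α β = inl a * inr b * qq (κ + α) β := by
  rw [map_mul, inl_qc, mul_assoc (inl a), (qq_commute κ 0 (inr b)).eq, ← mul_assoc,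
    mul_assoc _ (qq κ 0), qq_mul, zero_add]

theorem inr_mul_qc (a : U) (κ : ℂ) (b : U) (α β : ℂ) :
    inl a * inr (b * U.qc κ) * qq α β = inl a * inr b * qq α (κ + β) := by
  rw [map_mul, inr_qc, ← mul_assoc, mul_assoc _ (qq 0 κ), qq_mul, zero_add]

theorem coeff_minusStatic (j : Fin 2) (n k : ℤ) : (minusStatic j n).coeff k
    = inl (U.x .minus j (n - k)) * inr (U.phi .plus j k) * qq 0 (-(n - k) + -1 / 2 * k) := by
  rw [minusStatic_fused, minusL, minusR, legs_mul]
  push_cast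
  rw [zero_add]

theorem coeff_plusMoving (j : Fin 2) (n k : ℤ) : (plusMoving j n).coeff k
    = inl (U.phi .minus j (n - k)) * inr (U.x .plus j k) * qq (-1 / 2 * (n - k) + -k) 0 := by
  rw [plusMoving_fused, plusL, plusR, legs_mul]
  push_cast
  rw [zero_add]

theorem coeff_phiΔ (S : Sgn) (i : Fin 2) (n k : ℤ) : (phiΔ S i n).coeff k
    = inl (U.phi S i (n - k)) * inr (U.phi S i k) * qq (S.val / 2 * k) (-S.val / 2 * (n - k)) := by
  rw [phiΔ_fused, phiL, phiR, legs_mul]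
  push_cast
  rw [zero_add, add_zero]

theorem plusStatic_minusMoving_commute (i j : Fin 2) (m n : ℤ) :
    Commute (plusStatic i m) (minusMoving j n) :=
  commute_single_single (inl_inr_commute _ _) _ _

/-- The two terms of `Δ(x_i^+)` and `Δ(x_j^-)` with half currents commute: in `φ_i^-(z) x_j^-(w)`
and `x_i^+(z) φ_j^+(w)` the same structure function arises, as `g(q ^ (c₁ - c₂) y)`. -/
theorem plusMoving_minusStatic_commute (i j : Fin 2) (m n : ℤ) :
    Commute (plusMoving i m) (minusStatic j n) := by
  have h₁ := exchange_left .minus .minus i j (1 / 2) 0 0 (-1)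
  have h₂ := exchange_right .plus .plus j i 0 (-1 / 2) (-1) 0
  have e₁ : (fun m : ℕ => inl (U.phi .minus i (Sgn.minus.val * m)) * qq (1 / 2 * m) (0 * m))
      = fun m : ℕ => plusL i (-m) := by
    funext m
    rw [plusL_eq]
    simp only [Sgn.val]
    push_cast
    congr 2 <;> ring_nf
  have e₂ : (fun m : ℕ => inr (U.phi .plus j (Sgn.plus.val * m)) * qq (0 * m) (-1 / 2 * m))
      = fun m : ℕ => minusR j m := by
    funext m
    rw [minusR_eq]
    simp only [Sgn.val]
    push_cast
    congr 2
    ring_nf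
  rw [e₁, ← minusL_eq] at h₁
  rw [e₂, ← plusR_eq] at h₂
  refine Fused.commute (G := gg₂ (cartan i j) 1 (-1)) (plusMoving_fused i) (minusStatic_fused j)
    (fun n => plusL_of_pos) (fun n => minusR_of_neg)
    (fun _ _ => (inl_inr_commute _ _).mul_mul_qq _ _ _ _)
    (fun _ _ => (inl_inr_commute _ _).mul_mul_qq _ _ _ _) (gg₂_isCentral _ _ _)
    (h₁.congr_right ?_) (h₂.congr_right ?_) m n
  · congr 1 <;> norm_num [Sgn.val]
  · congr 1 <;> norm_num [Sgn.val, cartan_comm j i]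

/-- Only `[x_i^+ ⊗ 1, x_j^- ⊗ φ_j^+]` and `[φ_i^- ⊗ x_i^+, 1 ⊗ x_j^-]` contribute; the terms
`φ_i^- ⊗ φ_i^+` of the two commutators cancel. -/
theorem xΔ_plus_minus (i j : Fin 2) (m n : ℤ) :
    (q 1 - q (-1)) • (xΔ .plus i m * xΔ .minus j n - xΔ .minus j n * xΔ .plus i m)
      = if i = j then
          phiΔ .plus i (m + n) * HahnSeries.C (qq (((m : ℂ) - n) / 2) (((m : ℂ) - n) / 2))
            - phiΔ .minus i (m + n) * HahnSeries.C (qq (((n : ℂ) - m) / 2) (((n : ℂ) - m) / 2))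
        else 0 := by
  have hsum : xΔ .plus i m * xΔ .minus j n - xΔ .minus j n * xΔ .plus i m
      = (plusStatic i m * minusStatic j n - minusStatic j n * plusStatic i m)
        + (plusMoving i m * minusMoving j n - minusMoving j n * plusMoving i m) := by
    have h1 := (plusStatic_minusMoving_commute i j m n).eq
    have h2 := (plusMoving_minusStatic_commute i j m n).eq
    simp only [xΔ, Pi.add_apply, add_mul, mul_add, h1, h2]
    abel
  rw [hsum]
  ext k
  rw [HahnSeries.coeff_smul, HahnSeries.coeff_add, HahnSeries.coeff_sub, HahnSeries.coeff_sub,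
    plusStatic, minusMoving, coeff_C_mul', coeff_mul_C', HahnSeries.coeff_mul_single,
    HahnSeries.coeff_single_mul, coeff_minusStatic, coeff_plusMoving, commutator_inl,
    commutator_inr, smul_add, ← smul_mul_assoc, ← smul_mul_assoc, ← smul_mul_assoc,
    ← mul_smul_comm, ← map_smul, ← map_smul, U.x_plus_minus, U.x_plus_minus]
  split_ifs with hij
  · subst hij
    rw [map_sub, map_sub, sub_mul, sub_mul, mul_sub, sub_mul, inl_mul_qc, inl_mul_qc, inr_mul_qc,
      inr_mul_qc, HahnSeries.coeff_sub, coeff_mul_C', coeff_mul_C', coeff_phiΔ, coeff_phiΔ,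
      mul_assoc _ (qq _ _) (qq _ _), qq_mul, mul_assoc _ (qq _ _) (qq _ _), qq_mul]
    rw [show m + (n - k) = m + n - k by ring, show m - (k - n) = m + n - k by ring,
      show k - n + n = k by ring]
    simp only [Sgn.val]
    push_cast
    rw [show ((m : ℂ) - (n - k)) / 2 + 0 = 1 / 2 * k + (m - n) / 2 by ring,
      show -((n : ℂ) - k) + -1 / 2 * k = -1 / 2 * (m + n - k) + (m - n) / 2 by ring,
      show ((n : ℂ) - k - m) / 2 + 0 = -1 / 2 * (m - (k - n)) + -(k - n) by ring,
      show ((k : ℂ) - n - n) / 2 + 0 = -1 / 2 * (m + n - k) + (m - n) / 2 by ring,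
      show (-1 : ℂ) / 2 * (m - (k - n)) + -(k - n) = -1 / 2 * k + (n - m) / 2 by ring,
      show ((n : ℂ) - (k - n)) / 2 + 0 = - -1 / 2 * (m + n - k) + (n - m) / 2 by ring]
    abel
  · rw [map_zero, map_zero, zero_mul, zero_mul, mul_zero, zero_mul, add_zero, HahnSeries.coeff_zero]

end

section

open PowerSeries Finset

theorem exchange_of_gg₂_zero {ε : ℤ} {f : ℕ → U2} {g : ℤ → U2} {a b : ℤ} {α β : ℂ}
    (h : Exchange ε f g (gg₂ a α β)) (ha : a = b) (hα : α = 0) (hβ : β = 0) :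
    Exchange ε f g (gScaled b fun _ => 1) := by
  subst ha hα hβ
  refine h.congr_right ?_
  rw [gg₂]
  simp only [zero_mul, qq_zero]

theorem quad_plusL (i j : Fin 2) :
    Quad (q (-cartan i j : ℤ)) 1 (plusL i) fun n => inl (U.x .plus j n) := by
  have h := exchange_left .minus .plus i j (1 / 2) 0 0 0
  have e : (fun m : ℕ => inl (U.phi .minus i (Sgn.minus.val * m)) * qq (1 / 2 * m) (0 * m))
      = fun m : ℕ => plusL i (-m) := by
    funext m
    rw [plusL_eq]
    simp only [Sgn.val]
    push_cast
    congr 2 <;> ring_nf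
  rw [e, ← plusA_eq] at h
  refine Exchange.quad_minus (fun n => plusL_of_pos) (exchange_of_gg₂_zero h ?_ ?_ ?_) <;>
    norm_num [Sgn.val]

theorem quad_minusR (i j : Fin 2) :
    Quad 1 (q (-cartan i j : ℤ)) (minusR i) fun n => inr (U.x .minus j n) := by
  have h := exchange_right .plus .minus i j 0 (-1 / 2) 0 0
  have e : (fun m : ℕ => inr (U.phi .plus i (Sgn.plus.val * m)) * qq (0 * m) (-1 / 2 * m))
      = fun m : ℕ => minusR i m := by
    funext m
    rw [minusR_eq]
    simp only [Sgn.val]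
    push_cast
    congr 2
    ring_nf
  rw [e, ← minusA_eq] at h
  refine Exchange.quad_plus (fun n => minusR_of_neg) (exchange_of_gg₂_zero h ?_ ?_ ?_) <;>
    norm_num [Sgn.val]

theorem quad_plusMoving (i j : Fin 2) :
    Quad (q (-cartan i j : ℤ)) 1 (plusMoving i) (plusStatic j) :=
  (quad_plusL i j).fused_left (plusMoving_fused i) fun _ _ =>
    ((inl_inr_commute _ _).symm).mul_left (qq_commute _ _ _)

theorem quad_minusStatic (i j : Fin 2) :
    Quad 1 (q (-cartan i j : ℤ)) (minusStatic i) (minusMoving j) :=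
  (quad_minusR i j).fused_right (minusStatic_fused i) fun _ _ =>
    (inl_inr_commute _ _).mul_left (qq_commute _ _ _)

theorem toroidalPair_plusStatic {i j : Fin 2} (hij : i ≠ j) :
    ToroidalPair (q 2) (plusStatic i) (plusStatic j) := by
  have := (U.toroidalPair .plus hij).map ((hahnC U2).comp inl)
  norm_num [Sgn.val] at this
  exact this

theorem toroidalPair_minusMoving {i j : Fin 2} (hij : i ≠ j) :
    ToroidalPair (q (-2)) (minusMoving i) (minusMoving j) := by
  have := ((U.toroidalPair .minus hij).map ((hahnC U2).comp inr)).scale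
    (z := fun n => HahnSeries.single n 1)
    (fun m n => by rw [HahnSeries.single_mul_single, mul_one])
    (fun n y => commute_single fun k => Commute.one_left _)
  norm_num [Sgn.val] at this
  have e : ∀ i, (fun n : ℤ => HahnSeries.single n (1 : U2) * hahnC U2 (inr (U.x .minus i n)))
      = minusMoving i := by
    intro i
    funext n
    rw [minusMoving, hahnC_apply, HahnSeries.C_apply, HahnSeries.single_mul_single, one_mul,
      add_zero]
  rwa [e, e] at this

/-- The currents `φ_i^- ⊗ x_i^+`: rescale the currents of the second tensor factor and dress them
with the commuting half currents of the first. -/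
theorem toroidalPair_plusMoving {i j : Fin 2} (hij : i ≠ j) :
    ToroidalPair (q 2) (plusMoving i) (plusMoving j) := by
  have h := ((U.toroidalPair .plus hij).map ((hahnC U2).comp inr)).scale
    (z := fun n => HahnSeries.single n (qq (-n) 0))
    (fun m n => by
      rw [HahnSeries.single_mul_single, qq_mul, add_zero]
      push_cast
      rw [neg_add])
    (fun n y => commute_single fun k => qq_commute _ _ _)
  norm_num [Sgn.val] at h
  have e : ∀ i, (fun n : ℤ => HahnSeries.single n (qq (-n) 0) * hahnC U2 (inr (U.x .plus i n)))
      = fun n : ℤ => HahnSeries.single n (plusR i n) := by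
    intro i
    funext n
    rw [plusR, hahnC_apply, HahnSeries.C_apply, HahnSeries.single_mul_single, add_zero,
      (qq_commute _ _ _).eq]
  rw [e, e] at h
  have hLL : ∀ (i j : Fin 2) (m n : ℕ), Commute (HahnSeries.C (Γ := ℤ) (plusL i (-m)))
      (HahnSeries.C (plusL j (-n))) := fun i j m n => commute_C_C
        (inl_phi_commute _ _ _ _ _ _ _ _ _)
  have hLR : ∀ (i j : Fin 2) (m : ℕ) (n : ℤ), Commute (HahnSeries.C (Γ := ℤ) (plusL i (-m)))
      (HahnSeries.single n (plusR j n)) := fun i j m n =>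
    commute_single_single ((inl_inr_commute _ _).mul_mul_qq _ _ _ _) _ _
  exact h.dressed ((plusMoving_fused i).dressed_left (K := Base) fun n => plusL_of_pos)
    ((plusMoving_fused j).dressed_left (K := Base) fun n => plusL_of_pos) (hLL i i) (hLL i j)
    (hLL j j) (hLR i i) (hLR i j) (hLR j i) (hLR j j)

/-- The currents `x_i^- ⊗ φ_i^+`: rescale the currents of the first tensor factor and dress them
with the commuting half currents of the second. -/
theorem toroidalPair_minusStatic {i j : Fin 2} (hij : i ≠ j) :
    ToroidalPair (q (-2)) (minusStatic i) (minusStatic j) := by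
  have h := ((U.toroidalPair .minus hij).map ((hahnC U2).comp inl)).scale
    (z := fun n => HahnSeries.C (qq 0 (-n)))
    (fun m n => by
      rw [← map_mul, qq_mul, add_zero]
      push_cast
      rw [neg_add])
    (fun n y => C_qq_commute _ _ _)
  rw [show (2 : ℂ) * (Sgn.minus.val : ℂ) = -2 by norm_num [Sgn.val]] at h
  simp only [AlgHom.comp_apply] at h
  have e : ∀ i, (fun n : ℤ => HahnSeries.C (Γ := ℤ) (qq 0 (-n)) * hahnC U2 (inl (U.x .minus i n)))
      = fun n : ℤ => HahnSeries.C (minusL i n) := by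
    intro i
    funext n
    rw [minusL, hahnC_apply, ← map_mul, (qq_commute _ _ _).eq]
  rw [e, e] at h
  have hRR : ∀ (i j : Fin 2) (m n : ℕ), Commute (HahnSeries.single (m : ℤ) (minusR i m))
      (HahnSeries.single (n : ℤ) (minusR j n)) := fun i j m n =>
    commute_single_single (inr_phi_commute _ _ _ _ _ _ _ _ _) _ _
  have hRL : ∀ (i j : Fin 2) (m : ℕ) (n : ℤ), Commute (HahnSeries.single (m : ℤ) (minusR i m))
      (HahnSeries.C (minusL j n)) := fun i j m n =>
    commute_single_single ((inl_inr_commute _ _).symm.mul_mul_qq _ _ _ _) _ _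
  have hLR : ∀ (i : Fin 2) (m n : ℤ), Commute (minusL i m) (minusR i n) := fun i m n =>
    (inl_inr_commute _ _).mul_mul_qq _ _ _ _
  exact h.dressed ((minusStatic_fused i).dressed_right (K := Base) (fun n => minusR_of_neg) (hLR i))
    ((minusStatic_fused j).dressed_right (K := Base) (fun n => minusR_of_neg) (hLR j)) (hRR i i)
    (hRR i j) (hRR j j) (hRL i i) (hRL i j) (hRL j i) (hRL j j)

theorem OrdGE.single {A : Type} [Ring A] (n : ℤ) (a : A) : OrdGE n (HahnSeries.single n a) :=
  fun _ hk => HahnSeries.coeff_single_of_ne hk.ne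

theorem toroidalPair_xΔ (s : Sgn) {i j : Fin 2} (hij : i ≠ j) :
    ToroidalPair (q (2 * s.val)) (xΔ s i) (xΔ s j) := by
  have hsame : cartan i i = 2 := if_pos rfl
  have hne : cartan i j = -2 := if_neg hij
  have hne' : cartan j i = -2 := if_neg hij.symm
  cases s
  · have e : q (2 * (Sgn.plus.val : ℂ)) = q 2 := by norm_num [Sgn.val]
    rw [e]
    refine ToroidalPair.add (isUnit_q 2) (e := 0) (e' := 1) (toroidalPair_plusStatic hij)
      (toroidalPair_plusMoving hij) (fun n => ?_) (fun n => ?_) (fun n => ?_) (fun n => ?_)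
      zero_ne_one ?_ ?_ ?_
    · rw [zero_mul]; exact OrdGE.single 0 _
    · rw [zero_mul]; exact OrdGE.single 0 _
    · rw [one_mul]; exact (plusMoving_fused i).ordGE_left (fun n => plusL_of_pos) n
    · rw [one_mul]; exact (plusMoving_fused j).ordGE_left (fun n => plusL_of_pos) n
    · have := (quad_plusMoving i i).smul (q 2)
      rw [hsame] at this
      push_cast at this
      rwa [q_mul_q_neg, mul_one] at this
    · have := quad_plusMoving i j
      rw [hne] at this
      norm_num at this
      exact this
    · have := quad_plusMoving j i
      rw [hne'] at this
      norm_num at this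
      exact this
  · have e : q (2 * (Sgn.minus.val : ℂ)) = q (-2) := by norm_num [Sgn.val]
    rw [e]
    refine ToroidalPair.add (isUnit_q (-2)) (e := 1) (e' := 0) (toroidalPair_minusMoving hij)
      (toroidalPair_minusStatic hij) (fun n => ?_) (fun n => ?_) (fun n => ?_) (fun n => ?_)
      one_ne_zero ?_ ?_ ?_
    · rw [one_mul]; exact OrdGE.single _ _
    · rw [one_mul]; exact OrdGE.single _ _
    · rw [zero_mul]; exact (minusStatic_fused i).ordGE_right (fun n => minusR_of_neg) n
    · rw [zero_mul]; exact (minusStatic_fused j).ordGE_right (fun n => minusR_of_neg) n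
    · have := quad_minusStatic i i
      rw [hsame] at this
      push_cast at this
      exact this
    · have := (quad_minusStatic i j).smul (q (-2))
      rw [hne] at this
      norm_num at this
      rwa [mul_comm, q_mul_q_neg] at this
    · have := (quad_minusStatic j i).smul (q (-2))
      rw [hne'] at this
      norm_num at this
      rwa [mul_comm, q_mul_q_neg] at this

/-- The currents of the coproduct satisfy the defining relations. -/
theorem isToroidal_coproduct : IsToroidal (fun κ => HahnSeries.C (Γ := ℤ) (qq κ κ)) phiΔ xΔ where
  qc_add κ κ' := by rw [← map_mul, qq_mul]
  qc_phi _ _ _ _ := C_qq_commute _ _ _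
  qc_x _ _ _ _ := C_qq_commute _ _ _
  phi_of_neg := phiΔ_of_neg
  phi_phi := phiΔ_commute
  phi_plus_minus i j := (exchange_phi_phi i j).congr_right (by
    rw [map_mul, map_C_gg₂, map_C_gg₂]
    simp only [one_mul, neg_mul])
  phi_x S s i j := by
    cases s
    · refine (exchange_phi_plus S i j).congr_right ?_
      rw [map_C_gg₂]
      norm_num [Sgn.val]
    · refine (exchange_phi_minus S i j).congr_right ?_
      rw [map_C_gg₂]
      norm_num [Sgn.val]
  x_plus_minus := xΔ_plus_minus
  pair s _ _ hij := toroidalPair_xΔ s hij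

end

section

open PowerSeries Finset

/-! ### The coproduct -/

/-- `Δ(h_{i,n})`. -/
def hΔ (i : Fin 2) (n : ℤ) : HahnSeries ℤ U2 :=
  HahnSeries.C (inl (U.gen (.h i n)) * qq 0 (-(n.natAbs : ℂ) / 2))
    + HahnSeries.single n (inr (U.gen (.h i n)) * qq ((n.natAbs : ℂ) / 2) 0)

/-- The half currents `Δ(φ_i^±(z))` are the exponentials of the series with the coefficients
`Δ(h_{i,n})`: the two summands of `Δ(h_{i,n})` give the two tensor factors. -/
theorem phiΔ_eq_exp (s : Sgn) (i : Fin 2) (n : ℕ) : phiΔ s i (s.val * n)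
    = HahnSeries.C (inl (U.mk (Free.qGen s.val (.h i 0))) * inr (U.mk (Free.qGen s.val (.h i 0))))
      * coeff n (psExp (hSeries s (hΔ i))) := by
  set e := U.mk (Free.qGen s.val (.h i 0))
  set X : PowerSeries U := hSeries s fun l => U.gen (.h i l)
  let wl : ℕ → HahnSeries ℤ U2 := fun m => HahnSeries.C (qq 0 (-1 / 2 * m))
  let wr : ℕ → HahnSeries ℤ U2 := fun m => HahnSeries.single (s.val * m) (qq (1 / 2 * m) 0)
  have hsplit : hSeries s (hΔ i)
      = psScale wl (PowerSeries.map ((hahnC U2).comp inl).toRingHom X)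
        + psScale wr (PowerSeries.map ((hahnC U2).comp inr).toRingHom X) := by
    rw [hSeries_map, hSeries_map]
    ext1 m
    rw [map_add, psScale, psScale, coeff_mk, coeff_mk]
    simp only [hSeries, coeff_mk]
    split_ifs
    · rw [mul_zero, mul_zero, add_zero]
    · rw [mul_smul_comm, mul_smul_comm]
      refine Eq.trans ?_ (smul_add _ _ _)
      rw [hΔ, Sgn.natAbs_val_mul]
      congr 2
      · change _ = HahnSeries.C _ * HahnSeries.C (inl (U.gen (.h i (s.val * m))))
        rw [← map_mul, ← (qq_commute _ _ _).eq]
        congr 3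
        ring
      · change _ = HahnSeries.single _ _ * HahnSeries.C (inr (U.gen (.h i (s.val * m))))
        rw [HahnSeries.C_apply, HahnSeries.single_mul_single, ← (qq_commute _ _ _).eq, add_zero]
        congr 3
        ring
  have hwl : ∀ m y, Commute (wl m) y := fun m y => C_qq_commute _ _ _
  have hwr : ∀ m y, Commute (wr m) y := fun m y => commute_single fun k => qq_commute _ _ _
  have hcomm : Commute (psScale wl (PowerSeries.map ((hahnC U2).comp inl).toRingHom X))
      (psScale wr (PowerSeries.map ((hahnC U2).comp inr).toRingHom X)) := by
    ext1 m
    rw [coeff_mul, coeff_mul, ← sum_antidiagonal_swap m fun a b =>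
      coeff a (psScale wr _) * coeff b (psScale wl _)]
    refine Finset.sum_congr rfl fun p _ => ?_
    simp only [psScale, coeff_mk, coeff_map]
    refine Commute.eq ?_
    exact ((hwl _ _).mul_left ((hwr _ _).symm.mul_right
      ((inl_inr_commute (coeff p.1 X) (coeff p.2 X)).map (hahnC U2))))
  have hX : coeff 0 X = 0 := hSeries_coeff_zero _ _
  have h0 : ∀ (w : ℕ → HahnSeries ℤ U2) (F : U →ₐ[Base] HahnSeries ℤ U2),
      coeff 0 (psScale w (PowerSeries.map F.toRingHom X)) = 0 := by
    intro w F
    rw [psScale, coeff_mk, coeff_map, hX, map_zero, mul_zero]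
  rw [hsplit, psExp_add hcomm (h0 _ _) (h0 _ _),
    psExp_scale (by simp [wl, qq_zero]) (fun a b => ?_) _ hwl,
    psExp_scale (by simp [wr, qq_zero]) (fun a b => ?_) _ hwr, psExp_map, psExp_map,
    phiΔ_eq_coeff, coeff_mul, coeff_mul, Finset.mul_sum]
  · refine Finset.sum_congr rfl fun p _ => ?_
    simp only [psScale, coeff_mk, coeff_map]
    change _ = HahnSeries.C (inl e * inr e) * (HahnSeries.C (qq 0 (-1 / 2 * p.1)) *
      HahnSeries.C (inl (coeff p.1 (psExp X))) * (HahnSeries.single _ (qq (1 / 2 * p.2) 0) *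
        HahnSeries.C (inr (coeff p.2 (psExp X)))))
    rw [phiL_val_mul, phiR_val_mul, U.phi_val_mul, U.phi_val_mul, ← map_mul, HahnSeries.C_apply,
      HahnSeries.C_apply, HahnSeries.C_apply, HahnSeries.C_apply, HahnSeries.single_mul_single,
      HahnSeries.single_mul_single, HahnSeries.single_mul_single, HahnSeries.single_mul_single,
      zero_mul, zero_mul, add_zero, zero_add, zero_add]
    congr 1
    rw [(qq_commute _ _ (inl (coeff p.1 (psExp X)))).eq,
      (qq_commute _ _ (inr (coeff p.2 (psExp X)))).eq, legs_mul, legs_mul, ← mul_assoc]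
    congr 1
    rw [inl_mul_inr, inl_mul_inr, inl_mul_inr, Algebra.TensorProduct.tmul_mul_tmul]
  · simp only [wr]
    rw [HahnSeries.single_mul_single, qq_mul]
    push_cast
    rw [mul_add, mul_add, add_zero]
  · simp only [wl]
    rw [← map_mul, qq_mul]
    push_cast
    congr 2 <;> ring

/-- The values of the coproduct on the generators and on the currents, as Laurent series whose
coefficients lie in `𝒰 ⊗ 𝒰` before completion. -/
structure IsHahnCoproduct (Δ : U →ₐ[Base] Laurent ℤ U2) : Prop where
  c : Δ U.c = Completion.of _ (HahnSeries.C (inl U.c + inr U.c))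
  phi : ∀ s i n, Δ (U.phi s i n) = Completion.of _ (phiΔ s i n)
  x : ∀ s i n, Δ (U.x s i n) = Completion.of _ (xΔ s i n)
  h : ∀ i n, Δ (U.gen (.h i n)) = Completion.of _ (hΔ i n)

theorem isExp_C_qGen (κ : ℂ) (g : Gen) : IsExp ((PowerSeries.C κ : Base) •
    HahnSeries.C (Γ := ℤ) (inl (U.gen g) + inr (U.gen g)))
    (HahnSeries.C (inl (U.mk (Free.qGen κ g)) * inr (U.mk (Free.qGen κ g)))) := by
  have h := (((U.isExp_qGen κ g).map inl).add
    ((inl_inr_commute _ _)) ((U.isExp_qGen κ g).map inr)).map (hahnC U2)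
  rwa [map_smul, map_smul, ← smul_add, map_smul] at h

theorem exists_coproduct : ∃ Δ : U →ₐ[Base] Laurent ℤ U2, IsCoproduct Δ ∧ IsHahnCoproduct Δ := by
  let O := Completion.ofAlg (HahnSeries ℤ U2)
  let cΔ : HahnSeries ℤ U2 := HahnSeries.C (inl U.c + inr U.c)
  have hcc : ∀ y, Commute cΔ y := commute_C_of_central fun y =>
    commute_of_legs
      (fun a => ((U.c_commute a).map inl).add_left (inl_inr_commute a U.c).symm)
      (fun a => (inl_inr_commute U.c a).add_left ((U.c_commute a).map inr)) y
  obtain ⟨Δ, hc, hphi, hx, hh⟩ := (isToroidal_coproduct.map O).exists_hom (c := O cΔ)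
    (k := fun i n => O (hΔ i n))
    (e := fun s i => O (HahnSeries.C
      (inl (U.mk (Free.qGen s.val (.h i 0))) * inr (U.mk (Free.qGen s.val (.h i 0))))))
    (fun _ _ => (hcc _).map O) (fun _ _ _ => (hcc _).map O)
    (fun κ => by
      have := (isExp_C_qGen κ .c).map O
      rwa [map_smul] at this)
    (fun s i => by
      have := (isExp_C_qGen s.val (.h i 0)).map O
      rw [map_smul] at this
      convert this using 3
      rw [hΔ, ← HahnSeries.C_apply]
      simp [qq_zero])
    (fun s i n => by
      have := psExp_map O (hSeries s (hΔ i))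
      rw [hSeries_map] at this
      rw [this, coeff_map, phiΔ_eq_exp]
      exact map_mul O _ _)
  have hΔ : IsCoproduct Δ := by
    refine ⟨fun k => ?_, fun s i n k => ?_, fun i n k => ?_, fun i n k => ?_⟩
    · rw [hc]
      change Completion.of U2 ((HahnSeries.single (0 : ℤ) (inl U.c + inr U.c)).coeff k) = _
      rw [HahnSeries.coeff_single]
      split_ifs
      · rw [map_add]
        rfl
      · exact map_zero _
    · rw [hphi]
      change Completion.of U2 ((phiΔ s i n).coeff k) = _
      rw [coeff_phiΔ, tens, ← inl_mul_inr, map_mul inl, map_mul inr, inl_qc, inr_qc, legs_mul,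
        zero_add,
        add_zero]
      congr 3 <;> ring
    · rw [hx]
      change Completion.of U2 ((plusStatic i n).coeff k + (plusMoving i n).coeff k) = _
      rw [coeff_plusMoving, map_add, tens, tens, ← inl_mul_inr _ (U.x _ _ _), map_mul inl, inl_qc,
        plusStatic,
        HahnSeries.C_apply, HahnSeries.coeff_single]
      congr 1
      · split_ifs
        · rfl
        · exact map_zero _
      · rw [mul_assoc (inl _) (qq _ _), (qq_commute _ _ _).eq, ← mul_assoc]
        congr 3
        ring
    · rw [hx]
      change Completion.of U2 ((minusMoving i n).coeff k + (minusStatic i n).coeff k) = _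
      rw [coeff_minusStatic, map_add, tens, tens, ← inl_mul_inr _ (_ * _), map_mul inr, inr_qc,
        minusMoving, HahnSeries.coeff_single, ← mul_assoc]
      congr 1
      · split_ifs
        · rfl
        · exact map_zero _
      · congr 3
        ring
  exact ⟨Δ, hΔ, hc, hphi, hx, hh⟩

theorem IsCoproduct.unique {Δ Δ' : U →ₐ[Base] Laurent ℤ U2} (h : IsCoproduct Δ)
    (h' : IsCoproduct Δ') : Δ = Δ' := by
  refine U.hom_ext (Laurent.ext_coeff fun k => ?_) (fun s i n => Laurent.ext_coeff fun k => ?_)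
    (fun s i n => Laurent.ext_coeff fun k => ?_)
  · rw [h.c, h'.c]
  · rw [h.phi, h'.phi]
  · cases s
    · rw [h.x_plus, h'.x_plus]
    · rw [h.x_minus, h'.x_minus]

theorem IsCoproduct.isHahnCoproduct {Δ : U →ₐ[Base] Laurent ℤ U2} (h : IsCoproduct Δ) :
    IsHahnCoproduct Δ := by
  obtain ⟨Δ', h', hΔ'⟩ := exists_coproduct
  exact h.unique h' ▸ hΔ'

theorem existsUnique_coproduct : ∃! Δ : U →ₐ[Base] Laurent ℤ U2, IsCoproduct Δ :=
  let ⟨Δ, h, _⟩ := exists_coproduct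
  ⟨Δ, h, fun _ h' => h'.unique h⟩

theorem IsHahnCoproduct.qc {Δ : U →ₐ[Base] Laurent ℤ U2} (h : IsHahnCoproduct Δ) (κ : ℂ) :
    Δ (U.qc κ) = Completion.of _ (HahnSeries.C (qq κ κ)) := by
  have h₁ := (U.isExp_qc κ).map Δ
  have h₂ := (isExp_C_qGen κ .c).map (Completion.ofAlg (HahnSeries ℤ U2))
  rw [map_smul] at h₁ h₂
  rw [h.c] at h₁
  exact h₁.unique h₂

end

/-! ### Iterated Laurent series -/

section Curry

variable {A : Type} [Ring A]

/-- The exponents of the two successive variables of an iterated Laurent series, as functions of the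
exponents of `u` and `v`. -/
structure ExponentChange where
  /-- The change of exponents. -/
  equiv : ℤ × ℤ ≃+ ℤ × ℤ
  monotone_fst : Monotone fun p => (equiv p).1
  monotone_snd : ∀ p r, (equiv p).1 = (equiv r).1 → p ≤ r → (equiv p).2 ≤ (equiv r).2

variable (e : ExponentChange)

/-- A Laurent series in two variables as an iterated Laurent series. -/
def curry (x : HahnSeries (ℤ × ℤ) A) : HahnSeries ℤ (HahnSeries ℤ A) where
  coeff a :=
    { coeff := fun b => x.coeff (e.equiv.symm (a, b))
      isPWO_support' := by
        refine ((x.isPWO_support.mono (Set.inter_subset_left (t := {p | (e.equiv p).1 = a}))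
          ).image_of_monotoneOn (f := fun p => (e.equiv p).2)
          fun p hp r hr hpr => e.monotone_snd p r (hp.2.trans hr.2.symm) hpr).mono fun b hb => ?_
        exact ⟨e.equiv.symm (a, b), ⟨hb, by simp⟩, by simp⟩ }
  isPWO_support' := by
    refine (x.isPWO_support.image_of_monotone e.monotone_fst).mono fun a ha => ?_
    obtain ⟨b, hb⟩ : ∃ b, x.coeff (e.equiv.symm (a, b)) ≠ 0 := by
      by_contra! h
      exact ha (HahnSeries.ext (funext h))
    exact ⟨e.equiv.symm (a, b), hb, by simp⟩

theorem coeff_curry (x : HahnSeries (ℤ × ℤ) A) (a b : ℤ) :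
    ((curry e x).coeff a).coeff b = x.coeff (e.equiv.symm (a, b)) := rfl

theorem curry_mul (x y : HahnSeries (ℤ × ℤ) A) : curry e (x * y) = curry e x * curry e y := by
  ext a b
  rw [coeff_curry, HahnSeries.coeff_mul, HahnSeries.coeff_mul, HahnSeries.coeff_sum]
  simp only [HahnSeries.coeff_mul]
  rw [Finset.sum_sigma']
  refine Finset.sum_bij_ne_zero (fun p _ _ => ⟨((e.equiv p.1).1, (e.equiv p.2).1),
    ((e.equiv p.1).2, (e.equiv p.2).2)⟩) ?_ ?_ ?_ ?_
  · rintro ⟨p, r⟩ hp hne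
    have hsum := congrArg e.equiv (Finset.mem_antidiagonal.1 hp).2.2
    rw [map_add, AddEquiv.apply_symm_apply] at hsum
    have hx : ((curry e x).coeff (e.equiv p).1).coeff (e.equiv p).2 ≠ 0 := by
      rw [coeff_curry, Prod.mk.eta, AddEquiv.symm_apply_apply]
      exact left_ne_zero_of_mul hne
    have hy : ((curry e y).coeff (e.equiv r).1).coeff (e.equiv r).2 ≠ 0 := by
      rw [coeff_curry, Prod.mk.eta, AddEquiv.symm_apply_apply]
      exact right_ne_zero_of_mul hne
    refine Finset.mem_sigma.2 ⟨Finset.mem_antidiagonal.2 ⟨?_, ?_, congrArg Prod.fst hsum⟩,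
      Finset.mem_antidiagonal.2 ⟨hx, hy, congrArg Prod.snd hsum⟩⟩
    · exact fun h => hx (by rw [h, HahnSeries.coeff_zero])
    · exact fun h => hy (by rw [h, HahnSeries.coeff_zero])
  · rintro ⟨p, r⟩ _ _ ⟨p', r'⟩ _ _ h
    simp only [Sigma.mk.injEq, Prod.mk.injEq, heq_eq_eq] at h
    obtain ⟨⟨h1, h2⟩, h3, h4⟩ := h
    exact Prod.ext (e.equiv.injective (Prod.ext h1 h3)) (e.equiv.injective (Prod.ext h2 h4))
  · rintro ⟨⟨a₁, a₂⟩, ⟨b₁, b₂⟩⟩ hp hne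
    obtain ⟨h1, h2⟩ := Finset.mem_sigma.1 hp
    have h1 := (Finset.mem_antidiagonal.1 h1).2.2
    have h2 := (Finset.mem_antidiagonal.1 h2).2.2
    refine ⟨(e.equiv.symm (a₁, b₁), e.equiv.symm (a₂, b₂)), Finset.mem_antidiagonal.2
      ⟨left_ne_zero_of_mul hne, right_ne_zero_of_mul hne, ?_⟩, hne, by simp⟩
    rw [← map_add]
    exact congrArg _ (Prod.ext h1 h2)
  · rintro ⟨p, r⟩ _ _
    simp only [coeff_curry, Prod.mk.eta, AddEquiv.symm_apply_apply]

theorem curry_one : curry e (1 : HahnSeries (ℤ × ℤ) A) = 1 := by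
  ext a b
  rw [coeff_curry, HahnSeries.coeff_one, HahnSeries.coeff_one]
  by_cases ha : a = 0
  · subst ha
    rw [if_pos rfl, HahnSeries.coeff_one]
    by_cases hb : b = 0
    · subst hb
      rw [if_pos rfl, if_pos]
      exact map_zero e.equiv.symm
    · rw [if_neg hb, if_neg]
      intro h
      have := congrArg e.equiv h
      rw [AddEquiv.apply_symm_apply, map_zero] at this
      exact hb (congrArg Prod.snd this)
  · rw [if_neg ha, if_neg, HahnSeries.coeff_zero]
    intro h
    have := congrArg e.equiv h
    rw [AddEquiv.apply_symm_apply, map_zero] at this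
    exact ha (congrArg Prod.fst this)

variable [Algebra Base A]

/-- A Laurent series in two variables as an iterated Laurent series, as a homomorphism. -/
def curryAlg : HahnSeries (ℤ × ℤ) A →ₐ[Base] HahnSeries ℤ (HahnSeries ℤ A) :=
  AlgHom.ofLinearMap
    { toFun := curry e
      map_add' := fun _ _ => rfl
      map_smul' := fun _ _ => rfl }
    (curry_one e) (curry_mul e)

/-- The completion of `curryAlg`. -/
def laurentCurry : Laurent (ℤ × ℤ) A →ₐ[Base] Laurent ℤ (Laurent ℤ A) :=
  Completion.mapAlg ((hahnMap ℤ (Completion.ofAlg (HahnSeries ℤ A))).comp (curryAlg e))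

theorem Completion.eq_of_dense {A B N : Type} [Ring A] [Algebra Base A] [Ring B] [Algebra Base B]
    [AddCommGroup N] [Module Base N] (F : Completion A →ₐ[Base] Completion B)
    (l : Completion B →ₗ[Base] Completion N) (l' : Completion A →ₗ[Base] Completion N)
    (h : ∀ x, l (F (Completion.of A x)) = l' (Completion.of A x)) (y : Completion A) :
    l (F y) = l' y := by
  have : l ∘ₗ F.toLinearMap = l' := Completion.ext_dense h
  exact LinearMap.congr_fun this y

/-- The extension of a linear map from an algebra to the completion. -/
def Completion.extendRing {B N : Type} [Ring B] [Algebra Base B]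
    [AddCommGroup N] [Module Base N] (f : B →ₗ[Base] Completion N) :
    Completion B →ₗ[Base] Completion N :=
  Completion.extend f

/-- The coefficients of an element of the completion of the algebra of Laurent series. -/
def completionCoeff (b : ℤ) : Completion (Laurent ℤ A) →ₗ[Base] Completion A :=
  Completion.extendRing (B := Laurent ℤ A) (N := A) (Laurent.coeff (A := A) b)

/-- The coefficients of an iterated Laurent series. -/
def iteratedCoeff (a b : ℤ) (y : Laurent ℤ (Laurent ℤ A)) : Completion A :=
  completionCoeff b (Laurent.coeff (A := Laurent ℤ A) a y)

theorem iteratedCoeff_laurentCurry (a b : ℤ) (y : Laurent (ℤ × ℤ) A) :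
    iteratedCoeff a b (laurentCurry e y) = Laurent.coeff (e.equiv.symm (a, b)) y :=
  Completion.eq_of_dense (A := HahnSeries (ℤ × ℤ) A) (B := HahnSeries ℤ (Laurent ℤ A))
    (N := A) (laurentCurry e) ((completionCoeff b).comp (Laurent.coeff (A := Laurent ℤ A) a))
    (Laurent.coeff (e.equiv.symm (a, b)) (A := A)) (fun _ => rfl) y

theorem iteratedCoeff_ext {y z : Laurent ℤ (Laurent ℤ A)}
    (h : ∀ a b, iteratedCoeff a b y = iteratedCoeff a b z) : y = z := by
  refine Laurent.ext_coeff fun a => ?_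
  obtain ⟨y', hy⟩ := (completionEquiv (Laurent ℤ A)).surjective (Laurent.coeff a y)
  obtain ⟨z', hz⟩ := (completionEquiv (Laurent ℤ A)).surjective (Laurent.coeff a z)
  rw [← hy, ← hz]
  congr 1
  refine Laurent.ext_coeff fun b => ?_
  have := h a b
  rw [iteratedCoeff, iteratedCoeff, ← hy, ← hz] at this
  exact this

theorem laurentCurry_injective : Function.Injective (laurentCurry (A := A) e) := by
  intro y z h
  refine Laurent.ext_coeff fun p => ?_
  have := congrArg (iteratedCoeff (e.equiv p).1 (e.equiv p).2) h
  rwa [iteratedCoeff_laurentCurry, iteratedCoeff_laurentCurry, Prod.mk.eta,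
    AddEquiv.symm_apply_apply] at this

/-- The coefficient of `u ^ m v ^ n` in a series in `u` with coefficients in the series in `v`. -/
def ExponentChange.refl : ExponentChange where
  equiv := AddEquiv.refl _
  monotone_fst := fun _ _ h => h.1
  monotone_snd := fun _ _ _ h => h.2

/-- The coefficient of `(u v) ^ n u ^ (m - n)` in a series in `u v` with coefficients in the series
in `u`. -/
def ExponentChange.twist : ExponentChange where
  equiv :=
    { toFun := fun p => (p.2, p.1 - p.2)
      invFun := fun p => (p.1 + p.2, p.1)
      left_inv := fun p => by simp
      right_inv := fun p => by simp
      map_add' := fun p r => Prod.ext rfl (by simp; ring) }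
  monotone_fst := fun _ _ h => h.2
  monotone_snd := fun p r h hpr => by
    have h : p.2 = r.2 := h
    change p.1 - p.2 ≤ r.1 - r.2
    have := hpr.1
    omega

/-- The series in two variables with given coefficients, which vanish unless the exponents are large
enough. -/
def hahnOfBddBelow (f : ℤ → ℤ → A) (N : ℤ) (h : ∀ m n, m < N ∨ n < N → f m n = 0) :
    HahnSeries (ℤ × ℤ) A where
  coeff p := f p.1 p.2
  isPWO_support' := by
    have hI : ∀ c : ℤ, (Set.Ici c).IsPWO := fun c => by
      have := (BddBelow.isWF (s := Set.Ici c) bddBelow_Ici).isPWO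
      exact this
    exact ((hI N).prod (hI N)).mono fun p hp => by
      by_contra hN
      refine hp (h _ _ ?_)
      rw [Set.mem_prod, Set.mem_Ici, Set.mem_Ici] at hN
      omega

/-- An iterated Laurent series whose coefficients are bounded below in both exponents, uniformly,
is a Laurent series in two variables. -/
theorem exists_laurentCurry_refl {y : Laurent ℤ (Laurent ℤ A)} (f : ℤ → ℤ → A) (N : ℤ)
    (h : ∀ m n, m < N ∨ n < N → f m n = 0)
    (hf : ∀ m n, iteratedCoeff m n y = Completion.of A (f m n)) :
    ∃ t, laurentCurry .refl t = y :=
  ⟨Completion.of _ (hahnOfBddBelow f N h), iteratedCoeff_ext fun m n => by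
    rw [iteratedCoeff_laurentCurry, hf]
    rfl⟩

end Curry

/-! ### Coassociativity -/

theorem coeff_of_mul_C {A : Type} [Ring A] [Algebra Base A] (n : ℤ) (D : HahnSeries ℤ A) (t : A) :
    Laurent.coeff n (Completion.of _ D * Completion.of _ (HahnSeries.C t))
      = Completion.of A (D.coeff n * t) := by
  rw [← Completion.of_mul, Laurent.coeff_of, coeff_mul_C']

section Legs

variable {Δ : U →ₐ[Base] Laurent ℤ U2}

theorem legs_eq_tmul (a b : U) (α β : ℂ) :
    inl a * inr b * qq α β = (a * U.qc α) ⊗ₜ[Base] (b * U.qc β) := by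
  rw [inl_mul_inr, qq_eq, Algebra.TensorProduct.tmul_mul_tmul]

theorem idTensor_of_tmul (D : U →ₗ[Base] Completion U2) (a b : U) :
    idTensor D (Completion.of _ (a ⊗ₜ[Base] b))
      = Completion.map (TensorProduct.mk Base U U2 a) (D b) := rfl

theorem tensorId_of_tmul (D : U →ₗ[Base] Completion U2) (a b : U) :
    tensorId D (Completion.of _ (a ⊗ₜ[Base] b))
      = Completion.map ((TensorProduct.assoc Base U U U).toLinearMap
          ∘ₗ (TensorProduct.comm Base U U2).toLinearMap)
        (Completion.map (TensorProduct.mk Base U U2 b) (D a)) := rfl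

theorem IsHahnCoproduct.idTensor_legs (hΔ : IsHahnCoproduct Δ) {b : U} {D : HahnSeries ℤ U2}
    (hb : Δ b = Completion.of _ D) (a : U) (α β : ℂ) (n : ℤ) :
    idTensor (deltaCoeff Δ n) (Completion.of _ (inl a * inr b * qq α β))
      = Completion.of U3 ((a * U.qc α) ⊗ₜ[Base] (D.coeff n * qq β β)) := by
  rw [legs_eq_tmul, idTensor_of_tmul]
  have : deltaCoeff Δ n (b * U.qc β) = Completion.of U2 (D.coeff n * qq β β) := by
    change Laurent.coeff n (Δ (b * U.qc β)) = _
    rw [map_mul, hb, hΔ.qc, coeff_of_mul_C]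
  rw [this, Completion.map_of]
  rfl

theorem IsHahnCoproduct.tensorId_legs (hΔ : IsHahnCoproduct Δ) {a : U} {D : HahnSeries ℤ U2}
    (ha : Δ a = Completion.of _ D) (b : U) (α β : ℂ) (n : ℤ) :
    tensorId (deltaCoeff Δ n) (Completion.of _ (inl a * inr b * qq α β))
      = Completion.of U3 (TensorProduct.assoc Base U U U
          ((D.coeff n * qq α α) ⊗ₜ[Base] (b * U.qc β))) := by
  rw [legs_eq_tmul, tensorId_of_tmul]
  have : deltaCoeff Δ n (a * U.qc α) = Completion.of U2 (D.coeff n * qq α α) := by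
    change Laurent.coeff n (Δ (a * U.qc α)) = _
    rw [map_mul, ha, hΔ.qc, coeff_of_mul_C]
  rw [this, Completion.map_of, Completion.map_of]
  rfl

end Legs

section Constants

variable {A B : Type} [Ring A] [Algebra Base A] [Ring B] [Algebra Base B]

theorem Completion.map_of_mul {N : Type} [Ring N] [Algebra Base N]
    (l : Completion A →ₗ[Base] Completion N) (a : A) (b : N)
    (h : ∀ y, l (Completion.of A (a * y)) = Completion.of N b * l (Completion.of A y))
    (y : Completion A) : l (Completion.of A a * y) = Completion.of N b * l y := by
  have : l ∘ₗ LinearMap.mulLeft Base (Completion.of A a)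
      = LinearMap.mulLeft Base (Completion.of N b) ∘ₗ l := Completion.ext_dense h
  exact LinearMap.congr_fun this y

theorem Completion.map_mul_of' {N : Type} [Ring N] [Algebra Base N]
    (l : Completion A →ₗ[Base] Completion N) (a : A) (b : N)
    (h : ∀ y, l (Completion.of A (y * a)) = l (Completion.of A y) * Completion.of N b)
    (y : Completion A) : l (y * Completion.of A a) = l y * Completion.of N b := by
  have : l ∘ₗ LinearMap.mulRight Base (Completion.of A a)
      = LinearMap.mulRight Base (Completion.of N b) ∘ₗ l := Completion.ext_dense h
  exact LinearMap.congr_fun this y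

theorem Laurent.coeff_C_mul (n : ℤ) (b : B) (y : Laurent ℤ B) :
    Laurent.coeff n (Completion.of _ (HahnSeries.C b) * y)
      = Completion.of B b * Laurent.coeff n y :=
  Completion.map_of_mul (A := HahnSeries ℤ B) (Laurent.coeff n) (HahnSeries.C b) b
    (fun y => congrArg (Completion.of B) (coeff_C_mul' b y n)) y

theorem Laurent.coeff_mul_C (n : ℤ) (b : B) (y : Laurent ℤ B) :
    Laurent.coeff n (y * Completion.of _ (HahnSeries.C b))
      = Laurent.coeff n y * Completion.of B b :=
  Completion.map_mul_of' (A := HahnSeries ℤ B) (Laurent.coeff n) (HahnSeries.C b) b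
    (fun y => congrArg (Completion.of B) (coeff_mul_C' b y n)) y

theorem commute_laurentMap (f : A →ₐ[Base] B) {b : B} (h : ∀ t, Commute b (f t))
    (y : Laurent ℤ A) : Commute (Completion.of _ (HahnSeries.C b)) (laurentMap ℤ f y) := by
  have h' : ∀ z, Completion.of B b * Completion.map f.toLinearMap z
      = Completion.map f.toLinearMap z * Completion.of B b := fun z => by
    have : LinearMap.mulLeft Base (Completion.of B b) ∘ₗ Completion.map f.toLinearMap
        = LinearMap.mulRight Base (Completion.of B b) ∘ₗ Completion.map f.toLinearMap :=
      Completion.ext_dense fun y => congrArg (Completion.of B) (h y)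
    exact LinearMap.congr_fun this z
  refine Laurent.ext_coeff fun n => ?_
  rw [Laurent.coeff_C_mul, Laurent.coeff_mul_C, laurentMap_coeff, h']

theorem Completion.mul_map (f : A →ₗ[Base] B) (g : A →ₗ[Base] B) (b : B)
    (h : ∀ t, b * f t = g t) (z : Completion A) :
    Completion.of B b * Completion.map f z = Completion.map g z := by
  have : LinearMap.mulLeft Base (Completion.of B b) ∘ₗ Completion.map f = Completion.map g :=
    Completion.ext_dense fun y => congrArg (Completion.of B) (h y)
  exact LinearMap.congr_fun this z

theorem Completion.map_mul_of (f : A →ₗ[Base] B) (g : A →ₗ[Base] B) (b : B)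
    (h : ∀ t, f t * b = g t) (z : Completion A) :
    Completion.map f z * Completion.of B b = Completion.map g z := by
  have : LinearMap.mulRight Base (Completion.of B b) ∘ₗ Completion.map f = Completion.map g :=
    Completion.ext_dense fun y => congrArg (Completion.of B) (h y)
  exact LinearMap.congr_fun this z

theorem Completion.map_map {M N P : Type} [AddCommGroup M] [Module Base M] [AddCommGroup N]
    [Module Base N] [AddCommGroup P] [Module Base P] (f : M →ₗ[Base] N) (g : N →ₗ[Base] P)
    (z : Completion M) : Completion.map g (Completion.map f z) = Completion.map (g ∘ₗ f) z := by
  have : Completion.map g ∘ₗ Completion.map f = Completion.map (g ∘ₗ f) :=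
    Completion.ext_dense fun y => rfl
  exact LinearMap.congr_fun this z

end Constants

/-- The inclusion of the first two tensor factors. -/
def incl₁₂ : U2 →ₐ[Base] U3 :=
  Algebra.TensorProduct.map (AlgHom.id Base U) Algebra.TensorProduct.includeLeft

/-- The inclusion of the last two tensor factors. -/
def incl₂₃ : U2 →ₐ[Base] U3 := Algebra.TensorProduct.includeRight

/-- The inclusion of the first tensor factor. -/
def incl₁ : U →ₐ[Base] U3 := Algebra.TensorProduct.includeLeft

/-- The inclusion of the last tensor factor. -/
def incl₃ : U →ₐ[Base] U3 := incl₂₃.comp inr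

theorem incl₁_mul_incl₂₃ (a : U) (t : U2) : incl₁ a * incl₂₃ t = a ⊗ₜ[Base] t := by
  change (a ⊗ₜ[Base] (1 : U2)) * ((1 : U) ⊗ₜ[Base] t) = _
  rw [Algebra.TensorProduct.tmul_mul_tmul, mul_one, one_mul]

theorem incl₁_commute (a : U) (t : U2) : Commute (incl₁ a) (incl₂₃ t) := by
  rw [commute_iff_eq, incl₁_mul_incl₂₃]
  change _ = ((1 : U) ⊗ₜ[Base] t) * (a ⊗ₜ[Base] (1 : U2))
  rw [Algebra.TensorProduct.tmul_mul_tmul, mul_one, one_mul]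

theorem incl₁₂_mul_incl₃ (b : U) (t : U2) :
    incl₁₂ t * incl₃ b = TensorProduct.assoc Base U U U (t ⊗ₜ[Base] b) := by
  induction t using TensorProduct.induction_on with
  | zero => rw [map_zero, zero_mul, TensorProduct.zero_tmul, map_zero]
  | tmul x y =>
    change (x ⊗ₜ[Base] (y ⊗ₜ[Base] (1 : U))) * ((1 : U) ⊗ₜ[Base] ((1 : U) ⊗ₜ[Base] b)) = _
    rw [Algebra.TensorProduct.tmul_mul_tmul, Algebra.TensorProduct.tmul_mul_tmul, mul_one, one_mul,
      mul_one]
    rfl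
  | add x y hx hy => rw [map_add, add_mul, hx, hy, TensorProduct.add_tmul, map_add]

theorem incl₃_commute (b : U) (t : U2) : Commute (incl₃ b) (incl₁₂ t) := by
  induction t using TensorProduct.induction_on with
  | zero =>
    rw [map_zero]
    exact Commute.zero_right _
  | tmul x y =>
    change ((1 : U) ⊗ₜ[Base] ((1 : U) ⊗ₜ[Base] b)) * (x ⊗ₜ[Base] (y ⊗ₜ[Base] (1 : U)))
      = (x ⊗ₜ[Base] (y ⊗ₜ[Base] (1 : U))) * ((1 : U) ⊗ₜ[Base] ((1 : U) ⊗ₜ[Base] b))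
    simp only [Algebra.TensorProduct.tmul_mul_tmul, mul_one, one_mul]
  | add x y hx hy =>
    rw [map_add]
    exact hx.add_right hy

theorem idTensorAlg_commute (Δ : U →ₐ[Base] Laurent ℤ U2) (a b : U) :
    Commute (((Completion.ofAlg (HahnSeries ℤ U3)).comp ((hahnC U3).comp incl₁)) a)
      (((laurentMap ℤ incl₂₃).comp Δ) b) :=
  commute_laurentMap incl₂₃ (incl₁_commute a) _

theorem tensorIdAlg_commute (Δ : U →ₐ[Base] Laurent ℤ U2) (a b : U) :
    Commute (((laurentMap ℤ incl₁₂).comp Δ) a)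
      (((Completion.ofAlg (HahnSeries ℤ U3)).comp ((hahnC U3).comp incl₃)) b) :=
  (commute_laurentMap incl₁₂ (incl₃_commute b) _).symm

/-- `Id ⊗ Δ_v` as a homomorphism. -/
def idTensorAlg (Δ : U →ₐ[Base] Laurent ℤ U2) : U2 →ₐ[Base] Laurent ℤ U3 :=
  Algebra.TensorProduct.lift _ _ (idTensorAlg_commute Δ)

/-- `Δ_u ⊗ Id` as a homomorphism. -/
def tensorIdAlg (Δ : U →ₐ[Base] Laurent ℤ U2) : U2 →ₐ[Base] Laurent ℤ U3 :=
  Algebra.TensorProduct.lift _ _ (tensorIdAlg_commute Δ)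

theorem coeff_idTensorAlg (Δ : U →ₐ[Base] Laurent ℤ U2) (n : ℤ) (t : U2) :
    Laurent.coeff n (idTensorAlg Δ t) = idTensor (deltaCoeff Δ n) (Completion.of _ t) := by
  induction t using TensorProduct.induction_on with
  | zero => simp only [map_zero]
  | tmul a b =>
    rw [idTensorAlg, Algebra.TensorProduct.lift_tmul, idTensor_of_tmul]
    refine (Laurent.coeff_C_mul n (incl₁ a) (laurentMap ℤ incl₂₃ (Δ b))).trans ?_
    rw [laurentMap_coeff]
    exact Completion.mul_map _ _ _ (incl₁_mul_incl₂₃ a) _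
  | add x y hx hy => simp only [map_add, hx, hy]

theorem coeff_tensorIdAlg (Δ : U →ₐ[Base] Laurent ℤ U2) (n : ℤ) (t : U2) :
    Laurent.coeff n (tensorIdAlg Δ t) = tensorId (deltaCoeff Δ n) (Completion.of _ t) := by
  induction t using TensorProduct.induction_on with
  | zero => simp only [map_zero]
  | tmul a b =>
    rw [tensorIdAlg, Algebra.TensorProduct.lift_tmul, tensorId_of_tmul]
    refine (Laurent.coeff_mul_C n (incl₃ b) (laurentMap ℤ incl₁₂ (Δ a))).trans ?_
    rw [laurentMap_coeff, Completion.map_map]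
    exact Completion.map_mul_of _ _ _ (incl₁₂_mul_incl₃ b) _
  | add x y hx hy => simp only [map_add, hx, hy]

section Iterate

variable {A B C : Type} [Ring A] [Algebra Base A] [Ring B] [Algebra Base B] [Ring C]
  [Algebra Base C]

theorem Completion.extendRing_map (g : B →ₗ[Base] Completion C) (F : A →ₐ[Base] B)
    (l : Completion A →ₗ[Base] Completion C) (h : ∀ t, g (F t) = l (Completion.of A t))
    (z : Completion A) : Completion.extendRing g (Completion.map F.toLinearMap z) = l z := by
  have : Completion.extendRing g ∘ₗ Completion.map F.toLinearMap = l := Completion.ext_dense h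
  exact LinearMap.congr_fun this z

/-- The composition of two homomorphisms into Laurent series, with values in the iterated Laurent
series. -/
def iterate (F : B →ₐ[Base] Laurent ℤ C) (Δ : A →ₐ[Base] Laurent ℤ B) :
    A →ₐ[Base] Laurent ℤ (Laurent ℤ C) :=
  (laurentMap ℤ F).comp Δ

theorem iteratedCoeff_iterate (F : B →ₐ[Base] Laurent ℤ C) (Δ : A →ₐ[Base] Laurent ℤ B)
    (l : ℤ → Completion B →ₗ[Base] Completion C)
    (h : ∀ n t, Laurent.coeff n (F t) = l n (Completion.of _ t)) (m n : ℤ) (x : A) :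
    iteratedCoeff m n (iterate F Δ x) = l n (Laurent.coeff m (Δ x)) :=
  (congrArg (completionCoeff n) (laurentMap_coeff F (Δ x) m)).trans
    (Completion.extendRing_map (B := Laurent ℤ C) (Laurent.coeff (A := C) n) F (l n) (h n)
      (Laurent.coeff m (Δ x)))

/-- A homomorphism from `𝒰` whose values on the generators lie in the image of an injective
homomorphism of complete algebras factors through it. -/
theorem exists_factor {S R : Type} [Ring S] [Algebra Base S] [IsAdicComplete hIdeal S] [Ring R]
    [Algebra Base R] [IsHausdorff hIdeal R] [Module.IsTorsionFree Base R] (j : S →ₐ[Base] R)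
    (hj : Function.Injective j) (F : U →ₐ[Base] R) (h : ∀ g, ∃ t, j t = F (U.gen g)) :
    ∃ T : U →ₐ[Base] S, ∀ x, j (T x) = F x := by
  have : Module.IsTorsionFree Base S := isTorsionFree_of_hbar fun x hx =>
    hj (by
      rw [map_zero]
      refine eq_zero_of_hbar_smul (n := 1) ?_
      rw [pow_one, ← map_smul, hx, map_zero])
  choose v hv using h
  have hF : j.comp (liftFree v) = F.comp U.mk := free_hom_ext fun g => by
    change j (liftFree v (Free.gen g)) = F (U.gen g)
    rw [liftFree_gen, hv]
  have hF' : ∀ a, j (liftFree v a) = F (U.mk a) := fun a => AlgHom.congr_fun hF a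
  refine ⟨U.lift (liftFree v) fun a b hab => hj ?_, fun x => ?_⟩
  · rw [hF', hF', U.mk_eq_mk hab]
  · obtain ⟨a, rfl⟩ := U.mk_surjective x
    rw [U.lift_mk, hF']

/-- A homomorphism to the iterated Laurent series takes its values in the Laurent series in two
variables if it does so on the generators. -/
theorem exists_laurentCurry_lift [Module.IsTorsionFree Base C]
    (F : U →ₐ[Base] Laurent ℤ (Laurent ℤ C))
    (h : ∀ g, ∃ t, laurentCurry .refl t = F (U.gen g)) :
    ∃ T : U →ₐ[Base] Laurent (ℤ × ℤ) C, ∀ x, laurentCurry .refl (T x) = F x :=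
  exists_factor (S := Laurent (ℤ × ℤ) C) (R := Laurent ℤ (Laurent ℤ C))
    (laurentCurry (A := C) .refl)
    (laurentCurry_injective (A := C) .refl) F h

theorem iteratedCoeff_hom_ext [Module.IsTorsionFree Base C]
    {F G : U →ₐ[Base] Laurent ℤ (Laurent ℤ C)}
    (hc : ∀ a b, iteratedCoeff a b (F U.c) = iteratedCoeff a b (G U.c))
    (hphi : ∀ s i n a b, iteratedCoeff a b (F (U.phi s i n)) = iteratedCoeff a b (G (U.phi s i n)))
    (hx : ∀ s i n a b, iteratedCoeff a b (F (U.x s i n)) = iteratedCoeff a b (G (U.x s i n))) :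
    F = G :=
  U.hom_ext (iteratedCoeff_ext hc) (fun s i n => iteratedCoeff_ext (hphi s i n))
    fun s i n => iteratedCoeff_ext (hx s i n)

/-- Two homomorphisms into iterated Laurent series, in `u`, `v` and in `u v`, `u`, whose
coefficients agree on the currents, both come from a homomorphism into the Laurent series in two
variables if the first one does so on the generators. -/
theorem exists_common_lift [Module.IsTorsionFree Base C]
    (F G : U →ₐ[Base] Laurent ℤ (Laurent ℤ C)) (f g : ℤ → ℤ → U → Completion C)
    (hF : ∀ m n x, iteratedCoeff m n (F x) = f m n x)
    (hG : ∀ m n x, iteratedCoeff n (m - n) (G x) = g m n x)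
    (h : ∀ s, ∃ (p : ℤ → ℤ → C) (N : ℤ), (∀ m n, m < N ∨ n < N → p m n = 0) ∧
      ∀ m n, f m n (U.gen s) = Completion.of C (p m n))
    (hc : ∀ m n, f m n U.c = g m n U.c)
    (hphi : ∀ s i N m n, f m n (U.phi s i N) = g m n (U.phi s i N))
    (hx : ∀ s i N m n, f m n (U.x s i N) = g m n (U.x s i N)) :
    ∃ T : U →ₐ[Base] Laurent (ℤ × ℤ) C, ∀ (x : U) (m n : ℤ),
      Laurent.coeff (m, n) (T x) = f m n x ∧ Laurent.coeff (m, n) (T x) = g m n x := by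
  obtain ⟨T, hT⟩ := exists_laurentCurry_lift F fun s => by
    obtain ⟨p, N, hp, hfp⟩ := h s
    exact exists_laurentCurry_refl p N hp fun m n => (hF m n _).trans (hfp m n)
  have hTf : ∀ x m n, Laurent.coeff (m, n) (T x) = f m n x := fun x m n => by
    rw [← hF, ← hT, iteratedCoeff_laurentCurry]
    rfl
  have hG' : ∀ x a b, iteratedCoeff a b (G x) = g (a + b) a x := fun x a b => by
    rw [← hG, add_sub_cancel_left]
  have hTt : ∀ x a b, iteratedCoeff a b (((laurentCurry .twist).comp T) x) = f (a + b) a x :=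
    fun x a b => (iteratedCoeff_laurentCurry .twist a b (T x)).trans (hTf x _ _)
  have hTG : (laurentCurry .twist).comp T = G := iteratedCoeff_hom_ext
    (fun a b => by rw [hTt, hG', hc]) (fun s i n a b => by rw [hTt, hG', hphi])
    (fun s i n a b => by rw [hTt, hG', hx])
  refine ⟨T, fun x m n => ⟨hTf x m n, ?_⟩⟩
  rw [← hG, ← hTG, hTt, hTf, add_sub_cancel]

end Iterate

theorem iteratedCoeff_left (Δ : U →ₐ[Base] Laurent ℤ U2) (m n : ℤ) (x : U) :
    iteratedCoeff m n (iterate (idTensorAlg Δ) Δ x) = coassocLeft Δ m n x :=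
  iteratedCoeff_iterate (idTensorAlg Δ) Δ (fun n => idTensor (deltaCoeff Δ n))
    (coeff_idTensorAlg Δ) m n x

theorem iteratedCoeff_right (Δ : U →ₐ[Base] Laurent ℤ U2) (m n : ℤ) (x : U) :
    iteratedCoeff n (m - n) (iterate (tensorIdAlg Δ) Δ x) = coassocRight Δ m n x :=
  iteratedCoeff_iterate (tensorIdAlg Δ) Δ (fun n => tensorId (deltaCoeff Δ n))
    (coeff_tensorIdAlg Δ) n (m - n) x

/-- The element `a q ^ (α c) ⊗ b q ^ (β c) ⊗ d q ^ (γ c)`. -/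
def legs₃ (a b d : U) (α β γ : ℂ) : U3 :=
  (a * U.qc α) ⊗ₜ[Base] ((b * U.qc β) ⊗ₜ[Base] (d * U.qc γ))

theorem tmul_legs (a b d : U) (α β γ δ : ℂ) :
    (a * U.qc α) ⊗ₜ[Base] (inl b * inr d * qq γ δ * qq β β)
      = legs₃ a b d α (γ + β) (δ + β) := by
  rw [mul_assoc, qq_mul, legs_eq_tmul, legs₃]

theorem assoc_legs (a b d : U) (α β γ δ : ℂ) :
    TensorProduct.assoc Base U U U ((inl a * inr b * qq γ δ * qq α α) ⊗ₜ[Base] (d * U.qc β))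
      = legs₃ a b d (γ + α) (δ + α) β := by
  rw [mul_assoc, qq_mul, legs_eq_tmul, legs₃]
  rfl

theorem inl_eq_legs (a : U) : inl a = inl a * inr 1 * qq 0 0 := by
  rw [qq_zero, map_one, mul_one, mul_one]

theorem inr_eq_legs (a : U) : inr a = inl 1 * inr a * qq 0 0 := by
  rw [qq_zero, map_one, mul_one, one_mul]

theorem coeff_C_central (k : ℤ) : (HahnSeries.C (Γ := ℤ) (inl U.c + inr U.c)).coeff k
    = if k = 0 then inl U.c * inr 1 * qq 0 0 + inl 1 * inr U.c * qq 0 0 else 0 := by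
  rw [HahnSeries.C_apply, HahnSeries.coeff_single, ← inl_eq_legs, ← inr_eq_legs]
  congr

theorem coeff_one_legs (k : ℤ) : (1 : HahnSeries ℤ U2).coeff k
    = if k = 0 then inl 1 * inr 1 * qq 0 0 else 0 := by
  rw [HahnSeries.coeff_one, ← inl_eq_legs, map_one]
  congr

theorem coeff_xΔ_plus (i : Fin 2) (n k : ℤ) : (xΔ .plus i n).coeff k
    = (if k = 0 then inl (U.x .plus i n) * inr 1 * qq 0 0 else 0)
      + inl (U.phi .minus i (n - k)) * inr (U.x .plus i k) * qq (-1 / 2 * (n - k) + -k) 0 := by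
  rw [← coeff_plusMoving, ← inl_eq_legs]
  change (plusStatic i n).coeff k + (plusMoving i n).coeff k = _
  congr 1
  refine HahnSeries.coeff_single.trans ?_
  congr

theorem coeff_xΔ_minus (i : Fin 2) (n k : ℤ) : (xΔ .minus i n).coeff k
    = (if k = n then inl 1 * inr (U.x .minus i n) * qq 0 0 else 0)
      + inl (U.x .minus i (n - k)) * inr (U.phi .plus i k) * qq 0 (-(n - k) + -1 / 2 * k) := by
  rw [← coeff_minusStatic, ← inr_eq_legs]
  change (minusMoving i n).coeff k + (minusStatic i n).coeff k = _
  congr 1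
  refine HahnSeries.coeff_single.trans ?_
  congr

theorem coeff_hΔ (i : Fin 2) (n k : ℤ) : (hΔ i n).coeff k
    = (if k = 0 then inl (U.gen (.h i n)) * inr 1 * qq 0 (-(n.natAbs : ℂ) / 2) else 0)
      + if k = n then inl 1 * inr (U.gen (.h i n)) * qq ((n.natAbs : ℂ) / 2) 0 else 0 := by
  rw [hΔ, HahnSeries.coeff_add, HahnSeries.C_apply, HahnSeries.coeff_single,
    HahnSeries.coeff_single, map_one, map_one, mul_one, one_mul]
  congr

/-! ### Values of the two composites on the generators -/

section Values

variable {Δ : U →ₐ[Base] Laurent ℤ U2}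

theorem deltaCoeff_eq {x : U} {D : HahnSeries ℤ U2} (h : Δ x = Completion.of _ D) (m : ℤ) :
    deltaCoeff Δ m x = Completion.of U2 (D.coeff m) := by
  change Laurent.coeff m (Δ x) = _
  rw [h, Laurent.coeff_of]

theorem coproduct_one (Δ : U →ₐ[Base] Laurent ℤ U2) : Δ 1 = Completion.of _ 1 := map_one Δ

theorem IsHahnCoproduct.coassocLeft_c (hΔ : IsHahnCoproduct Δ) (m n : ℤ) :
    coassocLeft Δ m n U.c = Completion.of U3 (if m = 0 ∧ n = 0 then
      legs₃ U.c 1 1 0 0 0 + (legs₃ 1 U.c 1 0 0 0 + legs₃ 1 1 U.c 0 0 0) else 0) := by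
  rw [coassocLeft, deltaCoeff_eq hΔ.c, coeff_C_central]
  by_cases hm : m = 0
  · rw [if_pos hm, map_add, map_add, hΔ.idTensor_legs (coproduct_one Δ), hΔ.idTensor_legs hΔ.c,
      coeff_one_legs, coeff_C_central, ← map_add]
    congr 1
    by_cases hn : n = 0
    · simp only [if_pos hn, if_pos (And.intro hm hn), add_mul, TensorProduct.tmul_add, tmul_legs,
        add_zero]
    · simp only [if_neg hn, if_neg fun h : m = 0 ∧ n = 0 => hn h.2, zero_mul,
        TensorProduct.tmul_zero, add_zero]
  · rw [if_neg hm, if_neg fun h => hm h.1, map_zero, map_zero, map_zero]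

theorem IsHahnCoproduct.coassocRight_c (hΔ : IsHahnCoproduct Δ) (m n : ℤ) :
    coassocRight Δ m n U.c = Completion.of U3 (if m = 0 ∧ n = 0 then
      legs₃ U.c 1 1 0 0 0 + (legs₃ 1 U.c 1 0 0 0 + legs₃ 1 1 U.c 0 0 0) else 0) := by
  rw [coassocRight, deltaCoeff_eq hΔ.c, coeff_C_central]
  by_cases hn : n = 0
  · rw [if_pos hn, map_add, map_add, hΔ.tensorId_legs (coproduct_one Δ), hΔ.tensorId_legs hΔ.c,
      coeff_one_legs, coeff_C_central, ← map_add, hn, sub_zero]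
    congr 1
    by_cases hm : m = 0
    · simp only [hm, if_true, and_self, add_mul, TensorProduct.add_tmul, map_add, assoc_legs,
        add_zero, add_assoc]
    · simp only [hm, if_false, false_and, zero_mul, TensorProduct.zero_tmul, map_zero, add_zero]
  · rw [if_neg hn, if_neg fun h => hn h.2, map_zero, map_zero, map_zero]

theorem IsHahnCoproduct.coassocLeft_h (hΔ : IsHahnCoproduct Δ) (i : Fin 2) (N : ℤ) :
    ∃ X Y : ℤ → U3, (∀ n, n < min 0 N → X n = 0 ∧ Y n = 0) ∧ ∀ m n,
      coassocLeft Δ m n (U.gen (.h i N)) = Completion.of U3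
        ((if m = 0 then X n else 0) + if m = N then Y n else 0) := by
  refine ⟨fun n => (U.gen (.h i N) * U.qc 0) ⊗ₜ[Base] ((1 : HahnSeries ℤ U2).coeff n
    * qq (-(N.natAbs : ℂ) / 2) (-(N.natAbs : ℂ) / 2)),
    fun n => ((1 : U) * U.qc ((N.natAbs : ℂ) / 2)) ⊗ₜ[Base]
      ((QuantumToroidal.hΔ i N).coeff n * qq 0 0), fun n hn => ⟨?_, ?_⟩, fun m n => ?_⟩
  · beta_reduce
    rw [HahnSeries.coeff_one, if_neg (by omega), zero_mul, TensorProduct.tmul_zero]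
  · beta_reduce
    rw [coeff_hΔ, if_neg (by omega), if_neg (by omega), add_zero, zero_mul,
      TensorProduct.tmul_zero]
  · rw [coassocLeft, deltaCoeff_eq (hΔ.h i N), coeff_hΔ, map_add, map_add, map_add]
    congr 1
    · split_ifs
      · rw [hΔ.idTensor_legs (coproduct_one Δ)]
      · rw [map_zero, map_zero, map_zero]
    · split_ifs
      · rw [hΔ.idTensor_legs (hΔ.h i N)]
      · rw [map_zero, map_zero, map_zero]

theorem IsHahnCoproduct.coassocLeft_phi (hΔ : IsHahnCoproduct Δ) (s : Sgn) (i : Fin 2)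
    (N m n : ℤ) : coassocLeft Δ m n (U.phi s i N) = Completion.of U3
      (legs₃ (U.phi s i (N - m)) (U.phi s i (m - n)) (U.phi s i n) (s.val / 2 * m)
        (s.val / 2 * (m + n - N)) (s.val / 2 * (n - N))) := by
  rw [coassocLeft, deltaCoeff_eq (hΔ.phi s i N), coeff_phiΔ, hΔ.idTensor_legs (hΔ.phi s i m),
    coeff_phiΔ, tmul_legs]
  congr 2 <;> ring

theorem IsHahnCoproduct.coassocRight_phi (hΔ : IsHahnCoproduct Δ) (s : Sgn) (i : Fin 2)
    (N m n : ℤ) : coassocRight Δ m n (U.phi s i N) = Completion.of U3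
      (legs₃ (U.phi s i (N - m)) (U.phi s i (m - n)) (U.phi s i n) (s.val / 2 * m)
        (s.val / 2 * (m + n - N)) (s.val / 2 * (n - N))) := by
  rw [coassocRight, deltaCoeff_eq (hΔ.phi s i N), coeff_phiΔ, hΔ.tensorId_legs (hΔ.phi s i (N - n)),
    coeff_phiΔ, assoc_legs, show N - n - (m - n) = N - m by ring]
  congr 2 <;> push_cast <;> ring

theorem IsHahnCoproduct.coassocLeft_x_plus (hΔ : IsHahnCoproduct Δ) (i : Fin 2) (N m n : ℤ) :
    coassocLeft Δ m n (U.x .plus i N) = Completion.of U3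
      ((if m = 0 ∧ n = 0 then legs₃ (U.x .plus i N) 1 1 0 0 0 else 0)
        + (if n = 0 then
            legs₃ (U.phi .minus i (N - m)) (U.x .plus i m) 1 (-1 / 2 * (N + m)) 0 0 else 0)
        + legs₃ (U.phi .minus i (N - m)) (U.phi .minus i (m - n)) (U.x .plus i n)
          (-1 / 2 * (N + m)) (-1 / 2 * (m + n)) 0) := by
  have h₂ : idTensor (deltaCoeff Δ n) (Completion.of _ (inl (U.phi .minus i (N - m))
      * inr (U.x .plus i m) * qq (-1 / 2 * (N - m) + -m) 0)) = Completion.of U3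
      ((if n = 0 then
          legs₃ (U.phi .minus i (N - m)) (U.x .plus i m) 1 (-1 / 2 * (N + m)) 0 0 else 0)
        + legs₃ (U.phi .minus i (N - m)) (U.phi .minus i (m - n)) (U.x .plus i n)
          (-1 / 2 * (N + m)) (-1 / 2 * (m + n)) 0) := by
    rw [hΔ.idTensor_legs (hΔ.x .plus i m), coeff_xΔ_plus, add_mul, TensorProduct.tmul_add,
      tmul_legs]
    congr 2
    · split_ifs
      · rw [tmul_legs]
        congr 1 <;> ring
      · rw [zero_mul, TensorProduct.tmul_zero]
    · congr 1 <;> ring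
  have h₁ : idTensor (deltaCoeff Δ n) (Completion.of _
      (if m = 0 then inl (U.x .plus i N) * inr 1 * qq 0 0 else 0)) = Completion.of U3
      (if m = 0 ∧ n = 0 then legs₃ (U.x .plus i N) 1 1 0 0 0 else 0) := by
    by_cases hm : m = 0
    · rw [if_pos hm, hΔ.idTensor_legs (coproduct_one Δ), coeff_one_legs]
      by_cases hn : n = 0
      · rw [if_pos hn, if_pos ⟨hm, hn⟩, tmul_legs, add_zero]
      · rw [if_neg hn, if_neg fun h => hn h.2, zero_mul, TensorProduct.tmul_zero]
    · rw [if_neg hm, if_neg fun h => hm h.1, map_zero, map_zero, map_zero]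
  rw [coassocLeft, deltaCoeff_eq (hΔ.x .plus i N), coeff_xΔ_plus, map_add, map_add, h₁, h₂,
    ← map_add, add_assoc]

theorem IsHahnCoproduct.coassocRight_x_plus (hΔ : IsHahnCoproduct Δ) (i : Fin 2) (N m n : ℤ) :
    coassocRight Δ m n (U.x .plus i N) = Completion.of U3
      ((if m = 0 ∧ n = 0 then legs₃ (U.x .plus i N) 1 1 0 0 0 else 0)
        + (if n = 0 then
            legs₃ (U.phi .minus i (N - m)) (U.x .plus i m) 1 (-1 / 2 * (N + m)) 0 0 else 0)
        + legs₃ (U.phi .minus i (N - m)) (U.phi .minus i (m - n)) (U.x .plus i n)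
          (-1 / 2 * (N + m)) (-1 / 2 * (m + n)) 0) := by
  rw [coassocRight, deltaCoeff_eq (hΔ.x .plus i N), coeff_xΔ_plus, map_add, map_add,
    hΔ.tensorId_legs (hΔ.phi .minus i (N - n)), coeff_phiΔ, assoc_legs,
    show N - n - (m - n) = N - m by ring, map_add]
  congr 1
  · by_cases hn : n = 0
    · rw [if_pos hn, if_pos hn, hΔ.tensorId_legs (hΔ.x .plus i N), coeff_xΔ_plus, add_mul,
        TensorProduct.add_tmul, map_add, assoc_legs, hn, sub_zero]
      congr 2
      · by_cases hm : m = 0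
        · rw [if_pos hm, if_pos ⟨hm, rfl⟩, assoc_legs, add_zero]
        · rw [if_neg hm, if_neg fun h => hm h.1, zero_mul, TensorProduct.zero_tmul, map_zero]
      · congr 1 <;> ring
    · rw [if_neg hn, if_neg hn, if_neg fun h => hn h.2, add_zero, map_zero, map_zero, map_zero]
  · congr 2 <;> simp only [Sgn.val] <;> push_cast <;> ring

theorem IsHahnCoproduct.coassocLeft_x_minus (hΔ : IsHahnCoproduct Δ) (i : Fin 2) (N m n : ℤ) :
    coassocLeft Δ m n (U.x .minus i N) = Completion.of U3
      ((if m = N ∧ n = N then legs₃ 1 1 (U.x .minus i N) 0 0 0 else 0)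
        + (if m = N then
            legs₃ 1 (U.x .minus i (N - n)) (U.phi .plus i n) 0 0 (1 / 2 * n - N) else 0)
        + legs₃ (U.x .minus i (N - m)) (U.phi .plus i (m - n)) (U.phi .plus i n)
          0 (1 / 2 * (m + n) - N) (1 / 2 * n - N)) := by
  rw [coassocLeft, deltaCoeff_eq (hΔ.x .minus i N), coeff_xΔ_minus, map_add, map_add,
    hΔ.idTensor_legs (hΔ.phi .plus i m), coeff_phiΔ, tmul_legs, map_add _ (_ + _)]
  congr 1
  · by_cases hm : m = N
    · rw [if_pos hm, if_pos hm, hΔ.idTensor_legs (hΔ.x .minus i N), coeff_xΔ_minus, add_mul,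
        TensorProduct.tmul_add, tmul_legs]
      congr 2
      · by_cases hn : n = N
        · rw [if_pos hn, if_pos ⟨hm, hn⟩, tmul_legs, add_zero]
        · rw [if_neg hn, if_neg fun h => hn h.2, zero_mul, TensorProduct.tmul_zero]
      · congr 1 <;> ring
    · rw [if_neg hm, if_neg hm, if_neg fun h => hm h.1, add_zero, map_zero, map_zero, map_zero]
  · congr 2 <;> simp only [Sgn.val] <;> push_cast <;> ring

theorem IsHahnCoproduct.coassocRight_x_minus (hΔ : IsHahnCoproduct Δ) (i : Fin 2) (N m n : ℤ) :
    coassocRight Δ m n (U.x .minus i N) = Completion.of U3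
      ((if m = N ∧ n = N then legs₃ 1 1 (U.x .minus i N) 0 0 0 else 0)
        + (if m = N then
            legs₃ 1 (U.x .minus i (N - n)) (U.phi .plus i n) 0 0 (1 / 2 * n - N) else 0)
        + legs₃ (U.x .minus i (N - m)) (U.phi .plus i (m - n)) (U.phi .plus i n)
          0 (1 / 2 * (m + n) - N) (1 / 2 * n - N)) := by
  have h₂ : tensorId (deltaCoeff Δ (m - n)) (Completion.of _ (inl (U.x .minus i (N - n))
      * inr (U.phi .plus i n) * qq 0 (-(N - n) + -1 / 2 * n))) = Completion.of U3
      ((if m = N then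
            legs₃ 1 (U.x .minus i (N - n)) (U.phi .plus i n) 0 0 (1 / 2 * n - N) else 0)
        + legs₃ (U.x .minus i (N - m)) (U.phi .plus i (m - n)) (U.phi .plus i n)
          0 (1 / 2 * (m + n) - N) (1 / 2 * n - N)) := by
    rw [hΔ.tensorId_legs (hΔ.x .minus i (N - n)), coeff_xΔ_minus, add_mul, TensorProduct.add_tmul,
      map_add, assoc_legs, show N - n - (m - n) = N - m by ring]
    congr 2
    · by_cases hm : m = N
      · rw [if_pos hm, if_pos (by rw [hm]), assoc_legs]
        congr 1 <;> ring
      · rw [if_neg hm, if_neg (by omega), zero_mul, TensorProduct.zero_tmul, map_zero]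
    · congr 1 <;> push_cast <;> ring
  have h₁ : tensorId (deltaCoeff Δ (m - n)) (Completion.of _
      (if n = N then inl 1 * inr (U.x .minus i N) * qq 0 0 else 0)) = Completion.of U3
      (if m = N ∧ n = N then legs₃ 1 1 (U.x .minus i N) 0 0 0 else 0) := by
    by_cases hn : n = N
    · rw [if_pos hn, hΔ.tensorId_legs (coproduct_one Δ), coeff_one_legs]
      by_cases hm : m = N
      · rw [if_pos (by omega), if_pos ⟨hm, hn⟩, assoc_legs, add_zero]
      · rw [if_neg (by omega), if_neg fun h => hm h.1, zero_mul, TensorProduct.zero_tmul, map_zero]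
    · rw [if_neg hn, if_neg fun h => hn h.2, map_zero, map_zero, map_zero]
  rw [coassocRight, deltaCoeff_eq (hΔ.x .minus i N), coeff_xΔ_minus, map_add, map_add, h₁, h₂,
    ← map_add, add_assoc]

theorem legs₃_eq_zero {a b d : U} (h : a = 0 ∨ b = 0 ∨ d = 0) (α β γ : ℂ) :
    legs₃ a b d α β γ = 0 := by
  rcases h with rfl | rfl | rfl <;>
    simp only [legs₃, zero_mul, TensorProduct.zero_tmul, TensorProduct.tmul_zero]

/-- Coassociativity: both composites come from one homomorphism into the series in `u` and `v`. -/
theorem IsHahnCoproduct.coassociative (hΔ : IsHahnCoproduct Δ) :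
    ∃ T : U →ₐ[Base] Laurent (ℤ × ℤ) U3, ∀ (x : U) (m n : ℤ),
      Laurent.coeff (m, n) (T x) = coassocLeft Δ m n x ∧
      Laurent.coeff (m, n) (T x) = coassocRight Δ m n x := by
  refine exists_common_lift (iterate (idTensorAlg Δ) Δ) (iterate (tensorIdAlg Δ) Δ)
    (coassocLeft Δ) (coassocRight Δ) (iteratedCoeff_left Δ) (iteratedCoeff_right Δ) (fun g => ?_)
    (fun m n => by rw [hΔ.coassocLeft_c, hΔ.coassocRight_c])
    (fun s i N m n => by rw [hΔ.coassocLeft_phi, hΔ.coassocRight_phi]) (fun s i N m n => ?_)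
  · cases g with
    | c =>
      refine ⟨_, 0, fun m n hmn => ?_, hΔ.coassocLeft_c⟩
      exact if_neg (by omega)
    | h i N =>
      obtain ⟨X, Y, hXY, h⟩ := hΔ.coassocLeft_h i N
      refine ⟨_, min 0 N, fun m n hmn => ?_, h⟩
      rcases hmn with hm | hn
      · simp only [if_neg (show m ≠ 0 by omega), if_neg (show m ≠ N by omega), add_zero]
      · simp only [hXY n hn, ite_self, add_zero]
    | x s i N =>
      cases s with
      | plus =>
        refine ⟨_, min 0 N, fun m n hmn => ?_, hΔ.coassocLeft_x_plus i N⟩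
        rw [if_neg (by omega), legs₃_eq_zero (a := U.phi .minus i (N - m))
          (b := U.phi .minus i (m - n)), zero_add, add_zero]
        · split_ifs with hn
          · exact legs₃_eq_zero (.inl (U.phi_of_pos (by omega))) _ _ _
          · rfl
        · by_cases hm : m < N
          · exact .inl (U.phi_of_pos (by omega))
          · exact .inr (.inl (U.phi_of_pos (by omega)))
      | minus =>
        refine ⟨_, min 0 N, fun m n hmn => ?_, hΔ.coassocLeft_x_minus i N⟩
        rw [if_neg (by omega), legs₃_eq_zero (b := U.phi .plus i (m - n)), zero_add, add_zero]
        · split_ifs with hm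
          · exact legs₃_eq_zero (.inr (.inr (U.phi_of_lt (by omega)))) _ _ _
          · rfl
        · by_cases hn : n < 0
          · exact .inr (.inr (U.phi_of_lt hn))
          · exact .inr (.inl (U.phi_of_lt (by omega)))
  · cases s
    · rw [hΔ.coassocLeft_x_plus, hΔ.coassocRight_x_plus]
    · rw [hΔ.coassocLeft_x_minus, hΔ.coassocRight_x_minus]

end Values

/-! ### The counit axioms -/

theorem IsCounit.qc {ε : U →ₐ[Base] Base} (hε : IsCounit ε) (κ : ℂ) : ε (U.qc κ) = 1 := by
  have h := (U.isExp_qc κ).map ε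
  rw [map_smul, hε.c, smul_zero] at h
  exact h.unique IsExp.zero

/-- `Id ⊗ ε` as a homomorphism. -/
def counitRight (ε : U →ₐ[Base] Base) : U2 →ₐ[Base] U :=
  (Algebra.TensorProduct.rid Base Base U).toAlgHom.comp
    (Algebra.TensorProduct.map (AlgHom.id Base U) ε)

/-- `ε ⊗ Id` as a homomorphism. -/
def counitLeft (ε : U →ₐ[Base] Base) : U2 →ₐ[Base] U :=
  (Algebra.TensorProduct.lid Base U).toAlgHom.comp
    (Algebra.TensorProduct.map ε (AlgHom.id Base U))

theorem idTensorCounit_eq (ε : U →ₐ[Base] Base) :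
    idTensorCounit ε = Completion.map (counitRight ε).toLinearMap := by
  refine congrArg Completion.map (TensorProduct.ext' fun a b => rfl)

theorem counitTensorId_eq (ε : U →ₐ[Base] Base) :
    counitTensorId ε = Completion.map (counitLeft ε).toLinearMap := by
  refine congrArg Completion.map (TensorProduct.ext' fun a b => rfl)

theorem IsCounit.counitRight_legs {ε : U →ₐ[Base] Base} (hε : IsCounit ε) (a b : U)
    (α β : ℂ) : counitRight ε (inl a * inr b * qq α β) = ε b • (a * U.qc α) := by
  rw [legs_eq_tmul]
  change ε (b * U.qc β) • (a * U.qc α) = _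
  rw [map_mul, hε.qc, mul_one]

theorem IsCounit.counitLeft_legs {ε : U →ₐ[Base] Base} (hε : IsCounit ε) (a b : U)
    (α β : ℂ) : counitLeft ε (inl a * inr b * qq α β) = ε a • (b * U.qc β) := by
  rw [legs_eq_tmul]
  change ε (a * U.qc α) • (b * U.qc β) = _
  rw [map_mul, hε.qc, mul_one]

theorem coeff_laurentMap_of {A B : Type} [Ring A] [Algebra Base A] [Ring B] [Algebra Base B]
    (f : A →ₐ[Base] B) {y : Laurent ℤ A} {D : HahnSeries ℤ A} (h : y = Completion.of _ D) (k : ℤ) :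
    Laurent.coeff k (laurentMap ℤ f y) = Completion.of B (f (D.coeff k)) := by
  rw [laurentMap_coeff, h]
  rfl

theorem IsHahnCoproduct.counitRight {Δ : U →ₐ[Base] Laurent ℤ U2} (hΔ : IsHahnCoproduct Δ)
    {ε : U →ₐ[Base] Base} (hε : IsCounit ε) :
    (laurentMap ℤ (counitRight ε)).comp Δ
      = (Completion.ofAlg (HahnSeries ℤ U)).comp (hahnC U) := by
  have hR : ∀ (x : U) (k : ℤ),
      Laurent.coeff k (((Completion.ofAlg (HahnSeries ℤ U)).comp (hahnC U)) x)
        = Completion.of U (if k = 0 then x else 0) := fun x k =>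
    congrArg (Completion.of U) (HahnSeries.coeff_single.trans (by congr))
  refine U.hom_ext (Laurent.ext_coeff fun k => ?_) (fun s i n => Laurent.ext_coeff fun k => ?_)
    (fun s i n => Laurent.ext_coeff fun k => ?_)
  · refine (coeff_laurentMap_of _ hΔ.c k).trans ((congrArg _ ?_).trans (hR _ k).symm)
    rw [coeff_C_central]
    split_ifs
    · rw [map_add, hε.counitRight_legs, hε.counitRight_legs, map_one, one_smul, hε.c, zero_smul,
        U.qc_zero, mul_one, add_zero]
    · exact map_zero _
  · refine (coeff_laurentMap_of _ (hΔ.phi s i n) k).trans ((congrArg _ ?_).trans (hR _ k).symm)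
    rw [coeff_phiΔ, hε.counitRight_legs, hε.phi]
    split_ifs with hk
    · rw [hk, one_smul, sub_zero, Int.cast_zero, mul_zero, U.qc_zero, mul_one]
    · rw [zero_smul]
  · refine (coeff_laurentMap_of _ (hΔ.x s i n) k).trans ((congrArg _ ?_).trans (hR _ k).symm)
    cases s
    · rw [coeff_xΔ_plus, map_add, hε.counitRight_legs, hε.x, zero_smul, add_zero]
      split_ifs
      · rw [hε.counitRight_legs, map_one, one_smul, U.qc_zero, mul_one]
      · exact map_zero _
    · rw [coeff_xΔ_minus, map_add, hε.counitRight_legs, hε.phi]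
      have h₁ : QuantumToroidal.counitRight ε
          (if k = n then inl 1 * inr (U.x .minus i n) * qq 0 0 else 0) = 0 := by
        split_ifs
        · rw [hε.counitRight_legs, hε.x, zero_smul]
        · exact map_zero _
      rw [h₁, zero_add]
      split_ifs with hk
      · rw [hk, one_smul, sub_zero, U.qc_zero, mul_one]
      · rw [zero_smul]

/-- The Laurent series with scalar coefficients as Laurent series with coefficients in `𝒰`. -/
def scalarSeries : LaurentC →ₐ[ℂ] HahnSeries ℤ U :=
  AlgHom.ofLinearMap
    { toFun := fun f => HahnSeries.map (show HahnSeries ℤ ℂ from f) (algebraMap ℂ U)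
      map_add' := fun x y => HahnSeries.ext (funext fun g => map_add (algebraMap ℂ U) _ _)
      map_smul' := fun r x => HahnSeries.ext (funext fun g => by
        change algebraMap ℂ U (r * _) = r • algebraMap ℂ U _
        rw [map_mul, Algebra.smul_def]) }
    (by
      ext g
      change algebraMap ℂ U ((1 : HahnSeries ℤ ℂ).coeff g) = _
      rw [HahnSeries.coeff_one, HahnSeries.coeff_one]
      split_ifs <;> simp)
    fun x y => HahnSeries.map_mul ((algebraMap ℂ U : ℂ →+* U) : ℂ →ₙ+* U)

theorem scalarSeries_commute (a : U) (f : LaurentC) : Commute (hahnC U a) (scalarSeries f) := by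
  ext n
  change (HahnSeries.C a * scalarSeries f).coeff n = (scalarSeries f * HahnSeries.C a).coeff n
  rw [coeff_C_mul', coeff_mul_C']
  exact (Algebra.commutes _ _).symm

/-- The multiplication `𝒰 ⊗ ℂ((u)) → 𝒰((u))`. -/
def uLaurentAlg : ULaurent →ₐ[Base] HahnSeries ℤ U :=
  Algebra.TensorProduct.lift (hahnC U) scalarSeries scalarSeries_commute

/-- The comparison of the completion of `𝒰 ⊗ ℂ((u))` with `𝒰((u))`. -/
def uLaurentMap : Completion ULaurent →ₐ[Base] Laurent ℤ U := Completion.mapAlg uLaurentAlg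

theorem coeff_uLaurentMap (y : Completion ULaurent) (k : ℤ) :
    Laurent.coeff k (uLaurentMap y) = ULaurent.coeff k y := by
  refine Completion.eq_of_dense uLaurentMap (Laurent.coeff k) (ULaurent.coeff k) (fun t => ?_) y
  induction t using TensorProduct.induction_on with
  | zero => simp only [map_zero]
  | tmul a f =>
    refine congrArg (Completion.of U) ?_
    change (HahnSeries.C a * scalarSeries f).coeff k = LaurentC.coeff k f • a
    rw [coeff_C_mul', Algebra.smul_def, Algebra.commutes]
    rfl
  | add a b ha hb => simp only [map_add, ha, hb]

theorem coeff_term (a : U) (n k : ℤ) :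
    ULaurent.coeff k (ULaurent.term a n) = Completion.of U (if k = n then a else 0) := by
  change Completion.of U (((HahnSeries.single n (1 : ℂ)).coeff k) • a) = _
  rw [HahnSeries.coeff_single]
  congr 1
  split_ifs
  · exact one_smul _ _
  · exact zero_smul _ _

theorem IsHahnCoproduct.counitLeft {Δ : U →ₐ[Base] Laurent ℤ U2} (hΔ : IsHahnCoproduct Δ)
    {ε : U →ₐ[Base] Base} (hε : IsCounit ε) {S : U →ₐ[Base] Completion ULaurent}
    (hS : IsShift S) : (laurentMap ℤ (counitLeft ε)).comp Δ = uLaurentMap.comp S := by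
  have hR : ∀ {x : U} {n : ℤ}, S x = ULaurent.term x n → ∀ k : ℤ,
      Laurent.coeff k ((uLaurentMap.comp S) x) = Completion.of U (if k = n then x else 0) :=
    fun {x n} h k => (coeff_uLaurentMap (S x) k).trans (by rw [h, coeff_term])
  refine U.hom_ext (Laurent.ext_coeff fun k => ?_) (fun s i n => Laurent.ext_coeff fun k => ?_)
    (fun s i n => Laurent.ext_coeff fun k => ?_)
  · refine (coeff_laurentMap_of _ hΔ.c k).trans ((congrArg _ ?_).trans (hR hS.c k).symm)
    rw [coeff_C_central]
    split_ifs
    · rw [map_add, hε.counitLeft_legs, hε.counitLeft_legs, map_one, one_smul, hε.c, zero_smul,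
        U.qc_zero, mul_one, zero_add]
    · exact map_zero _
  · refine (coeff_laurentMap_of _ (hΔ.phi s i n) k).trans
      ((congrArg _ ?_).trans (hR (hS.phi s i n) k).symm)
    rw [coeff_phiΔ, hε.counitLeft_legs, hε.phi]
    by_cases hk : k = n
    · rw [if_pos hk, if_pos (by omega), hk, one_smul, sub_self, mul_zero, U.qc_zero, mul_one]
    · rw [if_neg hk, if_neg (by omega), zero_smul]
  · refine (coeff_laurentMap_of _ (hΔ.x s i n) k).trans
      ((congrArg _ ?_).trans (hR (hS.x s i n) k).symm)
    cases s
    · rw [coeff_xΔ_plus, map_add, hε.counitLeft_legs, hε.phi]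
      have h₁ : QuantumToroidal.counitLeft ε
          (if k = 0 then inl (U.x .plus i n) * inr 1 * qq 0 0 else 0) = 0 := by
        split_ifs
        · rw [hε.counitLeft_legs, hε.x, zero_smul]
        · exact map_zero _
      rw [h₁, zero_add]
      by_cases hk : k = n
      · rw [if_pos hk, if_pos (by omega), hk, one_smul, U.qc_zero, mul_one]
      · rw [if_neg hk, if_neg (by omega), zero_smul]
    · rw [coeff_xΔ_minus, map_add, hε.counitLeft_legs, hε.x, zero_smul, add_zero]
      split_ifs
      · rw [hε.counitLeft_legs, map_one, one_smul, U.qc_zero, mul_one]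
      · exact map_zero _

theorem IsHahnCoproduct.idTensorCounit {Δ : U →ₐ[Base] Laurent ℤ U2} (hΔ : IsHahnCoproduct Δ)
    {ε : U →ₐ[Base] Base} (hε : IsCounit ε) (x : U) (k : ℤ) :
    idTensorCounit ε (Laurent.coeff k (Δ x)) = if k = 0 then Completion.of U x else 0 := by
  rw [idTensorCounit_eq, ← laurentMap_coeff]
  refine (congrArg (Laurent.coeff k) (AlgHom.congr_fun (hΔ.counitRight hε) x)).trans ?_
  refine (congrArg (Completion.of U) HahnSeries.coeff_single).trans ?_
  split_ifs
  · rfl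
  · exact map_zero _

theorem IsHahnCoproduct.counitTensorId {Δ : U →ₐ[Base] Laurent ℤ U2} (hΔ : IsHahnCoproduct Δ)
    {ε : U →ₐ[Base] Base} (hε : IsCounit ε) {S : U →ₐ[Base] Completion ULaurent}
    (hS : IsShift S) (x : U) (k : ℤ) :
    counitTensorId ε (Laurent.coeff k (Δ x)) = ULaurent.coeff k (S x) := by
  rw [counitTensorId_eq, ← laurentMap_coeff, ← coeff_uLaurentMap]
  exact congrArg (Laurent.coeff k) (AlgHom.congr_fun (hΔ.counitLeft hε hS) x)

end QuantumToroidal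

end

theorem theorem4p1 :
    (∃! Δ : U →ₐ[Base] Laurent ℤ U2, IsCoproduct Δ) ∧
    (∃! ε : U →ₐ[Base] Base, IsCounit ε) ∧
    (∃! S : U →ₐ[Base] Completion ULaurent, IsShift S) ∧
    ∀ (Δ : U →ₐ[Base] Laurent ℤ U2) (ε : U →ₐ[Base] Base) (S : U →ₐ[Base] Completion ULaurent),
      IsCoproduct Δ → IsCounit ε → IsShift S →
        (∃ T : U →ₐ[Base] Laurent (ℤ × ℤ) U3, ∀ (x : U) (m n : ℤ),
          Laurent.coeff (m, n) (T x) = coassocLeft Δ m n x ∧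
          Laurent.coeff (m, n) (T x) = coassocRight Δ m n x) ∧
        (∀ (x : U) (k : ℤ), idTensorCounit ε (Laurent.coeff k (Δ x)) =
          if k = 0 then Completion.of U x else 0) ∧
        (∀ (x : U) (k : ℤ), counitTensorId ε (Laurent.coeff k (Δ x)) =
          ULaurent.coeff k (S x)) := by
  refine ⟨existsUnique_coproduct, existsUnique_counit, existsUnique_shift, fun Δ ε S hΔ hε hS => ?_⟩
  have h := hΔ.isHahnCoproduct
  exact ⟨h.coassociative, h.idTensorCounit hε, h.counitTensorId hε hS⟩
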